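/- Let $\Bbbk$ be a unital commutative ring and $n,d\in\mathbb N$. Let $\Lambda_{n,d}=\{\lambda\in\{0,1,2\}^n : \sum_i\lambda_i=d\}$, $\alpha_i=(0,\dots,1,-1,\dots,0)\in\mathbb Z^n$ ($1$ in place $i$; $1\le i\le n-1$), $\overline\lambda_i=\lambda_i-\lambda_{i+1}$. Throughout, 1-morphisms are words in $E_i\colon\lambda\to\lambda+\alpha_i$ and $F_i\colon\lambda\to\lambda-\alpha_i$ (rightmost letter first) all of whose weights lie in $\Lambda_{n,d}$, 2-morphisms are linear combinations of string diagrams, read from bottom to top with $\lambda$ the rightmost region, and every diagram having a region labelled by a weight outside $\Lambda_{n,d}$ is zero. For strands coloured $i,j,k$ (bottom, left to right), $A$ (resp. $B$) denotes the triple crossing whose middle strand bulges to the left (resp. right); $x_1$ and $x_2$ are dots on the left and right strand, and $\tau$ is a crossing. **The graded 2-Schur algebra.** Let $R=\Bbbk[X,Y,Z^{\pm1}]/(X^2=Y^2=1)$ and let $\mu\colon\mathbb Z^2\times\mathbb Z^2\to R^\times$, $\mu((a,b),(c,d))=X^{ac}Y^{bd}Z^{ad-bc}$. The $(\mathbb Z^2,\mu)$-graded-2-category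 $\mathcal{GS}_{n,d}$ over $R$ has object set $\Lambda_{n,d}$ and generating 2-morphisms: cup $1_\lambda\to E_iF_i1_\lambda$ of degree $(-\lambda_{i+1},\lambda_i-1)$; cap $F_iE_i1_\lambda\to1_\lambda$ of degree $(\lambda_{i+1}-1,-\lambda_i)$; dot $F_i\to F_i$ of degree $(-1,-1)$; crossing $F_iF_j\to F_jF_i$ of degree $p_{ij}=(-(\alpha_j)_{i+1},(\alpha_j)_i)$. They satisfy the graded interchange law ($f$ on the left placed above $g$ on the right equals $\mu(\deg f,\deg g)$ times $f$ placed below $g$) and: * two dots on a strand are zero; * the double crossing of $F_iF_j$ is $0$ if $i=j$, the identity if $|i-j|>1$, $-XYZ\,x_1+XYZ\,x_2$ if $j=i+1$, and $YZ^2x_1-YZ^2x_2$ if $j=i-1$; * for $i\ne j$, sliding a dot of the $j$-strand of a crossing of $F_iF_j$ from top left to bottom right gives the factor $\mu((-1,-1),p_{ij})$, and sliding a dot of the $i$-strand from bottom left to top right gives the factor $\mu(p_{ij},(-1,-1))$; for $i=j$: (crossing with dot top left) $-XY$ (dot bottom right) $=\mathrm{id}=$ (dot bottom left) $-XY$ (dot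 top right); * $A=\mu(p_{jk},p_{ij})\mu(p_{ik},p_{ij})\mu(p_{jk},p_{ik})\,B$ on $F_iF_jF_k$ unless $i=k$ and $|i-j|=1$; $-YZ^{-2}A+Z^{-1}B=\mathrm{id}$ on $F_iF_{i+1}F_i$; $XYZ^{-1}A-XZ^{-2}B=\mathrm{id}$ on $F_iF_{i-1}F_i$; * the zigzag $F_i\to F_iE_iF_i\to F_i$ is $\mathrm{id}$, and $\mathrm{id}_{E_i1_\lambda}=X^{1+\lambda_{i+1}}Y^{\lambda_i}$ times the zigzag $E_i\to E_iF_iE_i\to E_i$; * invertibility: let $\sigma_{ij}\colon F_iE_j1_\lambda\to E_jF_i1_\lambda$ be obtained by rotating the crossing $F_jF_i\to F_iF_j$ with the cup and cap of colour $j$. Then $\sigma_{ij}$ is invertible if $i\neq j$; $(\sigma_{ii},c_0,\dots,c_{\overline\lambda_i-1})\colon F_iE_i1_\lambda\oplus1_\lambda^{\oplus\overline\lambda_i}\to E_iF_i1_\lambda$ is invertible if $\overline\lambda_i\ge0$, where $c_m$ is the cup with $m$ dots; $(\sigma_{ii},c'_0,\dots,c'_{-\overline\lambda_i-1})\colon F_iE_i1_\lambda\to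 E_iF_i1_\lambda\oplus 1_\lambda^{\oplus(-\overline\lambda_i)}$ is invertible if $\overline\lambda_i\le0$, where $c'_m$ is the cap with $m$ dots. (That is, the entries of the inverse matrices are added as homogeneous generators with the relations saying that they form inverses; words with a weight outside $\Lambda_{n,d}$ count as zero objects.) Let $\mathcal{GS}_{n,d}^{\oplus,\mathrm{cl}}$ be its graded additive closure for the quantum grading $\mathrm{qdeg}=-(a+b)$ in $\mathbb Z^2$-degree $(a,b)$: 1-morphisms are finite formal direct sums of formal shifts $f\{m\}$, 2-morphisms are matrices, and $\alpha\colon f\{m\}\to g\{m'\}$ has degree $\mathrm{qdeg}(\alpha)+m'-m$. Let $\mathcal{GS}_{n,d}^{\oplus,\mathrm{cl}}|_{X=Y=Z=1}$ be the $\mathbb Z$-graded $\Bbbk$-linear 2-category obtained by dividing each space of 2-morphisms $H$ by $(X-1,Y-1,Z-1)H$. **The 2-category $\mathcal S(n,d)^\bullet$.** This is the (level-two) Mackaay–Stošić–Vaz 2-category $\mathcal S(n,d)$ over $\Bbbk$ with the relation that two dots on a strand are zero: its objects are $\Lambda_{n,d}$, its 1-morphisms are finite formal direct sums of shifts of words,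 and its 2-morphisms are matrices of $\Bbbk$-linear combinations of string diagrams (ordinary interchange law), graded as above. With $i\cdot j=2,-1,0$ for $i=j$, $|i-j|=1$, $|i-j|>1$, the generators are dots on $E_i$ and $F_i$ (degree $2$), crossings $E_iE_j\to E_jE_i$ and $F_iF_j\to F_jF_i$ (degree $-i\cdot j$), cups $1_\lambda\to E_iF_i$ and caps $E_iF_i\to1_\lambda$ (degree $1-\overline\lambda_i$), cups $1_\lambda\to F_iE_i$ and caps $F_iE_i\to 1_\lambda$ (degree $1+\overline\lambda_i$), with relations: * all four zigzags of cups and caps are identities, and dots and crossings are cyclic: the dot and the crossing on downward strands equal both $180^\circ$ rotations of the upward ones; * the clockwise (resp. counterclockwise) $i$-bubble with $m\ge 0$ dots in the region $\lambda$ is $0$ if $m<\overline\lambda_i-1$ (resp. $m<-\overline\lambda_i-1$), and is $(-1)^{\lambda_{i+1}}$ (resp. $(-1)^{\lambda_{i+1}-1}$) if equality holds. Write $\circlearrowright_r$ (resp. $\circlearrowleft_r$) for the bubble of degree $2r$, with $\overline\lambda_i-1+r$ (resp. $-\overline\lambda_i-1+r$) dots; when the number of dots is negative it is the fake bubble determined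 by $\circlearrowright_0=(-1)^{\lambda_{i+1}}$, $\circlearrowleft_0=(-1)^{\lambda_{i+1}-1}$ and $(\sum_r\circlearrowright_rt^r)(\sum_r\circlearrowleft_rt^r)=-1$; * the right curl on $E_i1_\lambda$ is $-\sum_{f=0}^{-\overline\lambda_i}x^{-\overline\lambda_i-f}\circlearrowright_f$ (bubbles on the right), and the left curl on an $i$-strand with left region $\nu$ is $\sum_{g=0}^{\overline\nu_i}\circlearrowleft_g x^{\overline\nu_i-g}$ (bubbles on the left); * $\mathrm{id}_{E_iF_i1_\lambda}$ equals the double sideways crossing through $F_iE_i$ minus $\sum_{f=0}^{\overline\lambda_i-1}\sum_{g=0}^{f}$ (cup with $f-g$ dots)$\,\circlearrowleft_g\,$(cap with $\overline\lambda_i-1-f$ dots); $\mathrm{id}_{F_iE_i1_\lambda}$ equals the double sideways crossing through $E_iF_i$ minus $\sum_{f=0}^{-\overline\lambda_i-1}\sum_{g=0}^{f}$ (cup with $f-g$ dots)$\,\circlearrowright_g\,$(cap with $-\overline\lambda_i-1-f$ dots); for $i\ne j$ the double sideways crossings on $E_iF_j$ and $F_iE_j$ are identities; * on upward strands: $\tau^2=0$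 and $x_1\tau-\tau x_2=\mathrm{id}=\tau x_1-x_2\tau$ on $E_iE_i$ (products composed from top to bottom, so that in $\tau x_2$ the dot is below the crossing); for $i\ne j$, dots slide through crossings, and the double crossing of $E_iE_j$ is $\mathrm{id}$ if $|i-j|>1$ and $(i-j)(x_1-x_2)$ if $|i-j|=1$; $A=B$ on $E_iE_jE_k$ unless $i=k$ and $|i-j|=1$, and $A-B=(i-j)\,\mathrm{id}$ on $E_iE_jE_i$ if $|i-j|=1$; * two dots on a strand are zero. **Proposition.** There is an isomorphism of $\mathbb Z$-graded $\Bbbk$-linear 2-categories $$\mathcal S(n,d)^\bullet\;\cong\;\mathcal{GS}_{n,d}^{\oplus,\mathrm{cl}}\big|_{X=Y=Z=1}.$$ -/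

import Mathlib

open CategoryTheory

universe u v w

noncomputable section

/-! ## Graded linear 2-categories -/

/-- The data of a linear 2-category over `R` with 2-morphism spaces graded by `Γ`: objects,
1-morphisms, the `R`-linear categories of 1-morphisms (vertical composition), the composition of
1-morphisms, and the whiskering of 2-morphisms by 1-morphisms. The piece of degree `d` of a
space of 2-morphisms is `deg f g d`.  `hcomp g f` is "`g` after `f`".  In a graded-2-category the
horizontal composite of `α : g ⟶ g'` and `β : f ⟶ f'` is by definition
`whL g β ≫ whR α f'` (the left 2-morphism on top). -/
structure GradedTwoCat (R : Type u) [CommRing R] (Γ : Type) where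
  Obj : Type
  Mor : Obj → Obj → Type w
  [cat : ∀ a b, Category.{v} (Mor a b)]
  [preadditive : ∀ a b, Preadditive (Mor a b)]
  [linear : ∀ a b, Linear R (Mor a b)]
  one : ∀ a, Mor a a
  hcomp : ∀ {a b c}, Mor b c → Mor a b → Mor a c
  whL : ∀ {a b c} (g : Mor b c) {f f' : Mor a b}, (f ⟶ f') →ₗ[R] (hcomp g f ⟶ hcomp g f')
  whR : ∀ {a b c} {g g' : Mor b c} (f : Mor a b), (g ⟶ g') →ₗ[R] (hcomp g f ⟶ hcomp g' f)
  deg : ∀ {a b} (f g : Mor a b), Γ → Submodule R (f ⟶ g)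

attribute [instance] GradedTwoCat.cat GradedTwoCat.preadditive GradedTwoCat.linear

/-- An isomorphism of graded linear 2-categories: bijections on objects and on 1-morphisms, and
`R`-linear bijections on 2-morphisms, preserving identities, both compositions, and degrees.
(`HEq` only accounts for the equality `mor_hcomp` of sources and targets.) -/
structure GradedTwoCat.Iso {R : Type u} [CommRing R] {Γ : Type}
    (C : GradedTwoCat.{u, v, w} R Γ) (D : GradedTwoCat.{u, v, w} R Γ) where
  obj : C.Obj ≃ D.Obj
  mor : ∀ {a b}, C.Mor a b ≃ D.Mor (obj a) (obj b)
  hom : ∀ {a b} (f g : C.Mor a b), (f ⟶ g) ≃ₗ[R] (mor f ⟶ mor g)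
  mor_one : ∀ a, mor (C.one a) = D.one (obj a)
  mor_hcomp : ∀ {a b c} (g : C.Mor b c) (f : C.Mor a b),
    mor (C.hcomp g f) = D.hcomp (mor g) (mor f)
  hom_id : ∀ {a b} (f : C.Mor a b), hom f f (𝟙 f) = 𝟙 (mor f)
  hom_comp : ∀ {a b} {f g h : C.Mor a b} (α : f ⟶ g) (β : g ⟶ h),
    hom f h (α ≫ β) = hom f g α ≫ hom g h β
  hom_whL : ∀ {a b c} (g : C.Mor b c) {f f' : C.Mor a b} (β : f ⟶ f'),
    HEq (hom _ _ (C.whL g β)) (D.whL (mor g) (hom f f' β))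
  hom_whR : ∀ {a b c} {g g' : C.Mor b c} (f : C.Mor a b) (α : g ⟶ g'),
    HEq (hom _ _ (C.whR f α)) (D.whR (mor f) (hom g g' α))
  mem_deg : ∀ {a b} {f g : C.Mor a b} (α : f ⟶ g) (d : Γ),
    hom f g α ∈ D.deg (mor f) (mor g) d ↔ α ∈ C.deg f g d

/-! ## Graded additive closure -/

/-- Formal grading shifts `f{n}`. -/
structure Shifted (C : Type w) where
  obj : C
  shift : ℤ

namespace Shifted

variable {C : Type w} [Category.{v} C]

instance : Category.{v} (Shifted C) where
  Hom f g := f.obj ⟶ g.obj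
  id f := 𝟙 f.obj
  comp α β := CategoryStruct.comp (obj := C) α β
  id_comp _ := Category.id_comp (obj := C) _
  comp_id _ := Category.comp_id (obj := C) _
  assoc _ _ _ := Category.assoc (obj := C) _ _ _

/-- A 2-morphism regarded as a 2-morphism between shifted 1-morphisms. -/
def homMk {f g : Shifted C} (α : f.obj ⟶ g.obj) : f ⟶ g := α

/-- The underlying 2-morphism. -/
def homOut {f g : Shifted C} (α : f ⟶ g) : f.obj ⟶ g.obj := α

instance [Preadditive C] : Preadditive (Shifted C) where
  homGroup f g := inferInstanceAs (AddCommGroup (f.obj ⟶ g.obj))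
  add_comp _ _ _ _ _ _ := Preadditive.add_comp (C := C) _ _ _ _ _ _
  comp_add _ _ _ _ _ _ := Preadditive.comp_add (C := C) _ _ _ _ _ _

instance (R : Type u) [CommRing R] [Preadditive C] [Linear R C] : Linear R (Shifted C) where
  homModule f g := inferInstanceAs (Module R (f.obj ⟶ g.obj))
  smul_comp _ _ _ _ _ _ := Linear.smul_comp (C := C) _ _ _ _ _ _
  comp_smul _ _ _ _ _ _ := Linear.comp_smul (C := C) _ _ _ _ _ _

end Shifted

/-- The additive closure of a linear category is linear, entrywise. -/
instance matLinear (R : Type u) [CommRing R] (C : Type w) [Category.{v} C] [Preadditive C]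
    [Linear R C] : Linear R (Mat_ C) where
  homModule M N := inferInstanceAs (Module R (∀ i j, M.X i ⟶ N.X j))
  smul_comp M N K r f g := by
    ext i k
    change ∑ j, (r • f i j) ≫ g j k = r • ∑ j, f i j ≫ g j k
    simp [Finset.smul_sum]
  comp_smul M N K f r g := by
    ext i k
    change ∑ j, f i j ≫ (r • g j k) = r • ∑ j, f i j ≫ g j k
    simp [Finset.smul_sum]

namespace GradedTwoCat

variable {R : Type u} [CommRing R] {Γ : Type}

section closure

variable (C : GradedTwoCat.{u, v, w} R Γ)

/-- The composite of two formal direct sums of shifted 1-morphisms: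
`(⨁ᵢ gᵢ{mᵢ}) (⨁ⱼ fⱼ{nⱼ}) = ⨁ᵢⱼ (gᵢ fⱼ){mᵢ + nⱼ}`. -/
def closureHcomp {a b c : C.Obj} (g : Mat_ (Shifted (C.Mor b c))) (f : Mat_ (Shifted (C.Mor a b))) :
    Mat_ (Shifted (C.Mor a c)) where
  ι := g.ι × f.ι
  X p := ⟨C.hcomp (g.X p.1).obj (f.X p.2).obj, (g.X p.1).shift + (f.X p.2).shift⟩

open scoped Classical in
/-- The entries of the left whiskering of a matrix by `⨁ᵢ gᵢ`: the entry from `gᵢ fⱼ` to `gᵢ' f'ⱼ'`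
is the whiskering of the entry from `fⱼ` to `f'ⱼ'` by `gᵢ` if `i = i'`, and zero otherwise. -/
def closureWhLEntry {a b c : C.Obj} (g : Mat_ (Shifted (C.Mor b c)))
    {f f' : Mat_ (Shifted (C.Mor a b))} (p : g.ι × f.ι) (q : g.ι × f'.ι) :
    ((f.X p.2).obj ⟶ (f'.X q.2).obj) →ₗ[R]
      (C.hcomp (g.X p.1).obj (f.X p.2).obj ⟶ C.hcomp (g.X q.1).obj (f'.X q.2).obj) :=
  if h : p.1 = q.1 then
    Linear.rightComp R _ (eqToHom (by rw [h])) ∘ₗ C.whL (g.X p.1).obj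
  else 0

/-- Whiskering a matrix of 2-morphisms on the left by a formal direct sum. -/
def closureWhL {a b c : C.Obj} (g : Mat_ (Shifted (C.Mor b c)))
    {f f' : Mat_ (Shifted (C.Mor a b))} :
    (f ⟶ f') →ₗ[R] (C.closureHcomp g f ⟶ C.closureHcomp g f') where
  toFun β := fun p q => Shifted.homMk (C.closureWhLEntry g p q (Shifted.homOut (β p.2 q.2)))
  map_add' β β' := by
    ext p q
    exact map_add (C.closureWhLEntry g p q) _ _
  map_smul' r β := by
    ext p q
    exact map_smul (C.closureWhLEntry g p q) r _

open scoped Classical in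
/-- The entries of the right whiskering of a matrix by `⨁ⱼ fⱼ`: the entry from `gᵢ fⱼ` to
`g'ᵢ' fⱼ'` is the whiskering of the entry from `gᵢ` to `g'ᵢ'` by `fⱼ` if `j = j'`, and zero
otherwise. -/
def closureWhREntry {a b c : C.Obj} {g g' : Mat_ (Shifted (C.Mor b c))}
    (f : Mat_ (Shifted (C.Mor a b))) (p : g.ι × f.ι) (q : g'.ι × f.ι) :
    ((g.X p.1).obj ⟶ (g'.X q.1).obj) →ₗ[R]
      (C.hcomp (g.X p.1).obj (f.X p.2).obj ⟶ C.hcomp (g'.X q.1).obj (f.X q.2).obj) :=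
  if h : p.2 = q.2 then
    Linear.rightComp R _ (eqToHom (by rw [h])) ∘ₗ C.whR (f.X p.2).obj
  else 0

/-- Whiskering a matrix of 2-morphisms on the right by a formal direct sum. -/
def closureWhR {a b c : C.Obj} {g g' : Mat_ (Shifted (C.Mor b c))}
    (f : Mat_ (Shifted (C.Mor a b))) :
    (g ⟶ g') →ₗ[R] (C.closureHcomp g f ⟶ C.closureHcomp g' f) where
  toFun α := fun p q => Shifted.homMk (C.closureWhREntry f p q (Shifted.homOut (α p.1 q.1)))
  map_add' α α' := by
    ext p q
    exact map_add (C.closureWhREntry f p q) _ _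
  map_smul' r α := by
    ext p q
    exact map_smul (C.closureWhREntry f p q) r _

/-- The graded additive closure of `C` with respect to the `ℤ`-grading obtained from its
`Γ`-grading through `q : Γ → ℤ`: 1-morphisms are finite formal direct sums of formal shifts
`f{n}`, 2-morphisms are matrices of 2-morphisms of `C`, and `α : f{n} ⟶ g{m}` has degree
`q (deg α) + m - n`.  (The 2-morphisms of degree zero are those of the version of the closure
in which only degree-preserving 2-morphisms are kept.) -/
def closure (q : Γ → ℤ) : GradedTwoCat.{u, v, max 1 w} R ℤ where
  Obj := C.Obj
  Mor a b := Mat_ (Shifted (C.Mor a b))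
  one a := ⟨Unit, fun _ => ⟨C.one a, 0⟩⟩
  hcomp g f := C.closureHcomp g f
  whL g := C.closureWhL g
  whR f := C.closureWhR f
  deg f g p :=
    { carrier := {α | ∀ i j, Shifted.homOut (α i j) ∈
        ⨆ (d : Γ) (_ : q d + (g.X j).shift - (f.X i).shift = p),
          C.deg (f.X i).obj (g.X j).obj d}
      zero_mem' := fun _ _ => Submodule.zero_mem _
      add_mem' := fun h h' i j => Submodule.add_mem _ (h i j) (h' i j)
      smul_mem' := fun r _ h i j => Submodule.smul_mem _ r (h i j) }

end closure

/-! ## Reduction of the scalars along an ideal -/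

section reduction

variable (k : Type u) [CommRing k] [Algebra k R] (I : Ideal R) (C : GradedTwoCat.{u, v, w} R Γ)

/-- The 1-morphisms from `a` to `b`, carrying the reduced spaces of 2-morphisms. -/
structure RedMor (_ : Ideal R) (a b : C.Obj) where
  out : C.Mor a b

variable {I C} in
/-- The submodule `I • Hom(f, g)`. -/
def redSub {a b : C.Obj} (f g : RedMor C I a b) : Submodule R (f.out ⟶ g.out) := I • ⊤

/-- Left composition, as a linear map. -/
def redLeft {a b : C.Obj} {f g h : RedMor C I a b} (α : f.out ⟶ g.out) :
    (g.out ⟶ h.out) →ₗ[R] (f.out ⟶ h.out) := Linear.leftComp R _ α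

lemma redComp_aux {a b : C.Obj} {f g h : RedMor C I a b} {α α' : f.out ⟶ g.out}
    {β β' : g.out ⟶ h.out} (hα : α - α' ∈ redSub f g) (hβ : β - β' ∈ redSub g h) :
    α ≫ β - α' ≫ β' ∈ redSub f h := by
  have h1 : (α - α') ≫ β ∈ redSub f h :=
    Submodule.smul_top_le_comap_smul_top I (Linear.rightComp R f.out β) hα
  have h2 : α' ≫ (β - β') ∈ redSub f h :=
    Submodule.smul_top_le_comap_smul_top I (Linear.leftComp R h.out α') hβ
  have := Submodule.add_mem _ h1 h2
  simpa using this

/-- Spaces of 2-morphisms modulo `I`. -/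
def RedHom {a b : C.Obj} (f g : RedMor C I a b) : Type v := (f.out ⟶ g.out) ⧸ redSub f g

instance {a b : C.Obj} (f g : RedMor C I a b) : AddCommGroup (RedHom I C f g) :=
  inferInstanceAs (AddCommGroup ((f.out ⟶ g.out) ⧸ redSub f g))

instance {a b : C.Obj} (f g : RedMor C I a b) : Module R (RedHom I C f g) :=
  inferInstanceAs (Module R ((f.out ⟶ g.out) ⧸ redSub f g))

variable {I C} in
/-- The class of a 2-morphism modulo `I`. -/
def redMk {a b : C.Obj} (f g : RedMor C I a b) : (f.out ⟶ g.out) →ₗ[R] RedHom I C f g :=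
  (redSub f g).mkQ

variable {I C} in
lemma redMk_surjective {a b : C.Obj} (f g : RedMor C I a b) :
    Function.Surjective (redMk f g) := Submodule.mkQ_surjective _

variable {I C} in
/-- Vertical composition modulo `I`. -/
def redComp {a b : C.Obj} {f g h : RedMor C I a b} (α : RedHom I C f g) (β : RedHom I C g h) :
    RedHom I C f h :=
  Quotient.map₂ (fun (α : f.out ⟶ g.out) (β : g.out ⟶ h.out) => α ≫ β) (by
    intro α α' hα β β' hβ
    exact (Submodule.quotientRel_def _).2 (redComp_aux I C
      ((Submodule.quotientRel_def _).1 hα) ((Submodule.quotientRel_def _).1 hβ))) α β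

lemma redComp_mk {a b : C.Obj} {f g h : RedMor C I a b} (α : f.out ⟶ g.out)
    (β : g.out ⟶ h.out) : redComp (redMk f g α) (redMk g h β) = redMk f h (α ≫ β) := rfl

instance redCategory (a b : C.Obj) : Category.{v} (RedMor C I a b) where
  Hom f g := RedHom I C f g
  id f := redMk f f (𝟙 f.out)
  comp α β := redComp α β
  id_comp {f g} α := by
    obtain ⟨α, rfl⟩ := redMk_surjective f g α
    rw [redComp_mk, Category.id_comp]
  comp_id {f g} α := by
    obtain ⟨α, rfl⟩ := redMk_surjective f g α
    rw [redComp_mk, Category.comp_id]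
  assoc {f g h l} α β γ := by
    obtain ⟨α, rfl⟩ := redMk_surjective f g α
    obtain ⟨β, rfl⟩ := redMk_surjective g h β
    obtain ⟨γ, rfl⟩ := redMk_surjective h l γ
    simp only [redComp_mk, Category.assoc]

instance redPreadditive (a b : C.Obj) : Preadditive (RedMor C I a b) where
  homGroup f g := inferInstanceAs (AddCommGroup (RedHom I C f g))
  add_comp f g h α α' β := by
    obtain ⟨α, rfl⟩ := redMk_surjective f g α
    obtain ⟨α', rfl⟩ := redMk_surjective f g α'
    obtain ⟨β, rfl⟩ := redMk_surjective g h β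
    change redComp (redMk f g α + redMk f g α') (redMk g h β) =
      redComp (redMk f g α) (redMk g h β) + redComp (redMk f g α') (redMk g h β)
    rw [← map_add, redComp_mk, redComp_mk, redComp_mk, ← map_add, Preadditive.add_comp]
  comp_add f g h α β β' := by
    obtain ⟨α, rfl⟩ := redMk_surjective f g α
    obtain ⟨β, rfl⟩ := redMk_surjective g h β
    obtain ⟨β', rfl⟩ := redMk_surjective g h β'
    change redComp (redMk f g α) (redMk g h β + redMk g h β') =
      redComp (redMk f g α) (redMk g h β) + redComp (redMk f g α) (redMk g h β')
    rw [← map_add, redComp_mk, redComp_mk, redComp_mk, ← map_add, Preadditive.comp_add]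

/-- The `k`-module structure: `k` acts through `k → R`. -/
instance redModule {a b : C.Obj} (f g : RedMor C I a b) : Module k (f ⟶ g) :=
  inferInstanceAs (Module k (RestrictScalars k R (RedHom I C f g)))

lemma red_smul {a b : C.Obj} (f g : RedMor C I a b) (r : k) (α : f.out ⟶ g.out) :
    (r • (show f ⟶ g from redMk f g α) : f ⟶ g) = redMk f g (algebraMap k R r • α) := rfl

instance redLinear (a b : C.Obj) : Linear k (RedMor C I a b) where
  homModule f g := redModule k I C f g
  smul_comp f g h r α β := by
    obtain ⟨α, rfl⟩ := redMk_surjective f g α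
    obtain ⟨β, rfl⟩ := redMk_surjective g h β
    change redComp (redMk f g (algebraMap k R r • α)) (redMk g h β) =
      redMk f h (algebraMap k R r • (α ≫ β))
    rw [redComp_mk, Linear.smul_comp]
  comp_smul f g h α r β := by
    obtain ⟨α, rfl⟩ := redMk_surjective f g α
    obtain ⟨β, rfl⟩ := redMk_surjective g h β
    change redComp (redMk f g α) (redMk g h (algebraMap k R r • β)) =
      redMk f h (algebraMap k R r • (α ≫ β))
    rw [redComp_mk, Linear.comp_smul]

variable {I C} in
/-- The map modulo `I` induced by an `R`-linear map between spaces of 2-morphisms. -/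
def redMap {a b c d : C.Obj} {f f' : RedMor C I a b} {g g' : RedMor C I c d}
    (φ : (f.out ⟶ f'.out) →ₗ[R] (g.out ⟶ g'.out)) : (f ⟶ f') →ₗ[k] (g ⟶ g') where
  toFun := Submodule.mapQ (redSub f f') (redSub g g') φ (Submodule.smul_top_le_comap_smul_top I φ)
  map_add' := map_add (Submodule.mapQ (redSub f f') (redSub g g') φ
    (Submodule.smul_top_le_comap_smul_top I φ))
  map_smul' r := map_smul (Submodule.mapQ (redSub f f') (redSub g g') φ
    (Submodule.smul_top_le_comap_smul_top I φ)) (algebraMap k R r)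

/-- The `k`-linear graded 2-category obtained from `C` by replacing each space of 2-morphisms
`Hom(f, g)` by `Hom(f, g) / I Hom(f, g)`. -/
def reduction : GradedTwoCat.{u, v, w} k Γ where
  Obj := C.Obj
  Mor a b := RedMor C I a b
  linear a b := redLinear k I C a b
  one a := ⟨C.one a⟩
  hcomp g f := ⟨C.hcomp g.out f.out⟩
  whL g := redMap k (C.whL g.out)
  whR f := redMap k (C.whR f.out)
  deg f g d :=
    { carrier := {α | ∃ α' ∈ C.deg f.out g.out d, redMk f g α' = α}
      zero_mem' := ⟨0, Submodule.zero_mem _, map_zero _⟩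
      add_mem' := by
        rintro _ _ ⟨α, hα, rfl⟩ ⟨β, hβ, rfl⟩
        exact ⟨α + β, Submodule.add_mem _ hα hβ, map_add _ _ _⟩
      smul_mem' := by
        rintro r _ ⟨α, hα, rfl⟩
        exact ⟨algebraMap k R r • α, Submodule.smul_mem _ _ hα, rfl⟩ }

end reduction

end GradedTwoCat

/-! ## Graded linear 2-categories presented by generators and relations -/

/-- The generators of a presented graded-2-category: a set `W` of regions (weights), letters `L`
(generating 1-morphisms) acting on regions, and generating 2-morphisms `Gen μ s t` between words
`s` and `t`, with rightmost region `μ`, each with a degree in `Γ`.  Regions that are not `good`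
are killed. -/
structure Signature (Γ : Type) where
  W : Type
  L : Type
  act : L → W → W
  good : W → Prop
  Gen : W → List L → List L → Type
  deg : ∀ {μ s t}, Gen μ s t → Γ

namespace Signature

variable {Γ : Type} (S : Signature Γ)

/-- The leftmost region of the word `w` with rightmost region `μ`; the rightmost letter acts
first. -/
def actW (w : List S.L) (μ : S.W) : S.W := w.foldr S.act μ

lemma actW_append (v w : List S.L) (μ : S.W) : S.actW (v ++ w) μ = S.actW v (S.actW w μ) := by
  simp [actW]

/-- All regions of the word `w` with rightmost region `μ` are good. -/
def GoodWord (μ : S.W) (w : List S.L) : Prop := ∀ u v, w = u ++ v → S.good (S.actW v μ)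

lemma GoodWord.append {μ : S.W} {v w : List S.L} (hv : S.GoodWord (S.actW w μ) v)
    (hw : S.GoodWord μ w) : S.GoodWord μ (v ++ w) := by
  intro x y h
  rcases List.append_eq_append_iff.1 h with ⟨z, rfl, rfl⟩ | ⟨z, rfl, rfl⟩
  · exact hw z y rfl
  · rw [actW_append]
    exact hv x z rfl

/-- Formal `R`-linear combinations of string diagrams with rightmost region `μ`, from the word `w`
(bottom) to the word `w'` (top).  `gen u v g` is the diagram with a single generator `g`, the
identity of `u` to its left and the identity of `v` to its right; `comp f g` stacks `g` on top
of `f`. -/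
inductive Term (R : Type u) (μ : S.W) : List S.L → List S.L → Type u
  | id {w w'} (h : w = w') : Term R μ w w'
  | gen {w w'} (u v : List S.L) {ν s t} (hν : S.actW v μ = ν) (g : S.Gen ν s t)
      (hw : w = u ++ s ++ v) (hw' : w' = u ++ t ++ v) : Term R μ w w'
  | comp {w w' w''} (f : Term R μ w w') (g : Term R μ w' w'') : Term R μ w w''
  | zero {w w'} : Term R μ w w'
  | add {w w'} (f g : Term R μ w w') : Term R μ w w'
  | smul {w w'} (r : R) (f : Term R μ w w') : Term R μ w w'

namespace Term

variable {S} {R : Type u}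

/-- Placing a diagram between the identity of `u` and the identity of `v`. -/
def whisk {μ ν : S.W} (u v : List S.L) (hν : S.actW v μ = ν) {s t : List S.L} :
    Term S R ν s t → ∀ {w w' : List S.L}, w = u ++ s ++ v → w' = u ++ t ++ v → Term S R μ w w'
  | id h, _, _, hw, hw' => id (by rw [hw, hw', h])
  | gen u₀ v₀ hν₀ g hs ht, _, _, hw, hw' =>
      gen (u ++ u₀) (v₀ ++ v) (by rw [actW_append, hν, hν₀]) g
        (by simp [hw, hs]) (by simp [hw', ht])
  | comp f g, _, _, hw, hw' => comp (whisk u v hν f hw rfl) (whisk u v hν g rfl hw')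
  | zero, _, _, _, _ => zero
  | add f g, _, _, hw, hw' => add (whisk u v hν f hw hw') (whisk u v hν g hw hw')
  | smul r f, _, _, hw, hw' => smul r (whisk u v hν f hw hw')

/-- The identity diagram. -/
abbrev one (μ : S.W) (w : List S.L) : Term S R μ w w := id rfl

/-- One generator between the words `u` and `v`. -/
abbrev lay {μ : S.W} (u : List S.L) {s t : List S.L} (v : List S.L) (g : S.Gen (S.actW v μ) s t) :
    Term S R μ (u ++ s ++ v) (u ++ t ++ v) := gen u v rfl g rfl rfl

/-- A diagram between the words `u` and `v`. -/
abbrev between {μ : S.W} (u : List S.L) {s t : List S.L} (v : List S.L)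
    (f : Term S R (S.actW v μ) s t) : Term S R μ (u ++ s ++ v) (u ++ t ++ v) :=
  whisk u v rfl f rfl rfl

/-- Finite sums `∑_{i < m} f i`. -/
def sum {μ : S.W} {w w' : List S.L} (m : ℕ) (f : Fin m → Term S R μ w w') : Term S R μ w w' :=
  (List.ofFn f).foldr add zero

/-- The `m`-th power of an endomorphism. -/
def pow {μ : S.W} {w : List S.L} (f : Term S R μ w w) : ℕ → Term S R μ w w
  | 0 => one μ w
  | m + 1 => comp (pow f m) f

/-- Homogeneous combinations of diagrams: the degree of a diagram is the sum of the degrees of its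
generators. -/
inductive Homog [AddMonoid Γ] {μ : S.W} : ∀ {w w' : List S.L}, Term S R μ w w' → Γ → Prop
  | id {w w'} (h : w = w') : Homog (Term.id h) 0
  | gen {w w'} (u v : List S.L) {ν s t} (hν : S.actW v μ = ν) (g : S.Gen ν s t)
      (hw : w = u ++ s ++ v) (hw' : w' = u ++ t ++ v) : Homog (Term.gen u v hν g hw hw') (S.deg g)
  | comp {w w' w''} {f : Term S R μ w w'} {g : Term S R μ w' w''} {d e : Γ} :
      Homog f d → Homog g e → Homog (Term.comp f g) (d + e)
  | zero {w w'} (d : Γ) : Homog (Term.zero (w := w) (w' := w')) d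
  | add {w w'} {f g : Term S R μ w w'} {d : Γ} : Homog f d → Homog g d → Homog (Term.add f g) d
  | smul {w w'} (r : R) {f : Term S R μ w w'} {d : Γ} : Homog f d → Homog (Term.smul r f) d

end Term

/-- A family of defining relations. -/
abbrev Relations (R : Type u) : Type u :=
  ∀ {μ : S.W} {s t : List S.L}, Term S R μ s t → Term S R μ s t → Prop

variable {S} {R : Type u} [CommRing R]

/-- Equality of combinations of diagrams in the graded-2-category presented by the relations
`rel`: the congruence generated by the axioms of linear categories, the graded interchange law,
the defining relations inside any diagram, and the vanishing of any diagram that has a region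
which is not good. -/
inductive Eqv (bil : Γ → Γ → Rˣ) (rel : Relations S R) {μ : S.W} :
    ∀ {w w' : List S.L}, Term S R μ w w' → Term S R μ w w' → Prop
  | refl {w w'} (f : Term S R μ w w') : Eqv bil rel f f
  | symm {w w'} {f g : Term S R μ w w'} : Eqv bil rel f g → Eqv bil rel g f
  | trans {w w'} {f g h : Term S R μ w w'} : Eqv bil rel f g → Eqv bil rel g h → Eqv bil rel f h
  | comp {w w' w''} {f f' : Term S R μ w w'} {g g' : Term S R μ w' w''} :
      Eqv bil rel f f' → Eqv bil rel g g' → Eqv bil rel (.comp f g) (.comp f' g')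
  | add {w w'} {f f' g g' : Term S R μ w w'} :
      Eqv bil rel f f' → Eqv bil rel g g' → Eqv bil rel (.add f g) (.add f' g')
  | smul {w w'} (r : R) {f f' : Term S R μ w w'} :
      Eqv bil rel f f' → Eqv bil rel (.smul r f) (.smul r f')
  | add_assoc {w w'} (f g h : Term S R μ w w') :
      Eqv bil rel (.add (.add f g) h) (.add f (.add g h))
  | add_comm {w w'} (f g : Term S R μ w w') : Eqv bil rel (.add f g) (.add g f)
  | zero_add {w w'} (f : Term S R μ w w') : Eqv bil rel (.add .zero f) f
  | neg_add {w w'} (f : Term S R μ w w') : Eqv bil rel (.add (.smul (-1) f) f) .zero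
  | smul_add {w w'} (r : R) (f g : Term S R μ w w') :
      Eqv bil rel (.smul r (.add f g)) (.add (.smul r f) (.smul r g))
  | add_smul {w w'} (r r' : R) (f : Term S R μ w w') :
      Eqv bil rel (.smul (r + r') f) (.add (.smul r f) (.smul r' f))
  | mul_smul {w w'} (r r' : R) (f : Term S R μ w w') :
      Eqv bil rel (.smul (r * r') f) (.smul r (.smul r' f))
  | one_smul {w w'} (f : Term S R μ w w') : Eqv bil rel (.smul 1 f) f
  | id_comp {w w'} (f : Term S R μ w w') : Eqv bil rel (.comp (.id rfl) f) f
  | comp_id {w w'} (f : Term S R μ w w') : Eqv bil rel (.comp f (.id rfl)) f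
  | assoc {w w' w'' w'''} (f : Term S R μ w w') (g : Term S R μ w' w'')
      (h : Term S R μ w'' w''') : Eqv bil rel (.comp (.comp f g) h) (.comp f (.comp g h))
  | add_comp {w w' w''} (f f' : Term S R μ w w') (g : Term S R μ w' w'') :
      Eqv bil rel (.comp (.add f f') g) (.add (.comp f g) (.comp f' g))
  | comp_add {w w' w''} (f : Term S R μ w w') (g g' : Term S R μ w' w'') :
      Eqv bil rel (.comp f (.add g g')) (.add (.comp f g) (.comp f g'))
  | smul_comp {w w' w''} (r : R) (f : Term S R μ w w') (g : Term S R μ w' w'') :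
      Eqv bil rel (.comp (.smul r f) g) (.smul r (.comp f g))
  | comp_smul {w w' w''} (r : R) (f : Term S R μ w w') (g : Term S R μ w' w'') :
      Eqv bil rel (.comp f (.smul r g)) (.smul r (.comp f g))
  -- `f` on the left above `g` on the right is `bil (deg f) (deg g)` times `f` below `g`
  | interchange {u m v : List S.L} {ν ν' : S.W} {s t s' t' : List S.L}
      (f : S.Gen ν s t) (g : S.Gen ν' s' t') {ug ug' vf vf' w₁ w₂ w₂' w₃ : List S.L}
      (hug : ug = u ++ s ++ m) (hug' : ug' = u ++ t ++ m)
      (hvf : vf = m ++ t' ++ v) (hvf' : vf' = m ++ s' ++ v)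
      (hν : S.actW vf μ = ν) (hν₁ : S.actW vf' μ = ν) (hν' : S.actW v μ = ν')
      (h1 : w₁ = ug ++ s' ++ v) (h2 : w₂ = ug ++ t' ++ v) (h2' : w₂ = u ++ s ++ vf)
      (h3 : w₃ = u ++ t ++ vf) (h1' : w₁ = u ++ s ++ vf') (h4 : w₂' = u ++ t ++ vf')
      (h4' : w₂' = ug' ++ s' ++ v) (h3' : w₃ = ug' ++ t' ++ v) :
      Eqv bil rel
        (.comp (.gen ug v hν' g h1 h2) (.gen u vf hν f h2' h3))
        (.smul (bil (S.deg f) (S.deg g) : R)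
          (.comp (.gen u vf' hν₁ f h1' h4) (.gen ug' v hν' g h4' h3')))
  | of {ν : S.W} {s t : List S.L} {f g : Term S R ν s t} (h : rel f g) (u v : List S.L)
      (hν : S.actW v μ = ν) {w w' : List S.L} (hw : w = u ++ s ++ v) (hw' : w' = u ++ t ++ v) :
      Eqv bil rel (f.whisk u v hν hw hw') (g.whisk u v hν hw hw')
  | bad {w w'} (h : w = w') (hb : ¬ S.GoodWord μ w) : Eqv bil rel (.id h) .zero

lemma Term.comp_eq_of_mid {μ : S.W} {w a b w'' : List S.L} (h : a = b)
    (F : ∀ c, c = b → Term S R μ w c) (G : ∀ c, c = b → Term S R μ c w'') :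
    Term.comp (F a h) (G a h) = Term.comp (F b rfl) (G b rfl) := by
  subst h; rfl

lemma Term.whisk_whisk {μ ν κ : S.W} {u v u' v' : List S.L} (hν : S.actW v ν = κ)
    (hμ : S.actW v' μ = ν) {s t : List S.L} (f : Term S R κ s t) :
    ∀ {w w' x x' : List S.L} (hw : w = u ++ s ++ v) (hw' : w' = u ++ t ++ v)
      (hx : x = u' ++ w ++ v') (hx' : x' = u' ++ w' ++ v')
      (hk : S.actW (v ++ v') μ = κ) (h1 : x = (u' ++ u) ++ s ++ (v ++ v'))
      (h2 : x' = (u' ++ u) ++ t ++ (v ++ v')),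
      (f.whisk u v hν hw hw').whisk u' v' hμ hx hx' =
        f.whisk (u' ++ u) (v ++ v') hk h1 h2 := by
  induction f with
  | id h => intros; rfl
  | gen u₀ v₀ h g h1 h2 => intros; simp [whisk]
  | @comp a b c f g ihf ihg =>
    intro w w' x x' hw hw' hx hx' hk h1 h2
    simp only [whisk]
    rw [ihf hw rfl hx rfl hk h1 (by simp), ihg rfl hw' rfl hx' hk (by simp) h2]
    exact Term.comp_eq_of_mid (b := (u' ++ u) ++ b ++ (v ++ v')) (by simp)
      (fun c hc => f.whisk (u' ++ u) (v ++ v') hk h1 hc)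
      (fun c hc => g.whisk (u' ++ u) (v ++ v') hk hc h2)
  | zero => intros; rfl
  | add f g ihf ihg =>
    intro w w' x x' hw hw' hx hx' hk h1 h2
    simp only [whisk]
    rw [ihf hw hw' hx hx' hk h1 h2, ihg hw hw' hx hx' hk h1 h2]
  | smul r f ih =>
    intro w w' x x' hw hw' hx hx' hk h1 h2
    simp only [whisk]
    rw [ih hw hw' hx hx' hk h1 h2]

lemma Eqv.whisk {bil : Γ → Γ → Rˣ} {rel : Relations S R} {μ ν : S.W} {u v : List S.L}
    (hν : S.actW v μ = ν) {s t : List S.L} {f g : Term S R ν s t} (h : Eqv bil rel f g) :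
    ∀ {w w' : List S.L} (hw : w = u ++ s ++ v) (hw' : w' = u ++ t ++ v),
      Eqv bil rel (f.whisk u v hν hw hw') (g.whisk u v hν hw hw') := by
  induction h with
  | refl f => intros; exact .refl _
  | symm _ ih => intro _ _ hw hw'; exact .symm (ih hw hw')
  | trans _ _ ih1 ih2 => intro _ _ hw hw'; exact .trans (ih1 hw hw') (ih2 hw hw')
  | comp _ _ ih1 ih2 => intro _ _ hw hw'; exact .comp (ih1 hw rfl) (ih2 rfl hw')
  | add _ _ ih1 ih2 => intro _ _ hw hw'; exact .add (ih1 hw hw') (ih2 hw hw')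
  | smul r _ ih => intro _ _ hw hw'; exact .smul r (ih hw hw')
  | add_assoc => intros; exact .add_assoc _ _ _
  | add_comm => intros; exact .add_comm _ _
  | zero_add => intros; exact .zero_add _
  | neg_add => intros; exact .neg_add _
  | smul_add => intros; exact .smul_add _ _ _
  | add_smul => intros; exact .add_smul _ _ _
  | mul_smul => intros; exact .mul_smul _ _ _
  | one_smul => intros; exact .one_smul _
  | id_comp f => intro _ _ hw hw'; subst hw; exact .id_comp _
  | comp_id f => intro _ _ hw hw'; subst hw'; exact .comp_id _
  | assoc => intros; exact .assoc _ _ _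
  | add_comp => intros; exact .add_comp _ _ _
  | comp_add => intros; exact .comp_add _ _ _
  | smul_comp => intros; exact .smul_comp _ _ _
  | comp_smul => intros; exact .comp_smul _ _ _
  | @interchange u₀ m v₀ _ _ s t s' t' f g _ _ _ _ _ _ _ _ hug hug' hvf hvf' =>
    intro _ _ hw hw'
    exact .interchange (u := u ++ u₀) (m := m) (v := v₀ ++ v) f g
      (by simp [hug]) (by simp [hug']) (by simp [hvf]) (by simp [hvf']) _ _ _ _ _ _ _ _ _ _ _
  | of h u₀ v₀ hν₀ hs ht =>
    intro _ _ hw hw'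
    rw [Term.whisk_whisk hν₀ hν _ hs ht hw hw' (by rw [actW_append, hν, hν₀])
        (by simp [hw, hs]) (by simp [hw', ht]),
      Term.whisk_whisk hν₀ hν _ hs ht hw hw' (by rw [actW_append, hν, hν₀])
        (by simp [hw, hs]) (by simp [hw', ht])]
    exact .of h _ _ _ _ _
  | @bad s _ h hb =>
    intro w w' hw hw'
    refine .bad _ fun hg => hb fun x y hxy => ?_
    have := hg (u ++ x) (y ++ v) (by simp [hw, hxy])
    rwa [actW_append, hν] at this

/-- The space of 2-morphisms from `w` to `w'`. -/
def PHom (bil : Γ → Γ → Rˣ) (rel : Relations S R) (μ : S.W) (w w' : List S.L) : Type u :=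
  Quot (Eqv bil rel (μ := μ) (w := w) (w' := w'))

namespace PHom

variable {bil : Γ → Γ → Rˣ} {rel : Relations S R} {μ : S.W} {w w' w'' : List S.L}

/-- The 2-morphism represented by a combination of diagrams. -/
def mk (bil : Γ → Γ → Rˣ) (rel : Relations S R) (f : Term S R μ w w') : PHom bil rel μ w w' :=
  Quot.mk _ f

/-- Vertical composition. -/
def comp (f : PHom bil rel μ w w') (g : PHom bil rel μ w' w'') : PHom bil rel μ w w'' :=
  Quot.map₂ Term.comp (fun f _ _ h => Eqv.comp (.refl f) h) (fun _ _ g h => Eqv.comp h (.refl g))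
    f g

instance : Add (PHom bil rel μ w w') :=
  ⟨Quot.map₂ Term.add (fun f _ _ h => Eqv.add (.refl f) h) (fun _ _ g h => Eqv.add h (.refl g))⟩

instance : Zero (PHom bil rel μ w w') := ⟨mk bil rel .zero⟩

instance : SMul R (PHom bil rel μ w w') :=
  ⟨fun r => Quot.map (Term.smul r) fun _ _ h => Eqv.smul r h⟩

instance : Neg (PHom bil rel μ w w') := ⟨fun f => (-1 : R) • f⟩

instance : AddCommGroup (PHom bil rel μ w w') :=
  { AddGroup.ofLeftAxioms (G := PHom bil rel μ w w')
      (by rintro ⟨f⟩ ⟨g⟩ ⟨h⟩; exact Quot.sound (.add_assoc f g h))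
      (by rintro ⟨f⟩; exact Quot.sound (.zero_add f))
      (by rintro ⟨f⟩; exact Quot.sound (.neg_add f)) with
    add_comm := by rintro ⟨f⟩ ⟨g⟩; exact Quot.sound (.add_comm f g) }

instance : Module R (PHom bil rel μ w w') :=
  Module.ofMinimalAxioms
    (by rintro r ⟨f⟩ ⟨g⟩; exact Quot.sound (.smul_add r f g))
    (by rintro r r' ⟨f⟩; exact Quot.sound (.add_smul r r' f))
    (by rintro r r' ⟨f⟩; exact Quot.sound (.mul_smul r r' f))
    (by rintro ⟨f⟩; exact Quot.sound (.one_smul f))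

/-- Placing a 2-morphism between the identity of `u` and the identity of `v`. -/
def whisk {ν : S.W} (u v : List S.L) (hν : S.actW v μ = ν) {s t : List S.L}
    (hw : w = u ++ s ++ v) (hw' : w' = u ++ t ++ v) :
    PHom bil rel ν s t →ₗ[R] PHom bil rel μ w w' where
  toFun := Quot.map (fun f => f.whisk u v hν hw hw') fun _ _ h => h.whisk hν hw hw'
  map_add' := by rintro ⟨f⟩ ⟨g⟩; rfl
  map_smul' := by rintro r ⟨f⟩; rfl

end PHom

/-- The 1-morphisms from `a` to `b`: words all of whose regions are good. -/
structure PMor (S : Signature Γ) (a b : {μ : S.W // S.good μ}) where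
  word : List S.L
  actW_eq : S.actW word a.1 = b.1
  good : S.GoodWord a.1 word

/-- The 1-morphisms from `a` to `b` of the presented graded-2-category. -/
structure PCat (bil : Γ → Γ → Rˣ) (rel : Relations S R) (a b : {μ : S.W // S.good μ}) where
  out : PMor S a b

section

variable (bil : Γ → Γ → Rˣ) (rel : Relations S R)

instance (a b : {μ : S.W // S.good μ}) : Category.{u} (PCat bil rel a b) where
  Hom f g := PHom bil rel a.1 f.out.word g.out.word
  id f := PHom.mk bil rel (.id rfl)
  comp f g := PHom.comp f g
  id_comp := by rintro _ _ ⟨f⟩; exact Quot.sound (.id_comp f)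
  comp_id := by rintro _ _ ⟨f⟩; exact Quot.sound (.comp_id f)
  assoc := by rintro _ _ _ _ ⟨f⟩ ⟨g⟩ ⟨h⟩; exact Quot.sound (.assoc f g h)

instance (a b : {μ : S.W // S.good μ}) : Preadditive (PCat bil rel a b) where
  homGroup f g := inferInstanceAs (AddCommGroup (PHom bil rel a.1 f.out.word g.out.word))
  add_comp := by rintro _ _ _ ⟨f⟩ ⟨f'⟩ ⟨g⟩; exact Quot.sound (.add_comp f f' g)
  comp_add := by rintro _ _ _ ⟨f⟩ ⟨g⟩ ⟨g'⟩; exact Quot.sound (.comp_add f g g')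

instance (a b : {μ : S.W // S.good μ}) : Linear R (PCat bil rel a b) where
  homModule f g := inferInstanceAs (Module R (PHom bil rel a.1 f.out.word g.out.word))
  smul_comp := by rintro _ _ _ r ⟨f⟩ ⟨g⟩; exact Quot.sound (.smul_comp r f g)
  comp_smul := by rintro _ _ _ ⟨f⟩ r ⟨g⟩; exact Quot.sound (.comp_smul r f g)

/-- The `(Γ, bil)`-graded-2-category with the given generators and the relations `rel`.  Objects
are the good regions. -/
def presented [AddMonoid Γ] : GradedTwoCat.{u, u, 0} R Γ where
  Obj := {μ : S.W // S.good μ}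
  Mor a b := PCat bil rel a b
  one a := ⟨⟨[], rfl, fun u v h => by
    obtain ⟨rfl, rfl⟩ := List.append_eq_nil_iff.1 h.symm
    exact a.2⟩⟩
  hcomp g f := ⟨⟨g.out.word ++ f.out.word,
    by rw [actW_append, f.out.actW_eq, g.out.actW_eq],
    GoodWord.append S (by rw [f.out.actW_eq]; exact g.out.good) f.out.good⟩⟩
  whL g := PHom.whisk g.out.word [] rfl (by simp) (by simp)
  whR f := PHom.whisk [] f.out.word f.out.actW_eq (by simp) (by simp)
  deg f g d :=
    { carrier := {α | ∃ t : Term S R _ f.out.word g.out.word, t.Homog d ∧ PHom.mk bil rel t = α}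
      zero_mem' := ⟨.zero, .zero d, rfl⟩
      add_mem' := by
        rintro _ _ ⟨t, ht, rfl⟩ ⟨t', ht', rfl⟩
        exact ⟨.add t t', .add ht ht', rfl⟩
      smul_mem' := by
        rintro r _ ⟨t, ht, rfl⟩
        exact ⟨.smul r t, .smul r ht, rfl⟩ }

end

end Signature

/-! ## Weights and words for `gl_n` -/

/-- The generating 1-morphisms `E_i` and `F_i`, for `n - 1` colours `i`. -/
inductive Letter (n : ℕ)
  | E (i : Fin (n - 1))
  | F (i : Fin (n - 1))

namespace SchurCat

variable {n : ℕ}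

/-- The coordinate `i` of a colour `i`. -/
def lo (i : Fin (n - 1)) : Fin n := ⟨i, by omega⟩

/-- The coordinate `i + 1` of a colour `i`. -/
def hi (i : Fin (n - 1)) : Fin n := ⟨i + 1, by omega⟩

/-- `α_i = (0, …, 1, -1, …, 0)`. -/
def root (i : Fin (n - 1)) : Fin n → ℤ := Pi.single (lo i) 1 - Pi.single (hi i) 1

/-- The action of `E_i` and `F_i` on weights. -/
def actLetter : Letter n → (Fin n → ℤ) → (Fin n → ℤ)
  | .E i, μ => μ + root i
  | .F i, μ => μ - root i

/-- The set `Λ_{n,d}` of weights in `{0,1,2}^n` with sum `d`. -/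
def IsWeight (n d : ℕ) (μ : Fin n → ℤ) : Prop := (∀ i, μ i = 0 ∨ μ i = 1 ∨ μ i = 2) ∧ ∑ i, μ i = d

/-- `μ̄_i = μ_i - μ_{i+1}`. -/
def bar (μ : Fin n → ℤ) (i : Fin (n - 1)) : ℤ := μ (lo i) - μ (hi i)

/-- `j = i + 1` for colours `i` and `j`. -/
def Succ (i j : Fin (n - 1)) : Prop := (j : ℕ) = i + 1

/-- `|i - j| = 1` for colours `i` and `j`. -/
def Adjacent (i j : Fin (n - 1)) : Prop := Succ i j ∨ Succ j i

/-- `|i - j| > 1` for colours `i` and `j`. -/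
def Distant (i j : Fin (n - 1)) : Prop := i ≠ j ∧ ¬ Adjacent i j

/-! ## The ring `R = k[X, Y, Z^{±1}]/(X² = Y² = 1)` and the bilinear form -/

section ring

variable (k : Type u) [CommRing k]

/-- `k[X, Y]/(X² - 1, Y² - 1)`. -/
abbrev RingXY : Type u :=
  MvPolynomial (Fin 2) k ⧸
    (Ideal.span {MvPolynomial.X 0 ^ 2 - 1, MvPolynomial.X 1 ^ 2 - 1} :
      Ideal (MvPolynomial (Fin 2) k))

/-- `k[X, Y, Z, Z⁻¹]/(X² - 1, Y² - 1)`. -/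
abbrev RingXYZ : Type u := LaurentPolynomial (RingXY k)

lemma sq_X : ((Ideal.Quotient.mk _ (MvPolynomial.X 0) : RingXY k)) *
    Ideal.Quotient.mk _ (MvPolynomial.X 0) = 1 := by
  rw [← map_mul, ← sub_eq_zero, ← map_one (Ideal.Quotient.mk _), ← map_sub,
    Ideal.Quotient.eq_zero_iff_mem, ← pow_two]
  exact Ideal.subset_span (by simp)

lemma sq_Y : ((Ideal.Quotient.mk _ (MvPolynomial.X 1) : RingXY k)) *
    Ideal.Quotient.mk _ (MvPolynomial.X 1) = 1 := by
  rw [← map_mul, ← sub_eq_zero, ← map_one (Ideal.Quotient.mk _), ← map_sub,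
    Ideal.Quotient.eq_zero_iff_mem, ← pow_two]
  exact Ideal.subset_span (by simp)

/-- The unit `X`. -/
def uX : (RingXYZ k)ˣ := Units.map (LaurentPolynomial.C : RingXY k →+* RingXYZ k).toMonoidHom
  ⟨Ideal.Quotient.mk _ (MvPolynomial.X 0), Ideal.Quotient.mk _ (MvPolynomial.X 0), sq_X k, sq_X k⟩

/-- The unit `Y`. -/
def uY : (RingXYZ k)ˣ := Units.map (LaurentPolynomial.C : RingXY k →+* RingXYZ k).toMonoidHom
  ⟨Ideal.Quotient.mk _ (MvPolynomial.X 1), Ideal.Quotient.mk _ (MvPolynomial.X 1), sq_Y k, sq_Y k⟩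

/-- The unit `Z`. -/
def uZ : (RingXYZ k)ˣ :=
  ⟨LaurentPolynomial.T 1, LaurentPolynomial.T (-1),
    by rw [← LaurentPolynomial.T_add]; simp, by rw [← LaurentPolynomial.T_add]; simp⟩

/-- The bilinear form `((a, b), (c, d)) ↦ X^{ac} Y^{bd} Z^{ad - bc}`. -/
def bil (x y : ℤ × ℤ) : (RingXYZ k)ˣ :=
  uX k ^ (x.1 * y.1) * uY k ^ (x.2 * y.2) * uZ k ^ (x.1 * y.2 - x.2 * y.1)

/-- The ideal `(X - 1, Y - 1, Z - 1)`. -/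
def specIdeal : Ideal (RingXYZ k) :=
  Ideal.span {(uX k : RingXYZ k) - 1, (uY k : RingXYZ k) - 1, (uZ k : RingXYZ k) - 1}

end ring

/-! ## The graded 2-Schur algebra -/

/-- `p_{ij} = (-(α_j)_{i+1}, (α_j)_i)`. -/
def p (i j : Fin (n - 1)) : ℤ × ℤ := (-(root j (hi i)), root j (lo i))

/-- The generating 2-morphisms of the graded 2-Schur algebra, with rightmost region `μ`: cups, caps,
dots and downward crossings, together with the entries of the inverses of the 2-morphisms that
are required to be invertible. -/
inductive Gen : (Fin n → ℤ) → List (Letter n) → List (Letter n) → Type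
  | cup {μ} (i : Fin (n - 1)) : Gen μ [] [.E i, .F i]
  | cap {μ} (i : Fin (n - 1)) : Gen μ [.F i, .E i] []
  | dot {μ} (i : Fin (n - 1)) : Gen μ [.F i] [.F i]
  | cross {μ} (i j : Fin (n - 1)) : Gen μ [.F i, .F j] [.F j, .F i]
  -- inverse of the sideways crossing, or the entry of the inverse opposite to it
  | invSide {μ} (i j : Fin (n - 1)) : Gen μ [.E j, .F i] [.F i, .E j]
  -- entry of the inverse opposite to the cup with `m` dots, `0 ≤ m < μ̄_i`
  | invCup {μ} (i : Fin (n - 1)) (m : Fin (bar μ i).toNat) : Gen μ [.E i, .F i] []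
  -- entry of the inverse opposite to the cap with `m` dots, `0 ≤ m < -μ̄_i`
  | invCap {μ} (i : Fin (n - 1)) (m : Fin (-bar μ i).toNat) : Gen μ [] [.F i, .E i]

/-- The `ℤ²`-degrees of the generating 2-morphisms.  (The sideways crossings have degree
`(0, 0)`.) -/
def Gen.deg : ∀ {μ : Fin n → ℤ} {s t : List (Letter n)}, Gen μ s t → ℤ × ℤ
  | μ, _, _, .cup i => (-μ (hi i), μ (lo i)) + (0, -1)
  | μ, _, _, .cap i => -(-μ (hi i), μ (lo i)) + (-1, 0)
  | _, _, _, .dot _ => (-1, -1)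
  | _, _, _, .cross i j => p i j
  | _, _, _, .invSide _ _ => (0, 0)
  | μ, _, _, .invCup i m => -((-μ (hi i), μ (lo i)) + (0, -1) + (m : ℤ) • ((-1, -1) : ℤ × ℤ))
  | μ, _, _, .invCap i m => -(-(-μ (hi i), μ (lo i)) + (-1, 0) + (m : ℤ) • ((-1, -1) : ℤ × ℤ))

/-- The generators of the graded 2-Schur algebra. -/
def sig (n d : ℕ) : Signature (ℤ × ℤ) where
  W := Fin n → ℤ
  L := Letter n
  act := actLetter
  good := IsWeight n d
  Gen := Gen
  deg := Gen.deg

section relations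

open Signature.Term

variable (k : Type u) [CommRing k] (n d : ℕ)

/-- Combinations of string diagrams of the graded 2-Schur algebra. -/
abbrev Diag (μ : Fin n → ℤ) (s t : List (Letter n)) : Type u :=
  Signature.Term (sig n d) (RingXYZ k) μ s t

variable {k n d}

/-- One generator between the words `u` and `v`. -/
abbrev put {μ : Fin n → ℤ} (u : List (Letter n)) {s t : List (Letter n)} (v : List (Letter n))
    (g : Gen (v.foldr actLetter μ) s t) : Diag k n d μ (u ++ s ++ v) (u ++ t ++ v) :=
  Signature.Term.lay (S := sig n d) u v g

/-- The identity of the word `w`. -/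
abbrev idw {μ : Fin n → ℤ} (w : List (Letter n)) : Diag k n d μ w w :=
  Signature.Term.one (S := sig n d) μ w

/-- A diagram between the words `u` and `v`. -/
abbrev within {μ : Fin n → ℤ} (u : List (Letter n)) {s t : List (Letter n)} (v : List (Letter n))
    (f : Diag k n d (v.foldr actLetter μ) s t) : Diag k n d μ (u ++ s ++ v) (u ++ t ++ v) :=
  Signature.Term.between (S := sig n d) u v f

variable (k d)

/-- The strand `F_i` with `m` dots. -/
def dots {μ : Fin n → ℤ} (i : Fin (n - 1)) (m : ℕ) : Diag k n d μ [.F i] [.F i] :=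
  pow (put [] [] (Gen.dot i)) m

/-- The sideways crossing `F_i E_j → E_j F_i`. -/
def side {μ : Fin n → ℤ} (i j : Fin (n - 1)) : Diag k n d μ [.F i, .E j] [.E j, .F i] :=
  comp (put [] [.F i, .E j] (Gen.cup j))
    (comp (put [.E j] [.E j] (Gen.cross j i)) (put [.E j, .F i] [] (Gen.cap j)))

/-- The cup with `m` dots on its right strand. -/
def cupDots {μ : Fin n → ℤ} (i : Fin (n - 1)) (m : ℕ) : Diag k n d μ [] [.E i, .F i] :=
  comp (put [] [] (Gen.cup i)) (within [.E i] [] (dots k d i m))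

/-- The cap with `m` dots on its left strand. -/
def capDots {μ : Fin n → ℤ} (i : Fin (n - 1)) (m : ℕ) : Diag k n d μ [.F i, .E i] [] :=
  comp (within [] [.E i] (dots k d i m)) (put [] [] (Gen.cap i))

/-- Three downward strands `i j k'`, with crossings at positions 1-2, 2-3, 1-2 from bottom to top:
the middle strand passes on the left. -/
def braidL {μ : Fin n → ℤ} (i j k' : Fin (n - 1)) :
    Diag k n d μ [.F i, .F j, .F k'] [.F k', .F j, .F i] :=
  comp (put [] [.F k'] (Gen.cross i j))
    (comp (put [.F j] [] (Gen.cross i k')) (put [] [.F i] (Gen.cross j k')))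

/-- Three downward strands `i j k'`, with crossings at positions 2-3, 1-2, 2-3 from bottom to top:
the middle strand passes on the right. -/
def braidR {μ : Fin n → ℤ} (i j k' : Fin (n - 1)) :
    Diag k n d μ [.F i, .F j, .F k'] [.F k', .F j, .F i] :=
  comp (put [.F i] [] (Gen.cross j k'))
    (comp (put [] [.F j] (Gen.cross i k')) (put [.F k'] [] (Gen.cross i j)))

/-- The defining relations of the graded 2-Schur algebra, other than the graded interchange law and
the vanishing of the diagrams with a region outside `Λ_{n,d}`. -/
inductive Rel : ∀ {μ : Fin n → ℤ} {s t : List (Letter n)},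
    Diag k n d μ s t → Diag k n d μ s t → Prop
  -- two dots annihilate
  | dot_dot {μ : Fin n → ℤ} (i : Fin (n - 1)) :
      Rel (μ := μ) (dots k d i 2) zero
  -- double crossings
  | cross_cross_same {μ : Fin n → ℤ} (i : Fin (n - 1)) :
      Rel (μ := μ) (comp (put [] [] (Gen.cross i i)) (put [] [] (Gen.cross i i))) zero
  | cross_cross_distant {μ : Fin n → ℤ} (i j : Fin (n - 1)) (h : Distant i j) :
      Rel (μ := μ) (comp (put [] [] (Gen.cross i j)) (put [] [] (Gen.cross j i))) (idw _)
  | cross_cross_succ {μ : Fin n → ℤ} (i j : Fin (n - 1)) (h : Succ i j) :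
      Rel (μ := μ) (comp (put [] [] (Gen.cross i j)) (put [] [] (Gen.cross j i)))
        (add (smul (-(uX k * uY k * uZ k : (RingXYZ k)ˣ)) (put [] [.F j] (Gen.dot i)))
          (smul (uX k * uY k * uZ k : (RingXYZ k)ˣ) (put [.F i] [] (Gen.dot j))))
  | cross_cross_pred {μ : Fin n → ℤ} (i j : Fin (n - 1)) (h : Succ j i) :
      Rel (μ := μ) (comp (put [] [] (Gen.cross i j)) (put [] [] (Gen.cross j i)))
        (add (smul (uY k * uZ k ^ 2 : (RingXYZ k)ˣ) (put [] [.F j] (Gen.dot i)))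
          (smul (-(uY k * uZ k ^ 2 : (RingXYZ k)ˣ)) (put [.F i] [] (Gen.dot j))))
  -- dot slides
  | slide_right {μ : Fin n → ℤ} (i j : Fin (n - 1)) (h : i ≠ j) :
      Rel (μ := μ) (comp (put [] [] (Gen.cross i j)) (put [] [.F i] (Gen.dot j)))
        (smul (bil k (-1, -1) (p i j) : (RingXYZ k)ˣ)
          (comp (put [.F i] [] (Gen.dot j)) (put [] [] (Gen.cross i j))))
  | slide_left {μ : Fin n → ℤ} (i j : Fin (n - 1)) (h : i ≠ j) :
      Rel (μ := μ) (comp (put [] [.F j] (Gen.dot i)) (put [] [] (Gen.cross i j)))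
        (smul (bil k (p i j) (-1, -1) : (RingXYZ k)ˣ)
          (comp (put [] [] (Gen.cross i j)) (put [.F j] [] (Gen.dot i))))
  | nil_right {μ : Fin n → ℤ} (i : Fin (n - 1)) :
      Rel (μ := μ)
        (add (comp (put [] [] (Gen.cross i i)) (put [] [.F i] (Gen.dot i)))
          (smul (-(uX k * uY k : (RingXYZ k)ˣ))
            (comp (put [.F i] [] (Gen.dot i)) (put [] [] (Gen.cross i i)))))
        (idw _)
  | nil_left {μ : Fin n → ℤ} (i : Fin (n - 1)) :
      Rel (μ := μ)
        (add (comp (put [] [.F i] (Gen.dot i)) (put [] [] (Gen.cross i i)))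
          (smul (-(uX k * uY k : (RingXYZ k)ˣ))
            (comp (put [] [] (Gen.cross i i)) (put [.F i] [] (Gen.dot i)))))
        (idw _)
  -- triple crossings
  | braid {μ : Fin n → ℤ} (i j k' : Fin (n - 1)) (h : ¬ (i = k' ∧ Adjacent i j)) :
      Rel (μ := μ) (braidL k d i j k')
        (smul (bil k (p j k') (p i j) * bil k (p i k') (p i j) * bil k (p j k') (p i k') :
          (RingXYZ k)ˣ) (braidR k d i j k'))
  | serre_succ {μ : Fin n → ℤ} (i j : Fin (n - 1)) (h : Succ i j) :
      Rel (μ := μ)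
        (add (smul (-(uY k * uZ k ^ (-2 : ℤ) : (RingXYZ k)ˣ)) (braidL k d i j i))
          (smul (uZ k ^ (-1 : ℤ) : (RingXYZ k)ˣ) (braidR k d i j i)))
        (idw _)
  | serre_pred {μ : Fin n → ℤ} (i j : Fin (n - 1)) (h : Succ j i) :
      Rel (μ := μ)
        (add (smul (uX k * uY k * uZ k ^ (-1 : ℤ) : (RingXYZ k)ˣ) (braidL k d i j i))
          (smul (-(uX k * uZ k ^ (-2 : ℤ) : (RingXYZ k)ˣ)) (braidR k d i j i)))
        (idw _)
  -- graded adjunction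
  | zigzag_F {μ : Fin n → ℤ} (i : Fin (n - 1)) :
      Rel (μ := μ) (idw [.F i])
        (comp (put [.F i] [] (Gen.cup i)) (put [] [.F i] (Gen.cap i)))
  | zigzag_E {μ : Fin n → ℤ} (i : Fin (n - 1)) :
      Rel (μ := μ) (idw [.E i])
        (smul (uX k ^ (1 + μ (hi i)) * uY k ^ (μ (lo i)) : (RingXYZ k)ˣ)
          (comp (put [] [.E i] (Gen.cup i)) (put [.E i] [] (Gen.cap i))))
  -- the sideways crossing `F_i E_j → E_j F_i` is invertible for `i ≠ j`
  | side_inv {μ : Fin n → ℤ} (i j : Fin (n - 1)) (h : i ≠ j) :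
      Rel (μ := μ) (comp (side k d i j) (put [] [] (Gen.invSide i j))) (idw _)
  | inv_side {μ : Fin n → ℤ} (i j : Fin (n - 1)) (h : i ≠ j) :
      Rel (μ := μ) (comp (put [] [] (Gen.invSide i j)) (side k d i j)) (idw _)
  -- `(side, cupDots 0, …, cupDots (μ̄_i - 1)) : F_i E_i ⊕ 1^{μ̄_i} → E_i F_i` is invertible
  -- for `μ̄_i ≥ 0`
  | pos_target {μ : Fin n → ℤ} (i : Fin (n - 1)) (h : 0 ≤ bar μ i) :
      Rel (μ := μ)
        (add (comp (put [] [] (Gen.invSide i i)) (side k d i i))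
          (sum (bar μ i).toNat fun m =>
            comp (put [] [] (Gen.invCup (μ := μ) i m)) (cupDots k d i m)))
        (idw _)
  | pos_side_side {μ : Fin n → ℤ} (i : Fin (n - 1)) (h : 0 ≤ bar μ i) :
      Rel (μ := μ) (comp (side k d i i) (put [] [] (Gen.invSide i i))) (idw _)
  | pos_side_cup {μ : Fin n → ℤ} (i : Fin (n - 1)) (h : 0 ≤ bar μ i)
      (m : Fin (bar μ i).toNat) :
      Rel (μ := μ) (comp (side k d i i) (put [] [] (Gen.invCup (μ := μ) i m))) zero
  | pos_cup_side {μ : Fin n → ℤ} (i : Fin (n - 1)) (h : 0 ≤ bar μ i)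
      (m : Fin (bar μ i).toNat) :
      Rel (μ := μ) (comp (cupDots k d i m) (put [] [] (Gen.invSide i i))) zero
  | pos_cup_cup {μ : Fin n → ℤ} (i : Fin (n - 1)) (h : 0 ≤ bar μ i)
      (m m' : Fin (bar μ i).toNat) :
      Rel (μ := μ) (comp (cupDots k d i m) (put [] [] (Gen.invCup (μ := μ) i m')))
        (if m = m' then idw [] else zero)
  -- `(side, capDots 0, …, capDots (-μ̄_i - 1)) : F_i E_i → E_i F_i ⊕ 1^{-μ̄_i}` is invertible
  -- for `μ̄_i ≤ 0`
  | neg_source {μ : Fin n → ℤ} (i : Fin (n - 1)) (h : bar μ i ≤ 0) :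
      Rel (μ := μ)
        (add (comp (side k d i i) (put [] [] (Gen.invSide i i)))
          (sum (-bar μ i).toNat fun m =>
            comp (capDots k d i m) (put [] [] (Gen.invCap (μ := μ) i m))))
        (idw _)
  | neg_side_side {μ : Fin n → ℤ} (i : Fin (n - 1)) (h : bar μ i ≤ 0) :
      Rel (μ := μ) (comp (put [] [] (Gen.invSide i i)) (side k d i i)) (idw _)
  | neg_side_cap {μ : Fin n → ℤ} (i : Fin (n - 1)) (h : bar μ i ≤ 0)
      (m : Fin (-bar μ i).toNat) :
      Rel (μ := μ) (comp (put [] [] (Gen.invSide i i)) (capDots k d i m)) zero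
  | neg_cap_side {μ : Fin n → ℤ} (i : Fin (n - 1)) (h : bar μ i ≤ 0)
      (m : Fin (-bar μ i).toNat) :
      Rel (μ := μ) (comp (put [] [] (Gen.invCap (μ := μ) i m)) (side k d i i)) zero
  | neg_cap_cap {μ : Fin n → ℤ} (i : Fin (n - 1)) (h : bar μ i ≤ 0)
      (m m' : Fin (-bar μ i).toNat) :
      Rel (μ := μ) (comp (put [] [] (Gen.invCap (μ := μ) i m)) (capDots k d i m'))
        (if m = m' then idw [] else zero)

end relations

/-- The graded 2-Schur algebra, a `(ℤ², bil)`-graded-2-category. -/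
def schur (k : Type u) [CommRing k] (n d : ℕ) : GradedTwoCat.{u, u, 0} (RingXYZ k) (ℤ × ℤ) :=
  Signature.presented (S := sig n d) (bil k) (Rel k d)

/-- The graded additive closure of the graded 2-Schur algebra with respect to the quantum grading
`qdeg D = -(a + b)` for `D` of `ℤ²`-degree `(a, b)`. -/
def schurClosure (k : Type u) [CommRing k] (n d : ℕ) : GradedTwoCat.{u, u, 1} (RingXYZ k) ℤ :=
  (schur k n d).closure fun x => -(x.1 + x.2)

/-- The specialization at `X = Y = Z = 1` of the graded additive closure of the graded 2-Schur
algebra. -/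
def schurSpecialized (k : Type u) [CommRing k] (n d : ℕ) : GradedTwoCat.{u, u, 1} k ℤ :=
  (schurClosure k n d).reduction k (specIdeal k)

end SchurCat

/-! ## The diagrammatic categorification `S(n,d)` of the `q`-Schur algebra -/

namespace MSV

open SchurCat

variable {n : ℕ}

/-- `i · j`, equal to `2`, `-1` or `0`. -/
def pairing (i j : Fin (n - 1)) : ℤ := root j (lo i) - root j (hi i)

/-- The generating 2-morphisms, with rightmost region `μ`: dots and crossings of both orientations,
and all oriented cups and caps. -/
inductive Gen : (Fin n → ℤ) → List (Letter n) → List (Letter n) → Type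
  | dotE {μ} (i : Fin (n - 1)) : Gen μ [.E i] [.E i]
  | dotF {μ} (i : Fin (n - 1)) : Gen μ [.F i] [.F i]
  | crossE {μ} (i j : Fin (n - 1)) : Gen μ [.E i, .E j] [.E j, .E i]
  | crossF {μ} (i j : Fin (n - 1)) : Gen μ [.F i, .F j] [.F j, .F i]
  | cupEF {μ} (i : Fin (n - 1)) : Gen μ [] [.E i, .F i]
  | cupFE {μ} (i : Fin (n - 1)) : Gen μ [] [.F i, .E i]
  | capEF {μ} (i : Fin (n - 1)) : Gen μ [.E i, .F i] []
  | capFE {μ} (i : Fin (n - 1)) : Gen μ [.F i, .E i] []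

/-- The degrees of the generating 2-morphisms. -/
def Gen.deg : ∀ {μ : Fin n → ℤ} {s t : List (Letter n)}, Gen μ s t → ℤ
  | _, _, _, .dotE i => pairing i i
  | _, _, _, .dotF i => pairing i i
  | _, _, _, .crossE i j => -pairing i j
  | _, _, _, .crossF i j => -pairing i j
  | μ, _, _, .cupEF i => 1 - bar μ i
  | μ, _, _, .cupFE i => 1 + bar μ i
  | μ, _, _, .capEF i => 1 - bar μ i
  | μ, _, _, .capFE i => 1 + bar μ i

/-- The generators of `S(n,d)`. -/
def sig (n d : ℕ) : Signature ℤ where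
  W := Fin n → ℤ
  L := Letter n
  act := actLetter
  good := IsWeight n d
  Gen := Gen
  deg := Gen.deg

section relations

open Signature.Term

variable (k : Type u) [CommRing k] (n d : ℕ)

/-- Combinations of string diagrams. -/
abbrev Diag (μ : Fin n → ℤ) (s t : List (Letter n)) : Type u :=
  Signature.Term (sig n d) k μ s t

variable {k n d}

/-- One generator between the words `u` and `v`. -/
abbrev put {μ : Fin n → ℤ} (u : List (Letter n)) {s t : List (Letter n)} (v : List (Letter n))
    (g : Gen (v.foldr actLetter μ) s t) : Diag k n d μ (u ++ s ++ v) (u ++ t ++ v) :=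
  Signature.Term.lay (S := sig n d) u v g

/-- The identity of the word `w`. -/
abbrev idw {μ : Fin n → ℤ} (w : List (Letter n)) : Diag k n d μ w w :=
  Signature.Term.one (S := sig n d) μ w

/-- A diagram between the words `u` and `v`. -/
abbrev within {μ : Fin n → ℤ} (u : List (Letter n)) {s t : List (Letter n)} (v : List (Letter n))
    (f : Diag k n d (v.foldr actLetter μ) s t) : Diag k n d μ (u ++ s ++ v) (u ++ t ++ v) :=
  Signature.Term.between (S := sig n d) u v f

variable (k d)

/-- The strand `E_i` with `m` dots. -/
def dotsE {μ : Fin n → ℤ} (i : Fin (n - 1)) (m : ℕ) : Diag k n d μ [.E i] [.E i] :=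
  pow (put [] [] (Gen.dotE i)) m

/-- The cup `1 → E_i F_i` with `m` dots. -/
def cupEF {μ : Fin n → ℤ} (i : Fin (n - 1)) (m : ℕ) : Diag k n d μ [] [.E i, .F i] :=
  comp (put [] [] (Gen.cupEF i)) (within [] [.F i] (dotsE k d i m))

/-- The cup `1 → F_i E_i` with `m` dots. -/
def cupFE {μ : Fin n → ℤ} (i : Fin (n - 1)) (m : ℕ) : Diag k n d μ [] [.F i, .E i] :=
  comp (put [] [] (Gen.cupFE i)) (within [.F i] [] (dotsE k d i m))

/-- The cap `E_i F_i → 1` with `m` dots. -/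
def capEF {μ : Fin n → ℤ} (i : Fin (n - 1)) (m : ℕ) : Diag k n d μ [.E i, .F i] [] :=
  comp (within [] [.F i] (dotsE k d i m)) (put [] [] (Gen.capEF i))

/-- The cap `F_i E_i → 1` with `m` dots. -/
def capFE {μ : Fin n → ℤ} (i : Fin (n - 1)) (m : ℕ) : Diag k n d μ [.F i, .E i] [] :=
  comp (within [.F i] [] (dotsE k d i m)) (put [] [] (Gen.capFE i))

/-- The (real) clockwise bubble with `m` dots. -/
def cw {μ : Fin n → ℤ} (i : Fin (n - 1)) (m : ℕ) : Diag k n d μ [] [] :=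
  comp (put [] [] (Gen.cupEF i)) (capEF k d i m)

/-- The (real) counterclockwise bubble with `m` dots. -/
def ccw {μ : Fin n → ℤ} (i : Fin (n - 1)) (m : ℕ) : Diag k n d μ [] [] :=
  comp (put [] [] (Gen.cupFE i)) (capFE k d i m)

/-- The value `(-1)^{μ_{i+1}}` of the clockwise bubble of degree zero. -/
def cwSign (μ : Fin n → ℤ) (i : Fin (n - 1)) : k := (((-1 : kˣ) ^ (μ (hi i)) : kˣ) : k)

/-- The value `(-1)^{μ_{i+1} - 1}` of the counterclockwise bubble of degree zero. -/
def ccwSign (μ : Fin n → ℤ) (i : Fin (n - 1)) : k := (((-1 : kˣ) ^ (μ (hi i) - 1) : kˣ) : k)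

/-- The fake clockwise bubble of degree `2r`, formally with `μ̄_i - 1 + r < 0` dots: the solution of
the infinite Grassmannian relation
`(∑_r cw_r t^r) (∑_r ccw_r t^r) = -1`, where `ccw_s` has `-μ̄_i - 1 + s` dots. -/
def fakeCw {μ : Fin n → ℤ} (i : Fin (n - 1)) : ℕ → Diag k n d μ [] []
  | 0 => smul (cwSign k μ i) (idw [])
  | r + 1 => smul (-ccwSign k μ i) (sum (r + 1) fun s =>
      comp (ccw k d i (-bar μ i - 1 + (s + 1)).toNat) (fakeCw i (r - s)))
termination_by r => r
decreasing_by omega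

/-- The fake counterclockwise bubble of degree `2r`, formally with `-μ̄_i - 1 + r < 0` dots. -/
def fakeCcw {μ : Fin n → ℤ} (i : Fin (n - 1)) : ℕ → Diag k n d μ [] []
  | 0 => smul (ccwSign k μ i) (idw [])
  | r + 1 => smul (-cwSign k μ i) (sum (r + 1) fun s =>
      comp (cw k d i (bar μ i - 1 + (s + 1)).toNat) (fakeCcw i (r - s)))
termination_by r => r
decreasing_by omega

/-- The sideways crossing `E_i F_j → F_j E_i`. -/
def sideEF {μ : Fin n → ℤ} (i j : Fin (n - 1)) : Diag k n d μ [.E i, .F j] [.F j, .E i] :=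
  comp (put [] [.E i, .F j] (Gen.cupFE j))
    (comp (put [.F j] [.F j] (Gen.crossE j i)) (put [.F j, .E i] [] (Gen.capEF j)))

/-- The sideways crossing `F_i E_j → E_j F_i`. -/
def sideFE {μ : Fin n → ℤ} (i j : Fin (n - 1)) : Diag k n d μ [.F i, .E j] [.E j, .F i] :=
  comp (put [.F i, .E j] [] (Gen.cupEF i))
    (comp (put [.F i] [.F i] (Gen.crossE j i)) (put [] [.E j, .F i] (Gen.capFE i)))

/-- Three upward strands `i j l`; the middle strand passes on the left. -/
def braidL {μ : Fin n → ℤ} (i j l : Fin (n - 1)) :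
    Diag k n d μ [.E i, .E j, .E l] [.E l, .E j, .E i] :=
  comp (put [] [.E l] (Gen.crossE i j))
    (comp (put [.E j] [] (Gen.crossE i l)) (put [] [.E i] (Gen.crossE j l)))

/-- Three upward strands `i j l`; the middle strand passes on the right. -/
def braidR {μ : Fin n → ℤ} (i j l : Fin (n - 1)) :
    Diag k n d μ [.E i, .E j, .E l] [.E l, .E j, .E i] :=
  comp (put [.E i] [] (Gen.crossE j l))
    (comp (put [] [.E j] (Gen.crossE i l)) (put [.E l] [] (Gen.crossE i j)))

/-- The scalar `i - j`. -/
def diff (i j : Fin (n - 1)) : k := (((i : ℤ) - (j : ℤ) : ℤ) : k)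

/-- The defining relations of `S(n,d)` (other than the vanishing of the diagrams with a region
outside `Λ_{n,d}`), together with the relation that two dots annihilate. -/
inductive Rel : ∀ {μ : Fin n → ℤ} {s t : List (Letter n)},
    Diag k n d μ s t → Diag k n d μ s t → Prop
  -- biadjointness
  | zigzag_E {μ : Fin n → ℤ} (i : Fin (n - 1)) :
      Rel (μ := μ) (comp (put [] [.E i] (Gen.cupEF i)) (put [.E i] [] (Gen.capFE i))) (idw [.E i])
  | zigzag_E' {μ : Fin n → ℤ} (i : Fin (n - 1)) :
      Rel (μ := μ) (comp (put [.E i] [] (Gen.cupFE i)) (put [] [.E i] (Gen.capEF i))) (idw [.E i])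
  | zigzag_F {μ : Fin n → ℤ} (i : Fin (n - 1)) :
      Rel (μ := μ) (comp (put [.F i] [] (Gen.cupEF i)) (put [] [.F i] (Gen.capFE i))) (idw [.F i])
  | zigzag_F' {μ : Fin n → ℤ} (i : Fin (n - 1)) :
      Rel (μ := μ) (comp (put [] [.F i] (Gen.cupFE i)) (put [.F i] [] (Gen.capEF i))) (idw [.F i])
  -- cyclicity of dots and crossings
  | dot_cyclic {μ : Fin n → ℤ} (i : Fin (n - 1)) :
      Rel (μ := μ) (put [] [] (Gen.dotF i))
        (comp (put [.F i] [] (Gen.cupEF i))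
          (comp (put [.F i] [.F i] (Gen.dotE i)) (put [] [.F i] (Gen.capFE i))))
  | dot_cyclic' {μ : Fin n → ℤ} (i : Fin (n - 1)) :
      Rel (μ := μ) (put [] [] (Gen.dotF i))
        (comp (put [] [.F i] (Gen.cupFE i))
          (comp (put [.F i] [.F i] (Gen.dotE i)) (put [.F i] [] (Gen.capEF i))))
  | cross_cyclic {μ : Fin n → ℤ} (i j : Fin (n - 1)) :
      Rel (μ := μ) (put [] [] (Gen.crossF i j))
        (comp (put [.F i, .F j] [] (Gen.cupEF i))
          (comp (put [.F i, .F j, .E i] [.F i] (Gen.cupEF j))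
            (comp (put [.F i, .F j] [.F j, .F i] (Gen.crossE i j))
              (comp (put [.F i] [.E i, .F j, .F i] (Gen.capFE j))
                (put [] [.F j, .F i] (Gen.capFE i))))))
  | cross_cyclic' {μ : Fin n → ℤ} (i j : Fin (n - 1)) :
      Rel (μ := μ) (put [] [] (Gen.crossF i j))
        (comp (put [] [.F i, .F j] (Gen.cupFE j))
          (comp (put [.F j] [.E j, .F i, .F j] (Gen.cupFE i))
            (comp (put [.F j, .F i] [.F i, .F j] (Gen.crossE i j))
              (comp (put [.F j, .F i, .E j] [.F j] (Gen.capEF i))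
                (put [.F j, .F i] [] (Gen.capEF j))))))
  -- bubbles of negative degree and of degree zero
  | cw_neg {μ : Fin n → ℤ} (i : Fin (n - 1)) (m : ℕ) (h : (m : ℤ) < bar μ i - 1) :
      Rel (μ := μ) (cw k d i m) zero
  | ccw_neg {μ : Fin n → ℤ} (i : Fin (n - 1)) (m : ℕ) (h : (m : ℤ) < -bar μ i - 1) :
      Rel (μ := μ) (ccw k d i m) zero
  | cw_zero {μ : Fin n → ℤ} (i : Fin (n - 1)) (m : ℕ) (h : (m : ℤ) = bar μ i - 1) :
      Rel (μ := μ) (cw k d i m) (smul (cwSign k μ i) (idw []))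
  | ccw_zero {μ : Fin n → ℤ} (i : Fin (n - 1)) (m : ℕ) (h : (m : ℤ) = -bar μ i - 1) :
      Rel (μ := μ) (ccw k d i m) (smul (ccwSign k μ i) (idw []))
  -- curls
  | curl_right {μ : Fin n → ℤ} (i : Fin (n - 1)) :
      Rel (μ := μ)
        (comp (put [.E i] [] (Gen.cupEF i))
          (comp (put [] [.F i] (Gen.crossE i i)) (put [.E i] [] (Gen.capEF i))))
        (smul (-1) (sum (-bar μ i + 1).toNat fun f =>
          comp (within [.E i] [] (fakeCw k d i f)) (dotsE k d i (-bar μ i - f).toNat)))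
  -- here the region on the left of the strand is `μ + α_i`
  | curl_left {μ : Fin n → ℤ} (i : Fin (n - 1)) :
      Rel (μ := μ)
        (comp (put [] [.E i] (Gen.cupFE i))
          (comp (put [.F i] [] (Gen.crossE i i)) (put [] [.E i] (Gen.capFE i))))
        (sum (bar (μ + root i) i + 1).toNat fun g =>
          comp (within [] [.E i] (fakeCcw k d i g)) (dotsE k d i (bar (μ + root i) i - g).toNat))
  -- decompositions of the identities of `E_i F_i` and `F_i E_i`
  | decomp_EF {μ : Fin n → ℤ} (i : Fin (n - 1)) :
      Rel (μ := μ) (idw [.E i, .F i])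
        (add (comp (sideEF k d i i) (sideFE k d i i))
          (smul (-1) (sum (bar μ i).toNat fun f => sum (f + 1) fun g =>
            comp (capEF k d i (bar μ i - 1 - f).toNat)
              (comp (fakeCcw k d i g) (cupEF k d i (f - g))))))
  | decomp_FE {μ : Fin n → ℤ} (i : Fin (n - 1)) :
      Rel (μ := μ) (idw [.F i, .E i])
        (add (comp (sideFE k d i i) (sideEF k d i i))
          (smul (-1) (sum (-bar μ i).toNat fun f => sum (f + 1) fun g =>
            comp (capFE k d i (-bar μ i - 1 - f).toNat)
              (comp (fakeCw k d i g) (cupFE k d i (f - g))))))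
  -- nilHecke relations
  | cross_cross_same {μ : Fin n → ℤ} (i : Fin (n - 1)) :
      Rel (μ := μ) (comp (put [] [] (Gen.crossE i i)) (put [] [] (Gen.crossE i i))) zero
  | nil_right {μ : Fin n → ℤ} (i : Fin (n - 1)) :
      Rel (μ := μ) (idw [.E i, .E i])
        (add (comp (put [] [] (Gen.crossE i i)) (put [] [.E i] (Gen.dotE i)))
          (smul (-1) (comp (put [.E i] [] (Gen.dotE i)) (put [] [] (Gen.crossE i i)))))
  | nil_left {μ : Fin n → ℤ} (i : Fin (n - 1)) :
      Rel (μ := μ) (idw [.E i, .E i])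
        (add (comp (put [] [.E i] (Gen.dotE i)) (put [] [] (Gen.crossE i i)))
          (smul (-1) (comp (put [] [] (Gen.crossE i i)) (put [.E i] [] (Gen.dotE i)))))
  -- mixed double crossings
  | mixed_EF {μ : Fin n → ℤ} (i j : Fin (n - 1)) (h : i ≠ j) :
      Rel (μ := μ) (comp (sideEF k d i j) (sideFE k d j i)) (idw [.E i, .F j])
  | mixed_FE {μ : Fin n → ℤ} (i j : Fin (n - 1)) (h : i ≠ j) :
      Rel (μ := μ) (comp (sideFE k d i j) (sideEF k d j i)) (idw [.F i, .E j])
  -- double crossings and dot slides for distinct colours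
  | cross_cross_distant {μ : Fin n → ℤ} (i j : Fin (n - 1)) (h : Distant i j) :
      Rel (μ := μ) (comp (put [] [] (Gen.crossE i j)) (put [] [] (Gen.crossE j i)))
        (idw [.E i, .E j])
  | cross_cross_adjacent {μ : Fin n → ℤ} (i j : Fin (n - 1)) (h : Adjacent i j) :
      Rel (μ := μ) (comp (put [] [] (Gen.crossE i j)) (put [] [] (Gen.crossE j i)))
        (smul (diff k i j)
          (add (put [] [.E j] (Gen.dotE i)) (smul (-1) (put [.E i] [] (Gen.dotE j)))))
  | slide_right {μ : Fin n → ℤ} (i j : Fin (n - 1)) (h : i ≠ j) :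
      Rel (μ := μ) (comp (put [] [] (Gen.crossE i j)) (put [] [.E i] (Gen.dotE j)))
        (comp (put [.E i] [] (Gen.dotE j)) (put [] [] (Gen.crossE i j)))
  | slide_left {μ : Fin n → ℤ} (i j : Fin (n - 1)) (h : i ≠ j) :
      Rel (μ := μ) (comp (put [] [.E j] (Gen.dotE i)) (put [] [] (Gen.crossE i j)))
        (comp (put [] [] (Gen.crossE i j)) (put [.E j] [] (Gen.dotE i)))
  -- triple crossings
  | braid {μ : Fin n → ℤ} (i j l : Fin (n - 1)) (h : ¬ (i = l ∧ Adjacent i j)) :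
      Rel (μ := μ) (braidL k d i j l) (braidR k d i j l)
  | serre {μ : Fin n → ℤ} (i j : Fin (n - 1)) (h : Adjacent i j) :
      Rel (μ := μ) (smul (diff k i j) (idw [.E i, .E j, .E i]))
        (add (braidL k d i j i) (smul (-1) (braidR k d i j i)))
  -- two dots annihilate
  | dot_dot {μ : Fin n → ℤ} (i : Fin (n - 1)) :
      Rel (μ := μ) (comp (put [] [] (Gen.dotF i)) (put [] [] (Gen.dotF i))) zero

end relations

/-- The `ℤ`-graded `k`-linear 2-category `S(n,d)^•`: 1-morphisms are formal finite direct sums of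
shifts of words in the `E_i` and `F_i`, and 2-morphisms are matrices of combinations of string
diagrams modulo the relations of `S(n,d)` and the relation that two dots annihilate. -/
def schurDot (k : Type u) [CommRing k] (n d : ℕ) : GradedTwoCat.{u, u, 1} k ℤ :=
  (Signature.presented (S := sig n d) (fun _ _ => 1) (Rel k d)).closure fun x => x

end MSV

end

/-!
Both presentations describe the same representations. A presented 2-category acts on a category
with weights through functors `E_i`, `F_i` and natural transformations for its generators
(`Signature.Rep`), and two diagrams are equal in the presented 2-category as soon as they act
equally in its tautological representation on words (`Signature.Words.mk_eq_of_eval`). It is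
therefore enough to translate representations, where the calculus of adjunctions and mates is
available. What they have in common is recorded in `SchurCat.SchurData`: adjunctions `F_i ⊣ E_i`
with downward dots and crossings that satisfy the downward relations, and inverses of the sideways
crossings or of the dotted cups and caps. The crossings of two strands of the same colour differ by
the sign `-1` in the two presentations.

A representation of the graded 2-Schur algebra at `X = Y = Z = 1` contains these data by definition.
To obtain the relations of `S(n,d)`, the upward dots and crossings are defined as the mates of the
downward ones, and mates turn the downward relations into the upward ones
(`SchurCat.Downward.FRel.eRel`). The cups `1 → F_i E_i` and caps `E_i F_i → 1` are built from the
inverses. As the entries of a weight `λ` are `0`, `1` or `2`, the difference `λ_i - λ_{i+1}` is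
between `-2` and `2`, and one of `F_i E_i`, `E_i F_i` vanishes unless it is `0`. A map out of
`E_i F_i` is thus determined by its values on dotted cups or on the sideways crossing
(`SchurCat.SchurData.ext_EF`), and this reduces the statement that the second cap slides through a
downward strand (`SchurCat.SchurData.map_ε'`) to the downward relations. The second pair of zigzags,
the second half of cyclicity, and the bubble, curl and decomposition relations follow weight by
weight (`MSV.Rep.IsModel.sat`). This part uses that dots square to zero, which kills almost all
dotted bubbles.

Conversely, a representation of `S(n,d)` provides the data (`MSV.Rep.schurData`): the decomposition
and bubble relations say that the sideways crossing rotated the other way, and the second caps and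
cups with the complementary number of dots, are the required inverses; the curl relations identify
the second adjunction with the one constructed above (`MSV.Rep.isModel`). Hence the generators of
each presentation are combinations of diagrams of the other, and the two substitutions are mutually
inverse on 2-morphisms over `k` (`SchurCat.substTo_substOf`, `SchurCat.substOf_substTo`).

Over `k[X, Y, Z^{±1}]/(X² = Y² = 1)`, setting `X = Y = Z = 1` turns the graded interchange law into
the ordinary one, and the 2-morphisms that become zero are exactly those in the submodule generated
by `X - 1`, `Y - 1` and `Z - 1` (`SchurCat.toDot_eq_zero_iff`), because diagrams that are equal over
`k` lift to diagrams that are congruent. The substitutions are homogeneous for the quantum grading.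
A specialization with these properties passes to matrices of shifted words
(`Signature.Specialization.iso`), that is, to the graded additive closures.
-/

-- Letters, weights and generators are fields of these definitions, and unification has to see
-- through them.
attribute [reducible] SchurCat.sig MSV.sig

noncomputable section

namespace Signature

/-! ### Actions of words on a linear category -/

/-- Transport of a morphism along equalities of its source and target. Unlike a composite with
`eqToHom`, it disappears definitionally when both equalities hold definitionally. -/
def castHom {C : Type w} [Category.{v} C] {X Y X' Y' : C} (hX : X = X') (hY : Y = Y')
    (f : X ⟶ Y) : X' ⟶ Y' := hX ▸ hY ▸ f

section castHom

variable {C : Type w} [Category.{v} C]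

lemma castHom_id {X X' : C} (h h' : X = X') : castHom h h' (𝟙 X) = 𝟙 X' := by
  subst h; rfl

lemma castHom_comp {X Y Z X' Y' Z' : C} (hX : X = X') (hY : Y = Y') (hZ : Z = Z')
    (f : X ⟶ Y) (g : Y ⟶ Z) :
    castHom hX hZ (f ≫ g) = castHom hX hY f ≫ castHom hY hZ g := by
  subst hX hY hZ; rfl

lemma castHom_castHom {X Y X' Y' X'' Y'' : C} (hX : X = X') (hY : Y = Y') (hX' : X' = X'')
    (hY' : Y' = Y'') (f : X ⟶ Y) :
    castHom hX' hY' (castHom hX hY f) = castHom (hX.trans hX') (hY.trans hY') f := by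
  subst hX hY hX' hY'; rfl

lemma castHom_nat {X₁ X₂ Y₁ Y₂ X₁' X₂' Y₁' Y₂' : C} (h1 : X₁ = X₁') (h2 : X₂ = X₂')
    (h3 : Y₁ = Y₁') (h4 : Y₂ = Y₂') {f : X₁ ⟶ X₂} {g : Y₁ ⟶ Y₂} {a : X₁ ⟶ Y₁} {b : X₂ ⟶ Y₂}
    (h : a ≫ g = f ≫ b) :
    castHom h1 h3 a ≫ castHom h3 h4 g = castHom h1 h2 f ≫ castHom h2 h4 b := by
  subst h1 h2 h3 h4; exact h

variable [Preadditive C]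

lemma castHom_zero {X Y X' Y' : C} (hX : X = X') (hY : Y = Y') :
    castHom hX hY (0 : X ⟶ Y) = 0 := by
  subst hX hY; rfl

lemma castHom_add {X Y X' Y' : C} (hX : X = X') (hY : Y = Y') (f g : X ⟶ Y) :
    castHom hX hY (f + g) = castHom hX hY f + castHom hX hY g := by
  subst hX hY; rfl

lemma castHom_smul {k : Type u} [CommRing k] [Linear k C] {X Y X' Y' : C} (hX : X = X')
    (hY : Y = Y') (r : k) (f : X ⟶ Y) :
    castHom hX hY (r • f) = r • castHom hX hY f := by
  subst hX hY; rfl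

end castHom

/-- A `k`-linear category with an endofunctor for each letter and a weight for each object, such
that letters act on weights by `actL`, objects whose weight is not good are zero objects, and
there are no nonzero morphisms between objects of different weights. -/
structure Action {L W : Type} (actL : L → W → W) (good : W → Prop) (k : Type u) [CommRing k]
    (C : Type w) [Category.{v} C] [Preadditive C] [Linear k C] where
  act : L → C ⥤ C
  [additive : ∀ l, (act l).Additive]
  [linear : ∀ l, (act l).Linear k]
  wt : C → W
  wt_act : ∀ l X, wt ((act l).obj X) = actL l (wt X)
  id_eq_zero : ∀ X, ¬ good (wt X) → 𝟙 X = 0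
  hom_eq_zero : ∀ {X Y : C} (f : X ⟶ Y), wt X ≠ wt Y → f = 0

namespace Action

attribute [instance] Action.additive Action.linear

variable {L W : Type} {actL : L → W → W} {good : W → Prop} {k : Type u} [CommRing k]
  {C : Type w} [Category.{v} C] [Preadditive C] [Linear k C] (A : Action actL good k C)

/-- The action of a word on objects; the rightmost letter acts first. -/
def obj : List L → C → C
  | [], X => X
  | l :: s, X => (A.act l).obj (obj s X)

/-- The action of a word on morphisms. -/
def map : ∀ (s : List L) {X Y : C}, (X ⟶ Y) → (A.obj s X ⟶ A.obj s Y)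
  | [], _, _, f => f
  | l :: s, _, _, f => (A.act l).map (map s f)

lemma obj_append (s t : List L) (X : C) : A.obj (s ++ t) X = A.obj s (A.obj t X) := by
  induction s with
  | nil => rfl
  | cons l s ih => exact congrArg (A.act l).obj ih

lemma wt_obj (s : List L) (X : C) : A.wt (A.obj s X) = s.foldr actL (A.wt X) := by
  induction s with
  | nil => rfl
  | cons l s ih => exact (A.wt_act l _).trans (congrArg (actL l) ih)

lemma map_id (s : List L) (X : C) : A.map s (𝟙 X) = 𝟙 _ := by
  induction s with
  | nil => rfl
  | cons l s ih => exact (congrArg (A.act l).map ih).trans ((A.act l).map_id _)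

lemma map_comp (s : List L) {X Y Z : C} (f : X ⟶ Y) (g : Y ⟶ Z) :
    A.map s (f ≫ g) = A.map s f ≫ A.map s g := by
  induction s with
  | nil => rfl
  | cons l s ih => exact (congrArg (A.act l).map ih).trans ((A.act l).map_comp _ _)

lemma map_zero (s : List L) (X Y : C) : A.map s (0 : X ⟶ Y) = 0 := by
  induction s with
  | nil => rfl
  | cons l s ih => exact (congrArg (A.act l).map ih).trans ((A.act l).map_zero _ _)

lemma map_add (s : List L) {X Y : C} (f g : X ⟶ Y) :
    A.map s (f + g) = A.map s f + A.map s g := by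
  induction s with
  | nil => rfl
  | cons l s ih => exact (congrArg (A.act l).map ih).trans (A.act l).map_add

lemma map_smul (s : List L) {X Y : C} (r : k) (f : X ⟶ Y) :
    A.map s (r • f) = r • A.map s f := by
  induction s with
  | nil => rfl
  | cons l s ih => exact (congrArg (A.act l).map ih).trans ((A.act l).map_smul _ _)

lemma map_castHom (s : List L) {X Y X' Y' : C} (hX : X = X') (hY : Y = Y') (f : X ⟶ Y) :
    A.map s (castHom hX hY f) =
      castHom (congrArg (A.obj s) hX) (congrArg (A.obj s) hY) (A.map s f) := by
  subst hX hY; rfl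

lemma map_append (s t : List L) {X Y : C} (f : X ⟶ Y) :
    A.map (s ++ t) f = castHom (A.obj_append s t X).symm (A.obj_append s t Y).symm
      (A.map s (A.map t f)) := by
  induction s with
  | nil => rfl
  | cons l s ih =>
    have h := A.map_castHom [l] (A.obj_append s t X).symm (A.obj_append s t Y).symm
      (A.map s (A.map t f))
    simp only [map, obj] at h
    simp only [List.cons_append, map, ih, h]
    rfl

lemma eq_of_bad_source {X Y : C} (h : ¬ good (A.wt X)) (f g : X ⟶ Y) : f = g := by
  rw [← Category.id_comp f, ← Category.id_comp g, A.id_eq_zero X h]; simp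

lemma eq_of_bad_map_source (G : C ⥤ C) [G.Additive] {X Y : C} (h : ¬ good (A.wt X))
    (f g : G.obj X ⟶ Y) : f = g := by
  have h0 : 𝟙 (G.obj X) = 0 := by
    rw [← CategoryTheory.Functor.map_id, A.id_eq_zero X h, G.map_zero]
  rw [← Category.id_comp f, ← Category.id_comp g, h0]; simp

lemma eq_of_bad_map_target (G : C ⥤ C) [G.Additive] {X Y : C} (h : ¬ good (A.wt Y))
    (f g : X ⟶ G.obj Y) : f = g := by
  have h0 : 𝟙 (G.obj Y) = 0 := by
    rw [← CategoryTheory.Functor.map_id, A.id_eq_zero Y h, G.map_zero]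
  rw [← Category.comp_id f, ← Category.comp_id g, h0]; simp

end Action

/-! ### Representations of a signature and the evaluation of diagrams -/

variable {Γ : Type} {S : Signature Γ} {k : Type u} [CommRing k]

/-- Natural transformations interpreting the generating 2-morphisms of a signature. -/
structure Rep (S : Signature Γ) {k : Type u} [CommRing k] {C : Type w} [Category.{v} C]
    [Preadditive C] [Linear k C] (A : Action S.act S.good k C) where
  gen : ∀ {ν : S.W} {s t : List S.L}, S.Gen ν s t → ∀ X, A.wt X = ν → (A.obj s X ⟶ A.obj t X)
  nat : ∀ {ν : S.W} {s t : List S.L} (g : S.Gen ν s t) {X Y : C} (f : X ⟶ Y) (hX : A.wt X = ν)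
    (hY : A.wt Y = ν), gen g X hX ≫ A.map t f = A.map s f ≫ gen g Y hY

namespace Rep

variable {C : Type w} [Category.{v} C] [Preadditive C] [Linear k C]
  {A : Action S.act S.good k C} (R : Rep S A)

lemma wt_obj_of {u : List S.L} {μ ν : S.W} {X : C} (hX : A.wt X = μ) (h : S.actW u μ = ν) :
    A.wt (A.obj u X) = ν := by
  rw [A.wt_obj, hX]; exact h

lemma obj_eq {w u s v : List S.L} (h : w = u ++ s ++ v) (X : C) :
    A.obj u (A.obj s (A.obj v X)) = A.obj w X := by
  rw [h, A.obj_append, A.obj_append]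

/-- The morphism represented by a diagram at an object of the weight of its rightmost region. -/
def eval {μ : S.W} {w w' : List S.L} (f : Term S k μ w w') (X : C) (hX : A.wt X = μ) :
    A.obj w X ⟶ A.obj w' X :=
  match w, w', f with
  | _, _, .id h => castHom rfl (congrArg (A.obj · X) h) (𝟙 _)
  | _, _, .gen u v hν g hw hw' =>
      castHom (obj_eq hw X) (obj_eq hw' X) (A.map u (R.gen g (A.obj v X) (wt_obj_of hX hν)))
  | _, _, .comp f g => eval f X hX ≫ eval g X hX
  | _, _, .zero => 0
  | _, _, .add f g => eval f X hX + eval g X hX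
  | _, _, .smul r f => r • eval f X hX
termination_by structural f

section

variable {μ : S.W} {w w' w'' : List S.L} (X : C) (hX : A.wt X = μ)

lemma eval_id : R.eval (.id rfl : Term S k μ w w) X hX = 𝟙 _ := rfl

lemma eval_comp (f : Term S k μ w w') (g : Term S k μ w' w'') :
    R.eval (.comp f g) X hX = R.eval f X hX ≫ R.eval g X hX := rfl

lemma eval_zero : R.eval (.zero : Term S k μ w w') X hX = 0 := rfl

lemma eval_add (f g : Term S k μ w w') :
    R.eval (.add f g) X hX = R.eval f X hX + R.eval g X hX := rfl

lemma eval_smul (r : k) (f : Term S k μ w w') : R.eval (.smul r f) X hX = r • R.eval f X hX := rfl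

end

lemma castHom_gen {ν : S.W} {s t : List S.L} (g : S.Gen ν s t) {X X' : C} (h : X = X')
    (hX : A.wt X = ν) (hX' : A.wt X' = ν) :
    R.gen g X' hX' = castHom (congrArg (A.obj s) h) (congrArg (A.obj t) h) (R.gen g X hX) := by
  subst h; rfl

lemma eval_whisk {μ ν : S.W} {u v : List S.L} (hν : S.actW v μ = ν) {s t : List S.L}
    (f : Term S k ν s t) : ∀ {w w' : List S.L} (hw : w = u ++ s ++ v) (hw' : w' = u ++ t ++ v)
    (X : C) (hX : A.wt X = μ), R.eval (f.whisk u v hν hw hw') X hX =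
      castHom (obj_eq hw X) (obj_eq hw' X)
        (A.map u (R.eval f (A.obj v X) (wt_obj_of hX hν))) := by
  induction f with
  | id h => intros; subst_vars; simp [Term.whisk, eval, castHom_id, A.map_id]
  | gen u₀ v₀ h g h1 h2 =>
    intro w w' hw hw' X hX
    simp only [Term.whisk, eval]
    rw [A.map_castHom, A.map_append, castHom_castHom, castHom_castHom,
      R.castHom_gen g (A.obj_append v₀ v X).symm (wt_obj_of (wt_obj_of hX hν) h), A.map_castHom,
      A.map_castHom, castHom_castHom]
  | comp f g ihf ihg =>
    intro w w' hw hw' X hX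
    simp only [Term.whisk, eval]
    rw [ihf hw rfl, ihg rfl hw', A.map_comp, ← castHom_comp]
  | zero => intros; simp [Term.whisk, eval, A.map_zero, castHom_zero]
  | add f g ihf ihg =>
    intro w w' hw hw' X hX
    simp only [Term.whisk, eval]
    rw [ihf hw hw', ihg hw hw', A.map_add, ← castHom_add]
  | smul r f ih =>
    intro w w' hw hw' X hX
    simp only [Term.whisk, eval]
    rw [ih hw hw', A.map_smul, ← castHom_smul]

lemma eval_nat {μ : S.W} {w w' : List S.L} (f : Term S k μ w w') {X Y : C} (φ : X ⟶ Y)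
    (hX : A.wt X = μ) (hY : A.wt Y = μ) :
    R.eval f X hX ≫ A.map w' φ = A.map w φ ≫ R.eval f Y hY := by
  induction f with
  | id h => subst h; simp [eval, castHom_id]
  | gen u v h g h1 h2 =>
    subst h1 h2
    simp only [eval]
    simp only [A.map_append, castHom_castHom]
    apply castHom_nat
    rw [← A.map_comp, R.nat g _ _ (wt_obj_of hY h), A.map_comp]
  | comp f g ihf ihg => simp only [eval, Category.assoc, ihg]; rw [← Category.assoc, ihf,
      Category.assoc]
  | zero => simp [eval]
  | add f g ihf ihg => simp [eval, ihf, ihg]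
  | smul r f ih => simp [eval, ih]

/-- The defining relations hold. -/
structure Sat (rel : Relations S k) : Prop where
  eq : ∀ {μ : S.W} {s t : List S.L} {f g : Term S k μ s t}, rel f g → ∀ X (hX : A.wt X = μ),
    R.eval f X hX = R.eval g X hX

/-- The interchange law amounts to naturality, up to the identification of the objects `X₁`, …, `X₄`
with values of composites of functors. -/
lemma interchange_aux {u m : List S.L} {s s' t t' : List S.L} {V : C}
    (φ : A.obj s' V ⟶ A.obj t' V)
    {a : A.obj s (A.obj m (A.obj s' V)) ⟶ A.obj t (A.obj m (A.obj s' V))}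
    {b : A.obj s (A.obj m (A.obj t' V)) ⟶ A.obj t (A.obj m (A.obj t' V))}
    (h : a ≫ A.map t (A.map m φ) = A.map s (A.map m φ) ≫ b) {X₁ X₂ X₃ X₄ : C}
    (h1 : A.obj (u ++ s ++ m) (A.obj s' V) = X₁) (h2 : A.obj (u ++ s ++ m) (A.obj t' V) = X₂)
    (h2' : A.obj u (A.obj s (A.obj m (A.obj t' V))) = X₂)
    (h3 : A.obj u (A.obj t (A.obj m (A.obj t' V))) = X₃)
    (h1' : A.obj u (A.obj s (A.obj m (A.obj s' V))) = X₁)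
    (h4 : A.obj u (A.obj t (A.obj m (A.obj s' V))) = X₄)
    (h4' : A.obj (u ++ t ++ m) (A.obj s' V) = X₄)
    (h3' : A.obj (u ++ t ++ m) (A.obj t' V) = X₃) :
    castHom h1 h2 (A.map (u ++ s ++ m) φ) ≫ castHom h2' h3 (A.map u b) =
      castHom h1' h4 (A.map u a) ≫ castHom h4' h3' (A.map (u ++ t ++ m) φ) := by
  subst h1' h2' h3 h4
  rw [A.map_append, A.map_append, A.map_append, A.map_append, castHom_castHom, castHom_castHom,
    castHom_castHom, castHom_castHom]
  change A.map u (A.map s (A.map m φ)) ≫ A.map u b = A.map u a ≫ A.map u (A.map t (A.map m φ))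
  rw [← A.map_comp, ← A.map_comp, h]

/-- Evaluation is well defined on the presented 2-category, for the ordinary interchange law. -/
theorem eval_eq {rel : Relations S k} (hR : R.Sat rel) {μ : S.W} {w w' : List S.L}
    {f g : Term S k μ w w'} (h : Eqv (fun _ _ => 1) rel f g) :
    ∀ X (hX : A.wt X = μ), R.eval f X hX = R.eval g X hX := by
  induction h with
  | refl f => intros; rfl
  | symm _ ih => intro X hX; exact (ih X hX).symm
  | trans _ _ ih1 ih2 => intro X hX; exact (ih1 X hX).trans (ih2 X hX)
  | comp _ _ ih1 ih2 => intro X hX; simp only [eval]; rw [ih1, ih2]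
  | add _ _ ih1 ih2 => intro X hX; simp only [eval]; rw [ih1, ih2]
  | smul r _ ih => intro X hX; simp only [eval]; rw [ih]
  | add_assoc => intros; exact _root_.add_assoc _ _ _
  | add_comm => intros; exact _root_.add_comm _ _
  | zero_add => intros; exact _root_.zero_add _
  | neg_add => intros; simp [eval]
  | smul_add => intros; exact _root_.smul_add _ _ _
  | add_smul => intros; exact _root_.add_smul _ _ _
  | mul_smul => intros; exact SemigroupAction.mul_smul _ _ _
  | one_smul => intros; exact _root_.one_smul _ _
  | id_comp f => intros; exact Category.id_comp _
  | comp_id f => intros; exact Category.comp_id _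
  | assoc => intros; exact Category.assoc _ _ _
  | add_comp => intros; exact Preadditive.add_comp _ _ _ _ _ _
  | comp_add => intros; exact Preadditive.comp_add _ _ _ _ _ _
  | smul_comp => intros; exact Linear.smul_comp _ _ _ _ _ _
  | comp_smul => intros; exact Linear.comp_smul _ _ _ _ _ _
  | @interchange u m v ν ν' s t s' t' f g ug ug' vf vf' w₁ w₂ w₂' w₃ hug hug' hvf hvf' hν hν₁ hν'
      h1 h2 h2' h3 h1' h4 h4' h3' =>
    intro X hX
    simp only [eval, Units.val_one, _root_.one_smul]
    have e : A.obj vf X = A.obj m (A.obj t' (A.obj v X)) := by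
      rw [hvf, A.obj_append, A.obj_append]
    have e' : A.obj vf' X = A.obj m (A.obj s' (A.obj v X)) := by
      rw [hvf', A.obj_append, A.obj_append]
    have hm : A.wt (A.obj m (A.obj t' (A.obj v X))) = ν := e ▸ wt_obj_of hX hν
    have hm' : A.wt (A.obj m (A.obj s' (A.obj v X))) = ν := e' ▸ wt_obj_of hX hν₁
    rw [R.castHom_gen f e.symm hm, R.castHom_gen f e'.symm hm', A.map_castHom, A.map_castHom,
      castHom_castHom, castHom_castHom]
    subst hug hug'
    exact interchange_aux _ (R.nat f _ hm' hm) _ _ _ _ _ _ _ _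
  | of h u v hν hw hw' =>
    intro X hX
    rw [eval_whisk, eval_whisk, hR.eq h]
  | @bad w w' h hb =>
    intro X hX
    subst h
    simp only [GoodWord, not_forall] at hb
    obtain ⟨x, y, rfl, hy⟩ := hb
    have : 𝟙 (A.obj y X) = 0 := A.id_eq_zero _ (by rw [A.wt_obj, hX]; exact hy)
    have h2 : 𝟙 (A.obj (x ++ y) X) = 0 := by
      have h3 := congrArg (A.map x) this
      rw [A.map_id, A.map_zero] at h3
      rw [A.obj_append, h3]
    exact h2

/-- The representation of another signature on the same category, obtained from an interpretation
of its generators as combinations of diagrams. -/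
def pull {Γ' : Type} {G : S.W → List S.L → List S.L → Type} {dg : ∀ {μ s t}, G μ s t → Γ'}
    (φ : ∀ {ν s t}, G ν s t → Term S k ν s t) :
    Rep (Signature.mk S.W S.L S.act S.good G dg) A where
  gen g X hX := R.eval (φ g) X hX
  nat g _ _ f hX hY := R.eval_nat (φ g) f hX hY

end Rep

/-- Substitution of combinations of diagrams for the generators. -/
def subst {Γ' : Type} {G : S.W → List S.L → List S.L → Type} {dg : ∀ {μ s t}, G μ s t → Γ'}
    (φ : ∀ {ν s t}, G ν s t → Term S k ν s t) {μ : S.W} {w w' : List S.L}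
    (f : Term (Signature.mk S.W S.L S.act S.good G dg) k μ w w') : Term S k μ w w' :=
  match w, w', f with
  | _, _, .id h => .id h
  | _, _, .gen u v hν g hw hw' => (φ g).whisk (S := S) (ν := _) u v hν hw hw'
  | _, _, .comp f g => .comp (subst φ f) (subst φ g)
  | _, _, .zero => .zero
  | _, _, .add f g => .add (subst φ f) (subst φ g)
  | _, _, .smul r f => .smul r (subst φ f)
termination_by structural f

/-- Substituting diagrams for the generators corresponds to pulling back representations. -/
lemma Rep.eval_subst {C : Type w} [Category.{v} C] [Preadditive C] [Linear k C]
    {A : Action S.act S.good k C} (R : Rep S A) {Γ' : Type}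
    {G : S.W → List S.L → List S.L → Type} {dg : ∀ {μ s t}, G μ s t → Γ'}
    (φ : ∀ {ν s t}, G ν s t → Term S k ν s t) {μ : S.W} {w w' : List S.L}
    (f : Term (Signature.mk S.W S.L S.act S.good G dg) k μ w w') (X : C) (hX : A.wt X = μ) :
    R.eval (subst (S := S) (dg := dg) φ f) X hX = (R.pull (dg := dg) φ).eval f X hX := by
  match w, w', f with
  | _, _, .id h => rfl
  | _, _, .gen u v h g h1 h2 => exact R.eval_whisk h (φ g) h1 h2 X hX
  | _, _, .comp f g =>
    exact congrArg₂ (· ≫ ·) (Rep.eval_subst R φ f X hX) (Rep.eval_subst R φ g X hX)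
  | _, _, .zero => rfl
  | _, _, .add f g =>
    exact congrArg₂ (· + ·) (Rep.eval_subst R φ f X hX) (Rep.eval_subst R φ g X hX)
  | _, _, .smul r f => exact congrArg (r • ·) (Rep.eval_subst R φ f X hX)
termination_by structural f

/-- Evaluation only depends on the values of the generators. -/
lemma Rep.eval_congr {C : Type w} [Category.{v} C] [Preadditive C] [Linear k C]
    {A : Action S.act S.good k C} {R R' : Rep S A}
    (h : ∀ {ν s t} (g : S.Gen ν s t) X hX, R.gen g X hX = R'.gen g X hX)
    {μ : S.W} {w w' : List S.L} (f : Term S k μ w w') (X : C) (hX : A.wt X = μ) :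
    R.eval f X hX = R'.eval f X hX := by
  induction f with
  | id h => rfl
  | gen u v _ g h1 h2 => simp only [eval, h]
  | comp f g ihf ihg => simp only [eval, ihf, ihg]
  | zero => rfl
  | add f g ihf ihg => simp only [eval, ihf, ihg]
  | smul r f ih => simp only [eval, ih]

end Signature

namespace Signature

/-! ### The universal representation, on words -/

variable {Γ : Type} {S : Signature Γ} {k : Type u} [CommRing k]

namespace PHom

variable {bil : Γ → Γ → kˣ} {rel : Relations S k} {μ : S.W} {w w' w'' : List S.L}

lemma ind {μ : S.W} {w w' : List S.L} {P : PHom bil rel μ w w' → Prop}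
    (h : ∀ f, P (mk bil rel f)) (f) : P f := Quot.ind h f

lemma mk_comp (f : Term S k μ w w') (g : Term S k μ w' w'') :
    mk bil rel (.comp f g) = comp (mk bil rel f) (mk bil rel g) := rfl

lemma mk_add (f g : Term S k μ w w') :
    mk bil rel (.add f g) = mk bil rel f + mk bil rel g := rfl

lemma mk_smul (r : k) (f : Term S k μ w w') :
    mk bil rel (.smul r f) = r • mk bil rel f := rfl

lemma comp_zero' (f : PHom bil rel μ w w') : comp f (0 : PHom bil rel μ w' w'') = 0 := by
  have h : comp f ((0 : k) • (0 : PHom bil rel μ w' w'')) = (0 : k) • comp f 0 := by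
    induction f using ind with | h f => exact Quot.sound (.comp_smul _ f .zero)
  simpa using h

lemma zero_comp' (f : PHom bil rel μ w' w'') : comp (0 : PHom bil rel μ w w') f = 0 := by
  have h : comp ((0 : k) • (0 : PHom bil rel μ w w')) f = (0 : k) • comp 0 f := by
    induction f using ind with | h f => exact Quot.sound (.smul_comp _ .zero f)
  simpa using h

/-- If generators preserve weights, then there are no nonzero 2-morphisms between words that act
differently on the rightmost region. -/
lemma mk_eq_zero (hS : ∀ {ν s t}, S.Gen ν s t → S.actW s ν = S.actW t ν)
    (f : Term S k μ w w') (h : S.actW w μ ≠ S.actW w' μ) : mk bil rel f = 0 := by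
  induction f with
  | id e => exact absurd (by rw [e]) h
  | gen u v hν g h1 h2 =>
    subst h1 h2
    exact absurd (by rw [actW_append, actW_append, actW_append, actW_append, hν, hS g]) h
  | @comp w w' w'' f g ihf ihg =>
    rw [mk_comp]
    by_cases h' : S.actW w μ = S.actW w' μ
    · rw [ihg (h' ▸ h), comp_zero']
    · rw [ihf h', zero_comp']
  | zero => rfl
  | add f g ihf ihg => rw [mk_add, ihf h, ihg h, _root_.zero_add]
  | smul r f ih => rw [mk_smul, ih h, smul_zero]

end PHom

/-- The words with rightmost region `μ`, as the objects of the category of all 2-morphisms of the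
presented 2-category between them. -/
structure Words (rel : Relations S k) (μ : S.W) where
  word : List S.L

namespace Words

variable (rel : Relations S k) (μ : S.W)

instance : Category.{u} (Words rel μ) where
  Hom f g := PHom (fun _ _ => 1) rel μ f.word g.word
  id f := PHom.mk _ rel (.id rfl)
  comp f g := PHom.comp f g
  id_comp := by rintro _ _ ⟨f⟩; exact Quot.sound (.id_comp f)
  comp_id := by rintro _ _ ⟨f⟩; exact Quot.sound (.comp_id f)
  assoc := by rintro _ _ _ _ ⟨f⟩ ⟨g⟩ ⟨h⟩; exact Quot.sound (.assoc f g h)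

instance : Preadditive (Words rel μ) where
  homGroup f g := inferInstanceAs (AddCommGroup (PHom (fun _ _ => 1) rel μ f.word g.word))
  add_comp := by rintro _ _ _ ⟨f⟩ ⟨f'⟩ ⟨g⟩; exact Quot.sound (.add_comp f f' g)
  comp_add := by rintro _ _ _ ⟨f⟩ ⟨g⟩ ⟨g'⟩; exact Quot.sound (.comp_add f g g')

instance : Linear k (Words rel μ) where
  homModule f g := inferInstanceAs (Module k (PHom (fun _ _ => 1) rel μ f.word g.word))
  smul_comp := by rintro _ _ _ r ⟨f⟩ ⟨g⟩; exact Quot.sound (.smul_comp r f g)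
  comp_smul := by rintro _ _ _ ⟨f⟩ r ⟨g⟩; exact Quot.sound (.comp_smul r f g)

variable {μ}

/-- The morphism represented by a combination of diagrams. -/
def mk' {X Y : Words rel μ} (f : Term S k μ X.word Y.word) : X ⟶ Y := PHom.mk _ rel f

variable {rel}

lemma ind {X Y : Words rel μ} {P : (X ⟶ Y) → Prop} (h : ∀ f, P (mk' rel f)) (f) : P f :=
  Quot.ind h f

lemma mk'_comp {X Y Z : Words rel μ} (f : Term S k μ X.word Y.word)
    (g : Term S k μ Y.word Z.word) :
    (mk' rel (.comp f g) : X ⟶ Z) = (mk' rel f : X ⟶ Y) ≫ (mk' rel g : Y ⟶ Z) := rfl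

lemma mk'_eq {X Y : Words rel μ} {f g : Term S k μ X.word Y.word}
    (h : Eqv (fun _ _ => 1) rel f g) : (mk' rel f : X ⟶ Y) = mk' rel g := Quot.sound h

lemma castHom_mk' {X Y X' Y' : Words rel μ} (hX : X = X') (hY : Y = Y')
    (f : ∀ w w' : List S.L, w = X.word → w' = Y.word → Term S k μ w w') :
    castHom hX hY (mk' rel (f X.word Y.word rfl rfl)) =
      mk' rel (f X'.word Y'.word (by rw [hX]) (by rw [hY])) := by
  subst hX hY; rfl

/-- Adding a letter on the left. -/
def actL (l : S.L) : Words rel μ ⥤ Words rel μ where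
  obj X := ⟨l :: X.word⟩
  map {X Y} f := PHom.whisk [l] [] rfl (w := l :: X.word) (w' := l :: Y.word)
    (by simp) (by simp) f
  map_id _ := rfl
  map_comp := by
    rintro X Y Z ⟨f⟩ ⟨g⟩
    change Term S k μ X.word Y.word at f
    change Term S k μ Y.word Z.word at g
    exact congrArg (PHom.mk _ rel) (Term.comp_eq_of_mid (μ := μ) (w := l :: X.word)
      (w'' := l :: Z.word) (a := l :: Y.word) (b := [l] ++ Y.word ++ []) (by simp)
      (fun c hc => f.whisk (ν := μ) [l] [] rfl (by simp) hc)
      (fun c hc => g.whisk (ν := μ) [l] [] rfl hc (by simp))).symm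

variable (rel μ) in
/-- Words act on words by concatenation. -/
def action (hS : ∀ {ν s t}, S.Gen ν s t → S.actW s ν = S.actW t ν) :
    Action S.act S.good k (Words rel μ) where
  act := actL
  additive l := ⟨fun {X Y f g} =>
    (PHom.whisk [l] [] rfl (w := l :: X.word) (w' := l :: Y.word) (by simp) (by simp)).map_add f g⟩
  linear l := ⟨fun {X Y} f r =>
    (PHom.whisk [l] [] rfl (w := l :: X.word) (w' := l :: Y.word) (by simp) (by simp)).map_smul r f⟩
  wt X := S.actW X.word μ
  wt_act _ _ := rfl
  id_eq_zero X h := Quot.sound (.bad rfl fun hg => h (hg [] _ rfl))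
  hom_eq_zero {X Y} f h := by
    induction f using ind with
    | h f => exact PHom.mk_eq_zero hS f h

section

variable (hS : ∀ {ν s t}, S.Gen ν s t → S.actW s ν = S.actW t ν)

lemma obj_word (s : List S.L) (X : Words rel μ) :
    ((action rel μ hS).obj s X).word = s ++ X.word := by
  induction s with
  | nil => rfl
  | cons l s ih => exact congrArg (l :: ·) ih

lemma map_mk' (s : List S.L) {X Y : Words rel μ} (f : Term S k μ X.word Y.word) :
    (action rel μ hS).map s (mk' rel f : X ⟶ Y) =
      mk' rel (f.whisk (ν := μ) s [] rfl (by simp [obj_word]) (by simp [obj_word])) := by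
  induction s with
  | nil =>
    obtain ⟨v⟩ := X
    obtain ⟨v'⟩ := Y
    change PHom.mk _ rel f = PHom.mk _ rel _
    congr 1
    change Term S k μ v v' at f
    have key : ∀ {v v' : List S.L} (f : Term S k μ v v') (h : v = [] ++ v ++ [])
        (h' : v' = [] ++ v' ++ []), f = f.whisk (ν := μ) [] [] rfl h h' := by
      intro v v' f
      induction f with
      | id => intros; rfl
      | gen u v hν g h1 h2 => intros; subst h1 h2; simp [Term.whisk]
      | @comp a b c f g ihf ihg =>
        intro h h'
        refine Eq.trans ?_ (Term.comp_eq_of_mid (a := b) (by simp)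
          (fun c hc => f.whisk (ν := μ) [] [] rfl h hc)
          (fun c hc => g.whisk (ν := μ) [] [] rfl hc h'))
        rw [← ihf, ← ihg]
      | zero => intros; rfl
      | add f g ihf ihg => intro h h'; simp only [Term.whisk]; rw [← ihf, ← ihg]
      | smul r f ih => intro h h'; simp only [Term.whisk]; rw [← ih]
    exact key f _ _
  | cons l s ih =>
    refine (congrArg (actL l).map ih).trans ?_
    exact congrArg (PHom.mk _ rel) (Term.whisk_whisk (ν := μ) (μ := μ) (κ := μ) rfl rfl f _ _ _ _
      rfl _ _)

/-- The tautological representation. -/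
def rep : Rep S (action rel μ hS) where
  gen {ν s t} g X hX := mk' rel (.gen [] X.word hX g (by simp [obj_word]) (by simp [obj_word]))
  nat {ν s t} g {X Y} f hX hY := by
    induction f using ind with
    | h f =>
      obtain ⟨v⟩ := X
      obtain ⟨v'⟩ := Y
      change Term S k μ v v' at f
      induction f with
      | @id v v' h =>
        subst h
        change _ ≫ (action rel μ hS).map t (𝟙 _) = (action rel μ hS).map s (𝟙 _) ≫ _
        rw [Action.map_id, Action.map_id, Category.comp_id, Category.id_comp]
      | gen u v hν g' h1 h2 =>
        rw [map_mk', map_mk']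
        simp only [Term.whisk, List.append_nil]
        refine (mk'_eq (Eqv.trans (.symm (.one_smul _)) (.symm
          (.interchange (bil := fun _ _ => 1) (u := []) (m := u) (v := v) (ug := s ++ u)
            (ug' := t ++ u) g g' ?_ ?_ h2 h1 ?_ ?_ ?_ ?_ ?_ ?_ ?_ ?_ ?_ ?_ ?_))))
        all_goals first | assumption | simp [obj_word, h1, h2]
      | @comp a b c f f' ihf ihf' =>
        rw [mk'_comp (X := ⟨a⟩) (Y := ⟨b⟩) (Z := ⟨c⟩), Action.map_comp, Action.map_comp]
        by_cases hb : S.actW b μ = ν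
        · rw [← Category.assoc, ihf hX hb, Category.assoc, ihf' hb hY, Category.assoc]
        · have hz : (mk' rel f : (⟨a⟩ : Words rel μ) ⟶ ⟨b⟩) = 0 :=
            (action rel μ hS).hom_eq_zero _ fun h => hb (h.symm.trans hX)
          rw [hz]
          simp [Action.map_zero]
      | zero =>
        change _ ≫ (action rel μ hS).map t 0 = (action rel μ hS).map s 0 ≫ _
        simp [Action.map_zero]
      | @add a b f f' ihf ihf' =>
        have h : (mk' rel (.add f f') : (⟨a⟩ : Words rel μ) ⟶ ⟨b⟩) = mk' rel f + mk' rel f' := rfl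
        rw [h, Action.map_add, Action.map_add, Preadditive.comp_add, Preadditive.add_comp,
          ihf hX hY, ihf' hX hY]
      | @smul a b r f ih =>
        have h : (mk' rel (.smul r f) : (⟨a⟩ : Words rel μ) ⟶ ⟨b⟩) = r • mk' rel f := rfl
        rw [h, Action.map_smul, Action.map_smul, Linear.comp_smul, Linear.smul_comp, ih hX hY]

lemma obj_nil (s : List S.L) : (action rel μ hS).obj s ⟨[]⟩ = ⟨s⟩ := by
  have := obj_word hS s (⟨[]⟩ : Words rel μ)
  rw [List.append_nil] at this
  cases h : (action rel μ hS).obj s ⟨[]⟩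
  rw [h] at this
  exact congrArg Words.mk this

/-- Evaluating a diagram at a word puts this word to the right of the diagram. -/
lemma eval_rep {ν : S.W} {w w' : List S.L} (f : Term S k ν w w') (X : Words rel μ)
    (hX : S.actW X.word μ = ν) :
    (rep hS).eval f X hX =
      mk' rel (f.whisk [] X.word hX (by simp [obj_word]) (by simp [obj_word])) := by
  induction f with
  | id h => subst h; rfl
  | gen u v h g h1 h2 =>
    subst h1 h2
    obtain ⟨x⟩ := X
    simp only [Rep.eval, rep, map_mk', Term.whisk]
    refine (castHom_mk' _ _ (fun w w' h h' => Term.gen _ _ _ g (h.trans ?_) (h'.trans ?_))).trans ?_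
    · simp [obj_word]
    · simp [obj_word]
    · congr 1
      simp [obj_word]
  | @comp a b c f g ihf ihg =>
    simp only [Rep.eval, ihf, ihg, Term.whisk]
    rw [← mk'_comp]
    congr 1
    exact Term.comp_eq_of_mid (by simp [obj_word])
      (fun d hd => f.whisk [] X.word hX _ hd) (fun d hd => g.whisk [] X.word hX hd _)
  | zero => rfl
  | add f g ihf ihg => simp only [Rep.eval, ihf, ihg, Term.whisk]; rfl
  | smul r f ih => simp only [Rep.eval, ih, Term.whisk]; rfl

/-- The tautological representation satisfies the defining relations. -/
lemma rep_sat : (rep (rel := rel) (μ := μ) hS).Sat rel := by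
  refine ⟨fun {ν s t f g} h X hX => ?_⟩
  refine (eval_rep hS f X hX).trans (.trans ?_ (eval_rep hS g X hX).symm)
  exact mk'_eq (.of h _ _ _ _ _)

/-- Diagrams with equal values in the tautological representation are equal in the presented
2-category. -/
lemma mk_eq_of_eval {w w' : List S.L} {f g : Term S k μ w w'}
    (h : (rep (rel := rel) hS).eval f ⟨[]⟩ rfl = (rep hS).eval g ⟨[]⟩ rfl) :
    PHom.mk (fun _ _ => 1) rel f = PHom.mk _ rel g := by
  replace h := (eval_rep hS f _ rfl).symm.trans (h.trans (eval_rep hS g _ rfl))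
  have h' := congrArg (castHom (obj_nil hS w) (obj_nil hS w')) h
  have key : ∀ f : Term S k μ w w', castHom (obj_nil hS w) (obj_nil hS w')
      (mk' rel (f.whisk (ν := μ) [] [] rfl (by simp [obj_word]) (by simp [obj_word]))) =
      (mk' rel f : (⟨w⟩ : Words rel μ) ⟶ ⟨w'⟩) := fun f => by
    rw [castHom_mk' _ _ (fun a b ha hb => f.whisk (ν := μ) [] [] rfl (ha.trans (by simp [obj_word]))
      (hb.trans (by simp [obj_word])))]
    exact (map_mk' hS [] (X := ⟨w⟩) (Y := ⟨w'⟩) f).symm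
  rw [key, key] at h'
  exact h'

end

end Words

end Signature

namespace SchurCat

open Signature

variable {n d : ℕ} {k : Type u} [CommRing k] {C : Type w} [Category.{v} C] [Preadditive C]
  [Linear k C]

/-- A `k`-linear category with endofunctors `E_i` and `F_i` and weights in `ℤ^n`, the objects with
a weight outside `Λ_{n,d}` being zero. -/
abbrev WeightAction (n d : ℕ) (k : Type u) [CommRing k] (C : Type w) [Category.{v} C]
    [Preadditive C] [Linear k C] :=
  Action (L := Letter n) (W := Fin n → ℤ) actLetter (IsWeight n d) k C

/-- The functor `E_i`. -/
abbrev _root_.Signature.Action.E (A : WeightAction n d k C) (i : Fin (n - 1)) : C ⥤ C :=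
  A.act (.E i)

/-- The functor `F_i`. -/
abbrev _root_.Signature.Action.F (A : WeightAction n d k C) (i : Fin (n - 1)) : C ⥤ C :=
  A.act (.F i)

/-! ### Mates under the adjunctions `F_i ⊣ E_i` -/

/-- Adjunctions `F_i ⊣ E_i` with dots on, and crossings of, the functors `F_i`. -/
structure Downward (A : WeightAction n d k C) where
  η : ∀ i X, X ⟶ (A.E i).obj ((A.F i).obj X)
  ε : ∀ i X, (A.F i).obj ((A.E i).obj X) ⟶ X
  x : ∀ i X, (A.F i).obj X ⟶ (A.F i).obj X
  c : ∀ i j X, (A.F i).obj ((A.F j).obj X) ⟶ (A.F j).obj ((A.F i).obj X)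
  η_nat : ∀ i {X Y : C} (f : X ⟶ Y), f ≫ η i Y = η i X ≫ (A.E i).map ((A.F i).map f)
  ε_nat : ∀ i {X Y : C} (f : X ⟶ Y), (A.F i).map ((A.E i).map f) ≫ ε i Y = ε i X ≫ f
  x_nat : ∀ i {X Y : C} (f : X ⟶ Y), (A.F i).map f ≫ x i Y = x i X ≫ (A.F i).map f
  c_nat : ∀ i j {X Y : C} (f : X ⟶ Y),
    (A.F i).map ((A.F j).map f) ≫ c i j Y = c i j X ≫ (A.F j).map ((A.F i).map f)
  zigzag_F : ∀ i X, (A.F i).map (η i X) ≫ ε i ((A.F i).obj X) = 𝟙 _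
  zigzag_E : ∀ i X, η i ((A.E i).obj X) ≫ (A.E i).map (ε i X) = 𝟙 _

namespace Downward

variable {A : WeightAction n d k C} (B : Downward A)

/-- A functor preserves commutative squares. -/
lemma map_sq {C D : Type*} [Category* C] [Category* D] (F : C ⥤ D) {X Y Z W : C} {f : X ⟶ Y}
    {g : Y ⟶ W} {f' : X ⟶ Z} {g' : Z ⟶ W} (h : f ≫ g = f' ≫ g') :
    F.map f ≫ F.map g = F.map f' ≫ F.map g' := by
  rw [← F.map_comp, h, F.map_comp]

/-- A functor preserves commutative triangles. -/
lemma map_tri {C D : Type*} [Category* C] [Category* D] (F : C ⥤ D) {X Y Z : C} {f : X ⟶ Y}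
    {g : Y ⟶ Z} {h : X ⟶ Z} (e : f ≫ g = h) : F.map f ≫ F.map g = F.map h := by
  rw [← F.map_comp, e]

/-- The mate `G E_j → E_j G` of a transformation `F_j G → G F_j`. -/
def mate (j : Fin (n - 1)) (G : C ⥤ C)
    (θ : ∀ Y, (A.F j).obj (G.obj Y) ⟶ G.obj ((A.F j).obj Y)) (X : C) :
    G.obj ((A.E j).obj X) ⟶ (A.E j).obj (G.obj X) :=
  B.η j _ ≫ (A.E j).map (θ _) ≫ (A.E j).map (G.map (B.ε j X))

lemma mate_counit (j : Fin (n - 1)) (G : C ⥤ C)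
    (θ : ∀ Y, (A.F j).obj (G.obj Y) ⟶ G.obj ((A.F j).obj Y)) (X : C) :
    (A.F j).map (B.mate j G θ X) ≫ B.ε j (G.obj X) = θ _ ≫ G.map (B.ε j X) := by
  simp only [mate, ← Functor.map_comp]
  rw [Functor.map_comp, Category.assoc, B.ε_nat, reassoc_of% B.zigzag_F]

lemma mate_nat (j : Fin (n - 1)) (G : C ⥤ C)
    (θ : ∀ Y, (A.F j).obj (G.obj Y) ⟶ G.obj ((A.F j).obj Y))
    (hθ : ∀ {X Y : C} (f : X ⟶ Y), (A.F j).map (G.map f) ≫ θ Y = θ X ≫ G.map ((A.F j).map f))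
    {X Y : C} (f : X ⟶ Y) :
    G.map ((A.E j).map f) ≫ B.mate j G θ Y = B.mate j G θ X ≫ (A.E j).map (G.map f) := by
  simp only [mate, Category.assoc]
  rw [reassoc_of% B.η_nat, ← Functor.map_comp_assoc, hθ]
  simp only [← Functor.map_comp, Category.assoc, B.ε_nat]

lemma mate_unit (j : Fin (n - 1)) (G : C ⥤ C)
    (θ : ∀ Y, (A.F j).obj (G.obj Y) ⟶ G.obj ((A.F j).obj Y))
    (hθ : ∀ {X Y : C} (f : X ⟶ Y), (A.F j).map (G.map f) ≫ θ Y = θ X ≫ G.map ((A.F j).map f))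
    (X : C) :
    G.map (B.η j X) ≫ B.mate j G θ ((A.F j).obj X) = B.η j (G.obj X) ≫ (A.E j).map (θ X) := by
  simp only [mate]
  rw [reassoc_of% B.η_nat, ← Functor.map_comp_assoc, hθ]
  simp only [← Functor.map_comp, Category.assoc, B.zigzag_F]
  simp

/-- The sideways crossing `F_i E_j → E_j F_i`. -/
def s (i j : Fin (n - 1)) (X : C) :
    (A.F i).obj ((A.E j).obj X) ⟶ (A.E j).obj ((A.F i).obj X) :=
  B.mate j (A.F i) (B.c j i) X

lemma s_nat (i j : Fin (n - 1)) {X Y : C} (f : X ⟶ Y) :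
    (A.F i).map ((A.E j).map f) ≫ B.s i j Y = B.s i j X ≫ (A.E j).map ((A.F i).map f) :=
  B.mate_nat j (A.F i) (B.c j i) (B.c_nat j i) f

lemma s_unit (i j : Fin (n - 1)) (X : C) :
    (A.F i).map (B.η j X) ≫ B.s i j ((A.F j).obj X) =
      B.η j ((A.F i).obj X) ≫ (A.E j).map (B.c j i X) :=
  B.mate_unit j (A.F i) (B.c j i) (B.c_nat j i) X

lemma s_counit (i j : Fin (n - 1)) (X : C) :
    (A.F j).map (B.s i j X) ≫ B.ε j ((A.F i).obj X) =
      B.c j i ((A.E j).obj X) ≫ (A.F i).map (B.ε j X) :=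
  B.mate_counit j (A.F i) (B.c j i) X

/-- The upward crossing `E_i E_j → E_j E_i`. -/
def cE (i j : Fin (n - 1)) (X : C) :
    (A.E i).obj ((A.E j).obj X) ⟶ (A.E j).obj ((A.E i).obj X) :=
  B.mate j (A.E i) (B.s j i) X

lemma cE_nat (i j : Fin (n - 1)) {X Y : C} (f : X ⟶ Y) :
    (A.E i).map ((A.E j).map f) ≫ B.cE i j Y = B.cE i j X ≫ (A.E j).map ((A.E i).map f) :=
  B.mate_nat j (A.E i) (B.s j i) (B.s_nat j i) f

lemma cE_unit (i j : Fin (n - 1)) (X : C) :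
    (A.E i).map (B.η j X) ≫ B.cE i j ((A.F j).obj X) =
      B.η j ((A.E i).obj X) ≫ (A.E j).map (B.s j i X) :=
  B.mate_unit j (A.E i) (B.s j i) (B.s_nat j i) X

lemma cE_counit (i j : Fin (n - 1)) (X : C) :
    (A.F j).map (B.cE i j X) ≫ B.ε j ((A.E i).obj X) =
      B.s j i ((A.E j).obj X) ≫ (A.E i).map (B.ε j X) :=
  B.mate_counit j (A.E i) (B.s j i) X

lemma cE_counit₂ (i j : Fin (n - 1)) (X : C) :
    (A.F i).map ((A.F j).map (B.cE i j X)) ≫ (A.F i).map (B.ε j _) ≫ B.ε i _ =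
      B.c i j _ ≫ (A.F j).map (B.ε i _) ≫ B.ε j _ := by
  rw [reassoc_of% map_sq _ (B.cE_counit i j _), B.ε_nat, reassoc_of% B.s_counit]

/-- The dot on `E_i`. -/
def xE (i : Fin (n - 1)) (X : C) : (A.E i).obj X ⟶ (A.E i).obj X :=
  B.η i _ ≫ (A.E i).map (B.x i _) ≫ (A.E i).map (B.ε i X)

lemma xE_nat (i : Fin (n - 1)) {X Y : C} (f : X ⟶ Y) :
    (A.E i).map f ≫ B.xE i Y = B.xE i X ≫ (A.E i).map f := by
  simp only [xE, Category.assoc]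
  rw [reassoc_of% B.η_nat, ← Functor.map_comp_assoc, B.x_nat]
  simp only [← Functor.map_comp, Category.assoc, B.ε_nat]

lemma xE_unit (i : Fin (n - 1)) (X : C) :
    B.η i X ≫ B.xE i ((A.F i).obj X) = B.η i X ≫ (A.E i).map (B.x i X) := by
  simp only [xE]
  rw [reassoc_of% B.η_nat, ← Functor.map_comp_assoc, B.x_nat]
  simp only [← Functor.map_comp, Category.assoc, B.zigzag_F]
  simp

lemma xE_counit (i : Fin (n - 1)) (X : C) :
    (A.F i).map (B.xE i X) ≫ B.ε i X = B.x i ((A.E i).obj X) ≫ B.ε i X := by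
  simp only [xE, ← Functor.map_comp]
  rw [Functor.map_comp, Category.assoc, B.ε_nat, reassoc_of% B.zigzag_F]

/-- Morphisms into `E_i X` are equal if their transposes are. -/
lemma hom_ext_E {i : Fin (n - 1)} {X Y : C} {f g : X ⟶ (A.E i).obj Y}
    (h : (A.F i).map f ≫ B.ε i Y = (A.F i).map g ≫ B.ε i Y) : f = g := by
  have key : ∀ f : X ⟶ (A.E i).obj Y,
      f = B.η i X ≫ (A.E i).map ((A.F i).map f ≫ B.ε i Y) := fun f => by
    rw [Functor.map_comp, ← reassoc_of% B.η_nat, B.zigzag_E, Category.comp_id]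
  rw [key f, h, ← key g]

/-- Morphisms out of `F_i X` are equal if their transposes are. -/
lemma hom_ext_F {i : Fin (n - 1)} {X Y : C} {f g : (A.F i).obj X ⟶ Y}
    (h : B.η i X ≫ (A.E i).map f = B.η i X ≫ (A.E i).map g) : f = g := by
  have key : ∀ f : (A.F i).obj X ⟶ Y,
      f = (A.F i).map (B.η i X ≫ (A.E i).map f) ≫ B.ε i Y := fun f => by
    rw [Functor.map_comp, Category.assoc, B.ε_nat, reassoc_of% B.zigzag_F]
  rw [key f, h, ← key g]

/-- The downward crossing is a rotation of the upward one. -/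
lemma c_eq (i j : Fin (n - 1)) (X : C) :
    B.c i j X = (A.F i).map ((A.F j).map (B.η i X)) ≫
      (A.F i).map ((A.F j).map ((A.E i).map (B.η j _))) ≫
      (A.F i).map ((A.F j).map (B.cE i j _)) ≫ (A.F i).map (B.ε j _) ≫ B.ε i _ := by
  rw [reassoc_of% map_sq _ (B.cE_counit i j _), B.ε_nat, reassoc_of% B.s_counit,
    reassoc_of% B.c_nat i j ((A.E i).map _), reassoc_of% B.c_nat i j (B.η i X),
    reassoc_of% map_sq (A.F j) (B.ε_nat i _), B.zigzag_F, reassoc_of% map_tri _ (B.zigzag_F i _)]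
  simp

/-- A transformation `E_i E_j → E_j E_i` with rotation `c i j` is the upward crossing. -/
lemma cE_unique (i j : Fin (n - 1))
    (g : ∀ X, (A.E i).obj ((A.E j).obj X) ⟶ (A.E j).obj ((A.E i).obj X))
    (hg : ∀ {X Y : C} (f : X ⟶ Y),
      (A.E i).map ((A.E j).map f) ≫ g Y = g X ≫ (A.E j).map ((A.E i).map f))
    (h : ∀ X, B.c i j X = (A.F i).map ((A.F j).map (B.η i X)) ≫
      (A.F i).map ((A.F j).map ((A.E i).map (B.η j _))) ≫
      (A.F i).map ((A.F j).map (g _)) ≫ (A.F i).map (B.ε j _) ≫ B.ε i _) (X : C) :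
    g X = B.cE i j X := by
  have key : (A.F i).map ((A.F j).map (g X)) ≫ (A.F i).map (B.ε j _) ≫ B.ε i _ =
      B.c i j _ ≫ (A.F j).map (B.ε i _) ≫ B.ε j _ := by
    set p := (A.F j).map (B.ε i ((A.E j).obj X)) ≫ B.ε j X with hp
    have h1 : B.η j _ ≫ (A.E j).map p = B.ε i ((A.E j).obj X) := by
      rw [hp, Functor.map_comp, ← reassoc_of% B.η_nat, B.zigzag_E, Category.comp_id]
    rw [h]
    simp only [Category.assoc]
    rw [← B.ε_nat, ← reassoc_of% map_sq _ (B.ε_nat j ((A.E i).map p)),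
      ← reassoc_of% map_sq _ (map_sq _ (hg p)), reassoc_of% map_tri _ (map_tri _ (map_tri _ h1)),
      reassoc_of% map_tri _ (map_tri _ (B.zigzag_E i _))]
    simp
  refine B.hom_ext_E (B.hom_ext_E ?_)
  simp only [Functor.map_comp, Category.assoc]
  rw [key, B.cE_counit₂]

end Downward

end SchurCat

namespace SchurCat

open Signature Functor

/-! ### Upward relations from downward relations, and conversely -/

/-- `β` is the transformation of right adjoints corresponding to the transformation `α` of left
adjoints. -/
def IsMate {C : Type w} [Category.{v} C] {L₁ L₂ R₁ R₂ : C ⥤ C} (a₁ : L₁ ⊣ R₁) (a₂ : L₂ ⊣ R₂)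
    (α : L₂ ⟶ L₁) (β : R₁ ⟶ R₂) : Prop := conjugateEquiv a₁ a₂ α = β

namespace IsMate

section

variable {C : Type w} [Category.{v} C]
  {L₁ L₂ L₃ R₁ R₂ R₃ : C ⥤ C} {a₁ : L₁ ⊣ R₁} {a₂ : L₂ ⊣ R₂} {a₃ : L₃ ⊣ R₃}
  {α α' : L₂ ⟶ L₁} {β β' : R₁ ⟶ R₂}

lemma of_counit (h : ∀ X, L₂.map (β.app X) ≫ a₂.counit.app X = α.app (R₁.obj X) ≫
    a₁.counit.app X) : IsMate a₁ a₂ α β := by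
  unfold IsMate
  ext X
  rw [conjugateEquiv_apply_app, ← Functor.map_comp, ← h]
  simp

/-- A relation between transformations of left adjoints is equivalent to its mate. -/
lemma eq_iff (h : IsMate a₁ a₂ α β) (h' : IsMate a₁ a₂ α' β') :
    (∀ X, α.app X = α'.app X) ↔ ∀ X, β.app X = β'.app X := by
  rw [← funext_iff, ← funext_iff, ← NatTrans.ext_iff, ← NatTrans.ext_iff, ← h, ← h',
    (conjugateEquiv a₁ a₂).apply_eq_iff_eq]

lemma id : IsMate a₁ a₁ (𝟙 _) (𝟙 _) := conjugateEquiv_id a₁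

lemma comp {α₁ : L₃ ⟶ L₂} {β₁ : R₂ ⟶ R₃} (h : IsMate a₁ a₂ α β) (h₁ : IsMate a₂ a₃ α₁ β₁) :
    IsMate a₁ a₃ (α₁ ≫ α) (β ≫ β₁) := by
  unfold IsMate at *
  rw [← h, ← h₁, conjugateEquiv_comp]

lemma whiskerLeft {L R : C ⥤ C} (a : L ⊣ R) (h : IsMate a₁ a₂ α β) :
    IsMate (a.comp a₁) (a.comp a₂) (Functor.whiskerLeft L α) (Functor.whiskerRight β R) := by
  unfold IsMate at *
  rw [← h, conjugateEquiv_whiskerLeft]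

lemma whiskerRight {L R : C ⥤ C} (a : L ⊣ R) (h : IsMate a₁ a₂ α β) :
    IsMate (a₁.comp a) (a₂.comp a) (Functor.whiskerRight α L) (Functor.whiskerLeft R β) := by
  unfold IsMate at *
  rw [← h, conjugateEquiv_whiskerRight]

end

variable {k : Type u} [CommRing k] {C : Type w} [Category.{v} C] [Preadditive C] [Linear k C]
  {L₁ L₂ R₁ R₂ : C ⥤ C} {a₁ : L₁ ⊣ R₁} {a₂ : L₂ ⊣ R₂} {α α' : L₂ ⟶ L₁} {β β' : R₁ ⟶ R₂}

lemma zero [R₂.Additive] : IsMate a₁ a₂ 0 0 := by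
  unfold IsMate
  ext X
  simp [conjugateEquiv_apply_app]

lemma sub [R₂.Additive] (h : IsMate a₁ a₂ α β) (h' : IsMate a₁ a₂ α' β') :
    IsMate a₁ a₂ (α - α') (β - β') := by
  unfold IsMate at *
  rw [← h, ← h']
  ext X
  simp [conjugateEquiv_apply_app]

lemma smul [R₂.Additive] [R₂.Linear k] (r : k) (h : IsMate a₁ a₂ α β) :
    IsMate a₁ a₂ (r • α) (r • β) := by
  unfold IsMate at *
  rw [← h]
  ext X
  simp [conjugateEquiv_apply_app]

end IsMate

lemma comp_adj_assoc {C : Type w} [Category.{v} C] {F₁ G₁ F₂ G₂ F₃ G₃ : C ⥤ C} (a₁ : F₁ ⊣ G₁)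
    (a₂ : F₂ ⊣ G₂) (a₃ : F₃ ⊣ G₃) : (a₁.comp a₂).comp a₃ = a₁.comp (a₂.comp a₃) := by
  apply Adjunction.ext
  ext X
  simp

variable {n d : ℕ} {k : Type u} [CommRing k] {C : Type w} [Category.{v} C] [Preadditive C]
  [Linear k C] {A : WeightAction n d k C}

namespace Downward

variable (B : Downward A)

/-- The adjunction `F_i ⊣ E_i`. -/
def adj (i : Fin (n - 1)) : A.F i ⊣ A.E i :=
  Adjunction.mkOfUnitCounit
    { unit := { app := fun X => B.η i X, naturality := fun _ _ f => B.η_nat i f }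
      counit := { app := fun X => B.ε i X, naturality := fun _ _ f => B.ε_nat i f }
      left_triangle := by ext X; simp [B.zigzag_F]
      right_triangle := by ext X; simp [B.zigzag_E] }

/-- The adjunction `F_i F_j ⊣ E_j E_i`. -/
def adj₂ (i j : Fin (n - 1)) : A.F j ⋙ A.F i ⊣ A.E i ⋙ A.E j := (B.adj j).comp (B.adj i)

/-- The adjunction `F_i F_j F_l ⊣ E_l E_j E_i`. -/
def adj₃ (i j l : Fin (n - 1)) : A.F l ⋙ A.F j ⋙ A.F i ⊣ (A.E i ⋙ A.E j) ⋙ A.E l :=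
  (B.adj l).comp (B.adj₂ i j)

lemma adj₃_eq (i j l : Fin (n - 1)) : B.adj₃ i j l = (B.adj₂ j l).comp (B.adj i) :=
  (comp_adj_assoc _ _ _).symm

/-- The dot on `F_i`, as a natural transformation. -/
def xN (i : Fin (n - 1)) : A.F i ⟶ A.F i where
  app X := B.x i X
  naturality _ _ f := B.x_nat i f

/-- The dot on `E_i`, as a natural transformation. -/
def xEN (i : Fin (n - 1)) : A.E i ⟶ A.E i where
  app X := B.xE i X
  naturality _ _ f := B.xE_nat i f

/-- The downward crossing, as a natural transformation. -/
def cN (i j : Fin (n - 1)) : A.F j ⋙ A.F i ⟶ A.F i ⋙ A.F j where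
  app X := B.c i j X
  naturality _ _ f := B.c_nat i j f

/-- The upward crossing, as a natural transformation. -/
def cEN (i j : Fin (n - 1)) : A.E j ⋙ A.E i ⟶ A.E i ⋙ A.E j where
  app X := B.cE i j X
  naturality _ _ f := B.cE_nat i j f

lemma isMate_x (i : Fin (n - 1)) : IsMate (B.adj i) (B.adj i) (B.xN i) (B.xEN i) :=
  .of_counit fun X => B.xE_counit i X

lemma isMate_c (i j : Fin (n - 1)) :
    IsMate (B.adj₂ j i) (B.adj₂ i j) (B.cN i j) (B.cEN i j) := by
  refine .of_counit fun X => ?_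
  simp only [adj₂, Adjunction.comp_counit_app]
  exact B.cE_counit₂ i j X

lemma isMate_c_right (i j l : Fin (n - 1)) :
    IsMate (B.adj₃ l j i) (B.adj₃ l i j) (whiskerRight (B.cN i j) (A.F l))
      (whiskerLeft (A.E l) (B.cEN i j)) := by
  rw [adj₃_eq, adj₃_eq]
  exact (B.isMate_c i j).whiskerRight (B.adj l)

lemma isMate_c_left (i j l : Fin (n - 1)) :
    IsMate (B.adj₃ j i l) (B.adj₃ i j l) (whiskerLeft (A.F l) (B.cN i j))
      (whiskerRight (B.cEN i j) (A.E l)) :=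
  (B.isMate_c i j).whiskerLeft (B.adj l)

/-- The scalar `i - j`. -/
def diff (k : Type u) [CommRing k] (i j : Fin (n - 1)) : k := (((i : ℤ) - (j : ℤ) : ℤ) : k)

/-- The strand `F_i` with `m` dots. -/
def xpow (i : Fin (n - 1)) (X : C) : ℕ → ((A.F i).obj X ⟶ (A.F i).obj X)
  | 0 => 𝟙 _
  | m + 1 => xpow i X m ≫ B.x i X

/-- The cup `X → E_i F_i X` with `m` dots. -/
def cupD (i : Fin (n - 1)) (m : ℕ) (X : C) : X ⟶ (A.E i).obj ((A.F i).obj X) :=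
  B.η i X ≫ (A.E i).map (B.xpow i X m)

/-- The cap `F_i E_i X → X` with `m` dots. -/
def capD (i : Fin (n - 1)) (m : ℕ) (X : C) : (A.F i).obj ((A.E i).obj X) ⟶ X :=
  B.xpow i _ m ≫ B.ε i X

/-- The relations between dots and crossings of the functors `F_i`. -/
structure FRel : Prop where
  cross_same i X : B.c i i X ≫ B.c i i X = 0
  cross_distant i j X (h : Distant i j) : B.c i j X ≫ B.c j i X = 𝟙 _
  cross_adj i j X (h : Adjacent i j) : B.c i j X ≫ B.c j i X =
    diff k i j • (B.x i ((A.F j).obj X) - (A.F i).map (B.x j X))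
  slide_right i j X (h : i ≠ j) :
    B.c i j X ≫ B.x j ((A.F i).obj X) = (A.F i).map (B.x j X) ≫ B.c i j X
  slide_left i j X (h : i ≠ j) :
    B.x i ((A.F j).obj X) ≫ B.c i j X = B.c i j X ≫ (A.F j).map (B.x i X)
  nil_right i X : (A.F i).map (B.x i X) ≫ B.c i i X - B.c i i X ≫ B.x i ((A.F i).obj X) = 𝟙 _
  nil_left i X : B.c i i X ≫ (A.F i).map (B.x i X) - B.x i ((A.F i).obj X) ≫ B.c i i X = 𝟙 _
  braid i j l X (h : ¬ (i = l ∧ Adjacent i j)) :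
    B.c i j ((A.F l).obj X) ≫ (A.F j).map (B.c i l X) ≫ B.c j l ((A.F i).obj X) =
      (A.F i).map (B.c j l X) ≫ B.c i l ((A.F j).obj X) ≫ (A.F l).map (B.c i j X)
  serre i j X (h : Adjacent i j) :
    (A.F i).map (B.c j i X) ≫ B.c i i ((A.F j).obj X) ≫ (A.F i).map (B.c i j X) -
      B.c i j ((A.F i).obj X) ≫ (A.F j).map (B.c i i X) ≫ B.c j i ((A.F i).obj X) =
      diff k i j • 𝟙 _

/-- The relations between dots and crossings of the functors `E_i`. -/
structure ERel : Prop where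
  cross_same i X : B.cE i i X ≫ B.cE i i X = 0
  cross_distant i j X (h : Distant i j) : B.cE i j X ≫ B.cE j i X = 𝟙 _
  cross_adj i j X (h : Adjacent i j) : B.cE i j X ≫ B.cE j i X =
    diff k i j • (B.xE i ((A.E j).obj X) - (A.E i).map (B.xE j X))
  slide_right i j X (h : i ≠ j) :
    B.cE i j X ≫ B.xE j ((A.E i).obj X) = (A.E i).map (B.xE j X) ≫ B.cE i j X
  slide_left i j X (h : i ≠ j) :
    B.xE i ((A.E j).obj X) ≫ B.cE i j X = B.cE i j X ≫ (A.E j).map (B.xE i X)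
  nil_right i X :
    B.cE i i X ≫ B.xE i ((A.E i).obj X) - (A.E i).map (B.xE i X) ≫ B.cE i i X = 𝟙 _
  nil_left i X :
    B.xE i ((A.E i).obj X) ≫ B.cE i i X - B.cE i i X ≫ (A.E i).map (B.xE i X) = 𝟙 _
  braid i j l X (h : ¬ (i = l ∧ Adjacent i j)) :
    B.cE i j ((A.E l).obj X) ≫ (A.E j).map (B.cE i l X) ≫ B.cE j l ((A.E i).obj X) =
      (A.E i).map (B.cE j l X) ≫ B.cE i l ((A.E j).obj X) ≫ (A.E l).map (B.cE i j X)
  serre i j X (h : Adjacent i j) :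
    B.cE i j ((A.E i).obj X) ≫ (A.E j).map (B.cE i i X) ≫ B.cE j i ((A.E i).obj X) -
      (A.E i).map (B.cE j i X) ≫ B.cE i i ((A.E j).obj X) ≫ (A.E i).map (B.cE i j X) =
      diff k i j • 𝟙 _

lemma cross_same_iff (i : Fin (n - 1)) : (∀ X, B.c i i X ≫ B.c i i X = 0) ↔
    ∀ X, B.cE i i X ≫ B.cE i i X = 0 :=
  ((B.isMate_c i i).comp (B.isMate_c i i)).eq_iff .zero

lemma cross_distant_iff (i j : Fin (n - 1)) : (∀ X, B.c i j X ≫ B.c j i X = 𝟙 _) ↔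
    ∀ X, B.cE j i X ≫ B.cE i j X = 𝟙 _ :=
  ((B.isMate_c j i).comp (B.isMate_c i j)).eq_iff .id

lemma cross_adj_iff (i j : Fin (n - 1)) (r : k) : (∀ X, B.c i j X ≫ B.c j i X =
    r • (B.x i ((A.F j).obj X) - (A.F i).map (B.x j X))) ↔
    ∀ X, B.cE j i X ≫ B.cE i j X =
    r • ((A.E j).map (B.xE i X) - B.xE j ((A.E i).obj X)) :=
  ((B.isMate_c j i).comp (B.isMate_c i j)).eq_iff
    ((((B.isMate_x i).whiskerLeft (B.adj j)).sub ((B.isMate_x j).whiskerRight (B.adj i))).smul r)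

lemma slide_right_iff (i j : Fin (n - 1)) :
    (∀ X, B.c i j X ≫ B.x j ((A.F i).obj X) = (A.F i).map (B.x j X) ≫ B.c i j X) ↔
    ∀ X, (A.E i).map (B.xE j X) ≫ B.cE i j X = B.cE i j X ≫ B.xE j ((A.E i).obj X) :=
  (IsMate.comp ((B.isMate_x j).whiskerLeft (B.adj i)) (B.isMate_c i j)).eq_iff
    (IsMate.comp (B.isMate_c i j) ((B.isMate_x j).whiskerRight (B.adj i)))

lemma slide_left_iff (i j : Fin (n - 1)) :
    (∀ X, B.x i ((A.F j).obj X) ≫ B.c i j X = B.c i j X ≫ (A.F j).map (B.x i X)) ↔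
    ∀ X, B.cE i j X ≫ (A.E j).map (B.xE i X) = B.xE i ((A.E j).obj X) ≫ B.cE i j X :=
  (IsMate.comp (B.isMate_c i j) ((B.isMate_x i).whiskerLeft (B.adj j))).eq_iff
    (IsMate.comp ((B.isMate_x i).whiskerRight (B.adj j)) (B.isMate_c i j))

lemma nil_right_iff (i : Fin (n - 1)) :
    (∀ X, (A.F i).map (B.x i X) ≫ B.c i i X - B.c i i X ≫ B.x i ((A.F i).obj X) = 𝟙 _) ↔
    ∀ X, B.cE i i X ≫ B.xE i ((A.E i).obj X) - (A.E i).map (B.xE i X) ≫ B.cE i i X = 𝟙 _ :=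
  ((IsMate.comp (B.isMate_c i i) ((B.isMate_x i).whiskerRight (B.adj i))).sub
    (IsMate.comp ((B.isMate_x i).whiskerLeft (B.adj i)) (B.isMate_c i i))).eq_iff .id

lemma nil_left_iff (i : Fin (n - 1)) :
    (∀ X, B.c i i X ≫ (A.F i).map (B.x i X) - B.x i ((A.F i).obj X) ≫ B.c i i X = 𝟙 _) ↔
    ∀ X, B.xE i ((A.E i).obj X) ≫ B.cE i i X - B.cE i i X ≫ (A.E i).map (B.xE i X) = 𝟙 _ :=
  ((IsMate.comp ((B.isMate_x i).whiskerRight (B.adj i)) (B.isMate_c i i)).sub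
    (IsMate.comp (B.isMate_c i i) ((B.isMate_x i).whiskerLeft (B.adj i)))).eq_iff .id

lemma isMate_braid (i j l : Fin (n - 1)) : IsMate (B.adj₃ l j i) (B.adj₃ i j l)
    (whiskerLeft (A.F l) (B.cN i j) ≫ whiskerRight (B.cN i l) (A.F j) ≫
      whiskerLeft (A.F i) (B.cN j l))
    ((whiskerRight (B.cEN j l) (A.E i) ≫ whiskerLeft (A.E j) (B.cEN i l)) ≫
      whiskerRight (B.cEN i j) (A.E l)) :=
  IsMate.comp (IsMate.comp (B.isMate_c_left j l i) (B.isMate_c_right i l j))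
    (B.isMate_c_left i j l)

lemma isMate_braid' (i j l : Fin (n - 1)) : IsMate (B.adj₃ l j i) (B.adj₃ i j l)
    (whiskerRight (B.cN j l) (A.F i) ≫ whiskerLeft (A.F j) (B.cN i l) ≫
      whiskerRight (B.cN i j) (A.F l))
    ((whiskerLeft (A.E l) (B.cEN i j) ≫ whiskerRight (B.cEN i l) (A.E j)) ≫
      whiskerLeft (A.E i) (B.cEN j l)) :=
  IsMate.comp (IsMate.comp (B.isMate_c_right i j l) (B.isMate_c_left i l j))
    (B.isMate_c_right j l i)

lemma braid_iff (i j l : Fin (n - 1)) : (∀ X,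
    B.c i j ((A.F l).obj X) ≫ (A.F j).map (B.c i l X) ≫ B.c j l ((A.F i).obj X) =
      (A.F i).map (B.c j l X) ≫ B.c i l ((A.F j).obj X) ≫ (A.F l).map (B.c i j X)) ↔
    ∀ X, ((A.E i).map (B.cE j l X) ≫ B.cE i l ((A.E j).obj X)) ≫ (A.E l).map (B.cE i j X) =
      (B.cE i j ((A.E l).obj X) ≫ (A.E j).map (B.cE i l X)) ≫ B.cE j l ((A.E i).obj X) :=
  (B.isMate_braid i j l).eq_iff (B.isMate_braid' i j l)

lemma serre_iff (i j : Fin (n - 1)) (r : k) : (∀ X,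
    (A.F i).map (B.c j i X) ≫ B.c i i ((A.F j).obj X) ≫ (A.F i).map (B.c i j X) -
      B.c i j ((A.F i).obj X) ≫ (A.F j).map (B.c i i X) ≫ B.c j i ((A.F i).obj X) =
      r • 𝟙 _) ↔
    ∀ X, (B.cE i j ((A.E i).obj X) ≫ (A.E j).map (B.cE i i X)) ≫ B.cE j i ((A.E i).obj X) -
      ((A.E i).map (B.cE j i X) ≫ B.cE i i ((A.E j).obj X)) ≫ (A.E i).map (B.cE i j X) =
      r • 𝟙 _ :=
  ((B.isMate_braid' i j i).sub (B.isMate_braid i j i)).eq_iff (.smul r .id)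

variable {B}

lemma diff_swap (i j : Fin (n - 1)) : diff k j i = - diff k i j := by
  simp [diff]

lemma _root_.SchurCat.Adjacent.symm {i j : Fin (n - 1)} (h : Adjacent i j) : Adjacent j i :=
  Or.symm h

lemma _root_.SchurCat.Adjacent.ne {i j : Fin (n - 1)} (h : Adjacent i j) : i ≠ j := by
  rintro rfl
  rcases h with h | h <;> exact absurd h (Nat.ne_of_lt (Nat.lt_succ_self _))

lemma _root_.SchurCat.Distant.symm {i j : Fin (n - 1)} (h : Distant i j) : Distant j i :=
  ⟨h.1.symm, fun h' => h.2 h'.symm⟩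

lemma cupD_zero (i : Fin (n - 1)) (X : C) : B.cupD i 0 X = B.η i X := by
  simp [cupD, xpow]

lemma cupD_succ (i : Fin (n - 1)) (m : ℕ) (X : C) :
    B.cupD i (m + 1) X = B.cupD i m X ≫ (A.E i).map (B.x i X) := by
  simp [cupD, xpow]

lemma capD_zero (i : Fin (n - 1)) (X : C) : B.capD i 0 X = B.ε i X := by
  simp [capD, xpow]

lemma xpow_succ' (i : Fin (n - 1)) (X : C) (m : ℕ) :
    B.xpow i X (m + 1) = B.x i X ≫ B.xpow i X m := by
  induction m with
  | zero => simp [xpow]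
  | succ m ih => rw [xpow, ih, Category.assoc, ← ih]; rfl

lemma capD_succ (i : Fin (n - 1)) (m : ℕ) (X : C) :
    B.capD i (m + 1) X = B.x i _ ≫ B.capD i m X := by
  simp [capD, xpow_succ']

/-- The upward relations are the mates of the downward ones. Passing to mates reverses compositions.
-/
theorem FRel.eRel (h : B.FRel) : B.ERel where
  cross_same i := (B.cross_same_iff i).1 (h.cross_same i)
  cross_distant i j X hij :=
    (B.cross_distant_iff j i).1 (fun X => h.cross_distant j i X hij.symm) X
  cross_adj i j X hij := by
    rw [(B.cross_adj_iff j i (diff k j i)).1 (fun X => h.cross_adj j i X hij.symm) X,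
      diff_swap, neg_smul, ← smul_neg, neg_sub]
  slide_right i j X hij :=
    ((B.slide_right_iff i j).1 (fun X => h.slide_right i j X hij) X).symm
  slide_left i j X hij := ((B.slide_left_iff i j).1 (fun X => h.slide_left i j X hij) X).symm
  nil_right i := (B.nil_right_iff i).1 (h.nil_right i)
  nil_left i := (B.nil_left_iff i).1 (h.nil_left i)
  braid i j l X hij := by
    simpa using ((B.braid_iff i j l).1 (fun X => h.braid i j l X hij) X).symm
  serre i j X hij := by
    simpa using (B.serre_iff i j (diff k i j)).1 (fun X => h.serre i j X hij) X

/-- The downward relations are the mates of the upward ones. -/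
theorem ERel.fRel (h : B.ERel) : B.FRel where
  cross_same i := (B.cross_same_iff i).2 (h.cross_same i)
  cross_distant i j X hij :=
    (B.cross_distant_iff i j).2 (fun X => h.cross_distant j i X hij.symm) X
  cross_adj i j X hij := by
    refine (B.cross_adj_iff i j (diff k i j)).2 (fun X => ?_) X
    rw [h.cross_adj j i X hij.symm, diff_swap, neg_smul, ← smul_neg, neg_sub]
  slide_right i j X hij :=
    (B.slide_right_iff i j).2 (fun X => (h.slide_right i j X hij).symm) X
  slide_left i j X hij := (B.slide_left_iff i j).2 (fun X => (h.slide_left i j X hij).symm) X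
  nil_right i := (B.nil_right_iff i).2 (h.nil_right i)
  nil_left i := (B.nil_left_iff i).2 (h.nil_left i)
  braid i j l X hij := by
    refine (B.braid_iff i j l).2 (fun X => ?_) X
    simpa using (h.braid i j l X hij).symm
  serre i j X hij := by
    refine (B.serre_iff i j (diff k i j)).2 (fun X => ?_) X
    simpa using h.serre i j X hij

end Downward

end SchurCat

/-! ### Specialization of the scalars -/

namespace Signature.Term

/-- Change of scalars. -/
def mapCoeff {Γ : Type} {S : Signature Γ} {R : Type u} {k : Type v} (φ : R → k) {μ : S.W}
    {w w' : List S.L} (f : Term S R μ w w') : Term S k μ w w' :=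
  match w, w', f with
  | _, _, .id h => .id h
  | _, _, .gen u v hν g hw hw' => .gen u v hν g hw hw'
  | _, _, .comp f g => .comp (mapCoeff φ f) (mapCoeff φ g)
  | _, _, .zero => .zero
  | _, _, .add f g => .add (mapCoeff φ f) (mapCoeff φ g)
  | _, _, .smul r f => .smul (φ r) (mapCoeff φ f)
termination_by structural f

variable {Γ : Type} {S : Signature Γ} {R : Type u} {k : Type v} (φ : R → k)

lemma mapCoeff_whisk {μ ν : S.W} {u v : List S.L} (hν : S.actW v μ = ν) {s t : List S.L}
    (f : Term S R ν s t) : ∀ {w w' : List S.L} (hw : w = u ++ s ++ v) (hw' : w' = u ++ t ++ v),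
      (f.whisk u v hν hw hw').mapCoeff φ = (f.mapCoeff φ).whisk u v hν hw hw' := by
  induction f with
  | id => intros; rfl
  | gen => intros; rfl
  | comp f g ihf ihg => intros; simp only [whisk, mapCoeff, ihf, ihg]
  | zero => intros; rfl
  | add f g ihf ihg => intros; simp only [whisk, mapCoeff, ihf, ihg]
  | smul r f ih => intros; simp only [whisk, mapCoeff, ih]

lemma mapCoeff_sum {μ : S.W} {w w' : List S.L} (m : ℕ) (f : Fin m → Term S R μ w w') :
    (sum m f).mapCoeff φ = sum m fun i => (f i).mapCoeff φ := by
  have h : ∀ l : List (Term S R μ w w'),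
      (l.foldr add zero).mapCoeff φ = (l.map (mapCoeff φ)).foldr add zero := fun l => by
    induction l with
    | nil => rfl
    | cons f l ih => simp only [List.foldr_cons, mapCoeff, ih, List.map_cons]
  rw [sum, h, List.map_ofFn]
  rfl

lemma mapCoeff_pow {μ : S.W} {w : List S.L} (f : Term S R μ w w) (m : ℕ) :
    (pow f m).mapCoeff φ = pow (f.mapCoeff φ) m := by
  induction m with
  | zero => rfl
  | succ m ih => simp only [pow, mapCoeff, ih]

end Signature.Term

namespace Signature.Rep

variable {Γ : Type} {S : Signature Γ} {k : Type u} [CommRing k] {C : Type w} [Category.{v} C]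
  [Preadditive C] [Linear k C] {A : Action S.act S.good k C} (R : Rep S A)

lemma eval_sum {μ : S.W} {w w' : List S.L} (m : ℕ) (f : Fin m → Term S k μ w w') (X : C)
    (hX : A.wt X = μ) : R.eval (Term.sum m f) X hX = ∑ i, R.eval (f i) X hX := by
  have h : ∀ l : List (Term S k μ w w'),
      R.eval (l.foldr .add .zero) X hX = (l.map (R.eval · X hX)).sum := fun l => by
    induction l with
    | nil => rfl
    | cons f l ih => simp only [List.foldr_cons, eval, ih, List.map_cons, List.sum_cons]
  rw [Term.sum, h, List.map_ofFn, List.sum_ofFn]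
  rfl

/-- The generator of a family indexed by the weights, at the weight of `X`. -/
def fam {s t : List S.L} (g : ∀ ν, S.Gen ν s t) (X : C) : A.obj s X ⟶ A.obj t X :=
  R.gen (g _) X rfl

lemma gen_eq_fam {s t : List S.L} (g : ∀ ν, S.Gen ν s t) {ν : S.W} (X : C) (h : A.wt X = ν) :
    R.gen (g ν) X h = R.fam g X := by
  subst h; rfl

lemma fam_nat {s t : List S.L} (g : ∀ ν, S.Gen ν s t) {X Y : C} (f : X ⟶ Y) :
    R.fam g X ≫ A.map t f = A.map s f ≫ R.fam g Y := by
  by_cases h : A.wt X = A.wt Y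
  · rw [← R.gen_eq_fam g Y h.symm]
    exact R.nat _ f _ _
  · rw [A.hom_eq_zero f h, A.map_zero, A.map_zero]
    simp

lemma eval_fam {s t u v w w' : List S.L} (g : ∀ ν, S.Gen ν s t) {μ : S.W} (X : C)
    (hX : A.wt X = μ) (hw : w = u ++ s ++ v) (hw' : w' = u ++ t ++ v) :
    R.eval (.gen u v (ν := S.actW v μ) rfl (g _) hw hw') X hX =
      castHom (obj_eq hw X) (obj_eq hw' X) (A.map u (R.fam g (A.obj v X))) :=
  congrArg (fun f => castHom _ _ (A.map u f)) (R.gen_eq_fam g (A.obj v X) (wt_obj_of hX rfl))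

end Signature.Rep

namespace SchurCat

open Signature

/-- The evaluation `X, Y, Z ↦ 1`. -/
def specHom (k : Type u) [CommRing k] : RingXYZ k →+* k :=
  LaurentPolynomial.eval₂ (Ideal.Quotient.lift _ (MvPolynomial.eval fun _ => (1 : k)) (by
    intro a ha
    refine (Ideal.span_le (I := RingHom.ker (MvPolynomial.eval fun _ => (1 : k)))).2 ?_ ha
    rintro _ (rfl | rfl) <;> simp)) 1

variable (k : Type u) [CommRing k]

/-- The evaluation `X, Y, Z ↦ 1` on units. -/
def specUnit : (RingXYZ k)ˣ →* kˣ := Units.map (specHom k).toMonoidHom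

lemma specHom_coe (r : (RingXYZ k)ˣ) : specHom k r = (specUnit k r : kˣ) := rfl

@[simp]
lemma specUnit_uX : specUnit k (uX k) = 1 := by
  ext
  simp only [specUnit, specHom, uX, RingHom.toMonoidHom_eq_coe, Units.coe_map, MonoidHom.coe_coe,
    LaurentPolynomial.eval₂_C, Units.val_one]
  exact (Ideal.Quotient.lift_mk _ _ _).trans (MvPolynomial.eval_X 0)

@[simp]
lemma specUnit_uY : specUnit k (uY k) = 1 := by
  ext
  simp only [specUnit, specHom, uY, RingHom.toMonoidHom_eq_coe, Units.coe_map, MonoidHom.coe_coe,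
    LaurentPolynomial.eval₂_C, Units.val_one]
  exact (Ideal.Quotient.lift_mk _ _ _).trans (MvPolynomial.eval_X 1)

@[simp]
lemma specUnit_uZ : specUnit k (uZ k) = 1 := by
  ext
  simp [specUnit, specHom, uZ]

@[simp]
lemma specUnit_bil (x y : ℤ × ℤ) : specUnit k (bil k x y) = 1 := by
  simp [bil]

lemma specHom_algebraMap (r : k) : specHom k (algebraMap k (RingXYZ k) r) = r := by
  rw [LaurentPolynomial.algebraMap_apply, specHom, LaurentPolynomial.eval₂_C]
  exact (Ideal.Quotient.lift_mk _ _ _).trans (MvPolynomial.eval_C r)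

/-- The defining relations of the graded 2-Schur algebra at `X = Y = Z = 1`. -/
def SpecRel (n d : ℕ) : Relations (sig n d) k := fun f g =>
  ∃ f' g' : Diag k n d _ _ _, Rel k d f' g' ∧ f = f'.mapCoeff (specHom k) ∧
    g = g'.mapCoeff (specHom k)

variable {n d : ℕ} {k} {C : Type w} [Category.{v} C] [Preadditive C]
  [Linear k C] {A : WeightAction n d k C}

/-! ### Weights -/

lemma wt_E (i : Fin (n - 1)) (X : C) : A.wt ((A.E i).obj X) = A.wt X + root i := A.wt_act _ _

lemma wt_F (i : Fin (n - 1)) (X : C) : A.wt ((A.F i).obj X) = A.wt X - root i := A.wt_act _ _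

lemma root_lo (i : Fin (n - 1)) : root i (lo i) = 1 := by simp [root, lo, hi]

lemma root_hi (i : Fin (n - 1)) : root i (hi i) = -1 := by simp [root, lo, hi]

lemma Distant.root {i j : Fin (n - 1)} (h : Distant i j) :
    root i (lo j) = 0 ∧ root i (hi j) = 0 := by
  have h0 : (i : ℕ) ≠ j := fun e => h.1 (Fin.ext e)
  have h1 : (j : ℕ) ≠ i + 1 := fun e => h.2 (.inl e)
  have h2 : (i : ℕ) ≠ j + 1 := fun e => h.2 (.inr e)
  constructor <;> simp [SchurCat.root, lo, hi, Pi.single_apply] <;> omega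

lemma Succ.root {i j : Fin (n - 1)} (h : Succ i j) : root i (lo j) = -1 ∧ root i (hi j) = 0 ∧
    root j (lo i) = 0 ∧ root j (hi i) = 1 := by
  have h1 : (j : ℕ) = i + 1 := h
  refine ⟨?_, ?_, ?_, ?_⟩ <;> simp [SchurCat.root, lo, hi, Pi.single_apply, h1] <;> omega

/-- `E_i X` is zero if `μ̄_i > 0` for the weight `μ` of `X`. -/
lemma bad_E {i : Fin (n - 1)} {X : C} (h : 0 < bar (A.wt X) i) :
    ¬ IsWeight n d (A.wt ((A.E i).obj X)) := by
  intro hw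
  have h1 := hw.1 (lo i)
  have h2 := hw.1 (hi i)
  rw [wt_E, Pi.add_apply] at h1 h2
  rw [root_lo] at h1
  rw [root_hi] at h2
  unfold bar at h
  omega

/-- `F_i X` is zero if `μ̄_i < 0` for the weight `μ` of `X`. -/
lemma bad_F {i : Fin (n - 1)} {X : C} (h : bar (A.wt X) i < 0) :
    ¬ IsWeight n d (A.wt ((A.F i).obj X)) := by
  intro hw
  have h1 := hw.1 (lo i)
  have h2 := hw.1 (hi i)
  rw [wt_F, Pi.sub_apply] at h1 h2
  rw [root_lo] at h1
  rw [root_hi] at h2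
  unfold bar at h
  omega

/-! ### Representations of the graded 2-Schur algebra at `X = Y = Z = 1` -/

/-- The inverses of the sideways crossings, and of the direct sums of sideways crossings with dotted
cups or caps, in a representation of the graded 2-Schur algebra at `X = Y = Z = 1`. At an object of
weight `μ`, `F_i E_i` vanishes if `μ̄_i > 0` and `E_i F_i` vanishes if `μ̄_i < 0`; the conditions on
the inverse matrices therefore only involve the sideways crossing if `μ̄_i = 0`, the dotted cups
if `μ̄_i > 0`, and the dotted caps if `μ̄_i < 0`. -/
structure SchurData (A : WeightAction n d k C) extends Downward A where
  t : ∀ i j X, (A.E j).obj ((A.F i).obj X) ⟶ (A.F i).obj ((A.E j).obj X)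
  p : ∀ (i : Fin (n - 1)) (_ : ℕ) X, (A.E i).obj ((A.F i).obj X) ⟶ X
  q : ∀ (i : Fin (n - 1)) (_ : ℕ) X, X ⟶ (A.F i).obj ((A.E i).obj X)
  t_nat : ∀ i j {X Y : C} (f : X ⟶ Y),
    (A.E j).map ((A.F i).map f) ≫ t i j Y = t i j X ≫ (A.F i).map ((A.E j).map f)
  p_nat : ∀ i m {X Y : C} (f : X ⟶ Y), (A.E i).map ((A.F i).map f) ≫ p i m Y = p i m X ≫ f
  q_nat : ∀ i m {X Y : C} (f : X ⟶ Y), f ≫ q i m Y = q i m X ≫ (A.F i).map ((A.E i).map f)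
  fRel : toDownward.FRel
  dot_dot : ∀ i X, x i X ≫ x i X = 0
  s_t : ∀ i j X, i ≠ j ∨ bar (A.wt X) i = 0 → toDownward.s i j X ≫ t i j X = 𝟙 _
  t_s : ∀ i j X, i ≠ j ∨ bar (A.wt X) i = 0 → t i j X ≫ toDownward.s i j X = 𝟙 _
  cup_p : ∀ i X (m m' : ℕ), (m : ℤ) < bar (A.wt X) i → (m' : ℤ) < bar (A.wt X) i →
    toDownward.cupD i m X ≫ p i m' X = if m = m' then 𝟙 X else 0
  q_cap : ∀ i X (m m' : ℕ), (m : ℤ) < -bar (A.wt X) i → (m' : ℤ) < -bar (A.wt X) i →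
    q i m X ≫ toDownward.capD i m' X = if m = m' then 𝟙 X else 0
  p_cup : ∀ i X, 0 < bar (A.wt X) i →
    ∑ m : Fin (bar (A.wt X) i).toNat, p i m X ≫ toDownward.cupD i m X = 𝟙 _
  cap_q : ∀ i X, bar (A.wt X) i < 0 →
    ∑ m : Fin (-bar (A.wt X) i).toNat, toDownward.capD i m X ≫ q i m X = 𝟙 _

namespace SpecRep

variable (R : Rep (sig n d) A)

/-- The sign by which the crossings of the two presentations differ. -/
def sgn (k : Type u) [CommRing k] (i j : Fin (n - 1)) : k := if i = j then -1 else 1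

lemma sgn_mul_self (i j : Fin (n - 1)) : sgn k i j * sgn k i j = 1 := by
  unfold sgn; split_ifs <;> simp

lemma sgn_comm (i j : Fin (n - 1)) : sgn k i j = sgn k j i := by
  simp [sgn, eq_comm]

lemma sgn_same (i : Fin (n - 1)) : sgn k i i = -1 := by simp [sgn]

lemma sgn_of_ne {i j : Fin (n - 1)} (h : i ≠ j) : sgn k i j = 1 := by simp [sgn, h]

/-- The cup `X → E_i F_i X`. -/
def cup (i : Fin (n - 1)) (X : C) : X ⟶ (A.E i).obj ((A.F i).obj X) :=
  R.fam (fun _ => Gen.cup i) X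

/-- The cap `F_i E_i X → X`. -/
def cap (i : Fin (n - 1)) (X : C) : (A.F i).obj ((A.E i).obj X) ⟶ X :=
  R.fam (fun _ => Gen.cap i) X

/-- The dot on `F_i X`. -/
def dot (i : Fin (n - 1)) (X : C) : (A.F i).obj X ⟶ (A.F i).obj X :=
  R.fam (fun _ => Gen.dot i) X

/-- The crossing `F_i F_j X → F_j F_i X`. -/
def cross (i j : Fin (n - 1)) (X : C) :
    (A.F i).obj ((A.F j).obj X) ⟶ (A.F j).obj ((A.F i).obj X) :=
  R.fam (fun _ => Gen.cross i j) X

/-- The generator `E_j F_i X → F_i E_j X`. -/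
def invSide (i j : Fin (n - 1)) (X : C) :
    (A.E j).obj ((A.F i).obj X) ⟶ (A.F i).obj ((A.E j).obj X) :=
  R.fam (fun _ => Gen.invSide i j) X

/-- The generator `E_i F_i X → X` opposite to the cup with `m` dots, and `0` for large `m`. -/
def invCup (i : Fin (n - 1)) (m : ℕ) (X : C) : (A.E i).obj ((A.F i).obj X) ⟶ X :=
  if h : m < (bar (A.wt X) i).toNat then R.gen (Gen.invCup i ⟨m, h⟩) X rfl else 0

/-- The generator `X → F_i E_i X` opposite to the cap with `m` dots, and `0` for large `m`. -/
def invCap (i : Fin (n - 1)) (m : ℕ) (X : C) : X ⟶ (A.F i).obj ((A.E i).obj X) :=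
  if h : m < (-bar (A.wt X) i).toNat then R.gen (Gen.invCap i ⟨m, h⟩) X rfl else 0

variable {μ : Fin n → ℤ} {u v w w' : List (Letter n)} (X : C) (hX : A.wt X = μ)

lemma eval_cup (i : Fin (n - 1))
    (hw : w = u ++ [] ++ v) (hw' : w' = u ++ [.E i, .F i] ++ v) :
    R.eval (.gen u v (ν := (sig n d).actW v μ) rfl
      (Gen.cup (μ := v.foldr actLetter μ) i) hw hw') X hX =
      castHom (Rep.obj_eq (S := sig n d) (A := A) hw X) (Rep.obj_eq (S := sig n d) (A := A) hw' X)
        (A.map u (X := A.obj [] (A.obj v X)) (Y := A.obj [.E i, .F i] (A.obj v X))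
          (cup R i (A.obj v X))) :=
  R.eval_fam (fun _ => Gen.cup i) X hX hw hw'

lemma eval_cap (i : Fin (n - 1))
    (hw : w = u ++ [.F i, .E i] ++ v) (hw' : w' = u ++ [] ++ v) :
    R.eval (.gen u v (ν := (sig n d).actW v μ) rfl
      (Gen.cap (μ := v.foldr actLetter μ) i) hw hw') X hX =
      castHom (Rep.obj_eq (S := sig n d) (A := A) hw X) (Rep.obj_eq (S := sig n d) (A := A) hw' X)
        (A.map u (X := A.obj [.F i, .E i] (A.obj v X)) (Y := A.obj [] (A.obj v X))
          (cap R i (A.obj v X))) :=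
  R.eval_fam (fun _ => Gen.cap i) X hX hw hw'

lemma eval_dot (i : Fin (n - 1))
    (hw : w = u ++ [.F i] ++ v) (hw' : w' = u ++ [.F i] ++ v) :
    R.eval (.gen u v (ν := (sig n d).actW v μ) rfl
      (Gen.dot (μ := v.foldr actLetter μ) i) hw hw') X hX =
      castHom (Rep.obj_eq (S := sig n d) (A := A) hw X) (Rep.obj_eq (S := sig n d) (A := A) hw' X)
        (A.map u (X := A.obj [.F i] (A.obj v X)) (Y := A.obj [.F i] (A.obj v X))
          (dot R i (A.obj v X))) :=
  R.eval_fam (fun _ => Gen.dot i) X hX hw hw'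

lemma eval_cross (i j : Fin (n - 1))
    (hw : w = u ++ [.F i, .F j] ++ v) (hw' : w' = u ++ [.F j, .F i] ++ v) :
    R.eval (.gen u v (ν := (sig n d).actW v μ) rfl
      (Gen.cross (μ := v.foldr actLetter μ) i j) hw hw') X hX =
      castHom (Rep.obj_eq (S := sig n d) (A := A) hw X) (Rep.obj_eq (S := sig n d) (A := A) hw' X)
        (A.map u (X := A.obj [.F i, .F j] (A.obj v X)) (Y := A.obj [.F j, .F i] (A.obj v X))
          (cross R i j (A.obj v X))) :=
  R.eval_fam (fun _ => Gen.cross i j) X hX hw hw'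

lemma eval_invSide (i j : Fin (n - 1))
    (hw : w = u ++ [.E j, .F i] ++ v) (hw' : w' = u ++ [.F i, .E j] ++ v) :
    R.eval (.gen u v (ν := (sig n d).actW v μ) rfl
      (Gen.invSide (μ := v.foldr actLetter μ) i j) hw hw') X hX =
      castHom (Rep.obj_eq (S := sig n d) (A := A) hw X) (Rep.obj_eq (S := sig n d) (A := A) hw' X)
        (A.map u (X := A.obj [.E j, .F i] (A.obj v X)) (Y := A.obj [.F i, .E j] (A.obj v X))
          (invSide R i j (A.obj v X))) :=
  R.eval_fam (fun _ => Gen.invSide i j) X hX hw hw'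

lemma gen_invCup (i : Fin (n - 1)) (m : Fin (bar μ i).toNat) :
    R.gen (Gen.invCup (μ := μ) i m) X hX = invCup R i m X := by
  subst hX
  exact (dif_pos (c := (m : ℕ) < (bar (A.wt X) i).toNat)
    (t := fun h => R.gen (Gen.invCup i ⟨m, h⟩) X rfl) (e := fun _ => 0) m.2).symm

lemma invCup_of_le (i : Fin (n - 1)) (m : ℕ) (h : ¬ m < (bar (A.wt X) i).toNat) :
    invCup R i m X = 0 := dif_neg h

lemma gen_invCap (i : Fin (n - 1)) (m : Fin (-bar μ i).toNat) :
    R.gen (Gen.invCap (μ := μ) i m) X hX = invCap R i m X := by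
  subst hX
  exact (dif_pos (c := (m : ℕ) < (-bar (A.wt X) i).toNat)
    (t := fun h => R.gen (Gen.invCap i ⟨m, h⟩) X rfl) (e := fun _ => 0) m.2).symm

lemma invCap_of_le (i : Fin (n - 1)) (m : ℕ) (h : ¬ m < (-bar (A.wt X) i).toNat) :
    invCap R i m X = 0 := dif_neg h

variable {R}

lemma eval_rel {μ : Fin n → ℤ} {s t : List (Letter n)} {f g : Diag k n d μ s t}
    (hR : R.Sat (SpecRel k n d)) (h : Rel k d f g) (X : C) (hX : A.wt X = μ) :
    R.eval (f.mapCoeff (specHom k)) X hX = R.eval (g.mapCoeff (specHom k)) X hX :=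
  hR.eq ⟨f, g, h, rfl, rfl⟩ X hX

lemma zigzag_F (hR : R.Sat (SpecRel k n d)) (i : Fin (n - 1)) (X : C) :
    (A.F i).map (cup R i X) ≫ cap R i ((A.F i).obj X) = 𝟙 _ := by
  have h := eval_rel hR (Rel.zigzag_F (μ := A.wt X) i) X rfl
  simp only [Term.mapCoeff, Rep.eval_comp, Rep.eval_id, eval_cup, eval_cap] at h
  exact h.symm

lemma zigzag_E (hR : R.Sat (SpecRel k n d)) (i : Fin (n - 1)) (X : C) :
    cup R i ((A.E i).obj X) ≫ (A.E i).map (cap R i X) = 𝟙 _ := by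
  have h := eval_rel hR (Rel.zigzag_E (μ := A.wt X) i) X rfl
  simp only [Term.mapCoeff, Rep.eval_comp, Rep.eval_id, Rep.eval_smul, eval_cup, eval_cap,
    specHom_coe, map_mul, map_zpow, specUnit_uX, specUnit_uY, one_zpow, mul_one, Units.val_one,
    one_smul] at h
  exact h.symm

variable (R) in
/-- The adjunctions, dots and crossings underlying a representation of the graded 2-Schur algebra
at `X = Y = Z = 1`, the crossings of two strands of the same colour being multiplied by `-1`. -/
@[simps]
def downward (hR : R.Sat (SpecRel k n d)) : Downward A where
  η := cup R
  ε := cap R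
  x := dot R
  c i j X := sgn k i j • cross R i j X
  η_nat i _ _ f := (R.fam_nat (fun _ => Gen.cup i) f).symm
  ε_nat i _ _ f := (R.fam_nat (fun _ => Gen.cap i) f).symm
  x_nat i _ _ f := (R.fam_nat (fun _ => Gen.dot i) f).symm
  c_nat i j _ _ f := by
    rw [Linear.smul_comp, Linear.comp_smul]
    exact congrArg _ (R.fam_nat (fun _ => Gen.cross i j) f).symm
  zigzag_F := zigzag_F hR
  zigzag_E := zigzag_E hR

variable (R) in
/-- At `X = Y = Z = 1` the relations between downward dots and crossings are those of `S(n,d)`,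
after the change of sign. -/
lemma fRel (hR : R.Sat (SpecRel k n d)) : (downward R hR).FRel where
  cross_same i X := by
    have h : cross R i i X ≫ cross R i i X = 0 := by
      have h := eval_rel hR (Rel.cross_cross_same (μ := A.wt X) i) X rfl
      simp only [Term.mapCoeff, Rep.eval_comp, Rep.eval_zero, eval_cross] at h
      exact h
    simp [h]
  cross_distant i j X hij := by
    have h : cross R i j X ≫ cross R j i X = 𝟙 _ := by
      have h := eval_rel hR (Rel.cross_cross_distant (μ := A.wt X) i j hij) X rfl
      simp only [Term.mapCoeff, Rep.eval_comp, Rep.eval_id, eval_cross] at h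
      exact h
    simp [sgn_of_ne hij.1, sgn_of_ne hij.1.symm, h]
  cross_adj i j X hij := by
    have h : cross R i j X ≫ cross R j i X =
        Downward.diff k i j • (dot R i ((A.F j).obj X) - (A.F i).map (dot R j X)) := by
      rcases hij with hij | hij
      · have h := eval_rel hR (Rel.cross_cross_succ (μ := A.wt X) i j hij) X rfl
        simp only [Term.mapCoeff, Rep.eval_comp, Rep.eval_add, Rep.eval_smul, eval_cross, eval_dot,
          specHom_coe, map_mul, map_neg, specUnit_uX, specUnit_uY, specUnit_uZ, mul_one,
          Units.val_one] at h
        have hd : Downward.diff k i j = -1 := by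
          have : (j : ℕ) = i + 1 := hij
          simp [Downward.diff, this]
        rw [hd, smul_sub, sub_eq_add_neg, neg_smul (1 : k) ((A.F i).map _), one_smul, neg_neg]
        simp only [one_smul k] at h
        exact h
      · have h := eval_rel hR (Rel.cross_cross_pred (μ := A.wt X) i j hij) X rfl
        simp only [Term.mapCoeff, Rep.eval_comp, Rep.eval_add, Rep.eval_smul, eval_cross, eval_dot,
          specHom_coe, map_mul, map_neg, map_pow, one_pow, specUnit_uY, specUnit_uZ, mul_one,
          Units.val_one] at h
        have hd : Downward.diff k i j = 1 := by
          have : (i : ℕ) = j + 1 := hij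
          simp [Downward.diff, this]
        rw [hd, smul_sub, sub_eq_add_neg, ← neg_smul]
        exact h
    simp [sgn_of_ne hij.ne, sgn_of_ne hij.ne.symm, h]
  slide_right i j X hij := by
    have h : cross R i j X ≫ dot R j ((A.F i).obj X) = (A.F i).map (dot R j X) ≫ cross R i j X := by
      have h := eval_rel hR (Rel.slide_right (μ := A.wt X) i j hij) X rfl
      simp only [Term.mapCoeff, Rep.eval_comp, Rep.eval_smul, eval_cross, eval_dot, specHom_coe,
        specUnit_bil, Units.val_one, one_smul] at h
      exact h
    simp [sgn_of_ne hij, h]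
  slide_left i j X hij := by
    have h : dot R i ((A.F j).obj X) ≫ cross R i j X = cross R i j X ≫ (A.F j).map (dot R i X) := by
      have h := eval_rel hR (Rel.slide_left (μ := A.wt X) i j hij) X rfl
      simp only [Term.mapCoeff, Rep.eval_comp, Rep.eval_smul, eval_cross, eval_dot, specHom_coe,
        specUnit_bil, Units.val_one, one_smul] at h
      exact h
    simp [sgn_of_ne hij, h]
  nil_right i X := by
    have h : cross R i i X ≫ dot R i ((A.F i).obj X) +
        (-1 : k) • ((A.F i).map (dot R i X) ≫ cross R i i X) = 𝟙 _ := by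
      have h := eval_rel hR (Rel.nil_right (μ := A.wt X) i) X rfl
      simp only [Term.mapCoeff, Rep.eval_comp, Rep.eval_id, Rep.eval_add, Rep.eval_smul, eval_cross,
        eval_dot, map_neg, specHom_coe, map_mul, specUnit_uX, specUnit_uY, mul_one,
        Units.val_one] at h
      exact h
    rw [← h]
    simp [sgn_same, add_comm]
  nil_left i X := by
    have h : dot R i ((A.F i).obj X) ≫ cross R i i X +
        (-1 : k) • (cross R i i X ≫ (A.F i).map (dot R i X)) = 𝟙 _ := by
      have h := eval_rel hR (Rel.nil_left (μ := A.wt X) i) X rfl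
      simp only [Term.mapCoeff, Rep.eval_comp, Rep.eval_id, Rep.eval_add, Rep.eval_smul, eval_cross,
        eval_dot, map_neg, specHom_coe, map_mul, specUnit_uX, specUnit_uY, mul_one,
        Units.val_one] at h
      exact h
    rw [← h]
    simp [sgn_same, add_comm]
  braid i j l X hij := by
    have h : cross R i j ((A.F l).obj X) ≫ (A.F j).map (cross R i l X) ≫
        cross R j l ((A.F i).obj X) = (A.F i).map (cross R j l X) ≫
          cross R i l ((A.F j).obj X) ≫ (A.F l).map (cross R i j X) := by
      have h := eval_rel hR (Rel.braid (μ := A.wt X) i j l hij) X rfl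
      simp only [braidL, braidR, Term.mapCoeff, Rep.eval_comp, Rep.eval_smul, eval_cross,
        specHom_coe, map_mul, mul_one, specUnit_bil, Units.val_one, one_smul] at h
      exact h
    simp only [downward_c, Linear.smul_comp, Linear.comp_smul, Functor.map_smul, smul_smul, h]
    congr 1
    ring
  serre i j X hij := by
    have h : (A.F i).map (cross R j i X) ≫ cross R i i ((A.F j).obj X) ≫
        (A.F i).map (cross R i j X) - cross R i j ((A.F i).obj X) ≫ (A.F j).map (cross R i i X) ≫
        cross R j i ((A.F i).obj X) = -(Downward.diff k i j • 𝟙 _) := by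
      rcases hij with hij | hij
      · have h := eval_rel hR (Rel.serre_succ (μ := A.wt X) i j hij) X rfl
        simp only [braidL, braidR, Term.mapCoeff, Rep.eval_comp, Rep.eval_id, Rep.eval_add,
          Rep.eval_smul, eval_cross, specHom_coe, map_mul, map_neg, map_zpow, one_zpow, specUnit_uY,
          specUnit_uZ, mul_one, Units.val_one] at h
        have hd : Downward.diff k i j = -1 := by
          have : (j : ℕ) = i + 1 := hij
          simp [Downward.diff, this]
        rw [hd, neg_smul, one_smul, neg_neg, sub_eq_neg_add, ← neg_one_smul k]
        simp only [one_smul k] at h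
        exact h
      · have h := eval_rel hR (Rel.serre_pred (μ := A.wt X) i j hij) X rfl
        simp only [braidL, braidR, Term.mapCoeff, Rep.eval_comp, Rep.eval_id, Rep.eval_add,
          Rep.eval_smul, eval_cross, specHom_coe, map_mul, map_neg, map_zpow, one_zpow, specUnit_uX,
          specUnit_uY, specUnit_uZ, mul_one, Units.val_one] at h
        have hd : Downward.diff k i j = 1 := by
          have : (i : ℕ) = j + 1 := hij
          simp [Downward.diff, this]
        rw [hd, one_smul, ← neg_sub, neg_inj, sub_eq_add_neg, ← neg_one_smul k]
        simp only [one_smul k] at h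
        exact h
    have h' := congrArg (fun f => -f) h
    simp only [neg_neg] at h'
    rw [← h']
    simp [sgn_of_ne hij.ne, sgn_of_ne hij.ne.symm, sgn_same, sub_eq_add_neg, add_comm]

/-- The cups, caps, dots and crossings of a representation of the graded 2-Schur algebra at
`X = Y = Z = 1` are those of `D`, up to the sign of the crossings. -/
structure IsDownward (R : Rep (sig n d) A) (D : Downward A) : Prop where
  cup_eq i X : cup R i X = D.η i X
  cap_eq i X : cap R i X = D.ε i X
  dot_eq i X : dot R i X = D.x i X
  cross_eq i j X : cross R i j X = sgn k i j • D.c i j X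

lemma isDownward (hR : R.Sat (SpecRel k n d)) : IsDownward R (downward R hR) where
  cup_eq _ _ := rfl
  cap_eq _ _ := rfl
  dot_eq _ _ := rfl
  cross_eq i j X := by rw [downward_c, smul_smul, sgn_mul_self, one_smul]

variable {D : Downward A} {μ : Fin n → ℤ} (X : C) (hX : A.wt X = μ)

lemma eval_dots (h : IsDownward R D) (i : Fin (n - 1)) (m : ℕ) :
    R.eval ((dots k d i m).mapCoeff (specHom k)) X hX = D.xpow i X m := by
  rw [dots, Term.mapCoeff_pow]
  induction m with
  | zero => rfl
  | succ m ih =>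
    rw [Term.pow, Rep.eval_comp, ih]
    simp only [Term.mapCoeff, eval_dot, h.dot_eq]
    rfl

lemma eval_within {s t : List (Letter n)} (u v : List (Letter n))
    (f : Diag k n d (v.foldr actLetter μ) s t) :
    R.eval ((within u v f).mapCoeff (specHom k)) X hX =
      castHom (Rep.obj_eq (S := sig n d) (A := A) rfl X) (Rep.obj_eq (S := sig n d) (A := A) rfl X)
        (A.map u (R.eval (f.mapCoeff (specHom k)) (A.obj v X)
          (Rep.wt_obj_of (S := sig n d) hX rfl))) :=
  (congrArg (R.eval · X hX) (Term.mapCoeff_whisk (S := sig n d) _ rfl f rfl rfl)).trans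
    (R.eval_whisk rfl _ rfl rfl X hX)

lemma eval_cupDots (h : IsDownward R D) (i : Fin (n - 1)) (m : ℕ) :
    R.eval ((cupDots k d i m).mapCoeff (specHom k)) X hX = D.cupD i m X := by
  rw [cupDots, Term.mapCoeff, Rep.eval_comp, eval_within, eval_dots _ _ h]
  simp only [Term.mapCoeff, eval_cup, h.cup_eq]
  rfl

lemma eval_capDots (h : IsDownward R D) (i : Fin (n - 1)) (m : ℕ) :
    R.eval ((capDots k d i m).mapCoeff (specHom k)) X hX = D.capD i m X := by
  rw [capDots, Term.mapCoeff, Rep.eval_comp, eval_within, eval_dots _ _ h]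
  simp only [Term.mapCoeff, eval_cap, h.cap_eq]
  rfl

lemma eval_side (h : IsDownward R D) (i j : Fin (n - 1)) :
    R.eval ((side k d i j).mapCoeff (specHom k)) X hX = sgn k i j • D.s i j X := by
  have h' : R.eval ((side k d i j).mapCoeff (specHom k)) X hX = cup R j _ ≫
      (A.E j).map (cross R j i _) ≫ (A.E j).map ((A.F i).map (cap R j X)) := by
    simp only [side, Term.mapCoeff, Rep.eval_comp, eval_cup, eval_cap, eval_cross]
    rfl
  rw [h', Downward.s, Downward.mate, h.cup_eq, h.cap_eq, h.cross_eq, Functor.map_smul, sgn_comm j i,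
    Linear.smul_comp, Linear.comp_smul]

/-- The inverses of sideways crossings in a representation of the graded 2-Schur algebra. -/
@[simps! toDownward]
def schurData (hR : R.Sat (SpecRel k n d)) : SchurData A where
  toDownward := downward R hR
  t i j X := sgn k i j • invSide R i j X
  p := invCup R
  q := invCap R
  t_nat i j _ _ f := by
    rw [Linear.smul_comp, Linear.comp_smul]
    exact congrArg _ (R.fam_nat (fun _ => Gen.invSide i j) f).symm
  p_nat i m X Y f := by
    by_cases h : A.wt Y = A.wt X
    · by_cases hm : m < (bar (A.wt X) i).toNat
      · have := R.nat (Gen.invCup i ⟨m, hm⟩) f rfl h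
        rw [gen_invCup R Y h i ⟨m, hm⟩, gen_invCup R X rfl i ⟨m, hm⟩] at this
        exact this.symm
      · have hm' := hm
        rw [← h] at hm'
        rw [invCup_of_le R X i m hm, invCup_of_le R Y i m hm']
        simp
    · rw [A.hom_eq_zero f (Ne.symm h)]
      simp
  q_nat i m X Y f := by
    by_cases h : A.wt Y = A.wt X
    · by_cases hm : m < (-bar (A.wt X) i).toNat
      · have := R.nat (Gen.invCap i ⟨m, hm⟩) f rfl h
        rw [gen_invCap R Y h i ⟨m, hm⟩, gen_invCap R X rfl i ⟨m, hm⟩] at this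
        exact this.symm
      · have hm' := hm
        rw [← h] at hm'
        rw [invCap_of_le R X i m hm, invCap_of_le R Y i m hm']
        simp
    · rw [A.hom_eq_zero f (Ne.symm h)]
      simp
  fRel := fRel R hR
  dot_dot i X := by
    have h := eval_rel hR (Rel.dot_dot (μ := A.wt X) i) X rfl
    rw [eval_dots X rfl (isDownward hR)] at h
    simp only [Downward.xpow, Category.id_comp, Term.mapCoeff, Rep.eval_zero] at h
    exact h
  s_t i j X hij := by
    have h : (sgn k i j • (downward R hR).s i j X) ≫ invSide R i j X = 𝟙 _ := by
      by_cases e : i = j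
      · subst e
        have h := eval_rel hR (Rel.pos_side_side (μ := A.wt X) i
          (hij.resolve_left (absurd rfl)).ge) X rfl
        simp only [Term.mapCoeff, Rep.eval_comp, Rep.eval_id, eval_invSide,
          eval_side X rfl (isDownward hR)] at h
        exact h
      · have h := eval_rel hR (Rel.side_inv (μ := A.wt X) i j e) X rfl
        simp only [Term.mapCoeff, Rep.eval_comp, Rep.eval_id, eval_invSide,
          eval_side X rfl (isDownward hR)] at h
        exact h
    rw [← h, Linear.comp_smul, Linear.smul_comp]
  t_s i j X hij := by
    have h : invSide R i j X ≫ (sgn k i j • (downward R hR).s i j X) = 𝟙 _ := by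
      by_cases e : i = j
      · subst e
        have h := eval_rel hR (Rel.neg_side_side (μ := A.wt X) i
          (hij.resolve_left (absurd rfl)).le) X rfl
        simp only [Term.mapCoeff, Rep.eval_comp, Rep.eval_id, eval_invSide,
          eval_side X rfl (isDownward hR)] at h
        exact h
      · have h := eval_rel hR (Rel.inv_side (μ := A.wt X) i j e) X rfl
        simp only [Term.mapCoeff, Rep.eval_comp, Rep.eval_id, eval_invSide,
          eval_side X rfl (isDownward hR)] at h
        exact h
    rw [← h, Linear.comp_smul, Linear.smul_comp]
  cup_p i X m m' hm hm' := by
    have hm₁ : m < (bar (A.wt X) i).toNat := by omega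
    have hm₂ : m' < (bar (A.wt X) i).toNat := by omega
    have h := eval_rel hR (Rel.pos_cup_cup (μ := A.wt X) i (by omega) ⟨m, hm₁⟩ ⟨m', hm₂⟩) X rfl
    simp only [Term.mapCoeff, Rep.eval_comp, eval_cupDots X rfl (isDownward hR), Fin.mk.injEq] at h
    rw [← gen_invCup R X rfl i ⟨m', hm₂⟩]
    refine h.trans ?_
    split_ifs <;> rfl
  q_cap i X m m' hm hm' := by
    have hm₁ : m < (-bar (A.wt X) i).toNat := by omega
    have hm₂ : m' < (-bar (A.wt X) i).toNat := by omega
    have h := eval_rel hR (Rel.neg_cap_cap (μ := A.wt X) i (by omega) ⟨m, hm₁⟩ ⟨m', hm₂⟩) X rfl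
    simp only [Term.mapCoeff, Rep.eval_comp, eval_capDots X rfl (isDownward hR), Fin.mk.injEq] at h
    rw [← gen_invCap R X rfl i ⟨m, hm₁⟩]
    refine h.trans ?_
    split_ifs <;> rfl
  p_cup i X hi := by
    have h : invSide R i i X ≫ (sgn k i i • (downward R hR).s i i X) +
        ∑ m : Fin (bar (A.wt X) i).toNat, invCup R i m X ≫ (downward R hR).cupD i m X = 𝟙 _ := by
      have h := eval_rel hR (Rel.pos_target (μ := A.wt X) i hi.le) X rfl
      simp only [Term.mapCoeff, Rep.eval_comp, Rep.eval_id, Rep.eval_add, Term.mapCoeff_sum,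
        Rep.eval_sum, eval_invSide, eval_cupDots X rfl (isDownward hR),
        eval_side X rfl (isDownward hR)] at h
      refine Eq.trans (congrArg (_ + ·) ?_) h
      exact Finset.sum_congr rfl fun m _ => congrArg (· ≫ _) (gen_invCup R X rfl i m).symm
    have hz : (downward R hR).s i i X = 0 := A.eq_of_bad_map_source (A.F i) (bad_E hi) _ _
    rw [hz, smul_zero, Limits.comp_zero, zero_add] at h
    exact h
  cap_q i X hi := by
    have h : (sgn k i i • (downward R hR).s i i X) ≫ invSide R i i X +
        ∑ m : Fin (-bar (A.wt X) i).toNat, (downward R hR).capD i m X ≫ invCap R i m X = 𝟙 _ := by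
      have h := eval_rel hR (Rel.neg_source (μ := A.wt X) i hi.le) X rfl
      simp only [Term.mapCoeff, Rep.eval_comp, Rep.eval_id, Rep.eval_add, Term.mapCoeff_sum,
        Rep.eval_sum, eval_invSide, eval_capDots X rfl (isDownward hR),
        eval_side X rfl (isDownward hR)] at h
      refine Eq.trans (congrArg (_ + ·) ?_) h
      exact Finset.sum_congr rfl fun m _ => congrArg (_ ≫ ·) (gen_invCap R X rfl i m).symm
    have hz : (downward R hR).s i i X = 0 := A.eq_of_bad_map_target (A.E i) (bad_F hi) _ _
    rw [hz, smul_zero, Limits.zero_comp, zero_add] at h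
    exact h

end SpecRep

end SchurCat

namespace SchurCat

open Signature MSV

/-! ### The second adjunction -/

variable {n d : ℕ} {k : Type u} [CommRing k] {C : Type w} [Category.{v} C] [Preadditive C]
  [Linear k C] {A : WeightAction n d k C}

section signs

variable (k) (μ : Fin n → ℤ) (i j : Fin (n - 1))

lemma cwSign_mul_self : cwSign k μ i * cwSign k μ i = 1 := by
  rw [cwSign, ← Units.val_mul, ← mul_zpow]
  simp

lemma ccwSign_eq : ccwSign k μ i = -cwSign k μ i := by
  rw [cwSign, ccwSign, zpow_sub]
  simp

lemma ccwSign_mul_self : ccwSign k μ i * ccwSign k μ i = 1 := by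
  rw [ccwSign_eq, neg_mul_neg, cwSign_mul_self]

lemma cwSign_of_even {μ : Fin n → ℤ} {i : Fin (n - 1)} (h : Even (μ (hi i))) :
    cwSign k μ i = 1 := by
  rw [cwSign, h.neg_one_zpow, Units.val_one]

lemma cwSign_of_odd {μ : Fin n → ℤ} {i : Fin (n - 1)} (h : Odd (μ (hi i))) :
    cwSign k μ i = -1 := by
  rw [cwSign, h.neg_one_zpow, Units.val_neg, Units.val_one]

lemma cwSign_congr {μ ν : Fin n → ℤ} {i j : Fin (n - 1)} (h : μ (hi i) = ν (hi j)) :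
    cwSign k μ i = cwSign k ν j := by
  rw [cwSign, cwSign, h]

lemma cwSign_succ {μ ν : Fin n → ℤ} {i j : Fin (n - 1)} (h : μ (hi i) = ν (hi j) + 1) :
    cwSign k μ i = -cwSign k ν j := by
  rw [cwSign, cwSign, h, zpow_add]
  simp

end signs

/-- As the entries of a weight are `0`, `1` or `2`, only five values of `μ̄_i` occur. -/
lemma IsWeight.bar_cases {μ : Fin n → ℤ} (h : IsWeight n d μ) (i : Fin (n - 1)) :
    bar μ i = -2 ∨ bar μ i = -1 ∨ bar μ i = 0 ∨ bar μ i = 1 ∨ bar μ i = 2 := by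
  have h1 := h.1 (lo i)
  have h2 := h.1 (hi i)
  unfold bar
  omega

lemma bar_E_self (i : Fin (n - 1)) (X : C) :
    bar (A.wt ((A.E i).obj X)) i = bar (A.wt X) i + 2 := by
  rw [bar, bar, wt_E, Pi.add_apply, Pi.add_apply, root_lo, root_hi]
  ring

lemma bar_F_self (i : Fin (n - 1)) (X : C) :
    bar (A.wt ((A.F i).obj X)) i = bar (A.wt X) i - 2 := by
  rw [bar, bar, wt_F, Pi.sub_apply, Pi.sub_apply, root_lo, root_hi]
  ring

lemma bar_F_distant {i j : Fin (n - 1)} (h : Distant i j) (X : C) :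
    bar (A.wt ((A.F i).obj X)) j = bar (A.wt X) j := by
  rw [bar, bar, wt_F, Pi.sub_apply, Pi.sub_apply, h.root.1, h.root.2]
  ring

lemma bar_F_adjacent {i j : Fin (n - 1)} (h : Adjacent i j) (X : C) :
    bar (A.wt ((A.F i).obj X)) j = bar (A.wt X) j + 1 := by
  rw [bar, bar, wt_F, Pi.sub_apply, Pi.sub_apply]
  rcases h with h | h
  · rw [h.root.1, h.root.2.1]
    ring
  · rw [h.root.2.2.1, h.root.2.2.2]
    ring

lemma cwSign_E_self (i : Fin (n - 1)) (X : C) :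
    cwSign k (A.wt ((A.E i).obj X)) i = -cwSign k (A.wt X) i := by
  rw [cwSign_succ k (μ := A.wt X) (ν := A.wt ((A.E i).obj X)) (i := i) (j := i), neg_neg]
  rw [wt_E, Pi.add_apply, root_hi]
  ring

lemma cwSign_F_self (i : Fin (n - 1)) (X : C) :
    cwSign k (A.wt ((A.F i).obj X)) i = -cwSign k (A.wt X) i := by
  refine cwSign_succ k ?_
  rw [wt_F, Pi.sub_apply, root_hi]
  ring

lemma cwSign_F_distant {i j : Fin (n - 1)} (h : Distant i j) (X : C) :
    cwSign k (A.wt ((A.F i).obj X)) j = cwSign k (A.wt X) j := by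
  refine cwSign_congr k ?_
  rw [wt_F, Pi.sub_apply, h.root.2, sub_zero]

lemma cwSign_F_adjacent {i j : Fin (n - 1)} (h : Adjacent i j) (X : C) :
    Downward.diff k j i * cwSign k (A.wt ((A.F i).obj X)) j = cwSign k (A.wt X) j := by
  rcases h with h | h
  · have hd : Downward.diff k j i = 1 := by
      have : (j : ℕ) = i + 1 := h
      simp [Downward.diff, this]
    rw [hd, one_mul]
    refine cwSign_congr k ?_
    rw [wt_F, Pi.sub_apply, h.root.2.1, sub_zero]
  · have hd : Downward.diff k j i = -1 := by
      have : (i : ℕ) = j + 1 := h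
      simp [Downward.diff, this]
    rw [hd, neg_one_mul]
    refine (cwSign_succ k ?_).symm
    rw [wt_F, Pi.sub_apply, h.root.2.2.2]
    ring

/-- If `μ̄_i = 0` and the weight of `F_i X` lies in `Λ_{n,d}`, then `μ_i = μ_{i+1} = 1`. -/
lemma odd_of_bar_eq_zero {i : Fin (n - 1)} {X : C} (h : bar (A.wt X) i = 0)
    (hF : IsWeight n d (A.wt ((A.F i).obj X))) : cwSign k (A.wt X) i = -1 := by
  have h1 := hF.1 (lo i)
  have h2 := hF.1 (hi i)
  rw [wt_F, Pi.sub_apply] at h1 h2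
  rw [root_lo] at h1
  rw [root_hi] at h2
  unfold bar at h
  have : A.wt X (hi i) = 1 := by omega
  exact cwSign_of_odd k (by rw [this]; exact odd_one)

namespace SchurData

variable (D : SchurData A)

/-- The cap `E_i F_i X → X`. -/
def ε' (i : Fin (n - 1)) (X : C) : (A.E i).obj ((A.F i).obj X) ⟶ X :=
  if 0 < bar (A.wt X) i then cwSign k (A.wt X) i • D.p i (bar (A.wt X) i - 1).toNat X
  else D.t i i X ≫ D.ε i X

/-- The cup `X → F_i E_i X`. -/
def η' (i : Fin (n - 1)) (X : C) : X ⟶ (A.F i).obj ((A.E i).obj X) :=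
  if bar (A.wt X) i < 0 then ccwSign k (A.wt X) i • D.q i (-bar (A.wt X) i - 1).toNat X
  else D.η i X ≫ D.t i i X

variable {i j : Fin (n - 1)} {X Y : C}

lemma ε'_of_pos (h : 0 < bar (A.wt X) i) :
    D.ε' i X = cwSign k (A.wt X) i • D.p i (bar (A.wt X) i - 1).toNat X := if_pos h

lemma ε'_of_nonpos (h : bar (A.wt X) i ≤ 0) : D.ε' i X = D.t i i X ≫ D.ε i X := if_neg h.not_gt

lemma η'_of_neg (h : bar (A.wt X) i < 0) :
    D.η' i X = ccwSign k (A.wt X) i • D.q i (-bar (A.wt X) i - 1).toNat X := if_pos h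

lemma η'_of_nonneg (h : 0 ≤ bar (A.wt X) i) : D.η' i X = D.η i X ≫ D.t i i X := if_neg h.not_gt

lemma ε'_nat (i : Fin (n - 1)) {X Y : C} (f : X ⟶ Y) :
    (A.E i).map ((A.F i).map f) ≫ D.ε' i Y = D.ε' i X ≫ f := by
  by_cases h : A.wt X = A.wt Y
  · by_cases hp : 0 < bar (A.wt X) i
    · rw [D.ε'_of_pos hp, D.ε'_of_pos (h ▸ hp), ← h, Linear.comp_smul, Linear.smul_comp, D.p_nat]
    · rw [D.ε'_of_nonpos (not_lt.1 hp), D.ε'_of_nonpos (not_lt.1 (h ▸ hp)), reassoc_of% D.t_nat,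
        D.ε_nat, Category.assoc]
  · rw [A.hom_eq_zero f h]
    simp

lemma η'_nat (i : Fin (n - 1)) {X Y : C} (f : X ⟶ Y) :
    f ≫ D.η' i Y = D.η' i X ≫ (A.F i).map ((A.E i).map f) := by
  by_cases h : A.wt X = A.wt Y
  · by_cases hp : bar (A.wt X) i < 0
    · rw [D.η'_of_neg hp, D.η'_of_neg (h ▸ hp), ← h, Linear.comp_smul, Linear.smul_comp, D.q_nat]
    · rw [D.η'_of_nonneg (not_lt.1 hp), D.η'_of_nonneg (not_lt.1 (h ▸ hp)), reassoc_of% D.η_nat,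
        D.t_nat, Category.assoc]
  · rw [A.hom_eq_zero f h]
    simp

lemma s_ε' (h : bar (A.wt X) i = 0) : D.s i i X ≫ D.ε' i X = D.ε i X := by
  rw [D.ε'_of_nonpos h.le, ← Category.assoc, D.s_t i i X (.inr h), Category.id_comp]

lemma η'_s (h : bar (A.wt X) i = 0) : D.η' i X ≫ D.s i i X = D.η i X := by
  rw [D.η'_of_nonneg h.ge, Category.assoc, D.t_s i i X (.inr h), Category.comp_id]

lemma cupD_ε' {m : ℕ} (h : (m : ℤ) + 1 < bar (A.wt X) i) : D.cupD i m X ≫ D.ε' i X = 0 := by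
  rw [D.ε'_of_pos (by omega), Linear.comp_smul, D.cup_p i X m _ (by omega) (by omega),
    if_neg (by omega), smul_zero]

lemma cupD_ε'_top {m : ℕ} (h : (m : ℤ) + 1 = bar (A.wt X) i) :
    D.cupD i m X ≫ D.ε' i X = cwSign k (A.wt X) i • 𝟙 X := by
  rw [D.ε'_of_pos (by omega), Linear.comp_smul, D.cup_p i X m _ (by omega) (by omega),
    if_pos (by omega)]

lemma η'_capD {m : ℕ} (h : (m : ℤ) + 1 < -bar (A.wt X) i) : D.η' i X ≫ D.capD i m X = 0 := by
  rw [D.η'_of_neg (by omega), Linear.smul_comp, D.q_cap i X _ m (by omega) (by omega),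
    if_neg (by omega), smul_zero]

lemma η'_capD_top {m : ℕ} (h : (m : ℤ) + 1 = -bar (A.wt X) i) :
    D.η' i X ≫ D.capD i m X = ccwSign k (A.wt X) i • 𝟙 X := by
  rw [D.η'_of_neg (by omega), Linear.smul_comp, D.q_cap i X _ m (by omega) (by omega),
    if_pos (by omega)]

/-- Morphisms out of `E_i F_i X` are determined by their restrictions along dotted cups or along
the sideways crossing. -/
lemma ext_EF (G : C ⥤ C) [G.Additive] {f g : G.obj ((A.E i).obj ((A.F i).obj X)) ⟶ Y}
    (hpos : ∀ m : ℕ, (m : ℤ) < bar (A.wt X) i →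
      G.map (D.cupD i m X) ≫ f = G.map (D.cupD i m X) ≫ g)
    (hzero : bar (A.wt X) i = 0 → G.map (D.s i i X) ≫ f = G.map (D.s i i X) ≫ g) : f = g := by
  rcases lt_trichotomy (bar (A.wt X) i) 0 with h | h | h
  · exact A.eq_of_bad_map_source (A.E i ⋙ G) (bad_F h) f g
  · have key : ∀ f : G.obj ((A.E i).obj ((A.F i).obj X)) ⟶ Y,
        f = G.map (D.t i i X) ≫ G.map (D.s i i X) ≫ f := fun f => by
      rw [← G.map_comp_assoc, D.t_s i i X (.inr h), G.map_id, Category.id_comp]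
    rw [key f, hzero h, ← key g]
  · have key : ∀ f : G.obj ((A.E i).obj ((A.F i).obj X)) ⟶ Y,
        f = ∑ m : Fin (bar (A.wt X) i).toNat,
          G.map (D.p i m X) ≫ G.map (D.cupD i m X) ≫ f := fun f => by
      conv_lhs => rw [← Category.id_comp f, ← G.map_id, ← D.p_cup i X h, G.map_sum,
        Preadditive.sum_comp]
      exact Finset.sum_congr rfl fun m _ => by rw [G.map_comp, Category.assoc]
    rw [key f, key g]
    exact Finset.sum_congr rfl fun m _ => by rw [hpos m (by omega)]

/-- Morphisms into `F_i E_i X` are determined by their composites with dotted caps or with the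
sideways crossing. -/
lemma ext_FE (G : C ⥤ C) [G.Additive] {f g : Y ⟶ G.obj ((A.F i).obj ((A.E i).obj X))}
    (hneg : ∀ m : ℕ, (m : ℤ) < -bar (A.wt X) i →
      f ≫ G.map (D.capD i m X) = g ≫ G.map (D.capD i m X))
    (hzero : bar (A.wt X) i = 0 → f ≫ G.map (D.s i i X) = g ≫ G.map (D.s i i X)) : f = g := by
  rcases lt_trichotomy (bar (A.wt X) i) 0 with h | h | h
  · have key : ∀ f : Y ⟶ G.obj ((A.F i).obj ((A.E i).obj X)),
        f = ∑ m : Fin (-bar (A.wt X) i).toNat,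
          (f ≫ G.map (D.capD i m X)) ≫ G.map (D.q i m X) := fun f => by
      conv_lhs => rw [← Category.comp_id f, ← G.map_id, ← D.cap_q i X h, G.map_sum,
        Preadditive.comp_sum]
      exact Finset.sum_congr rfl fun m _ => by rw [G.map_comp, Category.assoc]
    rw [key f, key g]
    exact Finset.sum_congr rfl fun m _ => by rw [hneg m (by omega)]
  · have key : ∀ f : Y ⟶ G.obj ((A.F i).obj ((A.E i).obj X)),
        f = (f ≫ G.map (D.s i i X)) ≫ G.map (D.t i i X) := fun f => by
      rw [Category.assoc, ← G.map_comp, D.s_t i i X (.inr h), G.map_id, Category.comp_id]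
    rw [key f, hzero h, ← key g]
  · exact A.eq_of_bad_map_target (A.F i ⋙ G) (bad_E h) f g

end SchurData

end SchurCat

namespace SchurCat

open Signature MSV Downward

variable {n d : ℕ} {k : Type u} [CommRing k] {C : Type w} [Category.{v} C] [Preadditive C]
  [Linear k C] {A : WeightAction n d k C}

namespace Downward

variable {B : Downward A} {i j : Fin (n - 1)} (X Y : C)

lemma cupD_counit_aux (m : ℕ) :
    (A.F i).map (B.cupD j m Y) ≫ B.s i j ((A.F j).obj Y) = B.η j ((A.F i).obj Y) ≫
      (A.E j).map (B.c j i Y ≫ (A.F i).map (B.xpow j Y m)) := by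
  rw [cupD, Functor.map_comp, Category.assoc, B.s_nat, reassoc_of% B.s_unit, ← Functor.map_comp]

lemma FRel.slide_pow (h : B.FRel) (hij : i ≠ j) (m : ℕ) :
    (A.F i).map (B.xpow j Y m) ≫ B.c i j Y = B.c i j Y ≫ B.xpow j ((A.F i).obj Y) m := by
  induction m with
  | zero => simp [xpow]
  | succ m ih =>
    rw [xpow, Functor.map_comp, Category.assoc, ← h.slide_right i j Y hij, reassoc_of% ih, xpow]

/-- A dotted `j`-cup to the right of a strand `F_i`, moved to the left of the strand. -/
lemma FRel.cupD_cross (h : B.FRel) (hij : i ≠ j) (m : ℕ) :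
    (A.F i).map (B.cupD j m Y) ≫ B.s i j ((A.F j).obj Y) ≫ (A.E j).map (B.c i j Y) =
      B.η j ((A.F i).obj Y) ≫ (A.E j).map (B.c j i Y ≫ B.c i j Y) ≫
        (A.E j).map (B.xpow j ((A.F i).obj Y) m) := by
  rw [← Category.assoc, cupD_counit_aux, Category.assoc, ← Functor.map_comp, Category.assoc,
    h.slide_pow Y hij, ← Functor.map_comp, Category.assoc]

/-- The part of the sideways braid relation that follows from adjunction alone: both sides are
determined by downward triple crossings. -/
lemma side_braid_transpose :
    (A.F j).map ((A.F i).map (B.s j j X) ≫ B.s i j ((A.F j).obj X) ≫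
      (A.E j).map (B.c i j X)) ≫ B.ε j _ =
      (B.c j i ((A.F j).obj ((A.E j).obj X)) ≫ (A.F i).map (B.c j j ((A.E j).obj X)) ≫
        B.c i j ((A.F j).obj ((A.E j).obj X))) ≫ (A.F j).map ((A.F i).map (B.ε j X)) := by
  simp only [Functor.map_comp, Category.assoc]
  rw [B.ε_nat, reassoc_of% B.s_counit, reassoc_of% B.c_nat,
    reassoc_of% map_sq _ (B.s_counit j j X), B.c_nat]

lemma side_braid_transpose' :
    (A.F j).map (B.c i j ((A.E j).obj X) ≫ (A.F j).map (B.s i j X) ≫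
      B.s j j ((A.F i).obj X)) ≫ B.ε j _ =
      ((A.F j).map (B.c i j ((A.E j).obj X)) ≫ B.c j j ((A.F i).obj ((A.E j).obj X)) ≫
        (A.F j).map (B.c j i ((A.E j).obj X))) ≫ (A.F j).map ((A.F i).map (B.ε j X)) := by
  simp only [Functor.map_comp, Category.assoc]
  rw [B.s_counit, reassoc_of% B.c_nat, map_sq _ (B.s_counit i j X)]

/-- The triple crossing of `F_i`, `F_j`, `E_j` for distant colours `i` and `j`. -/
lemma FRel.side_braid (h : B.FRel) (hij : Distant i j) :
    (A.F i).map (B.s j j X) ≫ B.s i j ((A.F j).obj X) ≫ (A.E j).map (B.c i j X) =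
      B.c i j ((A.E j).obj X) ≫ (A.F j).map (B.s i j X) ≫ B.s j j ((A.F i).obj X) := by
  refine B.hom_ext_E ?_
  rw [side_braid_transpose, side_braid_transpose', h.braid j i j _ fun h' => hij.2 h'.2.symm]

/-- The triple crossing of `F_i`, `F_j`, `E_j` for adjacent colours `i` and `j`. The correction term
rotates to a cap followed by a cup. -/
lemma FRel.side_serre (h : B.FRel) (hij : Adjacent i j) :
    (A.F i).map (B.s j j X) ≫ B.s i j ((A.F j).obj X) ≫ (A.E j).map (B.c i j X) =
      B.c i j ((A.E j).obj X) ≫ (A.F j).map (B.s i j X) ≫ B.s j j ((A.F i).obj X) -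
        Downward.diff k j i • ((A.F i).map (B.ε j X) ≫ B.η j ((A.F i).obj X)) := by
  refine B.hom_ext_E ?_
  rw [side_braid_transpose, Functor.map_sub, Preadditive.sub_comp, side_braid_transpose',
    Functor.map_smul, Linear.smul_comp, Functor.map_comp (A.F j) _ (B.η j _),
    Category.assoc ((A.F j).map _) ((A.F j).map _), B.zigzag_F, Category.comp_id,
    sub_eq_iff_eq_add.1 (h.serre j i ((A.E j).obj X) hij.symm)]
  simp

lemma cup_xpow_nat (m : ℕ) (f : X ⟶ X) :
    B.η j X ≫ (A.E j).map ((A.F j).map f) ≫ (A.E j).map (B.xpow j X m) = f ≫ B.cupD j m X := by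
  rw [← reassoc_of% B.η_nat]; rfl

lemma cup_xpow_succ (m : ℕ) :
    B.η j X ≫ (A.E j).map (B.x j X) ≫ (A.E j).map (B.xpow j X m) = B.cupD j (m + 1) X := by
  rw [cupD, xpow_succ', Functor.map_comp]

lemma FRel.c_map_x_c (h : B.FRel) : B.c i i X ≫ (A.F i).map (B.x i X) ≫ B.c i i X = B.c i i X := by
  rw [← Category.assoc, sub_eq_iff_eq_add.1 (h.nil_left i X), Preadditive.add_comp,
    Category.assoc, h.cross_same]
  simp

lemma FRel.c_x_c (h : B.FRel) :
    B.c i i X ≫ B.x i ((A.F i).obj X) ≫ B.c i i X = -B.c i i X := by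
  have h1 : B.x i ((A.F i).obj X) ≫ B.c i i X = B.c i i X ≫ (A.F i).map (B.x i X) - 𝟙 _ := by
    rw [← h.nil_left i X]; abel
  rw [h1, Preadditive.comp_sub, ← Category.assoc, h.cross_same]
  simp

lemma ERel.cE_map_xE_cE (h : B.ERel) :
    B.cE i i X ≫ (A.E i).map (B.xE i X) ≫ B.cE i i X = -B.cE i i X := by
  have h1 : B.cE i i X ≫ (A.E i).map (B.xE i X) = B.xE i ((A.E i).obj X) ≫ B.cE i i X - 𝟙 _ := by
    rw [← h.nil_left i X]; abel
  rw [← Category.assoc, h1, Preadditive.sub_comp, Category.assoc, h.cross_same]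
  simp

lemma FRel.s_map_x (h : B.FRel) : B.s i i X ≫ (A.E i).map (B.x i X) =
    B.x i ((A.E i).obj X) ≫ B.s i i X - B.ε i X ≫ B.η i X := by
  refine B.hom_ext_E ?_
  have h1 : B.c i i ((A.E i).obj X) ≫ B.x i ((A.F i).obj ((A.E i).obj X)) =
      (A.F i).map (B.x i ((A.E i).obj X)) ≫ B.c i i ((A.E i).obj X) - 𝟙 _ := by
    rw [← h.nil_right i ((A.E i).obj X)]; abel
  simp only [Functor.map_comp, Functor.map_sub, Preadditive.sub_comp, Category.assoc]
  rw [B.ε_nat, reassoc_of% B.s_counit, B.x_nat, reassoc_of% h1, B.zigzag_F, B.s_counit]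
  simp

lemma FRel.s_xE (h : B.FRel) : B.s i i X ≫ B.xE i ((A.F i).obj X) =
    (A.F i).map (B.xE i X) ≫ B.s i i X - B.ε i X ≫ B.η i X := by
  refine B.hom_ext_E ?_
  have h1 : B.x i ((A.F i).obj ((A.E i).obj X)) ≫ B.c i i ((A.E i).obj X) =
      B.c i i ((A.E i).obj X) ≫ (A.F i).map (B.x i ((A.E i).obj X)) - 𝟙 _ := by
    rw [← h.nil_left i ((A.E i).obj X)]; abel
  simp only [Functor.map_comp, Functor.map_sub, Preadditive.sub_comp, Category.assoc]
  rw [B.xE_counit, reassoc_of% B.x_nat, B.s_counit, reassoc_of% h1, B.zigzag_F, reassoc_of% B.c_nat,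
    map_sq _ (B.xE_counit i X)]
  simp

end Downward

namespace SchurData

variable (D : SchurData A) {i j : Fin (n - 1)} (X Y : C)

/-- Restricted along a dotted cup, both sides are the same dotted bubble; if `μ̄_j = 0` the claim is
a rotation of the braid relation. -/
lemma map_ε'_distant (hij : Distant i j) : (A.F i).map (D.ε' j Y) =
    D.s i j ((A.F j).obj Y) ≫ (A.E j).map (D.c i j Y) ≫ D.ε' j ((A.F i).obj Y) := by
  refine D.ext_EF (A.F i) (fun m hm => ?_) fun h0 => ?_
  · have h1 := D.fRel.cupD_cross Y hij.1 m
    rw [D.fRel.cross_distant j i Y hij.symm, CategoryTheory.Functor.map_id, Category.id_comp] at h1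
    rw [reassoc_of% h1]
    have hb : bar (A.wt ((A.F i).obj Y)) j = bar (A.wt Y) j := bar_F_distant hij Y
    rw [← Functor.map_comp, ← Category.assoc (D.η j _)]
    change _ = D.cupD j m ((A.F i).obj Y) ≫ _
    rcases lt_or_eq_of_le (Int.add_one_le_of_lt hm) with h | h
    · rw [D.cupD_ε' h, D.cupD_ε' (by omega), Functor.map_zero]
    · rw [D.cupD_ε'_top h, D.cupD_ε'_top (by omega), cwSign_F_distant hij, Functor.map_smul,
        CategoryTheory.Functor.map_id]
  · have hb : bar (A.wt ((A.F i).obj Y)) j = 0 := (bar_F_distant hij Y).trans h0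
    rw [reassoc_of% D.fRel.side_braid Y hij, D.s_ε' hb, D.s_counit, ← Functor.map_comp,
      D.s_ε' h0, ← Category.assoc, D.fRel.cross_distant i j _ hij, Category.id_comp]

/-- Crossing a strand `F_i` raises `μ̄_j` by one, and the double crossing adds a dot to one of its
terms; if `μ̄_j = 0` only the correction term of the rotated Serre relation survives. -/
lemma map_ε'_adjacent (hij : Adjacent i j) : (A.F i).map (D.ε' j Y) =
    D.s i j ((A.F j).obj Y) ≫ (A.E j).map (D.c i j Y) ≫ D.ε' j ((A.F i).obj Y) := by
  have hb : bar (A.wt ((A.F i).obj Y)) j = bar (A.wt Y) j + 1 := bar_F_adjacent hij Y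
  by_cases hF : IsWeight n d (A.wt ((A.F j).obj Y))
  swap
  · exact A.eq_of_bad_map_source (A.E j ⋙ A.F i) hF _ _
  refine D.ext_EF (A.F i) (fun m hm => ?_) fun h0 => ?_
  · have h1 := D.fRel.cupD_cross Y hij.ne m
    rw [D.fRel.cross_adj j i Y hij.symm, Functor.map_smul, Functor.map_sub, Linear.smul_comp,
      Linear.comp_smul, Preadditive.sub_comp, Preadditive.comp_sub, cup_xpow_nat,
      cup_xpow_succ] at h1
    rw [reassoc_of% h1, Linear.smul_comp, Preadditive.sub_comp, Category.assoc,
      D.cupD_ε' (X := (A.F i).obj Y) (m := m) (by omega), ← Functor.map_comp, Limits.comp_zero,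
      sub_zero]
    rcases lt_or_eq_of_le (Int.add_one_le_of_lt hm) with h | h
    · rw [D.cupD_ε' h, D.cupD_ε' (by push_cast; omega), Functor.map_zero, smul_zero]
    · rw [D.cupD_ε'_top h, D.cupD_ε'_top (by push_cast; omega), smul_smul,
        cwSign_F_adjacent hij, Functor.map_smul, CategoryTheory.Functor.map_id]
  -- Here `E_j F_i Y = 0`, and the second cap at `F_i Y` is, up to sign, inverse to a cup without
  -- dots.
  · have hz : D.s j j ((A.F i).obj Y) = 0 :=
      A.eq_of_bad_map_source (A.F j) (bad_E (by omega)) _ _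
    have ht : D.η j ((A.F i).obj Y) ≫ D.ε' j ((A.F i).obj Y) =
        cwSign k (A.wt ((A.F i).obj Y)) j • 𝟙 _ := by
      rw [← cupD_zero, D.cupD_ε'_top (by rw [hb, h0]; rfl)]
    have h1 := D.fRel.side_serre Y hij
    rw [hz, Limits.comp_zero, Limits.comp_zero, zero_sub] at h1
    rw [reassoc_of% h1, Preadditive.neg_comp, Linear.smul_comp, Category.assoc, ht,
      ← Functor.map_comp, D.s_ε' h0, Linear.comp_smul, smul_smul, cwSign_F_adjacent hij,
      odd_of_bar_eq_zero h0 hF]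
    simp

/-- The weights of the regions have `(λ_i, λ_{i+1}) = (2, 0)` and `(1, 1)`. -/
lemma map_ε'_same (hY : bar (A.wt Y) i = 2) : (A.F i).map (D.ε' i Y) =
    D.s i i ((A.F i).obj Y) ≫ (A.E i).map (D.c i i Y) ≫ D.ε' i ((A.F i).obj Y) := by
  by_cases hw : IsWeight n d (A.wt Y)
  swap
  · exact A.eq_of_bad_map_target (A.F i) hw _ _
  have hs : cwSign k (A.wt Y) i = 1 := by
    have h1 := hw.1 (lo i)
    have h2 := hw.1 (hi i)
    unfold bar at hY
    have : A.wt Y (hi i) = 0 := by omega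
    exact cwSign_of_even k (by rw [this]; exact Even.zero)
  have hb : bar (A.wt ((A.F i).obj Y)) i = 0 := by rw [bar_F_self, hY]; rfl
  -- The cup without dots gives a double crossing on the right; the cup with one dot gives a
  -- crossing, and then a zigzag.
  refine D.ext_EF (A.F i) (fun m hm => ?_) fun h0 => absurd (hY.symm.trans h0) (by norm_num)
  rw [← Category.assoc (CategoryTheory.Functor.map _ (D.cupD i m Y)) (D.s i i _), cupD_counit_aux,
    Category.assoc, ← Functor.map_comp_assoc, Category.assoc]
  obtain rfl | rfl : m = 0 ∨ m = 1 := by omega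
  · rw [← Functor.map_comp, D.cupD_ε' (by rw [hY]; norm_num), xpow, CategoryTheory.Functor.map_id,
      Category.id_comp, D.fRel.cross_same]
    simp
  · rw [← Functor.map_comp, D.cupD_ε'_top (by rw [hY]; norm_num), hs]
    simp only [xpow, Category.id_comp]
    rw [D.fRel.c_map_x_c, ← reassoc_of% D.s_unit, D.s_ε' hb, D.zigzag_F]
    simp

/-- The second cap of colour `j` slides through a downward strand of colour `i`. -/
lemma map_ε' (h : i ≠ j ∨ bar (A.wt Y) i = 2) : (A.F i).map (D.ε' j Y) =
    D.s i j ((A.F j).obj Y) ≫ (A.E j).map (D.c i j Y) ≫ D.ε' j ((A.F i).obj Y) := by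
  by_cases hij : i = j
  · subst hij
    exact D.map_ε'_same Y (h.resolve_left (absurd rfl))
  · by_cases ha : Adjacent i j
    · exact D.map_ε'_adjacent Y ha
    · exact D.map_ε'_distant Y ⟨hij, ha⟩

/-- The second cap of colour `j` slides through an upward strand of colour `i`; this is the mate of
`map_ε'`. -/
lemma ε'_E (h : i ≠ j ∨ bar (A.wt X) i = 0) : D.ε' j ((A.E i).obj X) =
    (A.E j).map (D.s j i X) ≫ D.cE j i ((A.F j).obj X) ≫ (A.E i).map (D.ε' j X) := by
  refine D.hom_ext_E ?_
  rw [D.map_ε' _ (h.imp_right fun h => by rw [bar_E_self, h]; rfl)]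
  simp only [Functor.map_comp, Category.assoc]
  rw [D.ε_nat, reassoc_of% D.cE_counit, reassoc_of% D.s_nat,
    reassoc_of% map_sq _ (D.s_counit j i X), D.ε'_nat]

/-- For weights `(0, 2)` the second unit is a rotation of the unit at weight `(1, 1)`. -/
lemma map_η' (h : bar (A.wt X) i = -2) : (A.E i).map (D.η' i X) =
    D.η' i ((A.E i).obj X) ≫ (A.F i).map (D.cE i i X) ≫ D.s i i ((A.E i).obj X) := by
  by_cases hw : IsWeight n d (A.wt X)
  swap
  · exact A.eq_of_bad_map_source (A.E i) hw _ _
  have hs : ccwSign k (A.wt X) i = -1 := by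
    have h1 := hw.1 (lo i)
    have h2 := hw.1 (hi i)
    unfold bar at h
    have : A.wt X (hi i) = 2 := by omega
    rw [ccwSign_eq, cwSign_of_even k (by rw [this]; exact even_two)]
  have hb : bar (A.wt ((A.E i).obj X)) i = 0 := by rw [bar_E_self, h]; rfl
  have hE := D.fRel.eRel
  refine D.ext_FE (A.E i) (fun m hm => ?_) fun h0 => absurd (h.symm.trans h0) (by norm_num)
  rw [← Functor.map_comp, Category.assoc, Category.assoc]
  obtain rfl | rfl : m = 0 ∨ m = 1 := by omega
  · rw [D.η'_capD (by rw [h]; norm_num), capD_zero, ← D.cE_counit,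
      reassoc_of% map_tri _ (hE.cross_same i X)]
    simp
  · rw [D.η'_capD_top (by rw [h]; norm_num), hs, capD_succ, capD_zero, ← D.xE_counit,
      Functor.map_comp, ← reassoc_of% D.s_nat, ← D.cE_counit, ← Functor.map_comp_assoc,
      ← Functor.map_comp_assoc, Category.assoc, hE.cE_map_xE_cE, Functor.map_neg,
      Preadditive.neg_comp, D.cE_counit, Preadditive.comp_neg, ← Category.assoc, D.η'_s hb,
      D.zigzag_E]
    simp

/-- For weights `(1, 1)` the second unit at `F_i Y` is a rotation of the one at `Y`. -/
lemma η'_F (h : bar (A.wt Y) i = 0) : D.η' i ((A.F i).obj Y) =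
    (A.F i).map (D.η' i Y) ≫ D.c i i ((A.E i).obj Y) ≫ (A.F i).map (D.s i i Y) := by
  have hb : bar (A.wt ((A.F i).obj Y)) i = -2 := by rw [bar_F_self, h]; rfl
  by_cases hw : IsWeight n d (A.wt ((A.F i).obj Y))
  swap
  · exact A.eq_of_bad_source hw _ _
  have hs : ccwSign k (A.wt ((A.F i).obj Y)) i = -1 := by
    rw [ccwSign_eq, cwSign_F_self, odd_of_bar_eq_zero h hw]
    simp
  refine D.ext_FE (𝟭 C) (fun m hm => ?_) fun h0 => absurd (hb.symm.trans h0) (by norm_num)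
  rw [Functor.id_map, Category.assoc, Category.assoc]
  obtain rfl | rfl : m = 0 ∨ m = 1 := by omega
  · rw [D.η'_capD (by rw [hb]; norm_num), capD_zero, D.s_counit, ← Category.assoc (D.c i i _),
      D.fRel.cross_same]
    simp
  · rw [D.η'_capD_top (by rw [hb]; norm_num), hs, capD_succ, capD_zero, reassoc_of% D.x_nat,
      D.s_counit, reassoc_of% D.fRel.c_x_c, Preadditive.neg_comp, Preadditive.comp_neg,
      ← D.s_counit, reassoc_of% map_tri _ (D.η'_s h), D.zigzag_F]
    simp

lemma map_q (h : bar (A.wt X) i = -1) : (A.E i).map (D.q i 0 X) = D.η i ((A.E i).obj X) := by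
  have h1 := D.cap_q i X (by omega)
  have h2 : (-bar (A.wt X) i).toNat = 1 := by omega
  rw [Fin.sum_congr' (fun m => D.capD i m X ≫ D.q i m X) h2.symm |>.symm] at h1
  simp only [Fin.sum_univ_one, Fin.val_cast, Fin.val_zero, capD_zero] at h1
  rw [← Category.id_comp (CategoryTheory.Functor.map _ _), ← D.zigzag_E, Category.assoc,
    map_tri _ h1]
  simp

lemma p_zero_cup (h : bar (A.wt X) i = 1) : D.p i 0 X ≫ D.η i X = 𝟙 _ := by
  have h1 := D.p_cup i X (by omega)
  have h2 : (bar (A.wt X) i).toNat = 1 := by omega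
  rw [Fin.sum_congr' (fun m => D.p i m X ≫ D.cupD i m X) h2.symm |>.symm] at h1
  simpa only [Fin.sum_univ_one, Fin.val_cast, Fin.val_zero, cupD_zero] using h1

lemma map_p (h : bar (A.wt X) i = 1) : (A.F i).map (D.p i 0 X) = D.ε i ((A.F i).obj X) := by
  rw [← Category.comp_id (CategoryTheory.Functor.map _ _), ← D.zigzag_F,
    reassoc_of% map_tri _ (D.p_zero_cup X h)]
  simp

lemma p_zero_E (h : bar (A.wt X) i = -1) :
    D.p i 0 ((A.E i).obj X) = (A.E i).map (D.ε i X) := by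
  rw [← Category.comp_id (D.p i 0 _), ← D.zigzag_E, ← Category.assoc,
    D.p_zero_cup _ (by rw [bar_E_self, h]; rfl), Category.id_comp]

/-- The first zigzag of the second adjunction. -/
lemma zigzag_E' (i : Fin (n - 1)) :
    (A.E i).map (D.η' i X) ≫ D.ε' i ((A.E i).obj X) = 𝟙 _ := by
  by_cases hw : IsWeight n d (A.wt X)
  swap
  · exact A.eq_of_bad_map_source (A.E i) hw _ _
  -- In the last two cases `E_i X` vanishes.
  rcases hw.bar_cases i with h | h | h | h | h
  · rw [D.map_η' X h, Category.assoc, Category.assoc,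
      D.s_ε' (by rw [bar_E_self, h]; rfl), D.cE_counit, ← Category.assoc,
      D.η'_s (by rw [bar_E_self, h]; rfl), D.zigzag_E]
  · have h1 := D.cupD_ε'_top (X := (A.E i).obj X) (m := 0) (i := i) (by rw [bar_E_self, h]; rfl)
    rw [cupD_zero] at h1
    rw [D.η'_of_neg (by omega), Functor.map_smul, Linear.smul_comp, h]
    erw [D.map_q X h]
    rw [h1, smul_smul, ccwSign_eq, cwSign_E_self, neg_mul_neg, cwSign_mul_self, one_smul]
  · rw [D.ε'_E X (.inr h), reassoc_of% map_tri _ (D.η'_s h), reassoc_of% D.cE_unit,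
      map_tri _ (D.s_ε' h), D.zigzag_E]
  · exact A.eq_of_bad_source (bad_E (by omega)) _ _
  · exact A.eq_of_bad_source (bad_E (by omega)) _ _

/-- The second zigzag of the second adjunction. -/
lemma zigzag_F' (i : Fin (n - 1)) :
    D.η' i ((A.F i).obj Y) ≫ (A.F i).map (D.ε' i Y) = 𝟙 _ := by
  by_cases hw : IsWeight n d (A.wt Y)
  swap
  · exact A.eq_of_bad_map_target (A.F i) hw _ _
  rcases hw.bar_cases i with h | h | h | h | h
  · exact A.eq_of_bad_source (bad_F (by omega)) _ _
  · exact A.eq_of_bad_source (bad_F (by omega)) _ _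
  · rw [D.η'_F Y h, Category.assoc, Category.assoc, map_tri _ (D.s_ε' h), ← D.s_counit,
      reassoc_of% map_tri _ (D.η'_s h), D.zigzag_F]
  · have h1 := D.η'_capD_top (X := (A.F i).obj Y) (m := 0) (i := i) (by rw [bar_F_self, h]; rfl)
    rw [capD_zero] at h1
    rw [D.ε'_of_pos (by omega), Functor.map_smul, Linear.comp_smul, h]
    erw [D.map_p Y h]
    rw [h1, smul_smul, ccwSign_eq, cwSign_F_self, neg_neg, cwSign_mul_self, one_smul]
  · have hb : bar (A.wt ((A.F i).obj Y)) i = 0 := by rw [bar_F_self, h]; rfl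
    rw [D.map_ε'_same Y h, ← Category.assoc, D.η'_s hb, ← reassoc_of% D.s_unit, D.s_ε' hb,
      D.zigzag_F]

end SchurData

end SchurCat

namespace SchurCat

open Signature MSV Downward

variable {n d : ℕ} {k : Type u} [CommRing k] {C : Type w} [Category.{v} C] [Preadditive C]
  [Linear k C] {A : WeightAction n d k C}

/-! ### Sideways crossings, bubbles and curls -/

namespace Downward

variable (B : Downward A) {i j : Fin (n - 1)} (X Y : C)

/-- The rotation `F_i E_j → E_j F_i` of the upward crossing `E_j E_i → E_i E_j`. -/
lemma rotate_cE (i j : Fin (n - 1)) : (A.F i).map ((A.E j).map (B.η i X)) ≫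
    (A.F i).map (B.cE j i ((A.F i).obj X)) ≫ B.ε i ((A.E j).obj ((A.F i).obj X)) = B.s i j X := by
  rw [B.cE_counit, reassoc_of% B.s_nat, map_tri _ (B.zigzag_F i X)]
  simp

lemma rotate_xE (i : Fin (n - 1)) : (A.F i).map (B.η i X) ≫
    (A.F i).map (B.xE i ((A.F i).obj X)) ≫ B.ε i ((A.F i).obj X) = B.x i X := by
  rw [B.xE_counit, reassoc_of% B.x_nat, B.zigzag_F, Category.comp_id]

/-- The strand `E_i` with `m` dots. -/
def xEpow (i : Fin (n - 1)) (X : C) : ℕ → ((A.E i).obj X ⟶ (A.E i).obj X)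
  | 0 => 𝟙 _
  | m + 1 => xEpow i X m ≫ B.xE i X

lemma xEpow_succ' (i : Fin (n - 1)) (X : C) (m : ℕ) :
    B.xEpow i X (m + 1) = B.xE i X ≫ B.xEpow i X m := by
  induction m with
  | zero => simp [xEpow]
  | succ m ih => rw [xEpow, ih, Category.assoc, ← ih]; rfl

lemma cup_xEpow (i : Fin (n - 1)) (X : C) (m : ℕ) :
    B.η i X ≫ B.xEpow i ((A.F i).obj X) m = B.cupD i m X := by
  induction m with
  | zero => simp [cupD, xEpow, xpow]
  | succ m ih =>
    rw [xEpow, ← Category.assoc, ih, cupD, Category.assoc, B.xE_nat, reassoc_of% B.xE_unit,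
      ← Functor.map_comp, ← xpow_succ']
    rfl

lemma xEpow_cap (i : Fin (n - 1)) (X : C) (m : ℕ) :
    (A.F i).map (B.xEpow i X m) ≫ B.ε i X = B.capD i m X := by
  induction m with
  | zero => simp [capD, xEpow, xpow]
  | succ m ih =>
    rw [xEpow_succ', Functor.map_comp, Category.assoc, ih, capD_succ, capD, ← Category.assoc,
      ← Category.assoc]
    have h : ∀ m : ℕ, (A.F i).map (B.xE i X) ≫ B.xpow i ((A.E i).obj X) m =
        B.xpow i ((A.E i).obj X) m ≫ (A.F i).map (B.xE i X) := fun m => by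
      induction m with
      | zero => simp [xpow]
      | succ m ih => rw [xpow, ← Category.assoc, ih, Category.assoc, B.x_nat, Category.assoc]
    rw [h, Category.assoc, B.xE_counit, ← Category.assoc, ← xpow_succ']
    rfl

variable {B} in
lemma xEpow_eq_zero (h : ∀ i X, B.x i X ≫ B.x i X = 0) {m : ℕ} (hm : 2 ≤ m) :
    B.xEpow i X m = 0 := by
  obtain ⟨m, rfl⟩ := Nat.exists_eq_add_of_le hm
  induction m with
  | zero =>
    refine B.hom_ext_E ?_
    simp only [xEpow, Category.id_comp]
    rw [Functor.map_comp, Category.assoc, B.xE_counit, reassoc_of% B.x_nat, B.xE_counit,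
      ← Category.assoc, h]
    simp
  | succ m ih => rw [← add_assoc, xEpow, ih (by omega), Limits.zero_comp]

lemma xEpow_add (m m' : ℕ) : B.xEpow i X m ≫ B.xEpow i X m' = B.xEpow i X (m + m') := by
  induction m' with
  | zero => simp [xEpow]
  | succ m' ih => rw [xEpow, ← Category.assoc, ih, ← add_assoc, xEpow]

lemma cupD_xE (i : Fin (n - 1)) (X : C) (m : ℕ) :
    B.cupD i m X ≫ B.xE i ((A.F i).obj X) = B.cupD i (m + 1) X := by
  rw [← cup_xEpow, ← cup_xEpow, xEpow, Category.assoc]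

lemma map_xE_capD (i : Fin (n - 1)) (X : C) (m : ℕ) :
    (A.F i).map (B.xE i X) ≫ B.capD i m X = B.capD i (m + 1) X := by
  rw [← xEpow_cap, ← xEpow_cap, xEpow_succ', Functor.map_comp, Category.assoc]

lemma sum_fin_one {M : Type*} [AddCommMonoid M] {N : ℕ} (h : N = 1) (T : ℕ → M) :
    ∑ f : Fin N, T f = T 0 := by
  subst h; simp

lemma sum_fin_two {M : Type*} [AddCommMonoid M] {N : ℕ} (h : N = 2) (T : ℕ → M) :
    ∑ f : Fin N, T f = T 0 + T 1 := by
  subst h; simp [Fin.sum_univ_two]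

lemma sum_triangle_one {M : Type*} [AddCommMonoid M] {N : ℕ} (h : N = 1) (T : ℕ → ℕ → M) :
    ∑ f : Fin N, ∑ g : Fin (f + 1), T f g = T 0 0 := by
  subst h; simp

lemma sum_triangle_two {M : Type*} [AddCommMonoid M] {N : ℕ} (h : N = 2) (T : ℕ → ℕ → M) :
    ∑ f : Fin N, ∑ g : Fin (f + 1), T f g = T 0 0 + (T 1 0 + T 1 1) := by
  subst h
  rw [Fin.sum_univ_two]
  exact congrArg₂ (· + ·) (Fin.sum_univ_one _) (Fin.sum_univ_two _)

end Downward

namespace SchurData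

variable (D : SchurData A) {i j : Fin (n - 1)} (X Y : C)

lemma xEpow_eq_zero {m : ℕ} (hm : 2 ≤ m) : D.xEpow i X m = 0 :=
  Downward.xEpow_eq_zero X D.dot_dot hm

lemma cupD_eq_zero {m : ℕ} (hm : 2 ≤ m) : D.cupD i m X = 0 := by
  rw [← cup_xEpow, D.xEpow_eq_zero _ hm, Limits.comp_zero]

lemma capD_eq_zero {m : ℕ} (hm : 2 ≤ m) : D.capD i m X = 0 := by
  rw [← xEpow_cap, D.xEpow_eq_zero _ hm, Functor.map_zero, Limits.zero_comp]

/-- The sideways crossing `E_i F_j → F_j E_i` obtained by rotating the upward crossing with the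
second adjunction. -/
def sideEF (i j : Fin (n - 1)) (X : C) :
    (A.E i).obj ((A.F j).obj X) ⟶ (A.F j).obj ((A.E i).obj X) :=
  D.η' j _ ≫ (A.F j).map (D.cE j i ((A.F j).obj X)) ≫ (A.F j).map ((A.E i).map (D.ε' j X))

lemma s_sideEF (h : i ≠ j ∨ bar (A.wt X) i = 0) : D.s j i X ≫ D.sideEF i j X = 𝟙 _ := by
  rw [sideEF, reassoc_of% D.η'_nat, ← Functor.map_comp, ← Functor.map_comp, ← D.ε'_E X h,
    D.zigzag_F']

/-- The sideways crossing rotated by the second adjunction is the given inverse. -/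
lemma sideEF_eq (h : i ≠ j ∨ bar (A.wt X) i = 0) : D.sideEF i j X = D.t j i X := by
  have h' : j ≠ i ∨ bar (A.wt X) j = 0 := by
    by_cases e : i = j
    · subst e; exact h
    · exact .inl (Ne.symm e)
  rw [← Category.id_comp (D.sideEF i j X), ← D.t_s j i X h', Category.assoc, D.s_sideEF X h,
    Category.comp_id]

/-- A rotation of `map_ε'`; where the latter does not apply, the source vanishes. -/
lemma sideEF_ε' : D.sideEF j i ((A.F j).obj X) ≫ (A.F i).map (D.ε' j X) =
    (A.E j).map (D.c i j X) ≫ D.ε' j ((A.F i).obj X) := by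
  by_cases h : i ≠ j ∨ bar (A.wt X) i = 2
  · have h' : j ≠ i ∨ bar (A.wt ((A.F j).obj X)) j = 0 := by
      by_cases e : i = j
      · subst e
        refine .inr ?_
        rw [bar_F_self, h.resolve_left (absurd rfl)]; rfl
      · exact .inl (Ne.symm e)
    have h'' : i ≠ j ∨ bar (A.wt ((A.F j).obj X)) i = 0 := by
      by_cases e : i = j
      · subst e; exact h'
      · exact .inl e
    rw [D.sideEF_eq _ h', D.map_ε' X h, ← Category.assoc, D.t_s i j _ h'', Category.id_comp]
  · rw [not_or, not_ne_iff] at h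
    obtain ⟨rfl, h⟩ := h
    by_cases hw : IsWeight n d (A.wt X)
    · refine A.eq_of_bad_map_source (A.E i) (bad_F ?_) _ _
      have := hw.bar_cases i
      rw [bar_F_self]
      omega
    · exact A.eq_of_bad_map_source (A.F i ⋙ A.F i ⋙ A.E i) hw _ _

/-- Cyclicity of the crossing, for the second adjunction. -/
lemma c_eq' (i j : Fin (n - 1)) : D.c i j X = D.η' j _ ≫ (A.F j).map (D.η' i _) ≫
    (A.F j).map ((A.F i).map (D.cE i j _)) ≫
    (A.F j).map ((A.F i).map ((A.E j).map (D.ε' i _))) ≫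
    (A.F j).map ((A.F i).map (D.ε' j X)) := by
  have h := D.sideEF_ε' (i := i) (j := j) X
  simp only [sideEF, Category.assoc] at h
  have h' := congrArg (A.F j).map h
  simp only [Functor.map_comp] at h'
  rw [h', ← reassoc_of% D.η'_nat, D.zigzag_F', Category.comp_id]

lemma xE_ε' (i : Fin (n - 1)) :
    D.xE i ((A.F i).obj X) ≫ D.ε' i X = (A.E i).map (D.x i X) ≫ D.ε' i X := by
  refine D.ext_EF (𝟭 C) (fun m hm => ?_) fun h0 => ?_
  · change D.cupD i m X ≫ _ = D.cupD i m X ≫ _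
    rw [← Category.assoc, ← Category.assoc, D.cupD_xE, ← D.cupD_succ]
  · rw [Functor.id_map, reassoc_of% D.fRel.s_map_x X, reassoc_of% D.fRel.s_xE X]
    simp only [Preadditive.sub_comp, Category.assoc]
    rw [D.s_ε' h0, D.xE_counit]

/-- Cyclicity of the dot, for the second adjunction. -/
lemma x_eq' (i : Fin (n - 1)) : D.x i X = D.η' i ((A.F i).obj X) ≫
    (A.F i).map (D.xE i ((A.F i).obj X)) ≫ (A.F i).map (D.ε' i X) := by
  rw [map_sq _ (D.xE_ε' X i), ← reassoc_of% D.η'_nat, D.zigzag_F', Category.comp_id]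

/-- A clockwise bubble is a dotted cup followed by the second cap. -/
def cwB (i : Fin (n - 1)) (m : ℕ) : X ⟶ X := D.cupD i m X ≫ D.ε' i X

/-- A counterclockwise bubble is the second cup followed by a dotted cap. -/
def ccwB (i : Fin (n - 1)) (m : ℕ) : X ⟶ X := D.η' i X ≫ D.capD i m X

lemma cwB_eq_zero {m : ℕ} (hm : 2 ≤ m) : D.cwB X i m = 0 := by
  rw [cwB, D.cupD_eq_zero X hm, Limits.zero_comp]

lemma ccwB_eq_zero {m : ℕ} (hm : 2 ≤ m) : D.ccwB X i m = 0 := by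
  rw [ccwB, D.capD_eq_zero X hm, Limits.comp_zero]

/-- Clockwise bubbles, real or fake; for the fake ones, only the values that occur when dots square
to zero. -/
def fakeCwB (i : Fin (n - 1)) (r : ℕ) : X ⟶ X :=
  if r = 0 then cwSign k (A.wt X) i • 𝟙 X
  else if r = 1 then D.ccwB X i (-bar (A.wt X) i).toNat else 0

/-- Counterclockwise bubbles, real or fake; for the fake ones, only the values that occur when dots
square to zero. -/
def fakeCcwB (i : Fin (n - 1)) (r : ℕ) : X ⟶ X :=
  if r = 0 then ccwSign k (A.wt X) i • 𝟙 X
  else if r = 1 then D.cwB X i (bar (A.wt X) i).toNat else 0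

lemma right_curl_eq (i : Fin (n - 1)) : (A.E i).map (D.η i X) ≫ D.cE i i ((A.F i).obj X) ≫
    (A.E i).map (D.ε' i X) = D.η i _ ≫ (A.E i).map (D.s i i X ≫ D.ε' i X) := by
  rw [reassoc_of% D.cE_unit, Functor.map_comp]

lemma left_curl_eq (i : Fin (n - 1)) : D.η' i ((A.E i).obj X) ≫ (A.F i).map (D.cE i i X) ≫
    D.ε i ((A.E i).obj X) = D.η' i _ ≫ D.s i i _ ≫ (A.E i).map (D.ε i X) := by
  rw [D.cE_counit]

/-- The right curl. It is a zigzag if `μ̄_i = 0`. If `μ̄_i < 0` the sideways crossing vanishes, and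
so does the sum: its terms have two dots or a vanishing bubble if `μ̄_i = -2`, and its two terms
cancel if `μ̄_i = -1`. -/
lemma right_curl (i : Fin (n - 1)) : (A.E i).map (D.η i X) ≫ D.cE i i ((A.F i).obj X) ≫
    (A.E i).map (D.ε' i X) = -∑ f : Fin (-bar (A.wt X) i + 1).toNat,
      (A.E i).map (D.fakeCwB X i f) ≫ D.xEpow i X (-bar (A.wt X) i - f).toNat := by
  by_cases hE : IsWeight n d (A.wt ((A.E i).obj X))
  swap
  · exact A.eq_of_bad_source hE _ _
  by_cases hw : IsWeight n d (A.wt X)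
  swap
  · exact A.eq_of_bad_map_source (A.E i) hw _ _
  have hb : bar (A.wt X) i ≤ 0 := by
    by_contra h
    exact bad_E (not_le.1 h) hE
  rw [D.right_curl_eq]
  have hcases : bar (A.wt X) i = -2 ∨ bar (A.wt X) i = -1 ∨ bar (A.wt X) i = 0 := by
    have := hw.bar_cases i
    omega
  rcases hcases with h | h | h
  · have hz : D.s i i X = 0 := A.eq_of_bad_map_target (A.E i) (bad_F (by omega)) _ _
    rw [hz, Limits.zero_comp, Functor.map_zero, Limits.comp_zero, eq_comm, neg_eq_zero]
    refine Finset.sum_eq_zero fun f _ => ?_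
    obtain ⟨f, hf⟩ := f
    obtain rfl | rfl | rfl : f = 0 ∨ f = 1 ∨ f = 2 := by omega
    · rw [D.xEpow_eq_zero _ (by simp [h]), Limits.comp_zero]
    · simp [fakeCwB, D.ccwB_eq_zero X (i := i) (m := (-bar (A.wt X) i).toNat) (by omega)]
    · simp [fakeCwB]
  · have hz : D.s i i X = 0 := A.eq_of_bad_map_target (A.E i) (bad_F (by omega)) _ _
    have h2 : (-bar (A.wt X) i + 1).toNat = 2 := by omega
    rw [hz, Limits.zero_comp, Functor.map_zero, Limits.comp_zero, eq_comm, neg_eq_zero,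
      sum_fin_two h2 (fun f => (A.E i).map (D.fakeCwB X i f) ≫
        D.xEpow i X (-bar (A.wt X) i - f).toNat)]
    have hq : (A.E i).map (D.ccwB X i 1) = ccwSign k (A.wt X) i • D.xE i X := by
      rw [ccwB, D.η'_of_neg (by omega), h, Linear.smul_comp, Functor.map_smul, Functor.map_comp]
      erw [D.map_q X h]
      rw [capD_succ, capD_zero, Functor.map_comp]
      rfl
    simp [fakeCwB, h, xEpow, hq, ccwSign_eq]
  · have h2 : (-bar (A.wt X) i + 1).toNat = 1 := by omega
    have hs : cwSign k (A.wt X) i = -1 := by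
      have h1 := hE.1 (lo i)
      have h2 := hE.1 (hi i)
      rw [wt_E, Pi.add_apply] at h1 h2
      rw [root_lo] at h1
      rw [root_hi] at h2
      unfold bar at h
      have : A.wt X (hi i) = 1 := by omega
      exact cwSign_of_odd k (by rw [this]; exact odd_one)
    rw [D.s_ε' h, D.zigzag_E,
      sum_fin_one h2 (fun f => (A.E i).map (D.fakeCwB X i f) ≫
        D.xEpow i X (-bar (A.wt X) i - f).toNat)]
    simp [fakeCwB, h, xEpow, hs]

/-- The left curl, with left region the weight of `E_i X`; the cases are those of `right_curl`. -/
lemma left_curl (i : Fin (n - 1)) : D.η' i ((A.E i).obj X) ≫ (A.F i).map (D.cE i i X) ≫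
    D.ε i ((A.E i).obj X) = ∑ g : Fin (bar (A.wt ((A.E i).obj X)) i + 1).toNat,
      D.fakeCcwB ((A.E i).obj X) i g ≫
        D.xEpow i X (bar (A.wt ((A.E i).obj X)) i - g).toNat := by
  by_cases hE : IsWeight n d (A.wt ((A.E i).obj X))
  swap
  · exact A.eq_of_bad_source hE _ _
  by_cases hw : IsWeight n d (A.wt X)
  swap
  · exact A.eq_of_bad_map_source (A.E i) hw _ _
  have hb : bar (A.wt ((A.E i).obj X)) i = bar (A.wt X) i + 2 := bar_E_self i X
  rw [D.left_curl_eq]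
  have hcases : bar (A.wt X) i = -2 ∨ bar (A.wt X) i = -1 ∨ bar (A.wt X) i = 0 := by
    have := hw.bar_cases i
    have := hE.bar_cases i
    omega
  rcases hcases with h | h | h
  · have h2 : (bar (A.wt ((A.E i).obj X)) i + 1).toNat = 1 := by omega
    have hs : ccwSign k (A.wt ((A.E i).obj X)) i = 1 := by
      have h1 := hw.1 (lo i)
      have h2 := hw.1 (hi i)
      unfold bar at h
      have : A.wt X (hi i) = 2 := by omega
      rw [ccwSign_eq, cwSign_E_self, neg_neg, cwSign_of_even k (by rw [this]; exact even_two)]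
    rw [← Category.assoc, D.η'_s (by omega), D.zigzag_E,
      sum_fin_one h2 (fun g => D.fakeCcwB ((A.E i).obj X) i g ≫
        D.xEpow i X (bar (A.wt ((A.E i).obj X)) i - g).toNat)]
    simp [fakeCcwB, hb, h, xEpow, hs]
  · have hz : D.s i i ((A.E i).obj X) = 0 :=
      A.eq_of_bad_map_source (A.F i) (bad_E (by omega)) _ _
    have h2 : (bar (A.wt ((A.E i).obj X)) i + 1).toNat = 2 := by omega
    rw [hz, Limits.zero_comp, Limits.comp_zero, eq_comm,
      sum_fin_two h2 (fun g => D.fakeCcwB ((A.E i).obj X) i g ≫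
        D.xEpow i X (bar (A.wt ((A.E i).obj X)) i - g).toNat)]
    have hp : D.cwB ((A.E i).obj X) i 1 = cwSign k (A.wt ((A.E i).obj X)) i • D.xE i X := by
      have h1 : bar (A.wt ((A.E i).obj X)) i = 1 := by omega
      rw [cwB, D.ε'_of_pos (by omega), h1, Linear.comp_smul]
      erw [D.p_zero_E X h]
      rw [cupD_succ, cupD_zero, Category.assoc]
      rfl
    simp [fakeCcwB, hb, h, xEpow, hp, ccwSign_eq]
  · have hz : D.s i i ((A.E i).obj X) = 0 :=
      A.eq_of_bad_map_source (A.F i) (bad_E (by omega)) _ _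
    rw [hz, Limits.zero_comp, Limits.comp_zero, eq_comm]
    refine Finset.sum_eq_zero fun g _ => ?_
    obtain ⟨g, hg⟩ := g
    obtain rfl | rfl | rfl : g = 0 ∨ g = 1 ∨ g = 2 := by omega
    · rw [D.xEpow_eq_zero X (by simp [hb, h]), Limits.comp_zero]
    · simp [fakeCcwB, D.cwB_eq_zero ((A.E i).obj X) (i := i)
        (m := (bar (A.wt ((A.E i).obj X)) i).toNat) (by omega)]
    · simp [fakeCcwB]

/-- The generators opposite to the dotted cups differ by dots. -/
lemma xE_p_one (h : bar (A.wt X) i = 2) :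
    D.xE i ((A.F i).obj X) ≫ D.p i 1 X = D.p i 0 X := by
  refine D.ext_EF (𝟭 C) (fun m hm => ?_) fun h0 => absurd (h.symm.trans h0) (by norm_num)
  change D.cupD i m X ≫ _ = D.cupD i m X ≫ _
  rw [← Category.assoc, D.cupD_xE, D.cup_p i X m 0 hm (by omega)]
  obtain rfl | rfl : m = 0 ∨ m = 1 := by omega
  · rw [D.cup_p i X 1 1 (by omega) (by omega)]; simp
  · rw [D.cupD_eq_zero X le_rfl]; simp

/-- The generators opposite to the dotted caps differ by dots. -/
lemma q_one_xE (h : bar (A.wt X) i = -2) :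
    D.q i 1 X ≫ (A.F i).map (D.xE i X) = D.q i 0 X := by
  refine D.ext_FE (𝟭 C) (fun m hm => ?_) fun h0 => absurd (h.symm.trans h0) (by norm_num)
  change _ ≫ D.capD i m X = _ ≫ D.capD i m X
  rw [Category.assoc, D.map_xE_capD, D.q_cap i X 0 m (by omega) hm]
  obtain rfl | rfl : m = 0 ∨ m = 1 := by omega
  · rw [D.q_cap i X 1 1 (by omega) (by omega)]; simp
  · rw [D.capD_eq_zero X le_rfl]; simp

/-- The decomposition of the identity of `E_i F_i`, from the fact that the sideways crossing, or the
sum of the dotted cups, is invertible. -/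
lemma decomp_EF (i : Fin (n - 1)) : 𝟙 ((A.E i).obj ((A.F i).obj X)) =
    D.sideEF i i X ≫ D.s i i X + (-1 : k) • ∑ f : Fin (bar (A.wt X) i).toNat, ∑ g : Fin (f + 1),
      (D.xEpow i ((A.F i).obj X) (bar (A.wt X) i - 1 - f).toNat ≫ D.ε' i X) ≫
        D.fakeCcwB X i g ≫ D.cupD i (f - g) X := by
  by_cases hw : IsWeight n d (A.wt X)
  swap
  · exact A.eq_of_bad_map_source (A.F i ⋙ A.E i) hw _ _
  by_cases hF : bar (A.wt X) i < 0
  · exact A.eq_of_bad_map_source (A.E i) (bad_F hF) _ _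
  have hcases : bar (A.wt X) i = 2 ∨ bar (A.wt X) i = 1 ∨ bar (A.wt X) i = 0 := by
    have := hw.bar_cases i
    omega
  rcases hcases with h | h | h
  · have hz : D.s i i X = 0 := A.eq_of_bad_map_source (A.F i) (bad_E (by omega)) _ _
    have h2 : (bar (A.wt X) i).toNat = 2 := by omega
    have hp := D.p_cup i X (by omega)
    rw [sum_fin_two h2 (fun m => D.p i m X ≫ D.cupD i m X)] at hp
    rw [hz, Limits.comp_zero, zero_add, sum_triangle_two h2 (fun f g =>
      (D.xEpow i ((A.F i).obj X) (bar (A.wt X) i - 1 - f).toNat ≫ D.ε' i X) ≫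
        D.fakeCcwB X i g ≫ D.cupD i (f - g) X)]
    have h3 : D.fakeCcwB X i 1 = 0 := by
      simp [fakeCcwB, D.cwB_eq_zero X (i := i) (m := (bar (A.wt X) i).toNat) (by omega)]
    have hε : D.ε' i X = cwSign k (A.wt X) i • D.p i 1 X := by
      rw [D.ε'_of_pos (by omega), h]; rfl
    have h4 := D.xE_p_one X h
    simp only [h3, h]
    rw [← hp]
    norm_num [fakeCcwB, xEpow, hε, reassoc_of% h4, smul_smul, ccwSign_eq, cwSign_mul_self, add_comm]
  · have hz : D.s i i X = 0 := A.eq_of_bad_map_source (A.F i) (bad_E (by omega)) _ _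
    have h2 : (bar (A.wt X) i).toNat = 1 := by omega
    have hp := D.p_zero_cup X h
    have hε : D.ε' i X = cwSign k (A.wt X) i • D.p i 0 X := by
      rw [D.ε'_of_pos (by omega), h]; rfl
    rw [hz, Limits.comp_zero, zero_add, sum_triangle_one h2 (fun f g =>
      (D.xEpow i ((A.F i).obj X) (bar (A.wt X) i - 1 - f).toNat ≫ D.ε' i X) ≫
        D.fakeCcwB X i g ≫ D.cupD i (f - g) X)]
    simp only [h]
    simp [fakeCcwB, xEpow, hε, cupD_zero, hp, smul_smul, ccwSign_eq, cwSign_mul_self]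
  -- There are no dotted cups.
  · have h2 : (bar (A.wt X) i).toNat = 0 := by omega
    have : IsEmpty (Fin (bar (A.wt X) i).toNat) := by rw [h2]; infer_instance
    rw [Finset.univ_eq_empty, Finset.sum_empty, smul_zero, add_zero, D.sideEF_eq X (.inr h),
      D.t_s i i X (.inr h)]

/-- The decomposition of the identity of `F_i E_i`, from the fact that the sideways crossing, or the
sum of the dotted caps, is invertible. -/
lemma decomp_FE (i : Fin (n - 1)) : 𝟙 ((A.F i).obj ((A.E i).obj X)) =
    D.s i i X ≫ D.sideEF i i X + (-1 : k) • ∑ f : Fin (-bar (A.wt X) i).toNat, ∑ g : Fin (f + 1),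
      D.capD i (-bar (A.wt X) i - 1 - f).toNat X ≫
        D.fakeCwB X i g ≫ D.η' i X ≫ (A.F i).map (D.xEpow i X (f - g)) := by
  by_cases hw : IsWeight n d (A.wt X)
  swap
  · exact A.eq_of_bad_map_source (A.E i ⋙ A.F i) hw _ _
  by_cases hE : 0 < bar (A.wt X) i
  · exact A.eq_of_bad_map_source (A.F i) (bad_E hE) _ _
  have hcases : bar (A.wt X) i = -2 ∨ bar (A.wt X) i = -1 ∨ bar (A.wt X) i = 0 := by
    have := hw.bar_cases i
    omega
  rcases hcases with h | h | h
  · have hz : D.s i i X = 0 := A.eq_of_bad_map_target (A.E i) (bad_F (by omega)) _ _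
    have h2 : (-bar (A.wt X) i).toNat = 2 := by omega
    have hp := D.cap_q i X (by omega)
    rw [sum_fin_two h2 (fun m => D.capD i m X ≫ D.q i m X)] at hp
    rw [hz, Limits.zero_comp, zero_add, sum_triangle_two h2 (fun f g =>
      D.capD i (-bar (A.wt X) i - 1 - f).toNat X ≫
        D.fakeCwB X i g ≫ D.η' i X ≫ (A.F i).map (D.xEpow i X (f - g)))]
    have h3 : D.fakeCwB X i 1 = 0 := by
      simp [fakeCwB, D.ccwB_eq_zero X (i := i) (m := (-bar (A.wt X) i).toNat) (by omega)]
    have hε : D.η' i X = ccwSign k (A.wt X) i • D.q i 1 X := by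
      rw [D.η'_of_neg (by omega), h]; rfl
    have h4 := D.q_one_xE X h
    simp only [h3, h]
    rw [← hp]
    norm_num [fakeCwB, xEpow, hε, h4, smul_smul, ccwSign_eq, cwSign_mul_self, add_comm]
  · have hz : D.s i i X = 0 := A.eq_of_bad_map_target (A.E i) (bad_F (by omega)) _ _
    have h2 : (-bar (A.wt X) i).toNat = 1 := by omega
    have hp := D.cap_q i X (by omega)
    rw [sum_fin_one h2 (fun m => D.capD i m X ≫ D.q i m X)] at hp
    have hε : D.η' i X = ccwSign k (A.wt X) i • D.q i 0 X := by
      rw [D.η'_of_neg (by omega), h]; rfl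
    rw [hz, Limits.zero_comp, zero_add, sum_triangle_one h2 (fun f g =>
      D.capD i (-bar (A.wt X) i - 1 - f).toNat X ≫
        D.fakeCwB X i g ≫ D.η' i X ≫ (A.F i).map (D.xEpow i X (f - g)))]
    simp only [h]
    simp [fakeCwB, xEpow, hε, hp, smul_smul, ccwSign_eq, cwSign_mul_self]
  -- There are no dotted caps.
  · have h2 : (-bar (A.wt X) i).toNat = 0 := by omega
    have : IsEmpty (Fin (-bar (A.wt X) i).toNat) := by rw [h2]; infer_instance
    rw [Finset.univ_eq_empty, Finset.sum_empty, smul_zero, add_zero, D.sideEF_eq X (.inr h),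
      D.s_t i i X (.inr h)]

end SchurData

end SchurCat

/-! ### Evaluation of the diagrams of `S(n,d)` -/

namespace MSV

open Signature SchurCat Downward

variable {n d : ℕ} {k : Type u} [CommRing k] {C : Type w} [Category.{v} C] [Preadditive C]
  [Linear k C] {A : WeightAction n d k C}

namespace Rep

variable (R : Rep (sig n d) A)

/-- The cup `X → E_i F_i X`. -/
def cupEF (i : Fin (n - 1)) (X : C) : X ⟶
    (A.E i).obj ((A.F i).obj X) := R.fam (fun _ => Gen.cupEF i) X

/-- The cup `X → F_i E_i X`. -/
def cupFE (i : Fin (n - 1)) (X : C) : X ⟶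
    (A.F i).obj ((A.E i).obj X) := R.fam (fun _ => Gen.cupFE i) X

/-- The cap `E_i F_i X → X`. -/
def capEF (i : Fin (n - 1)) (X : C) : (A.E i).obj ((A.F i).obj X) ⟶
    X := R.fam (fun _ => Gen.capEF i) X

/-- The cap `F_i E_i X → X`. -/
def capFE (i : Fin (n - 1)) (X : C) : (A.F i).obj ((A.E i).obj X) ⟶
    X := R.fam (fun _ => Gen.capFE i) X

/-- The dot on `E_i X`. -/
def dotE (i : Fin (n - 1)) (X : C) : (A.E i).obj X ⟶
    (A.E i).obj X := R.fam (fun _ => Gen.dotE i) X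

/-- The dot on `F_i X`. -/
def dotF (i : Fin (n - 1)) (X : C) : (A.F i).obj X ⟶
    (A.F i).obj X := R.fam (fun _ => Gen.dotF i) X

/-- The crossing `E_i E_j X → E_j E_i X`. -/
def crossE (i j : Fin (n - 1)) (X : C) : (A.E i).obj ((A.E j).obj X) ⟶
    (A.E j).obj ((A.E i).obj X) := R.fam (fun _ => Gen.crossE i j) X

/-- The crossing `F_i F_j X → F_j F_i X`. -/
def crossF (i j : Fin (n - 1)) (X : C) : (A.F i).obj ((A.F j).obj X) ⟶
    (A.F j).obj ((A.F i).obj X) := R.fam (fun _ => Gen.crossF i j) X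

lemma cupEF_nat (i : Fin (n - 1)) {X Y : C} (f : X ⟶ Y) :
    A.map [] f ≫ cupEF R i Y = cupEF R i X ≫ A.map [.E i, .F i] f :=
  (R.fam_nat (fun _ => Gen.cupEF i) f).symm

lemma cupFE_nat (i : Fin (n - 1)) {X Y : C} (f : X ⟶ Y) :
    A.map [] f ≫ cupFE R i Y = cupFE R i X ≫ A.map [.F i, .E i] f :=
  (R.fam_nat (fun _ => Gen.cupFE i) f).symm

lemma capFE_nat (i : Fin (n - 1)) {X Y : C} (f : X ⟶ Y) :
    A.map [.F i, .E i] f ≫ capFE R i Y = capFE R i X ≫ A.map [] f :=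
  (R.fam_nat (fun _ => Gen.capFE i) f).symm

lemma dotE_nat (i : Fin (n - 1)) {X Y : C} (f : X ⟶ Y) :
    A.map [.E i] f ≫ dotE R i Y = dotE R i X ≫ A.map [.E i] f :=
  (R.fam_nat (fun _ => Gen.dotE i) f).symm

lemma dotF_nat (i : Fin (n - 1)) {X Y : C} (f : X ⟶ Y) :
    A.map [.F i] f ≫ dotF R i Y = dotF R i X ≫ A.map [.F i] f :=
  (R.fam_nat (fun _ => Gen.dotF i) f).symm

lemma crossE_nat (i j : Fin (n - 1)) {X Y : C} (f : X ⟶ Y) :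
    A.map [.E i, .E j] f ≫ crossE R i j Y = crossE R i j X ≫ A.map [.E j, .E i] f :=
  (R.fam_nat (fun _ => Gen.crossE i j) f).symm

lemma crossF_nat (i j : Fin (n - 1)) {X Y : C} (f : X ⟶ Y) :
    A.map [.F i, .F j] f ≫ crossF R i j Y = crossF R i j X ≫ A.map [.F j, .F i] f :=
  (R.fam_nat (fun _ => Gen.crossF i j) f).symm

variable {μ : Fin n → ℤ} {u v w w' : List (Letter n)} (X : C) (hX : A.wt X = μ)

lemma eval_cupEF (i : Fin (n - 1)) (hw : w = u ++ [] ++ v) (hw' : w' = u ++ [.E i, .F i] ++ v) :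
    R.eval (.gen u v (ν := (sig n d).actW v μ) rfl
      (Gen.cupEF (μ := v.foldr actLetter μ) i) hw hw') X hX =
      castHom (Rep.obj_eq (S := sig n d) (A := A) hw X) (Rep.obj_eq (S := sig n d) (A := A) hw' X)
        (A.map u (X := A.obj [] (A.obj v X)) (Y := A.obj [.E i, .F i] (A.obj v X))
          (cupEF R i (A.obj v X))) :=
  R.eval_fam (fun _ => Gen.cupEF i) X hX hw hw'

lemma eval_cupFE (i : Fin (n - 1)) (hw : w = u ++ [] ++ v) (hw' : w' = u ++ [.F i, .E i] ++ v) :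
    R.eval (.gen u v (ν := (sig n d).actW v μ) rfl
      (Gen.cupFE (μ := v.foldr actLetter μ) i) hw hw') X hX =
      castHom (Rep.obj_eq (S := sig n d) (A := A) hw X) (Rep.obj_eq (S := sig n d) (A := A) hw' X)
        (A.map u (X := A.obj [] (A.obj v X)) (Y := A.obj [.F i, .E i] (A.obj v X))
          (cupFE R i (A.obj v X))) :=
  R.eval_fam (fun _ => Gen.cupFE i) X hX hw hw'

lemma eval_capEF (i : Fin (n - 1)) (hw : w = u ++ [.E i, .F i] ++ v) (hw' : w' = u ++ [] ++ v) :
    R.eval (.gen u v (ν := (sig n d).actW v μ) rfl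
      (Gen.capEF (μ := v.foldr actLetter μ) i) hw hw') X hX =
      castHom (Rep.obj_eq (S := sig n d) (A := A) hw X) (Rep.obj_eq (S := sig n d) (A := A) hw' X)
        (A.map u (X := A.obj [.E i, .F i] (A.obj v X)) (Y := A.obj [] (A.obj v X))
          (capEF R i (A.obj v X))) :=
  R.eval_fam (fun _ => Gen.capEF i) X hX hw hw'

lemma eval_capFE (i : Fin (n - 1)) (hw : w = u ++ [.F i, .E i] ++ v) (hw' : w' = u ++ [] ++ v) :
    R.eval (.gen u v (ν := (sig n d).actW v μ) rfl
      (Gen.capFE (μ := v.foldr actLetter μ) i) hw hw') X hX =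
      castHom (Rep.obj_eq (S := sig n d) (A := A) hw X) (Rep.obj_eq (S := sig n d) (A := A) hw' X)
        (A.map u (X := A.obj [.F i, .E i] (A.obj v X)) (Y := A.obj [] (A.obj v X))
          (capFE R i (A.obj v X))) :=
  R.eval_fam (fun _ => Gen.capFE i) X hX hw hw'

lemma eval_dotE (i : Fin (n - 1)) (hw : w = u ++ [.E i] ++ v) (hw' : w' = u ++ [.E i] ++ v) :
    R.eval (.gen u v (ν := (sig n d).actW v μ) rfl
      (Gen.dotE (μ := v.foldr actLetter μ) i) hw hw') X hX =
      castHom (Rep.obj_eq (S := sig n d) (A := A) hw X) (Rep.obj_eq (S := sig n d) (A := A) hw' X)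
        (A.map u (X := A.obj [.E i] (A.obj v X)) (Y := A.obj [.E i] (A.obj v X))
          (dotE R i (A.obj v X))) :=
  R.eval_fam (fun _ => Gen.dotE i) X hX hw hw'

lemma eval_dotF (i : Fin (n - 1)) (hw : w = u ++ [.F i] ++ v) (hw' : w' = u ++ [.F i] ++ v) :
    R.eval (.gen u v (ν := (sig n d).actW v μ) rfl
      (Gen.dotF (μ := v.foldr actLetter μ) i) hw hw') X hX =
      castHom (Rep.obj_eq (S := sig n d) (A := A) hw X) (Rep.obj_eq (S := sig n d) (A := A) hw' X)
        (A.map u (X := A.obj [.F i] (A.obj v X)) (Y := A.obj [.F i] (A.obj v X))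
          (dotF R i (A.obj v X))) :=
  R.eval_fam (fun _ => Gen.dotF i) X hX hw hw'

lemma eval_crossE (i j : Fin (n - 1)) (hw : w = u ++ [.E i, .E j] ++ v)
    (hw' : w' = u ++ [.E j, .E i] ++ v) :
    R.eval (.gen u v (ν := (sig n d).actW v μ) rfl
      (Gen.crossE (μ := v.foldr actLetter μ) i j) hw hw') X hX =
      castHom (Rep.obj_eq (S := sig n d) (A := A) hw X) (Rep.obj_eq (S := sig n d) (A := A) hw' X)
        (A.map u (X := A.obj [.E i, .E j] (A.obj v X)) (Y := A.obj [.E j, .E i] (A.obj v X))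
          (crossE R i j (A.obj v X))) :=
  R.eval_fam (fun _ => Gen.crossE i j) X hX hw hw'

lemma eval_crossF (i j : Fin (n - 1)) (hw : w = u ++ [.F i, .F j] ++ v)
    (hw' : w' = u ++ [.F j, .F i] ++ v) :
    R.eval (.gen u v (ν := (sig n d).actW v μ) rfl
      (Gen.crossF (μ := v.foldr actLetter μ) i j) hw hw') X hX =
      castHom (Rep.obj_eq (S := sig n d) (A := A) hw X) (Rep.obj_eq (S := sig n d) (A := A) hw' X)
        (A.map u (X := A.obj [.F i, .F j] (A.obj v X)) (Y := A.obj [.F j, .F i] (A.obj v X))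
          (crossF R i j (A.obj v X))) :=
  R.eval_fam (fun _ => Gen.crossF i j) X hX hw hw'

lemma eval_between {s t : List (Letter n)} (u v : List (Letter n))
    (f : Diag k n d (v.foldr actLetter μ) s t) (hw : w = u ++ s ++ v) (hw' : w' = u ++ t ++ v) :
    R.eval (Signature.Term.whisk (S := sig n d) (ν := (sig n d).actW v μ) u v rfl f hw hw') X hX =
      castHom (Rep.obj_eq (S := sig n d) (A := A) hw X) (Rep.obj_eq (S := sig n d) (A := A) hw' X)
        (A.map u (R.eval f (A.obj v X) (Rep.wt_obj_of (S := sig n d) hX rfl))) :=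
  R.eval_whisk (S := sig n d) rfl f hw hw' X hX

variable {R}

/-- The generating 2-morphisms of `S(n,d)` are represented by the adjunctions, dots and crossings
of `D` and by the mates obtained from them. -/
structure IsModel (R : Rep (sig n d) A) (D : SchurData A) : Prop where
  cupEF_eq i X : cupEF R i X = D.η i X
  capFE_eq i X : capFE R i X = D.ε i X
  dotF_eq i X : dotF R i X = D.x i X
  crossF_eq i j X : crossF R i j X = D.c i j X
  cupFE_eq i X : cupFE R i X = D.η' i X
  capEF_eq i X : capEF R i X = D.ε' i X
  dotE_eq i X : dotE R i X = D.xE i X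
  crossE_eq i j X : crossE R i j X = D.cE i j X

/-- The strand `E_i` with `m` dots. -/
def dotEpow (R : Rep (sig n d) A) (i : Fin (n - 1)) (X : C) : ℕ → ((A.E i).obj X ⟶ (A.E i).obj X)
  | 0 => 𝟙 _
  | m + 1 => dotEpow R i X m ≫ dotE R i X

variable (R)

lemma eval_dotsE (i : Fin (n - 1)) (m : ℕ) :
    R.eval (dotsE k d i m) X hX = dotEpow R i X m := by
  rw [dotsE]
  induction m with
  | zero => rfl
  | succ m ih =>
    rw [Term.pow, Rep.eval_comp, ih]
    simp only [eval_dotE]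
    rfl

lemma eval_cupEF_dots (i : Fin (n - 1)) (m : ℕ) :
    R.eval (MSV.cupEF k d i m) X hX = cupEF R i X ≫ dotEpow R i _ m := by
  rw [MSV.cupEF, Rep.eval_comp, within, eval_between, eval_dotsE, eval_cupEF]
  rfl

lemma eval_cupFE_dots (i : Fin (n - 1)) (m : ℕ) :
    R.eval (MSV.cupFE k d i m) X hX = cupFE R i X ≫ (A.F i).map (dotEpow R i X m) := by
  rw [MSV.cupFE, Rep.eval_comp, within, eval_between, eval_dotsE, eval_cupFE]
  rfl

lemma eval_capEF_dots (i : Fin (n - 1)) (m : ℕ) :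
    R.eval (MSV.capEF k d i m) X hX = dotEpow R i _ m ≫ capEF R i X := by
  rw [MSV.capEF, Rep.eval_comp, within, eval_between, eval_dotsE, eval_capEF]
  rfl

lemma eval_capFE_dots (i : Fin (n - 1)) (m : ℕ) :
    R.eval (MSV.capFE k d i m) X hX = (A.F i).map (dotEpow R i X m) ≫ capFE R i X := by
  rw [MSV.capFE, Rep.eval_comp, within, eval_between, eval_dotsE, eval_capFE]
  rfl

/-- The clockwise bubble with `m` dots. -/
def cwR (i : Fin (n - 1)) (m : ℕ) : X ⟶ X := cupEF R i X ≫ dotEpow R i _ m ≫ capEF R i X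

/-- The counterclockwise bubble with `m` dots. -/
def ccwR (i : Fin (n - 1)) (m : ℕ) : X ⟶ X :=
  cupFE R i X ≫ (A.F i).map (dotEpow R i _ m) ≫ capFE R i X

lemma eval_cw (i : Fin (n - 1)) (m : ℕ) : R.eval (cw k d i m) X hX = cwR R X i m := by
  rw [cw, Rep.eval_comp, eval_capEF_dots, eval_cupEF]
  rfl

lemma eval_ccw (i : Fin (n - 1)) (m : ℕ) : R.eval (ccw k d i m) X hX = ccwR R X i m := by
  rw [ccw, Rep.eval_comp, eval_capFE_dots, eval_cupFE]
  rfl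

lemma eval_fakeCw_zero (i : Fin (n - 1)) :
    R.eval (fakeCw k d i 0) X hX = cwSign k μ i • 𝟙 X := by
  rw [fakeCw]; rfl

lemma eval_fakeCcw_zero (i : Fin (n - 1)) :
    R.eval (fakeCcw k d i 0) X hX = ccwSign k μ i • 𝟙 X := by
  rw [fakeCcw]; rfl

lemma eval_fakeCw_one (i : Fin (n - 1)) :
    R.eval (fakeCw k d i 1) X hX = ccwR R X i (-bar μ i).toNat := by
  rw [fakeCw, Rep.eval_smul, Rep.eval_sum, Fin.sum_univ_one, Rep.eval_comp, eval_ccw]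
  change -ccwSign k μ i • (ccwR R X i (-bar μ i - 1 + 1).toNat ≫ R.eval (fakeCw k d i 0) X hX) = _
  have h : ∀ f : X ⟶ X, -ccwSign k μ i • (f ≫ (cwSign k μ i • 𝟙 X)) = f := fun f => by
    rw [Linear.comp_smul, smul_smul, ccwSign_eq, neg_neg, cwSign_mul_self, one_smul,
      Category.comp_id]
  rw [eval_fakeCw_zero, sub_add_cancel]
  exact h _

lemma eval_fakeCcw_one (i : Fin (n - 1)) :
    R.eval (fakeCcw k d i 1) X hX = cwR R X i (bar μ i).toNat := by
  rw [fakeCcw, Rep.eval_smul, Rep.eval_sum, Fin.sum_univ_one, Rep.eval_comp, eval_cw]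
  change -cwSign k μ i • (cwR R X i (bar μ i - 1 + 1).toNat ≫ R.eval (fakeCcw k d i 0) X hX) = _
  have h : ∀ f : X ⟶ X, -cwSign k μ i • (f ≫ (ccwSign k μ i • 𝟙 X)) = f := fun f => by
    rw [Linear.comp_smul, smul_smul, ccwSign_eq, neg_mul_neg, cwSign_mul_self, one_smul,
      Category.comp_id]
  rw [eval_fakeCcw_zero, sub_add_cancel]
  exact h _

/-- The recursion expresses the fake bubble of degree `4` through real bubbles, which vanish here.
-/
lemma eval_fakeCw_two (i : Fin (n - 1)) (h1 : ccwR R X i (-bar μ i).toNat = 0)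
    (h2 : ccwR R X i (-bar μ i + 1).toNat = 0) : R.eval (fakeCw k d i 2) X hX = 0 := by
  rw [fakeCw, Rep.eval_smul, Rep.eval_sum, Fin.sum_univ_two, Rep.eval_comp, Rep.eval_comp,
    eval_ccw, eval_ccw]
  change -ccwSign k μ i • (ccwR R X i (-bar μ i - 1 + 1).toNat ≫ R.eval (fakeCw k d i 1) X hX +
    ccwR R X i (-bar μ i - 1 + ((1 : ℕ) + 1)).toNat ≫ R.eval (fakeCw k d i 0) X hX) = _
  rw [sub_add_cancel, h1, show -bar μ i - 1 + (((1 : ℕ) : ℤ) + 1) = -bar μ i + 1 by push_cast; ring,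
    h2]
  have h : ∀ f g : X ⟶ X, -ccwSign k μ i • ((0 : X ⟶ X) ≫ f + (0 : X ⟶ X) ≫ g) = 0 := by simp
  exact h _ _

lemma eval_fakeCcw_two (i : Fin (n - 1)) (h1 : cwR R X i (bar μ i).toNat = 0)
    (h2 : cwR R X i (bar μ i + 1).toNat = 0) : R.eval (fakeCcw k d i 2) X hX = 0 := by
  rw [fakeCcw, Rep.eval_smul, Rep.eval_sum, Fin.sum_univ_two, Rep.eval_comp, Rep.eval_comp,
    eval_cw, eval_cw]
  change -cwSign k μ i • (cwR R X i (bar μ i - 1 + 1).toNat ≫ R.eval (fakeCcw k d i 1) X hX +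
    cwR R X i (bar μ i - 1 + ((1 : ℕ) + 1)).toNat ≫ R.eval (fakeCcw k d i 0) X hX) = _
  rw [sub_add_cancel, h1, show bar μ i - 1 + (((1 : ℕ) : ℤ) + 1) = bar μ i + 1 by push_cast; ring,
    h2]
  have h : ∀ f g : X ⟶ X, -cwSign k μ i • ((0 : X ⟶ X) ≫ f + (0 : X ⟶ X) ≫ g) = 0 := by simp
  exact h _ _

/-- The sideways crossing `E_i F_j X → F_j E_i X`. -/
def sideEFR (i j : Fin (n - 1)) (X : C) :
    (A.E i).obj ((A.F j).obj X) ⟶ (A.F j).obj ((A.E i).obj X) :=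
  cupFE R j _ ≫ (A.F j).map (crossE R j i ((A.F j).obj X)) ≫
    (A.F j).map ((A.E i).map (capEF R j X))

/-- The sideways crossing `F_i E_j X → E_j F_i X`. -/
def sideFER (i j : Fin (n - 1)) (X : C) :
    (A.F i).obj ((A.E j).obj X) ⟶ (A.E j).obj ((A.F i).obj X) :=
  (A.F i).map ((A.E j).map (cupEF R i X)) ≫ (A.F i).map (crossE R j i ((A.F i).obj X)) ≫
    capFE R i ((A.E j).obj ((A.F i).obj X))

lemma eval_sideEF (i j : Fin (n - 1)) : R.eval (sideEF k d i j) X hX = sideEFR R i j X := by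
  simp only [sideEF, Rep.eval_comp, eval_cupFE, eval_crossE, eval_capEF]
  rfl

lemma eval_sideFE (i j : Fin (n - 1)) : R.eval (sideFE k d i j) X hX = sideFER R i j X := by
  simp only [sideFE, Rep.eval_comp, eval_cupEF, eval_crossE, eval_capFE]
  rfl

end Rep

end MSV

namespace MSV.Rep.IsModel

open Signature SchurCat Downward

variable {n d : ℕ} {k : Type u} [CommRing k] {C : Type w} [Category.{v} C] [Preadditive C]
  [Linear k C] {A : WeightAction n d k C} {R : Rep (sig n d) A} {D : SchurData A}

/-! ### The relations of `S(n,d)` follow from those of the graded 2-Schur algebra -/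

lemma dotEpow_eq (h : IsModel R D) (i : Fin (n - 1)) (X : C) (m : ℕ) :
    dotEpow R i X m = D.xEpow i X m := by
  induction m with
  | zero => rfl
  | succ m ih => rw [dotEpow, ih, h.dotE_eq]; rfl

lemma cwR_eq (h : IsModel R D) (X : C) (i : Fin (n - 1)) (m : ℕ) :
    cwR R X i m = D.cwB X i m := by
  rw [cwR, h.dotEpow_eq, h.cupEF_eq, h.capEF_eq, SchurData.cwB, ← cup_xEpow, Category.assoc]

lemma ccwR_eq (h : IsModel R D) (X : C) (i : Fin (n - 1)) (m : ℕ) :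
    ccwR R X i m = D.ccwB X i m := by
  rw [ccwR, h.dotEpow_eq, h.cupFE_eq, h.capFE_eq, SchurData.ccwB, ← xEpow_cap]

lemma sideEFR_eq (h : IsModel R D) (i j : Fin (n - 1)) (X : C) :
    sideEFR R i j X = D.sideEF i j X := by
  rw [sideEFR, h.cupFE_eq, h.crossE_eq, h.capEF_eq, SchurData.sideEF]

lemma sideFER_eq (h : IsModel R D) (i j : Fin (n - 1)) (X : C) :
    sideFER R i j X = D.s i j X := by
  rw [sideFER, h.cupEF_eq, h.crossE_eq, h.capFE_eq, rotate_cE]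

lemma eval_fakeCw (h : IsModel R D) (X : C) (i : Fin (n - 1)) (r : ℕ)
    (hr : (r : ℤ) ≤ -bar (A.wt X) i) :
    R.eval (fakeCw k d i r) X rfl = D.fakeCwB X i r := by
  by_cases hw : IsWeight n d (A.wt X)
  swap
  · exact A.eq_of_bad_source hw _ _
  have := hw.bar_cases i
  obtain rfl | rfl | rfl : r = 0 ∨ r = 1 ∨ r = 2 := by omega
  · exact eval_fakeCw_zero R X rfl i
  · rw [eval_fakeCw_one, h.ccwR_eq]
    rfl
  · refine eval_fakeCw_two R X rfl i ?_ ?_ <;> rw [h.ccwR_eq, D.ccwB_eq_zero X (by omega)]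

lemma eval_fakeCcw (h : IsModel R D) {μ : Fin n → ℤ} (X : C) (hX : A.wt X = μ) (i : Fin (n - 1))
    (r : ℕ) (hr : (r : ℤ) ≤ bar μ i) :
    R.eval (fakeCcw k d i r) X hX = D.fakeCcwB X i r := by
  subst hX
  by_cases hw : IsWeight n d (A.wt X)
  swap
  · exact A.eq_of_bad_source hw _ _
  have := hw.bar_cases i
  obtain rfl | rfl | rfl : r = 0 ∨ r = 1 ∨ r = 2 := by omega
  · exact eval_fakeCcw_zero R X rfl i
  · rw [eval_fakeCcw_one, h.cwR_eq]
    rfl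
  · refine eval_fakeCcw_two R X rfl i ?_ ?_ <;> rw [h.cwR_eq, D.cwB_eq_zero X (by omega)]

/-- A representation given by `SchurData` satisfies the relations of `S(n,d)`. -/
theorem sat (h : IsModel R D) : R.Sat (Rel k d) := by
  have hE := D.fRel.eRel
  refine ⟨fun hrel X hX => ?_⟩
  subst hX
  cases hrel with
  | zigzag_E i =>
    simp only [Rep.eval_comp, Rep.eval_id, eval_cupEF, eval_capFE, h.cupEF_eq, h.capFE_eq]
    exact D.zigzag_E i X
  | zigzag_E' i =>
    simp only [Rep.eval_comp, Rep.eval_id, eval_cupFE, eval_capEF, h.cupFE_eq, h.capEF_eq]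
    exact D.zigzag_E' X i
  | zigzag_F i =>
    simp only [Rep.eval_comp, Rep.eval_id, eval_cupEF, eval_capFE, h.cupEF_eq, h.capFE_eq]
    exact D.zigzag_F i X
  | zigzag_F' i =>
    simp only [Rep.eval_comp, Rep.eval_id, eval_cupFE, eval_capEF, h.cupFE_eq, h.capEF_eq]
    exact D.zigzag_F' X i
  | dot_cyclic i =>
    simp only [Rep.eval_comp, eval_dotF, eval_dotE, eval_cupEF, eval_capFE, h.cupEF_eq, h.capFE_eq,
      h.dotE_eq, h.dotF_eq]
    exact (D.rotate_xE X i).symm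
  | dot_cyclic' i =>
    simp only [Rep.eval_comp, eval_dotF, eval_dotE, eval_cupFE, eval_capEF, h.cupFE_eq, h.capEF_eq,
      h.dotE_eq, h.dotF_eq]
    exact D.x_eq' X i
  | cross_cyclic i j =>
    simp only [Rep.eval_comp, eval_crossF, eval_crossE, eval_cupEF, eval_capFE, h.cupEF_eq,
      h.capFE_eq, h.crossE_eq, h.crossF_eq]
    exact D.c_eq i j X
  | cross_cyclic' i j =>
    simp only [Rep.eval_comp, eval_crossF, eval_crossE, eval_cupFE, eval_capEF, h.cupFE_eq,
      h.capEF_eq, h.crossE_eq, h.crossF_eq]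
    exact D.c_eq' X i j
  | cw_neg i m hm =>
    rw [eval_cw, h.cwR_eq]
    exact D.cupD_ε' (by omega)
  | ccw_neg i m hm =>
    rw [eval_ccw, h.ccwR_eq]
    exact D.η'_capD (by omega)
  | cw_zero i m hm =>
    rw [eval_cw, h.cwR_eq]
    exact D.cupD_ε'_top (by omega)
  | ccw_zero i m hm =>
    rw [eval_ccw, h.ccwR_eq]
    exact D.η'_capD_top (by omega)
  | curl_right i =>
    simp only [Rep.eval_comp, Rep.eval_smul, Rep.eval_sum, eval_dotsE, within, eval_between,
      eval_cupEF, eval_crossE, eval_capEF, h.cupEF_eq, h.capEF_eq, h.crossE_eq, h.dotEpow_eq]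
    refine (D.right_curl X i).trans ?_
    rw [← neg_one_smul k]
    refine congrArg _ (Finset.sum_congr rfl fun f _ => ?_)
    rw [← h.eval_fakeCw X i f (by have := f.2; omega)]
    rfl
  | curl_left i =>
    simp only [Rep.eval_comp, Rep.eval_sum, eval_dotsE, within, eval_between, eval_cupFE,
      eval_crossE, eval_capFE, h.cupFE_eq, h.capFE_eq, h.crossE_eq, h.dotEpow_eq]
    have key := D.left_curl X i
    rw [wt_E] at key
    refine key.trans ?_
    refine Finset.sum_congr rfl fun f _ => ?_
    rw [← h.eval_fakeCcw _ (wt_E i X) i f (by have := f.2; omega)]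
    rfl
  | decomp_EF i =>
    simp only [Rep.eval_comp, Rep.eval_smul, Rep.eval_sum, Rep.eval_add, Rep.eval_id, eval_sideEF,
      eval_sideFE, eval_capEF_dots, eval_cupEF_dots, h.cupEF_eq, h.capEF_eq, h.sideEFR_eq,
      h.sideFER_eq, h.dotEpow_eq]
    refine (D.decomp_EF X i).trans (congrArg _ (congrArg _ (Finset.sum_congr rfl fun f _ =>
      Finset.sum_congr rfl fun g _ => ?_)))
    rw [← cup_xEpow, h.eval_fakeCcw X rfl i g (by have := f.2; have := g.2; omega)]
    rfl
  | decomp_FE i =>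
    simp only [Rep.eval_comp, Rep.eval_smul, Rep.eval_sum, Rep.eval_add, Rep.eval_id, eval_sideEF,
      eval_sideFE, eval_capFE_dots, eval_cupFE_dots, h.cupFE_eq, h.capFE_eq, h.sideEFR_eq,
      h.sideFER_eq, h.dotEpow_eq]
    refine (D.decomp_FE X i).trans (congrArg _ (congrArg _ (Finset.sum_congr rfl fun f _ =>
      Finset.sum_congr rfl fun g _ => ?_)))
    rw [← xEpow_cap, h.eval_fakeCw X i g (by have := f.2; have := g.2; omega)]
    rfl
  | cross_cross_same i =>
    simp only [Rep.eval_comp, Rep.eval_zero, eval_crossE, h.crossE_eq]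
    exact hE.cross_same i X
  | nil_right i =>
    simp only [Rep.eval_comp, Rep.eval_add, Rep.eval_smul, Rep.eval_id, eval_crossE, eval_dotE,
      h.crossE_eq, h.dotE_eq]
    refine (hE.nil_right i X).symm.trans ?_
    rw [neg_one_smul k, ← sub_eq_add_neg]
    rfl
  | nil_left i =>
    simp only [Rep.eval_comp, Rep.eval_add, Rep.eval_smul, Rep.eval_id, eval_crossE, eval_dotE,
      h.crossE_eq, h.dotE_eq]
    refine (hE.nil_left i X).symm.trans ?_
    rw [neg_one_smul k, ← sub_eq_add_neg]
    rfl
  | mixed_EF i j hij =>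
    simp only [Rep.eval_comp, Rep.eval_id, eval_sideEF, eval_sideFE, h.sideEFR_eq, h.sideFER_eq]
    rw [D.sideEF_eq X (.inl hij)]
    exact D.t_s j i X (.inl hij.symm)
  | mixed_FE i j hij =>
    simp only [Rep.eval_comp, Rep.eval_id, eval_sideEF, eval_sideFE, h.sideEFR_eq, h.sideFER_eq]
    rw [D.sideEF_eq X (.inl hij.symm)]
    exact D.s_t i j X (.inl hij)
  | cross_cross_distant i j hij =>
    simp only [Rep.eval_comp, Rep.eval_id, eval_crossE, h.crossE_eq]
    exact hE.cross_distant i j X hij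
  | cross_cross_adjacent i j hij =>
    simp only [Rep.eval_comp, Rep.eval_smul, Rep.eval_add, eval_crossE, eval_dotE, h.crossE_eq,
      h.dotE_eq]
    refine (hE.cross_adj i j X hij).trans ?_
    rw [neg_one_smul k, ← sub_eq_add_neg]
    rfl
  | slide_right i j hij =>
    simp only [Rep.eval_comp, eval_crossE, eval_dotE, h.crossE_eq, h.dotE_eq]
    exact hE.slide_right i j X hij
  | slide_left i j hij =>
    simp only [Rep.eval_comp, eval_crossE, eval_dotE, h.crossE_eq, h.dotE_eq]
    exact hE.slide_left i j X hij
  | braid i j l hij =>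
    simp only [braidL, braidR, Rep.eval_comp, eval_crossE, h.crossE_eq]
    exact hE.braid i j l X hij
  | serre i j hij =>
    simp only [braidL, braidR, Rep.eval_comp, Rep.eval_smul, Rep.eval_id, Rep.eval_add, eval_crossE,
      h.crossE_eq]
    refine (hE.serre i j X hij).symm.trans ?_
    rw [neg_one_smul k, ← sub_eq_add_neg]
    rfl
  | dot_dot i =>
    simp only [Rep.eval_comp, Rep.eval_zero, eval_dotF, h.dotF_eq]
    exact D.dot_dot i X

end MSV.Rep.IsModel

namespace MSV.Rep

open Signature SchurCat Downward

variable {n d : ℕ} {k : Type u} [CommRing k] {C : Type w} [Category.{v} C] [Preadditive C]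
  [Linear k C] {A : WeightAction n d k C}

/-! ### The graded 2-Schur algebra acts through `S(n,d)` -/

variable (R : Rep (sig n d) A)

/-- The adjunctions `F_i ⊣ E_i`, the downward dots and the downward crossings in a representation of
`S(n,d)`. -/
@[simps]
def downward (hR : R.Sat (Rel k d)) : Downward A where
  η := cupEF R
  ε := capFE R
  x := dotF R
  c := crossF R
  η_nat i _ _ f := cupEF_nat R i f
  ε_nat i _ _ f := capFE_nat R i f
  x_nat i _ _ f := dotF_nat R i f
  c_nat i j _ _ f := crossF_nat R i j f
  zigzag_F i X := by
    have h := hR.eq (Rel.zigzag_F (μ := A.wt X) i) X rfl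
    simp only [Rep.eval_comp, Rep.eval_id, eval_cupEF, eval_capFE] at h
    exact h
  zigzag_E i X := by
    have h := hR.eq (Rel.zigzag_E (μ := A.wt X) i) X rfl
    simp only [Rep.eval_comp, Rep.eval_id, eval_cupEF, eval_capFE] at h
    exact h

variable {R} (hR : R.Sat (Rel k d)) {i j : Fin (n - 1)} (X Y : C)

lemma crossE_eq (i j : Fin (n - 1)) : crossE R i j X = (downward R hR).cE i j X := by
  refine (downward R hR).cE_unique i j (crossE R i j) (fun f => crossE_nat R i j f) (fun X => ?_) X
  have h := hR.eq (Rel.cross_cyclic (μ := A.wt X) i j) X rfl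
  simp only [Rep.eval_comp, eval_crossF, eval_crossE, eval_cupEF, eval_capFE] at h
  exact h

lemma dotE_eq (i : Fin (n - 1)) : dotE R i X = (downward R hR).xE i X := by
  refine (downward R hR).hom_ext_E ?_
  have h := hR.eq (Rel.dot_cyclic (μ := A.wt ((A.E i).obj X)) i) ((A.E i).obj X) rfl
  simp only [Rep.eval_comp, eval_dotF, eval_dotE, eval_cupEF, eval_capFE] at h
  have h' : (downward R hR).x i ((A.E i).obj X) = (A.F i).map ((downward R hR).η i _) ≫
    (A.F i).map (dotE R i _) ≫ (downward R hR).ε i _ := h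
  have hn : (A.E i).map ((downward R hR).ε i X) ≫ dotE R i X =
    dotE R i _ ≫ (A.E i).map ((downward R hR).ε i X) := dotE_nat R i _
  rw [xE_counit, h', Category.assoc, Category.assoc, ← ε_nat, ← reassoc_of% map_sq _ hn,
    reassoc_of% map_tri _ ((downward R hR).zigzag_E i X)]
  simp

lemma eRel : (downward R hR).ERel where
  cross_same i X := by
    have h := hR.eq (Rel.cross_cross_same (μ := A.wt X) i) X rfl
    simp only [Rep.eval_comp, Rep.eval_zero, eval_crossE, crossE_eq hR] at h
    exact h
  cross_distant i j X hij := by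
    have h := hR.eq (Rel.cross_cross_distant (μ := A.wt X) i j hij) X rfl
    simp only [Rep.eval_comp, Rep.eval_id, eval_crossE, crossE_eq hR] at h
    exact h
  cross_adj i j X hij := by
    have h := hR.eq (Rel.cross_cross_adjacent (μ := A.wt X) i j hij) X rfl
    simp only [Rep.eval_comp, Rep.eval_smul, Rep.eval_add, eval_crossE, eval_dotE, crossE_eq hR,
      dotE_eq hR] at h
    rw [neg_one_smul k, ← sub_eq_add_neg] at h
    exact h
  slide_right i j X hij := by
    have h := hR.eq (Rel.slide_right (μ := A.wt X) i j hij) X rfl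
    simp only [Rep.eval_comp, eval_crossE, eval_dotE, crossE_eq hR, dotE_eq hR] at h
    exact h
  slide_left i j X hij := by
    have h := hR.eq (Rel.slide_left (μ := A.wt X) i j hij) X rfl
    simp only [Rep.eval_comp, eval_crossE, eval_dotE, crossE_eq hR, dotE_eq hR] at h
    exact h
  nil_right i X := by
    have h := hR.eq (Rel.nil_right (μ := A.wt X) i) X rfl
    simp only [Rep.eval_comp, Rep.eval_add, Rep.eval_smul, Rep.eval_id, eval_crossE, eval_dotE,
      crossE_eq hR, dotE_eq hR] at h
    rw [neg_one_smul k, ← sub_eq_add_neg] at h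
    exact h.symm
  nil_left i X := by
    have h := hR.eq (Rel.nil_left (μ := A.wt X) i) X rfl
    simp only [Rep.eval_comp, Rep.eval_add, Rep.eval_smul, Rep.eval_id, eval_crossE, eval_dotE,
      crossE_eq hR, dotE_eq hR] at h
    rw [neg_one_smul k, ← sub_eq_add_neg] at h
    exact h.symm
  braid i j l X hij := by
    have h := hR.eq (Rel.braid (μ := A.wt X) i j l hij) X rfl
    simp only [braidL, braidR, Rep.eval_comp, eval_crossE, crossE_eq hR] at h
    exact h
  serre i j X hij := by
    have h := hR.eq (Rel.serre (μ := A.wt X) i j hij) X rfl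
    simp only [braidL, braidR, Rep.eval_comp, Rep.eval_smul, Rep.eval_id, Rep.eval_add, eval_crossE,
      crossE_eq hR] at h
    rw [neg_one_smul k, ← sub_eq_add_neg] at h
    exact h.symm

lemma dot_dot (i : Fin (n - 1)) (X : C) :
    (downward R hR).x i X ≫ (downward R hR).x i X = 0 := by
  have h := hR.eq (Rel.dot_dot (μ := A.wt X) i) X rfl
  simp only [Rep.eval_comp, Rep.eval_zero, eval_dotF] at h
  exact h

lemma dotEpow_eq (i : Fin (n - 1)) (m : ℕ) : dotEpow R i X m = (downward R hR).xEpow i X m := by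
  induction m with
  | zero => rfl
  | succ m ih => rw [dotEpow, ih, dotE_eq hR]; rfl

lemma sideFER_eq (i j : Fin (n - 1)) : sideFER R i j X = (downward R hR).s i j X := by
  rw [sideFER, crossE_eq hR]
  exact (downward R hR).rotate_cE X i j

lemma cwR_eq (i : Fin (n - 1)) (m : ℕ) :
    cwR R X i m = (downward R hR).cupD i m X ≫ capEF R i X := by
  rw [cwR, dotEpow_eq hR, ← cup_xEpow, Category.assoc]
  rfl

lemma ccwR_eq (i : Fin (n - 1)) (m : ℕ) :
    ccwR R X i m = cupFE R i X ≫ (downward R hR).capD i m X := by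
  rw [ccwR, dotEpow_eq hR, ← xEpow_cap]
  rfl

/-- Bubbles of negative degree vanish. -/
lemma cwR_neg (hR : R.Sat (Rel k d)) (X : C) {i : Fin (n - 1)} (m : ℕ)
    (h : (m : ℤ) < bar (A.wt X) i - 1) : cwR R X i m = 0 := by
  rw [← eval_cw R X rfl]
  exact hR.eq (Rel.cw_neg (μ := A.wt X) i m h) X rfl

lemma ccwR_neg (hR : R.Sat (Rel k d)) (X : C) {i : Fin (n - 1)} (m : ℕ)
    (h : (m : ℤ) < -bar (A.wt X) i - 1) : ccwR R X i m = 0 := by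
  rw [← eval_ccw R X rfl]
  exact hR.eq (Rel.ccw_neg (μ := A.wt X) i m h) X rfl

lemma cwR_zero (hR : R.Sat (Rel k d)) (X : C) {i : Fin (n - 1)} (m : ℕ)
    (h : (m : ℤ) = bar (A.wt X) i - 1) :
    cwR R X i m = cwSign k (A.wt X) i • 𝟙 X := by
  rw [← eval_cw R X rfl]
  exact hR.eq (Rel.cw_zero (μ := A.wt X) i m h) X rfl

lemma ccwR_zero (hR : R.Sat (Rel k d)) (X : C) {i : Fin (n - 1)} (m : ℕ)
    (h : (m : ℤ) = -bar (A.wt X) i - 1) :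
    ccwR R X i m = ccwSign k (A.wt X) i • 𝟙 X := by
  rw [← eval_ccw R X rfl]
  exact hR.eq (Rel.ccw_zero (μ := A.wt X) i m h) X rfl

/-- A bubble with two dots vanishes. -/
lemma cwR_large (hR : R.Sat (Rel k d)) (X : C) {i : Fin (n - 1)} (m : ℕ)
    (h : 2 ≤ m) : cwR R X i m = 0 := by
  rw [cwR, dotEpow_eq hR, Downward.xEpow_eq_zero _ (dot_dot hR) h, Limits.zero_comp,
    Limits.comp_zero]

lemma ccwR_large (hR : R.Sat (Rel k d)) (X : C) {i : Fin (n - 1)} (m : ℕ)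
    (h : 2 ≤ m) : ccwR R X i m = 0 := by
  rw [ccwR, dotEpow_eq hR, Downward.xEpow_eq_zero _ (dot_dot hR) h, Functor.map_zero,
    Limits.zero_comp, Limits.comp_zero]

/-- The fake clockwise bubble of degree `2r`, as an endomorphism of the object of the region. -/
def fakeCwR (R : Rep (sig n d) A) (X : C) {μ : Fin n → ℤ} (hX : A.wt X = μ) (i : Fin (n - 1))
    (r : ℕ) : X ⟶ X :=
  R.eval (fakeCw k d i r) X hX

/-- The fake counterclockwise bubble of degree `2r`, as an endomorphism of the object of the
region. -/
def fakeCcwR (R : Rep (sig n d) A) (X : C) {μ : Fin n → ℤ} (hX : A.wt X = μ) (i : Fin (n - 1))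
    (r : ℕ) : X ⟶ X :=
  R.eval (fakeCcw k d i r) X hX

lemma fakeCwR_zero {μ : Fin n → ℤ} (hX : A.wt X = μ) (i : Fin (n - 1)) :
    fakeCwR R X hX i 0 = cwSign k μ i • 𝟙 X :=
  eval_fakeCw_zero R X hX i

lemma fakeCcwR_zero {μ : Fin n → ℤ} (hX : A.wt X = μ) (i : Fin (n - 1)) :
    fakeCcwR R X hX i 0 = ccwSign k μ i • 𝟙 X :=
  eval_fakeCcw_zero R X hX i

lemma fakeCwR_one {μ : Fin n → ℤ} (hX : A.wt X = μ) (i : Fin (n - 1)) :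
    fakeCwR R X hX i 1 = ccwR R X i (-bar μ i).toNat :=
  eval_fakeCw_one R X hX i

lemma fakeCcwR_one {μ : Fin n → ℤ} (hX : A.wt X = μ) (i : Fin (n - 1)) :
    fakeCcwR R X hX i 1 = cwR R X i (bar μ i).toNat :=
  eval_fakeCcw_one R X hX i

lemma decomp_EF (i : Fin (n - 1)) : 𝟙 ((A.E i).obj ((A.F i).obj X)) =
    sideEFR R i i X ≫ (downward R hR).s i i X + (-1 : k) •
      ∑ f : Fin (bar (A.wt X) i).toNat, ∑ g : Fin (f + 1),
        (dotEpow R i _ (bar (A.wt X) i - 1 - f).toNat ≫ capEF R i X) ≫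
          fakeCcwR R X rfl i g ≫ (downward R hR).cupD i (f - g) X := by
  have h := hR.eq (Rel.decomp_EF (μ := A.wt X) i) X rfl
  simp only [Rep.eval_comp, Rep.eval_smul, Rep.eval_sum, Rep.eval_add, Rep.eval_id, eval_sideEF,
    eval_sideFE, eval_capEF_dots, eval_cupEF_dots, sideFER_eq hR] at h
  refine h.trans (congrArg _ (congrArg _ (Finset.sum_congr rfl fun f _ =>
      Finset.sum_congr rfl fun g _ => ?_)))
  rw [← cup_xEpow, dotEpow_eq hR _ i (f - g)]
  rfl

lemma decomp_FE (i : Fin (n - 1)) : 𝟙 ((A.F i).obj ((A.E i).obj X)) =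
    (downward R hR).s i i X ≫ sideEFR R i i X + (-1 : k) •
      ∑ f : Fin (-bar (A.wt X) i).toNat, ∑ g : Fin (f + 1),
        (downward R hR).capD i (-bar (A.wt X) i - 1 - f).toNat X ≫
          fakeCwR R X rfl i g ≫ cupFE R i X ≫ (A.F i).map (dotEpow R i X (f - g)) := by
  have h := hR.eq (Rel.decomp_FE (μ := A.wt X) i) X rfl
  simp only [Rep.eval_comp, Rep.eval_smul, Rep.eval_sum, Rep.eval_add, Rep.eval_id, eval_sideEF,
    eval_sideFE, eval_capFE_dots, eval_cupFE_dots, sideFER_eq hR] at h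
  refine h.trans (congrArg _ (congrArg _ (Finset.sum_congr rfl fun f _ =>
      Finset.sum_congr rfl fun g _ => ?_)))
  rw [← xEpow_cap, dotEpow_eq hR _ i (-bar (A.wt X) i - 1 - _).toNat]
  rfl

lemma s_sideEFR (h : i ≠ j ∨ bar (A.wt X) i = 0) :
    (downward R hR).s i j X ≫ sideEFR R j i X = 𝟙 _ := by
  by_cases e : i = j
  · subst e
    have h0 := h.resolve_left (absurd rfl)
    have h1 := decomp_FE hR X i
    have : IsEmpty (Fin (-bar (A.wt X) i).toNat) := by rw [h0]; exact Fin.isEmpty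
    rw [Finset.univ_eq_empty, Finset.sum_empty, smul_zero, add_zero] at h1
    exact h1.symm
  · have h1 := hR.eq (Rel.mixed_FE (μ := A.wt X) i j e) X rfl
    simp only [Rep.eval_comp, Rep.eval_id, eval_sideEF, eval_sideFE, sideFER_eq hR] at h1
    exact h1

lemma sideEFR_s (h : i ≠ j ∨ bar (A.wt X) i = 0) :
    sideEFR R j i X ≫ (downward R hR).s i j X = 𝟙 _ := by
  by_cases e : i = j
  · subst e
    have h0 := h.resolve_left (absurd rfl)
    have h1 := decomp_EF hR X i
    have : IsEmpty (Fin (bar (A.wt X) i).toNat) := by rw [h0]; exact Fin.isEmpty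
    rw [Finset.univ_eq_empty, Finset.sum_empty, smul_zero, add_zero] at h1
    exact h1.symm
  · have h1 := hR.eq (Rel.mixed_EF (μ := A.wt X) j i (Ne.symm e)) X rfl
    simp only [Rep.eval_comp, Rep.eval_id, eval_sideEF, eval_sideFE, sideFER_eq hR] at h1
    exact h1

/-- The decomposition of `E_i F_i` for `μ̄_i > 0`, where `F_i E_i` vanishes. -/
lemma p_cup (h : 0 < bar (A.wt X) i) : ∑ m : Fin (bar (A.wt X) i).toNat,
    (cwSign k (A.wt X) i • (dotEpow R i _ (bar (A.wt X) i - 1 - m).toNat ≫ capEF R i X)) ≫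
      (downward R hR).cupD i m X = 𝟙 _ := by
  by_cases hw : IsWeight n d (A.wt X)
  swap
  · exact A.eq_of_bad_map_source (A.F i ⋙ A.E i) hw _ _
  have hz : (downward R hR).s i i X = 0 := A.eq_of_bad_map_source (A.F i) (bad_E h) _ _
  have hd := decomp_EF hR X i
  rw [hz, Limits.comp_zero, zero_add] at hd
  have h0 := fakeCcwR_zero (R := R) X rfl i
  rw [hd]
  have hcases : bar (A.wt X) i = 1 ∨ bar (A.wt X) i = 2 := by
    have := hw.bar_cases i
    omega
  rcases hcases with hb | hb
  · have h2 : (bar (A.wt X) i).toNat = 1 := by omega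
    rw [sum_fin_one h2 (fun m => (cwSign k (A.wt X) i •
        (dotEpow R i _ (bar (A.wt X) i - 1 - m).toNat ≫ capEF R i X)) ≫
      (downward R hR).cupD i m X),
      sum_triangle_one h2 (fun f g => (dotEpow R i _ (bar (A.wt X) i - 1 - f).toNat ≫
        capEF R i X) ≫ fakeCcwR R X rfl i g ≫ (downward R hR).cupD i (f - g) X), h0]
    simp [ccwSign_eq]
  · have h2 : (bar (A.wt X) i).toNat = 2 := by omega
    have h1 : fakeCcwR R X rfl i 1 = 0 := by
      rw [fakeCcwR_one, cwR_large hR X _ (by omega)]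
    rw [sum_fin_two h2 (fun m => (cwSign k (A.wt X) i •
        (dotEpow R i _ (bar (A.wt X) i - 1 - m).toNat ≫ capEF R i X)) ≫
      (downward R hR).cupD i m X),
      sum_triangle_two h2 (fun f g => (dotEpow R i _ (bar (A.wt X) i - 1 - f).toNat ≫
        capEF R i X) ≫ fakeCcwR R X rfl i g ≫ (downward R hR).cupD i (f - g) X), h0, h1]
    simp [ccwSign_eq, add_comm]

/-- The decomposition of `F_i E_i` for `μ̄_i < 0`, where `E_i F_i` vanishes. -/
lemma cap_q (h : bar (A.wt X) i < 0) : ∑ m : Fin (-bar (A.wt X) i).toNat,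
    (downward R hR).capD i m X ≫ (ccwSign k (A.wt X) i •
      (cupFE R i X ≫ (A.F i).map (dotEpow R i X (-bar (A.wt X) i - 1 - m).toNat))) = 𝟙 _ := by
  by_cases hw : IsWeight n d (A.wt X)
  swap
  · exact A.eq_of_bad_map_source (A.E i ⋙ A.F i) hw _ _
  have hz : (downward R hR).s i i X = 0 := A.eq_of_bad_map_target (A.E i) (bad_F h) _ _
  have hd := decomp_FE hR X i
  rw [hz, Limits.zero_comp, zero_add] at hd
  have h0 := fakeCwR_zero (R := R) X rfl i
  rw [hd]
  have hcases : bar (A.wt X) i = -1 ∨ bar (A.wt X) i = -2 := by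
    have := hw.bar_cases i
    omega
  rcases hcases with hb | hb
  · have h2 : (-bar (A.wt X) i).toNat = 1 := by omega
    rw [sum_fin_one h2 (fun m => (downward R hR).capD i m X ≫ (ccwSign k (A.wt X) i •
      (cupFE R i X ≫ (A.F i).map (dotEpow R i X (-bar (A.wt X) i - 1 - m).toNat)))),
      sum_triangle_one h2 (fun f g => (downward R hR).capD i (-bar (A.wt X) i - 1 - f).toNat X ≫
          fakeCwR R X rfl i g ≫ cupFE R i X ≫ (A.F i).map (dotEpow R i X (f - g))), h0]
    simp [ccwSign_eq, hb, dotEpow]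
  · have h2 : (-bar (A.wt X) i).toNat = 2 := by omega
    have h1 : fakeCwR R X rfl i 1 = 0 := by
      rw [fakeCwR_one, ccwR_large hR X _ (by omega)]
    rw [sum_fin_two h2 (fun m => (downward R hR).capD i m X ≫ (ccwSign k (A.wt X) i •
      (cupFE R i X ≫ (A.F i).map (dotEpow R i X (-bar (A.wt X) i - 1 - m).toNat)))),
      sum_triangle_two h2 (fun f g => (downward R hR).capD i (-bar (A.wt X) i - 1 - f).toNat X ≫
          fakeCwR R X rfl i g ≫ cupFE R i X ≫ (A.F i).map (dotEpow R i X (f - g))),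
      h0, h1]
    simp [ccwSign_eq, hb, dotEpow, add_comm]

/-- Naturality of a family of diagrams, one for each weight of the rightmost region. -/
lemma eval_nat_of_wt {s t : List (Letter n)} (f : ∀ μ, Diag k n d μ s t) {X Y : C}
    (φ : X ⟶ Y) : A.map s φ ≫ R.eval (f _) Y rfl = R.eval (f _) X rfl ≫ A.map t φ := by
  by_cases h : A.wt X = A.wt Y
  · have h1 := R.eval_nat (S := sig n d) (f _) φ rfl h.symm
    rw [h1]
    congr 1
    have key : ∀ (μ : Fin n → ℤ) (hμ : A.wt Y = μ),
        R.eval (f _) Y rfl = R.eval (f μ) Y hμ := by rintro _ rfl; rfl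
    exact key _ _
  · rw [A.hom_eq_zero φ h, A.map_zero, A.map_zero]
    simp

/-- The 2-morphisms of the graded 2-Schur algebra at `X = Y = Z = 1` in a representation of
`S(n,d)`. The inverses required for the dotted cups and caps are obtained by sliding the remaining
dots to the second caps and cups. -/
@[simps! toDownward]
def schurData : SchurData A where
  toDownward := downward R hR
  t i j X := sideEFR R j i X
  p i m X := cwSign k (A.wt X) i •
    (dotEpow R i _ (bar (A.wt X) i - 1 - m).toNat ≫ capEF R i X)
  q i m X := ccwSign k (A.wt X) i •
    (cupFE R i X ≫ (A.F i).map (dotEpow R i X (-bar (A.wt X) i - 1 - m).toNat))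
  t_nat i j X Y f := by
    rw [← eval_sideEF R X rfl, ← eval_sideEF R Y rfl]
    exact eval_nat_of_wt (fun _ => sideEF k d j i) f
  p_nat i m X Y f := by
    rw [← eval_capEF_dots R X rfl, ← eval_capEF_dots R Y rfl]
    exact eval_nat_of_wt (fun μ => .smul (cwSign k μ i) (MSV.capEF k d i (bar μ i - 1 - m).toNat)) f
  q_nat i m X Y f := by
    rw [← eval_cupFE_dots R X rfl, ← eval_cupFE_dots R Y rfl]
    exact eval_nat_of_wt (R := R)
      (fun μ => .smul (ccwSign k μ i) (MSV.cupFE k d i (-bar μ i - 1 - m).toNat)) f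
  fRel := (eRel hR).fRel
  dot_dot := dot_dot hR
  s_t i j X h := s_sideEFR hR X h
  t_s i j X h := sideEFR_s hR X h
  cup_p i X m m' hm hm' := by
    have h : (downward R hR).cupD i m X ≫ dotEpow R i _ (bar (A.wt X) i - 1 - m').toNat ≫
        capEF R i X = cwR R X i (m + (bar (A.wt X) i - 1 - m').toNat) := by
      rw [cwR_eq hR, ← cup_xEpow, ← cup_xEpow, ← xEpow_add, dotEpow_eq hR]
      simp only [Category.assoc]
    rw [Linear.comp_smul, h]
    -- If `m ≠ m'`, the bubble has negative degree or at least two dots.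
    split_ifs with e
    · rw [cwR_zero hR X _ (by omega), smul_smul, cwSign_mul_self, one_smul]
    · rcases lt_or_gt_of_ne e with h' | h'
      · rw [cwR_neg hR X _ (by omega), smul_zero]
      · rw [cwR_large hR X _ (by omega), smul_zero]
  q_cap i X m m' hm hm' := by
    have h : (cupFE R i X ≫ (A.F i).map (dotEpow R i X (-bar (A.wt X) i - 1 - m).toNat)) ≫
        (downward R hR).capD i m' X = ccwR R X i ((-bar (A.wt X) i - 1 - m).toNat + m') := by
      rw [ccwR_eq hR, ← xEpow_cap, ← xEpow_cap, ← xEpow_add, dotEpow_eq hR]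
      simp only [Category.assoc, Functor.map_comp]
    rw [Linear.smul_comp, h]
    split_ifs with e
    · rw [ccwR_zero hR X _ (by omega), smul_smul, ccwSign_mul_self, one_smul]
    · rcases lt_or_gt_of_ne e with h' | h'
      · rw [ccwR_large hR X _ (by omega), smul_zero]
      · rw [ccwR_neg hR X _ (by omega), smul_zero]
  p_cup i X h := p_cup hR X h
  cap_q i X h := cap_q hR X h

/-- The right curl at `μ̄_i = 0` determines the second cap. -/
lemma s_capEF (h : bar (A.wt X) i = 0) : (downward R hR).s i i X ≫ capEF R i X = capFE R i X := by
  refine (downward R hR).hom_ext_F ?_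
  by_cases hE : IsWeight n d (A.wt ((A.E i).obj X))
  swap
  · exact A.eq_of_bad_source hE _ _
  have hs : cwSign k (A.wt X) i = -1 := by
    have h1 := hE.1 (lo i)
    have h2 := hE.1 (hi i)
    rw [wt_E, Pi.add_apply] at h1 h2
    rw [root_lo] at h1
    rw [root_hi] at h2
    unfold bar at h
    have : A.wt X (hi i) = 1 := by omega
    exact cwSign_of_odd k (by rw [this]; exact odd_one)
  have h1 := hR.eq (Rel.curl_right (μ := A.wt X) i) X rfl
  simp only [Rep.eval_comp, Rep.eval_smul, Rep.eval_sum, eval_dotsE, within, eval_between,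
    eval_cupEF, eval_crossE, eval_capEF, crossE_eq hR] at h1
  have h2 : (-bar (A.wt X) i + 1).toNat = 1 := by omega
  have h3 : (A.E i).map ((downward R hR).η i X) ≫ (downward R hR).cE i i ((A.F i).obj X) ≫
      (A.E i).map (capEF R i X) = (-1 : k) • ∑ f : Fin (-bar (A.wt X) i + 1).toNat,
        (A.E i).map (fakeCwR R X rfl i f) ≫
          dotEpow R i X (-bar (A.wt X) i - f).toNat := h1
  rw [sum_fin_one h2 (fun f => (A.E i).map (fakeCwR R X rfl i f) ≫
          dotEpow R i X (-bar (A.wt X) i - f).toNat), fakeCwR_zero, reassoc_of% cE_unit,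
    ← Functor.map_comp] at h3
  rw [h3]
  refine Eq.trans ?_ ((downward R hR).zigzag_E i X).symm
  simp [hs, h, dotEpow]

/-- The left curl at `μ̄_i = 0` determines the second cup. -/
lemma cupFE_s (h : bar (A.wt X) i = 0) : cupFE R i X ≫ (downward R hR).s i i X = cupEF R i X := by
  by_cases hF : IsWeight n d (A.wt ((A.F i).obj X))
  swap
  · exact A.eq_of_bad_map_target (A.E i) hF _ _
  have hw : (A.wt ((A.F i).obj X)) + root i = A.wt X := by rw [wt_F, sub_add_cancel]
  have hw' : A.wt ((A.E i).obj ((A.F i).obj X)) = A.wt X := by rw [wt_E, hw]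
  have h1 := hR.eq (Rel.curl_left (μ := A.wt ((A.F i).obj X)) i) ((A.F i).obj X) rfl
  simp only [Rep.eval_comp, Rep.eval_sum, eval_dotsE, within, eval_between, eval_cupFE, eval_crossE,
    eval_capFE, crossE_eq hR] at h1
  have h2 : (bar (A.wt ((A.F i).obj X) + root i) i + 1).toNat = 1 := by rw [hw, h]; rfl
  have h3 : cupFE R i _ ≫ (A.F i).map ((downward R hR).cE i i _) ≫ (downward R hR).ε i _ =
      ∑ f : Fin (bar (A.wt ((A.F i).obj X) + root i) i + 1).toNat,
        fakeCcwR R ((A.E i).obj ((A.F i).obj X)) (wt_E _ _) i f ≫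
          dotEpow R i _ (bar (A.wt ((A.F i).obj X) + root i) i - f).toNat := h1
  rw [sum_fin_one h2 (fun f => fakeCcwR R ((A.E i).obj ((A.F i).obj X))
      (wt_E _ _) i f ≫ dotEpow R i _ (bar (A.wt ((A.F i).obj X) + root i) i - f).toNat),
    fakeCcwR_zero, cE_counit, hw, h, ccwSign_eq, odd_of_bar_eq_zero h hF] at h3
  have h4 : cupEF R i X ≫ cupFE R i ((A.E i).obj ((A.F i).obj X)) =
      cupFE R i X ≫ (A.F i).map ((A.E i).map ((downward R hR).η i X)) := cupFE_nat R i _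
  have h5 := congrArg (cupEF R i X ≫ ·) h3
  rw [reassoc_of% h4, reassoc_of% s_nat, map_tri _ ((downward R hR).zigzag_F i X)] at h5
  simpa [dotEpow] using h5

/-- The upward generators and the second cups and caps of a representation of `S(n,d)` are those
constructed from its `SchurData`. -/
lemma isModel : IsModel R (schurData hR) where
  cupEF_eq _ _ := rfl
  capFE_eq _ _ := rfl
  dotF_eq _ _ := rfl
  crossF_eq _ _ _ := rfl
  dotE_eq i X := dotE_eq hR X i
  crossE_eq i j X := crossE_eq hR X i j
  capEF_eq i X := by
    rcases lt_trichotomy (bar (A.wt X) i) 0 with h | h | h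
    · exact A.eq_of_bad_map_source (A.E i) (bad_F h) _ _
    · rw [SchurData.ε'_of_nonpos _ h.le]
      refine Eq.trans ?_ (congrArg (sideEFR R i i X ≫ ·) (s_capEF hR X h))
      change _ = sideEFR R i i X ≫ _ ≫ _
      rw [← Category.assoc, sideEFR_s hR X (.inr h), Category.id_comp]
    · rw [SchurData.ε'_of_pos _ h]
      change _ = cwSign k (A.wt X) i • cwSign k (A.wt X) i • (dotEpow R i _
        (bar (A.wt X) i - 1 - (bar (A.wt X) i - 1).toNat).toNat ≫ capEF R i X)
      rw [smul_smul, cwSign_mul_self, one_smul,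
        show (bar (A.wt X) i - 1 - (bar (A.wt X) i - 1).toNat).toNat = 0 by omega]
      exact (Category.id_comp _).symm
  cupFE_eq i X := by
    rcases lt_trichotomy (bar (A.wt X) i) 0 with h | h | h
    · rw [SchurData.η'_of_neg _ h]
      change _ = ccwSign k (A.wt X) i • ccwSign k (A.wt X) i • (cupFE R i X ≫
        (A.F i).map (dotEpow R i X (-bar (A.wt X) i - 1 - (-bar (A.wt X) i - 1).toNat).toNat))
      rw [smul_smul, ccwSign_mul_self, one_smul,
        show (-bar (A.wt X) i - 1 - (-bar (A.wt X) i - 1).toNat).toNat = 0 by omega]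
      simp [dotEpow]
    · rw [SchurData.η'_of_nonneg _ h.ge]
      refine Eq.trans ?_ (congrArg (· ≫ sideEFR R i i X) (cupFE_s hR X h))
      change _ = (_ ≫ _) ≫ _
      rw [Category.assoc, s_sideEFR hR X (.inr h), Category.comp_id]
    · exact A.eq_of_bad_map_target (A.F i) (bad_E h) _ _

end MSV.Rep

namespace SchurCat.SpecRep

open Signature Downward

variable {n d : ℕ} {k : Type u} [CommRing k] {C : Type w} [Category.{v} C] [Preadditive C]
  [Linear k C] {A : WeightAction n d k C}

/-! ### Representations of the graded 2-Schur algebra determined by their basic data -/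

/-- The generators of a representation of the graded 2-Schur algebra at `X = Y = Z = 1` are those
determined by `D`. -/
structure IsModel (R : Rep (sig n d) A) (D : SchurData A) : Prop
    extends IsDownward R D.toDownward where
  invSide_eq i j X : invSide R i j X = sgn k i j • D.t i j X
  invCup_eq i (m : ℕ) X (h : m < (bar (A.wt X) i).toNat) : invCup R i m X = D.p i m X
  invCap_eq i (m : ℕ) X (h : m < (-bar (A.wt X) i).toNat) : invCap R i m X = D.q i m X

variable {R R' : Rep (sig n d) A} {D : SchurData A}

lemma isModel (hR : R.Sat (SpecRel k n d)) : IsModel R (schurData hR) where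
  toIsDownward := isDownward hR
  invSide_eq i j X := by
    change _ = sgn k i j • sgn k i j • invSide R i j X
    rw [smul_smul, sgn_mul_self, one_smul]
  invCup_eq _ _ _ _ := rfl
  invCap_eq _ _ _ _ := rfl

namespace IsModel

/-- A representation is determined by its `SchurData`. -/
lemma gen_eq (h : IsModel R D) (h' : IsModel R' D) {ν : Fin n → ℤ} {s t : List (Letter n)}
    (g : Gen ν s t) (X : C) (hX : A.wt X = ν) : R.gen g X hX = R'.gen g X hX := by
  subst hX
  cases g with
  | cup i => exact (h.cup_eq i X).trans (h'.cup_eq i X).symm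
  | cap i => exact (h.cap_eq i X).trans (h'.cap_eq i X).symm
  | dot i => exact (h.dot_eq i X).trans (h'.dot_eq i X).symm
  | cross i j => exact (h.cross_eq i j X).trans (h'.cross_eq i j X).symm
  | invSide i j => exact (h.invSide_eq i j X).trans (h'.invSide_eq i j X).symm
  | invCup i m =>
    rw [gen_invCup, gen_invCup, h.invCup_eq i m X m.2, h'.invCup_eq i m X m.2]
  | invCap i m =>
    rw [gen_invCap, gen_invCap, h.invCap_eq i m X m.2, h'.invCap_eq i m X m.2]

lemma eval_invCup (h : IsModel R D) (X : C) (i : Fin (n - 1)) (m : Fin (bar (A.wt X) i).toNat) :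
    R.eval (.gen (S := sig n d) [] [] rfl (Gen.invCup (μ := A.wt X) i m) rfl rfl) X rfl =
      D.p i m X :=
  (gen_invCup R X rfl i m).trans (h.invCup_eq i m X m.2)

lemma eval_invCap (h : IsModel R D) (X : C) (i : Fin (n - 1)) (m : Fin (-bar (A.wt X) i).toNat) :
    R.eval (.gen (S := sig n d) [] [] rfl (Gen.invCap (μ := A.wt X) i m) rfl rfl) X rfl =
      D.q i m X :=
  (gen_invCap R X rfl i m).trans (h.invCap_eq i m X m.2)

/-- A representation given by `SchurData` satisfies the relations of the graded 2-Schur algebra at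
`X = Y = Z = 1`. -/
theorem sat (h : IsModel R D) : R.Sat (SpecRel k n d) := by
  refine ⟨fun {μ s t f g} hrel X hX => ?_⟩
  obtain ⟨f, g, hrel, rfl, rfl⟩ := hrel
  have hF := D.fRel
  have hD := h.toIsDownward
  subst hX
  cases hrel with
  | dot_dot i =>
    rw [eval_dots X rfl hD]
    simp only [Downward.xpow, Category.id_comp, Term.mapCoeff, Rep.eval_zero]
    exact D.dot_dot i X
  | cross_cross_same i =>
    simp only [Term.mapCoeff, Rep.eval_comp, Rep.eval_zero, eval_cross, h.cross_eq]
    have key : (sgn k i i • D.c i i X) ≫ (sgn k i i • D.c i i X) = 0 := by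
      rw [Linear.smul_comp, Linear.comp_smul, hF.cross_same, smul_zero, smul_zero]
    exact key
  | cross_cross_distant i j hij =>
    simp only [Term.mapCoeff, Rep.eval_comp, Rep.eval_id, eval_cross, h.cross_eq, sgn_of_ne hij.1,
      sgn_of_ne hij.1.symm, one_smul]
    exact hF.cross_distant i j X hij
  | cross_cross_succ i j hij =>
    have hij' : Adjacent i j := .inl hij
    simp only [Term.mapCoeff, Rep.eval_comp, Rep.eval_add, Rep.eval_smul, eval_cross, eval_dot,
      specHom_coe, map_mul, map_neg, specUnit_uX, specUnit_uY, specUnit_uZ, mul_one, Units.val_one,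
      h.cross_eq, h.dot_eq, sgn_of_ne hij'.ne, sgn_of_ne hij'.ne.symm]
    simp only [one_smul k]
    refine (hF.cross_adj i j X hij').trans ?_
    have hd : Downward.diff k i j = -1 := by
      have : (j : ℕ) = i + 1 := hij
      simp [Downward.diff, this]
    rw [hd, smul_sub, sub_eq_add_neg, neg_smul (1 : k) ((A.F i).map _), one_smul, neg_neg]
    rfl
  | cross_cross_pred i j hij =>
    have hij' : Adjacent i j := .inr hij
    simp only [Term.mapCoeff, Rep.eval_comp, Rep.eval_add, Rep.eval_smul, eval_cross, eval_dot,
      specHom_coe, map_mul, map_neg, map_pow, one_pow, specUnit_uY, specUnit_uZ, mul_one,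
      Units.val_one, h.cross_eq, h.dot_eq, sgn_of_ne hij'.ne, sgn_of_ne hij'.ne.symm]
    simp only [one_smul k]
    refine (hF.cross_adj i j X hij').trans ?_
    have hd : Downward.diff k i j = 1 := by
      have : (i : ℕ) = j + 1 := hij
      simp [Downward.diff, this]
    rw [hd, one_smul, sub_eq_add_neg, ← neg_one_smul k]
    rfl
  | slide_right i j hij =>
    simp only [Term.mapCoeff, Rep.eval_comp, Rep.eval_smul, eval_cross, eval_dot, specHom_coe,
      specUnit_bil, Units.val_one, one_smul, h.cross_eq, h.dot_eq, sgn_of_ne hij]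
    exact hF.slide_right i j X hij
  | slide_left i j hij =>
    simp only [Term.mapCoeff, Rep.eval_comp, Rep.eval_smul, eval_cross, eval_dot, specHom_coe,
      specUnit_bil, Units.val_one, one_smul, h.cross_eq, h.dot_eq, sgn_of_ne hij]
    exact hF.slide_left i j X hij
  | nil_right i =>
    simp only [Term.mapCoeff, Rep.eval_comp, Rep.eval_add, Rep.eval_smul, Rep.eval_id, eval_cross,
      eval_dot, specHom_coe, map_mul, map_neg, specUnit_uX, specUnit_uY, mul_one, Units.val_one,
      h.cross_eq, h.dot_eq, sgn_same]
    have key : ((-1 : k) • D.c i i X) ≫ D.x i ((A.F i).obj X) +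
        (-1 : k) • ((A.F i).map (D.x i X) ≫ ((-1 : k) • D.c i i X)) = 𝟙 _ := by
      rw [← hF.nil_right i X, Linear.smul_comp, Linear.comp_smul, smul_smul, neg_mul_neg, one_mul,
        one_smul, neg_one_smul, neg_add_eq_sub]
    exact key
  | nil_left i =>
    simp only [Term.mapCoeff, Rep.eval_comp, Rep.eval_add, Rep.eval_smul, Rep.eval_id, eval_cross,
      eval_dot, specHom_coe, map_mul, map_neg, specUnit_uX, specUnit_uY, mul_one, Units.val_one,
      h.cross_eq, h.dot_eq, sgn_same]
    have key : D.x i ((A.F i).obj X) ≫ ((-1 : k) • D.c i i X) +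
        (-1 : k) • (((-1 : k) • D.c i i X) ≫ (A.F i).map (D.x i X)) = 𝟙 _ := by
      rw [← hF.nil_left i X, Linear.smul_comp, Linear.comp_smul, smul_smul, neg_mul_neg, one_mul,
        one_smul, neg_one_smul, neg_add_eq_sub]
    exact key
  | braid i j l hij =>
    simp only [braidL, braidR, Term.mapCoeff, Rep.eval_comp, Rep.eval_smul, eval_cross, specHom_coe,
      map_mul, mul_one, specUnit_bil, Units.val_one, one_smul, h.cross_eq]
    have key := hF.braid i j l X hij
    change (sgn k i j • D.c i j _) ≫ (A.F j).map (sgn k i l • D.c i l X) ≫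
      (sgn k j l • D.c j l _) = (A.F i).map (sgn k j l • D.c j l X) ≫
        (sgn k i l • D.c i l _) ≫ (A.F l).map (sgn k i j • D.c i j X)
    simp only [Linear.smul_comp, Linear.comp_smul, Functor.map_smul, smul_smul, key]
    congr 1
    ring
  | serre_succ i j hij =>
    have hij' : Adjacent i j := .inl hij
    simp only [braidL, braidR, Term.mapCoeff, Rep.eval_comp, Rep.eval_id, Rep.eval_add,
      Rep.eval_smul, eval_cross, specHom_coe, map_mul, map_neg, map_zpow, one_zpow, specUnit_uY,
      specUnit_uZ, mul_one, Units.val_one, h.cross_eq, sgn_same, sgn_of_ne hij'.ne,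
      sgn_of_ne hij'.ne.symm]
    have hd : Downward.diff k i j = -1 := by
      have : (j : ℕ) = i + 1 := hij
      simp [Downward.diff, this]
    have key := hF.serre i j X hij'
    rw [hd, neg_one_smul, ← neg_inj, neg_neg, neg_sub] at key
    refine Eq.trans ?_ key
    change (-1 : k) • (((1 : k) • D.c i j _) ≫ (A.F j).map ((-1 : k) • D.c i i X) ≫
      ((1 : k) • D.c j i _)) + (1 : k) • ((A.F i).map ((1 : k) • D.c j i X) ≫
        ((-1 : k) • D.c i i _) ≫ (A.F i).map ((1 : k) • D.c i j X)) = _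
    simp only [Linear.smul_comp, Linear.comp_smul, Functor.map_smul, one_smul, smul_smul,
      neg_mul_neg, one_mul]
    rw [neg_one_smul, ← sub_eq_add_neg]
  | serre_pred i j hij =>
    have hij' : Adjacent i j := .inr hij
    simp only [braidL, braidR, Term.mapCoeff, Rep.eval_comp, Rep.eval_id, Rep.eval_add,
      Rep.eval_smul, eval_cross, specHom_coe, map_mul, map_neg, map_zpow, one_zpow, specUnit_uY,
      specUnit_uX, specUnit_uZ, mul_one, Units.val_one, h.cross_eq, sgn_same, sgn_of_ne hij'.ne,
      sgn_of_ne hij'.ne.symm]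
    have hd : Downward.diff k i j = 1 := by
      have : (i : ℕ) = j + 1 := hij
      simp [Downward.diff, this]
    have key := hF.serre i j X hij'
    rw [hd, one_smul] at key
    refine Eq.trans ?_ key
    change (1 : k) • (((1 : k) • D.c i j _) ≫ (A.F j).map ((-1 : k) • D.c i i X) ≫
      ((1 : k) • D.c j i _)) + (-1 : k) • ((A.F i).map ((1 : k) • D.c j i X) ≫
        ((-1 : k) • D.c i i _) ≫ (A.F i).map ((1 : k) • D.c i j X)) = _
    simp only [Linear.smul_comp, Linear.comp_smul, Functor.map_smul, one_smul, smul_smul,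
      neg_mul_neg, one_mul]
    rw [neg_one_smul, neg_add_eq_sub]
  | zigzag_F i =>
    simp only [Term.mapCoeff, Rep.eval_comp, Rep.eval_id, eval_cup, eval_cap, h.cup_eq, h.cap_eq]
    exact (D.zigzag_F i X).symm
  | zigzag_E i =>
    simp only [Term.mapCoeff, Rep.eval_comp, Rep.eval_id, Rep.eval_smul, eval_cup, eval_cap,
      specHom_coe, map_mul, map_zpow, specUnit_uX, specUnit_uY, one_zpow, mul_one, Units.val_one,
      one_smul, h.cup_eq, h.cap_eq]
    exact (D.zigzag_E i X).symm
  | side_inv i j hij =>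
    simp only [Term.mapCoeff, Rep.eval_comp, Rep.eval_id, eval_invSide, eval_side X rfl hD,
      h.invSide_eq, sgn_of_ne hij, one_smul]
    exact D.s_t i j X (.inl hij)
  | inv_side i j hij =>
    simp only [Term.mapCoeff, Rep.eval_comp, Rep.eval_id, eval_invSide, eval_side X rfl hD,
      h.invSide_eq, sgn_of_ne hij, one_smul]
    exact D.t_s i j X (.inl hij)
  | pos_target i hi =>
    simp only [Term.mapCoeff, Rep.eval_comp, Rep.eval_id, Rep.eval_add, Term.mapCoeff_sum,
      Rep.eval_sum, eval_invSide, eval_cupDots X rfl hD, eval_side X rfl hD, h.invSide_eq, sgn_same,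
      h.eval_invCup]
    change ((-1 : k) • D.t i i X) ≫ ((-1 : k) • D.s i i X) +
      ∑ m : Fin (bar (A.wt X) i).toNat, D.p i m X ≫ D.cupD i m X = 𝟙 _
    rcases hi.eq_or_lt with h0 | h0
    · have : IsEmpty (Fin (bar (A.wt X) i).toNat) := by rw [← h0]; exact Fin.isEmpty
      rw [Finset.univ_eq_empty, Finset.sum_empty, add_zero, Linear.smul_comp, Linear.comp_smul,
        smul_smul, neg_mul_neg, one_mul, one_smul, D.t_s i i X (.inr h0.symm)]
    · rw [D.p_cup i X h0, show D.s i i X = 0 from A.eq_of_bad_map_source (A.F i) (bad_E h0) _ _,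
        smul_zero, Limits.comp_zero, zero_add]
  | pos_side_side i hi =>
    rcases hi.eq_or_lt with h0 | h0
    · simp only [Term.mapCoeff, Rep.eval_comp, Rep.eval_id, eval_invSide, eval_side X rfl hD,
        h.invSide_eq, sgn_same]
      change ((-1 : k) • D.s i i X) ≫ ((-1 : k) • D.t i i X) = 𝟙 _
      rw [Linear.smul_comp, Linear.comp_smul, smul_smul, neg_mul_neg, one_mul, one_smul,
        D.s_t i i X (.inr h0.symm)]
    · exact A.eq_of_bad_map_source (A.F i) (bad_E h0) _ _
  | pos_side_cup i hi m =>
    have hb : 0 < bar (A.wt X) i := by have := m.2; omega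
    exact A.eq_of_bad_map_source (A.F i) (bad_E hb) _ _
  | pos_cup_side i hi m =>
    have hb : 0 < bar (A.wt X) i := by have := m.2; omega
    exact A.eq_of_bad_map_target (A.F i) (bad_E hb) _ _
  | pos_cup_cup i hi m m' =>
    simp only [Term.mapCoeff, Rep.eval_comp, eval_cupDots X rfl hD, h.eval_invCup]
    refine (D.cup_p i X m m' (by omega) (by omega)).trans ?_
    simp only [Fin.ext_iff]
    split_ifs <;> rfl
  | neg_source i hi =>
    simp only [Term.mapCoeff, Rep.eval_comp, Rep.eval_id, Rep.eval_add, Term.mapCoeff_sum,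
      Rep.eval_sum, eval_invSide, eval_capDots X rfl hD, eval_side X rfl hD, h.invSide_eq, sgn_same,
      h.eval_invCap]
    change ((-1 : k) • D.s i i X) ≫ ((-1 : k) • D.t i i X) +
      ∑ m : Fin (-bar (A.wt X) i).toNat, D.capD i m X ≫ D.q i m X = 𝟙 _
    rcases hi.eq_or_lt with h0 | h0
    · have : IsEmpty (Fin (-bar (A.wt X) i).toNat) := by rw [h0]; exact Fin.isEmpty
      rw [Finset.univ_eq_empty, Finset.sum_empty, add_zero, Linear.smul_comp, Linear.comp_smul,
        smul_smul, neg_mul_neg, one_mul, one_smul, D.s_t i i X (.inr h0)]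
    · rw [D.cap_q i X h0, show D.s i i X = 0 from A.eq_of_bad_map_target (A.E i) (bad_F h0) _ _,
        smul_zero, Limits.zero_comp, zero_add]
  | neg_side_side i hi =>
    rcases hi.eq_or_lt with h0 | h0
    · simp only [Term.mapCoeff, Rep.eval_comp, Rep.eval_id, eval_invSide, eval_side X rfl hD,
        h.invSide_eq, sgn_same]
      change ((-1 : k) • D.t i i X) ≫ ((-1 : k) • D.s i i X) = 𝟙 _
      rw [Linear.smul_comp, Linear.comp_smul, smul_smul, neg_mul_neg, one_mul, one_smul,
        D.t_s i i X (.inr h0)]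
    · exact A.eq_of_bad_map_source (A.E i) (bad_F h0) _ _
  | neg_side_cap i hi m =>
    have hb : bar (A.wt X) i < 0 := by have := m.2; omega
    exact A.eq_of_bad_map_source (A.E i) (bad_F hb) _ _
  | neg_cap_side i hi m =>
    have hb : bar (A.wt X) i < 0 := by have := m.2; omega
    exact A.eq_of_bad_map_target (A.E i) (bad_F hb) _ _
  | neg_cap_cap i hi m m' =>
    simp only [Term.mapCoeff, Rep.eval_comp, eval_capDots X rfl hD, h.eval_invCap]
    refine (D.q_cap i X m m' (by omega) (by omega)).trans ?_
    simp only [Fin.ext_iff]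
    split_ifs <;> rfl

end IsModel

end SchurCat.SpecRep

/-- A representation of `S(n,d)` is determined by its `SchurData`. -/
lemma MSV.Rep.IsModel.gen_eq {n d : ℕ} {k : Type u} [CommRing k] {C : Type w} [Category.{v} C]
    [Preadditive C] [Linear k C] {A : SchurCat.WeightAction n d k C}
    {R R' : Signature.Rep (MSV.sig n d) A} {D : SchurCat.SchurData A} (h : IsModel R D)
    (h' : IsModel R' D) {ν : Fin n → ℤ} {s t : List (Letter n)}
    (g : MSV.Gen ν s t) (X : C) (hX : A.wt X = ν) : R.gen g X hX = R'.gen g X hX := by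
  subst hX
  cases g with
  | dotE i => exact (h.dotE_eq i X).trans (h'.dotE_eq i X).symm
  | dotF i => exact (h.dotF_eq i X).trans (h'.dotF_eq i X).symm
  | crossE i j => exact (h.crossE_eq i j X).trans (h'.crossE_eq i j X).symm
  | crossF i j => exact (h.crossF_eq i j X).trans (h'.crossF_eq i j X).symm
  | cupEF i => exact (h.cupEF_eq i X).trans (h'.cupEF_eq i X).symm
  | cupFE i => exact (h.cupFE_eq i X).trans (h'.cupFE_eq i X).symm
  | capEF i => exact (h.capEF_eq i X).trans (h'.capEF_eq i X).symm
  | capFE i => exact (h.capFE_eq i X).trans (h'.capFE_eq i X).symm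

namespace SchurCat

open Signature Downward

variable {n d : ℕ} {k : Type u} [CommRing k]

/-! ### The two interpretations -/

section

open Signature.Term

variable (n d k)

variable {n d k} in
/-- One generator between the words `u` and `v`, with coefficients in `k`. -/
abbrev SpecRep.put {μ : Fin n → ℤ} (u : List (Letter n)) {s t : List (Letter n)}
    (v : List (Letter n)) (g : Gen (v.foldr actLetter μ) s t) :
    Term (sig n d) k μ (u ++ s ++ v) (u ++ t ++ v) :=
  lay (S := sig n d) u v g

/-- The generators of `S(n,d)` as diagrams of the graded 2-Schur algebra at `X = Y = Z = 1`. The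
upward dots and crossings are rotated downward ones. The second cups and caps are, up to sign,
the generators opposite to the caps and cups with the largest number of dots if there are any, and
are obtained from the first cups and caps by a sideways crossing if `μ̄_i = 0`. -/
def ofMSV : ∀ {ν : Fin n → ℤ} {s t : List (Letter n)}, MSV.Gen ν s t → Term (sig n d) k ν s t
  | _, _, _, .dotE i => comp (SpecRep.put [] [.E i] (Gen.cup i))
      (comp (SpecRep.put [.E i] [.E i] (Gen.dot i)) (SpecRep.put [.E i] [] (Gen.cap i)))
  | _, _, _, .dotF i => SpecRep.put [] [] (Gen.dot i)
  | _, _, _, .crossE i j => smul (SpecRep.sgn k i j) (comp (SpecRep.put [] [.E i, .E j] (Gen.cup j))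
      (comp (between (S := sig n d) [.E j] [.E j] ((side k d j i).mapCoeff (specHom k)))
        (SpecRep.put [.E j, .E i] [] (Gen.cap j))))
  | _, _, _, .crossF i j => smul (SpecRep.sgn k i j) (SpecRep.put [] [] (Gen.cross i j))
  | _, _, _, .cupEF i => SpecRep.put [] [] (Gen.cup i)
  | ν, _, _, .cupFE i =>
      if h : bar ν i < 0 then smul (MSV.ccwSign k ν i)
        (SpecRep.put [] [] (Gen.invCap (μ := ν) i ⟨(-bar ν i - 1).toNat, by omega⟩))
      else if bar ν i = 0 then
        comp (SpecRep.put [] [] (Gen.cup i)) (smul (-1) (SpecRep.put [] [] (Gen.invSide i i)))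
      else zero
  | ν, _, _, .capEF i =>
      if h : 0 < bar ν i then smul (MSV.cwSign k ν i)
        (SpecRep.put [] [] (Gen.invCup (μ := ν) i ⟨(bar ν i - 1).toNat, by omega⟩))
      else if bar ν i = 0 then
        comp (smul (-1) (SpecRep.put [] [] (Gen.invSide i i))) (SpecRep.put [] [] (Gen.cap i))
      else zero
  | _, _, _, .capFE i => SpecRep.put [] [] (Gen.cap i)

/-- The generators of the graded 2-Schur algebra at `X = Y = Z = 1` as diagrams of `S(n,d)`. The
generators opposite to the dotted cups and caps are, up to sign, caps and cups with the
complementary numbers of dots. -/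
def toMSV : ∀ {ν : Fin n → ℤ} {s t : List (Letter n)}, Gen ν s t → Term (MSV.sig n d) k ν s t
  | _, _, _, .cup i => MSV.put [] [] (MSV.Gen.cupEF i)
  | _, _, _, .cap i => MSV.put [] [] (MSV.Gen.capFE i)
  | _, _, _, .dot i => MSV.put [] [] (MSV.Gen.dotF i)
  | _, _, _, .cross i j => smul (SpecRep.sgn k i j) (MSV.put [] [] (MSV.Gen.crossF i j))
  | _, _, _, .invSide i j => smul (SpecRep.sgn k i j) (MSV.sideEF k d j i)
  | ν, _, _, .invCup i m =>
      smul (MSV.cwSign k ν i) (MSV.capEF k d i (bar ν i - 1 - (m : ℕ)).toNat)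
  | ν, _, _, .invCap i m =>
      smul (MSV.ccwSign k ν i) (MSV.cupFE k d i (-bar ν i - 1 - (m : ℕ)).toNat)

end

variable {C : Type w} [Category.{v} C] [Preadditive C] [Linear k C] {A : WeightAction n d k C}

/-- A representation of the graded 2-Schur algebra at `X = Y = Z = 1`, as a representation of
`S(n,d)`. -/
def pullOfMSV (R : Rep (sig n d) A) : Rep (MSV.sig n d) A :=
  R.pull (dg := MSV.Gen.deg) (ofMSV n d k)

/-- A representation of `S(n,d)`, as a representation of the graded 2-Schur algebra at
`X = Y = Z = 1`. -/
def pullToMSV (R : Rep (MSV.sig n d) A) : Rep (sig n d) A :=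
  Rep.pull (S := MSV.sig n d) (dg := Gen.deg) R (toMSV n d k)

/-- The interpretation of `S(n,d)` in the graded 2-Schur algebra preserves `SchurData`. -/
lemma isModel_pullOfMSV {R : Rep (sig n d) A} {D : SchurData A} (h : SpecRep.IsModel R D) :
    MSV.Rep.IsModel (pullOfMSV R) D where
  cupEF_eq i X := h.cup_eq i X
  capFE_eq i X := h.cap_eq i X
  dotF_eq i X := h.dot_eq i X
  crossF_eq i j X := by
    change SpecRep.sgn k i j • SpecRep.cross R i j X = _
    rw [h.cross_eq, smul_smul, SpecRep.sgn_mul_self, one_smul]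
  dotE_eq i X := by
    change R.eval (ofMSV n d k (MSV.Gen.dotE i)) X rfl = _
    simp only [ofMSV, Rep.eval_comp, SpecRep.eval_cup, SpecRep.eval_cap, SpecRep.eval_dot, h.cup_eq,
      h.cap_eq, h.dot_eq]
    rfl
  crossE_eq i j X := by
    have h1 : R.eval (Term.between (S := sig n d) [.E j] [.E j]
        ((side k d j i).mapCoeff (specHom k))) X rfl = (A.E j).map (SpecRep.sgn k j i •
          D.s j i ((A.E j).obj X)) :=
      (R.eval_whisk (S := sig n d) rfl _ rfl rfl X rfl).trans
        (congrArg (A.E j).map (SpecRep.eval_side _ _ h.toIsDownward j i))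
    have key : SpecRep.sgn k i j • (D.η j ((A.E i).obj ((A.E j).obj X)) ≫
        (A.E j).map (SpecRep.sgn k j i • D.s j i ((A.E j).obj X)) ≫
          (A.E j).map ((A.E i).map (D.ε j X))) = D.cE i j X := by
      rw [Functor.map_smul, Linear.smul_comp, Linear.comp_smul, smul_smul,
        SpecRep.sgn_comm j i, SpecRep.sgn_mul_self, one_smul]
      rfl
    change R.eval (ofMSV n d k (MSV.Gen.crossE i j)) X rfl = _
    simp only [ofMSV, Rep.eval_comp, Rep.eval_smul, SpecRep.eval_cup, SpecRep.eval_cap, h.cup_eq,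
      h.cap_eq]
    refine Eq.trans (congrArg (fun f => SpecRep.sgn k i j • (D.η j _ ≫ f ≫ _)) h1) key
  cupFE_eq i X := by
    change R.eval (ofMSV n d k (MSV.Gen.cupFE i)) X rfl = _
    rcases lt_trichotomy (bar (A.wt X) i) 0 with h0 | h0 | h0
    · simp only [ofMSV, dif_pos h0, Rep.eval_smul, h.eval_invCap]
      exact (D.η'_of_neg h0).symm
    · simp only [ofMSV, dif_neg h0.not_lt, if_pos h0, Rep.eval_comp, Rep.eval_smul,
        SpecRep.eval_cup, SpecRep.eval_invSide, h.cup_eq, h.invSide_eq, SpecRep.sgn_same]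
      rw [D.η'_of_nonneg h0.ge]
      have key : D.η i X ≫ ((-1 : k) • (-1 : k) • D.t i i X) = D.η i X ≫ D.t i i X := by
        rw [smul_smul, neg_mul_neg, one_mul, one_smul]
      exact key
    · exact A.eq_of_bad_map_target (A.F i) (bad_E h0) _ _
  capEF_eq i X := by
    change R.eval (ofMSV n d k (MSV.Gen.capEF i)) X rfl = _
    rcases lt_trichotomy (bar (A.wt X) i) 0 with h0 | h0 | h0
    · exact A.eq_of_bad_map_source (A.E i) (bad_F h0) _ _
    · simp only [ofMSV, dif_neg h0.not_gt, if_pos h0, Rep.eval_comp, Rep.eval_smul,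
        SpecRep.eval_cap, SpecRep.eval_invSide, h.cap_eq, h.invSide_eq, SpecRep.sgn_same]
      rw [D.ε'_of_nonpos h0.le]
      have key : ((-1 : k) • (-1 : k) • D.t i i X) ≫ D.ε i X = D.t i i X ≫ D.ε i X := by
        rw [smul_smul, neg_mul_neg, one_mul, one_smul]
      exact key
    · simp only [ofMSV, dif_pos h0, Rep.eval_smul, h.eval_invCup]
      exact (D.ε'_of_pos h0).symm

/-- The interpretation of the graded 2-Schur algebra in `S(n,d)` preserves `SchurData`. -/
lemma isModel_pullToMSV {R : Rep (MSV.sig n d) A} {D : SchurData A} (h : MSV.Rep.IsModel R D) :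
    SpecRep.IsModel (pullToMSV R) D where
  cup_eq i X := h.cupEF_eq i X
  cap_eq i X := h.capFE_eq i X
  dot_eq i X := h.dotF_eq i X
  cross_eq i j X := congrArg (SpecRep.sgn k i j • ·) (h.crossF_eq i j X)
  invSide_eq i j X := by
    refine Eq.trans (b := SpecRep.sgn k i j • D.sideEF j i X)
      (congrArg (SpecRep.sgn k i j • ·) ?_) ?_
    · exact (MSV.Rep.eval_sideEF R X rfl j i).trans (h.sideEFR_eq j i X)
    · by_cases hij : i = j
      · subst hij
        rcases lt_trichotomy (bar (A.wt X) i) 0 with h0 | h0 | h0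
        · exact A.eq_of_bad_map_source (A.E i) (bad_F h0) _ _
        · rw [D.sideEF_eq X (.inr h0)]
        · exact A.eq_of_bad_map_target (A.F i) (bad_E h0) _ _
      · rw [D.sideEF_eq X (.inl (Ne.symm hij))]
  invCup_eq i m X hm := by
    by_cases hw : IsWeight n d (A.wt X)
    swap
    · exact A.eq_of_bad_map_source (A.F i ⋙ A.E i) hw _ _
    rw [← SpecRep.gen_invCup _ X rfl i ⟨m, hm⟩]
    refine Eq.trans (congrArg (MSV.cwSign k (A.wt X) i • ·)
      (MSV.Rep.eval_capEF_dots R X rfl i _)) ?_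
    have h0 : 0 < bar (A.wt X) i := by omega
    have key : MSV.cwSign k (A.wt X) i • (D.xEpow i ((A.F i).obj X) (bar (A.wt X) i - 1 - m).toNat ≫
        D.ε' i X) = D.p i m X := by
      rw [D.ε'_of_pos h0, Linear.comp_smul, smul_smul, cwSign_mul_self, one_smul]
      have := hw.bar_cases i
      obtain e | ⟨e, rfl⟩ : (m : ℤ) = bar (A.wt X) i - 1 ∨ bar (A.wt X) i = 2 ∧ m = 0 := by omega
      · rw [show (bar (A.wt X) i - 1 - m).toNat = 0 by omega,
          show (bar (A.wt X) i - 1).toNat = m by omega]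
        exact Category.id_comp _
      · rw [e]
        refine Eq.trans ?_ (D.xE_p_one X e)
        exact congrArg (· ≫ _) (Category.id_comp _)
    rw [← h.dotEpow_eq, ← h.capEF_eq] at key
    exact key
  invCap_eq i m X hm := by
    by_cases hw : IsWeight n d (A.wt X)
    swap
    · exact A.eq_of_bad_map_target (A.E i ⋙ A.F i) hw _ _
    rw [← SpecRep.gen_invCap _ X rfl i ⟨m, hm⟩]
    refine Eq.trans (congrArg (MSV.ccwSign k (A.wt X) i • ·)
      (MSV.Rep.eval_cupFE_dots R X rfl i _)) ?_
    have h0 : bar (A.wt X) i < 0 := by omega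
    have key : MSV.ccwSign k (A.wt X) i • (D.η' i X ≫
        (A.F i).map (D.xEpow i X (-bar (A.wt X) i - 1 - m).toNat)) = D.q i m X := by
      rw [D.η'_of_neg h0, Linear.smul_comp, smul_smul, ccwSign_mul_self, one_smul]
      have := hw.bar_cases i
      obtain e | ⟨e, rfl⟩ : (m : ℤ) = -bar (A.wt X) i - 1 ∨ bar (A.wt X) i = -2 ∧ m = 0 := by omega
      · rw [show (-bar (A.wt X) i - 1 - m).toNat = 0 by omega,
          show (-bar (A.wt X) i - 1).toNat = m by omega]
        exact (congrArg (_ ≫ ·) (CategoryTheory.Functor.map_id _ _)).trans (Category.comp_id _)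
      · rw [e]
        refine Eq.trans ?_ (D.q_one_xE X e)
        exact congrArg (fun f => _ ≫ (A.F i).map f) (Category.id_comp _)
    rw [← h.dotEpow_eq, ← h.cupFE_eq] at key
    exact key

end SchurCat

namespace Signature

variable {Γ : Type} {S : Signature Γ}

/-! ### Reduction of the scalars of a presented 2-category -/

namespace PHom

section

variable {R : Type u} [CommRing R] {bil : Γ → Γ → Rˣ} {rel : Relations S R} {μ : S.W}
  {w w' w'' : List S.L}

variable (bil rel μ w w' w'') in
/-- Vertical composition, as a bilinear map. -/
def compₗ : PHom bil rel μ w w' →ₗ[R] PHom bil rel μ w' w'' →ₗ[R] PHom bil rel μ w w'' :=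
  LinearMap.mk₂ R comp
    (by rintro ⟨f⟩ ⟨f'⟩ ⟨g⟩; exact Quot.sound (.add_comp f f' g))
    (by rintro r ⟨f⟩ ⟨g⟩; exact Quot.sound (.smul_comp r f g))
    (by rintro ⟨f⟩ ⟨g⟩ ⟨g'⟩; exact Quot.sound (.comp_add f g g'))
    (by rintro r ⟨f⟩ ⟨g⟩; exact Quot.sound (.comp_smul r f g))

end

variable {R k : Type u} [CommRing R] [CommRing k] [Algebra k R] {bil : Γ → Γ → Rˣ}
  {rel : Relations S R} {I : Ideal R} {μ : S.W} {w w' w'' : List S.L}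

variable (bil rel I μ w w') in
/-- The 2-morphisms modulo an ideal of scalars. -/
abbrev Mod : Type u := PHom bil rel μ w w' ⧸ (I • ⊤ : Submodule R (PHom bil rel μ w w'))

variable (bil rel I) in
/-- The class modulo `I` of the 2-morphism represented by a diagram. -/
def toMod (f : Term S R μ w w') : Mod bil rel I μ w w' :=
  Submodule.Quotient.mk (mk bil rel f)

variable (bil rel I) in
/-- The class modulo `I` of the 2-morphism obtained by extending scalars along `k → R`. -/
def modMk (f : Term S k μ w w') : Mod bil rel I μ w w' :=
  toMod bil rel I (f.mapCoeff (algebraMap k R))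

lemma toMod_comp_congr {f f' : Term S R μ w w'} {g g' : Term S R μ w' w''}
    (hf : toMod bil rel I f = toMod bil rel I f') (hg : toMod bil rel I g = toMod bil rel I g') :
    toMod bil rel I (.comp f g) = toMod bil rel I (.comp f' g') := by
  refine Eq.trans (b := toMod bil rel I (.comp f' g)) ?_ ?_
  · exact congrArg (Submodule.mapQ _ (I • ⊤) ((compₗ bil rel μ w w' w'').flip (mk bil rel g))
      (Submodule.smul_top_le_comap_smul_top I _)) hf
  · exact congrArg (Submodule.mapQ _ (I • ⊤) (compₗ bil rel μ w w' w'' (mk bil rel f'))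
      (Submodule.smul_top_le_comap_smul_top I _)) hg

lemma toMod_eqv {f g : Term S R μ w w'} (h : Eqv bil rel f g) :
    toMod bil rel I f = toMod bil rel I g :=
  congrArg Submodule.Quotient.mk (Quot.sound h)

lemma mod_smul {σ : R → k} (hI : ∀ r, algebraMap k R (σ r) - r ∈ I) (r : R)
    (x : Mod bil rel I μ w w') : algebraMap k R (σ r) • x = r • x := by
  obtain ⟨x, rfl⟩ := Submodule.Quotient.mk_surjective _ x
  rw [← Submodule.Quotient.mk_smul, ← Submodule.Quotient.mk_smul, Submodule.Quotient.eq, ← sub_smul]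
  exact Submodule.smul_mem_smul (hI r) trivial

/-- Specializing the scalars and extending them back does not change the class modulo `I`. -/
lemma modMk_mapCoeff {σ : R → k} (hI : ∀ r, algebraMap k R (σ r) - r ∈ I) (f : Term S R μ w w') :
    modMk bil rel I (f.mapCoeff σ) = toMod bil rel I f := by
  induction f with
  | id => rfl
  | gen => rfl
  | comp f g ihf ihg => exact toMod_comp_congr ihf ihg
  | zero => rfl
  | add f g ihf ihg => exact congrArg₂ (· + ·) ihf ihg
  | smul r f ih => exact (congrArg (algebraMap k R (σ r) • ·) ih).trans (mod_smul hI r _)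

/-- Diagrams over `k` that are equal for the specialized relations and the ordinary interchange law
are equal modulo `I` over `R`. -/
lemma modMk_eq {σ : R → k} (hI : ∀ r, algebraMap k R (σ r) - r ∈ I)
    (hbil : ∀ x y, σ (bil x y) = 1) {rel' : Relations S k}
    (hrel : ∀ {ν : S.W} {s t : List S.L} {f g : Term S k ν s t}, rel' f g →
      ∃ f' g' : Term S R ν s t, rel f' g' ∧ f = f'.mapCoeff σ ∧ g = g'.mapCoeff σ)
    {f g : Term S k μ w w'} (h : Eqv (fun _ _ => 1) rel' f g) :
    modMk bil rel I f = modMk bil rel I g := by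
  induction h with
  | refl f => rfl
  | symm _ ih => exact ih.symm
  | trans _ _ ih1 ih2 => exact ih1.trans ih2
  | comp _ _ ih1 ih2 => exact toMod_comp_congr ih1 ih2
  | add _ _ ih1 ih2 => exact congrArg₂ (· + ·) ih1 ih2
  | smul r _ ih => exact congrArg (algebraMap k R r • ·) ih
  | add_assoc => exact toMod_eqv (.add_assoc _ _ _)
  | add_comm => exact toMod_eqv (.add_comm _ _)
  | zero_add => exact toMod_eqv (.zero_add _)
  | neg_add f =>
    refine Eq.trans ?_ (toMod_eqv (.neg_add (f.mapCoeff (algebraMap k R))))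
    change toMod bil rel I (.add (.smul (algebraMap k R (-1)) _) _) = _
    rw [map_neg, map_one]
  | smul_add => exact toMod_eqv (.smul_add _ _ _)
  | add_smul r r' f =>
    refine Eq.trans ?_ (toMod_eqv (.add_smul _ _ (f.mapCoeff (algebraMap k R))))
    change toMod bil rel I (.smul (algebraMap k R (r + r')) _) = _
    rw [map_add]
  | mul_smul r r' f =>
    refine Eq.trans ?_ (toMod_eqv (.mul_smul _ _ (f.mapCoeff (algebraMap k R))))
    change toMod bil rel I (.smul (algebraMap k R (r * r')) _) = _
    rw [map_mul]
  | one_smul f =>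
    refine Eq.trans ?_ (toMod_eqv (.one_smul (f.mapCoeff (algebraMap k R))))
    change toMod bil rel I (.smul (algebraMap k R 1) _) = _
    rw [map_one]
  | id_comp f => exact toMod_eqv (.id_comp _)
  | comp_id f => exact toMod_eqv (.comp_id _)
  | assoc => exact toMod_eqv (.assoc _ _ _)
  | add_comp => exact toMod_eqv (.add_comp _ _ _)
  | comp_add => exact toMod_eqv (.comp_add _ _ _)
  | smul_comp => exact toMod_eqv (.smul_comp _ _ _)
  | comp_smul => exact toMod_eqv (.comp_smul _ _ _)
  | interchange f g hug hug' hvf hvf' hν hν₁ hν' h1 h2 h2' h3 h1' h4 h4' h3' =>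
    refine Eq.trans (b := (bil (S.deg f) (S.deg g) : R) • modMk (k := k) bil rel I
      (.comp (.gen _ _ hν₁ f h1' h4) (.gen _ _ hν' g h4' h3'))) (toMod_eqv
      (.interchange (rel := rel) (bil := bil) f g hug hug' hvf hvf' hν hν₁ hν' h1 h2 h2' h3 h1' h4
        h4' h3')) ?_
    rw [← mod_smul hI, hbil]
    rfl
  | of h u v hν hw hw' =>
    obtain ⟨f, g, h', rfl, rfl⟩ := hrel h
    rw [← Term.mapCoeff_whisk, ← Term.mapCoeff_whisk, modMk_mapCoeff hI, modMk_mapCoeff hI]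
    exact toMod_eqv (.of h' u v hν hw hw')
  | bad h hb => exact toMod_eqv (.bad h hb)

end PHom

/-- Specialization of scalars is compatible with the relations, the graded interchange law becoming
the ordinary one. -/
lemma Eqv.mapCoeff {R k : Type u} [CommRing R] [CommRing k] {bil : Γ → Γ → Rˣ}
    {rel : Relations S R} (σ : R →+* k) (hbil : ∀ x y, σ (bil x y) = 1) {rel' : Relations S k}
    (hrel : ∀ {ν : S.W} {s t : List S.L} {f g : Term S R ν s t}, rel f g →
      rel' (f.mapCoeff σ) (g.mapCoeff σ)) {μ : S.W} {w w' : List S.L}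
    {f g : Term S R μ w w'} (h : Eqv bil rel f g) :
    Eqv (fun _ _ => 1) rel' (f.mapCoeff σ) (g.mapCoeff σ) := by
  induction h with
  | refl f => exact .refl _
  | symm _ ih => exact .symm ih
  | trans _ _ ih1 ih2 => exact .trans ih1 ih2
  | comp _ _ ih1 ih2 => exact .comp ih1 ih2
  | add _ _ ih1 ih2 => exact .add ih1 ih2
  | smul r _ ih => exact .smul _ ih
  | add_assoc => exact .add_assoc _ _ _
  | add_comm => exact .add_comm _ _
  | zero_add => exact .zero_add _
  | neg_add f =>
    simp only [Term.mapCoeff, map_neg, map_one]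
    exact .neg_add _
  | smul_add => exact .smul_add _ _ _
  | add_smul r r' f =>
    simp only [Term.mapCoeff, map_add]
    exact .add_smul _ _ _
  | mul_smul r r' f =>
    simp only [Term.mapCoeff, map_mul]
    exact .mul_smul _ _ _
  | one_smul f =>
    simp only [Term.mapCoeff, map_one]
    exact .one_smul _
  | id_comp f => exact .id_comp _
  | comp_id f => exact .comp_id _
  | assoc => exact .assoc _ _ _
  | add_comp => exact .add_comp _ _ _
  | comp_add => exact .comp_add _ _ _
  | smul_comp => exact .smul_comp _ _ _
  | comp_smul => exact .comp_smul _ _ _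
  | interchange f g hug hug' hvf hvf' hν hν₁ hν' h1 h2 h2' h3 h1' h4 h4' h3' =>
    simp only [Term.mapCoeff, hbil]
    exact .interchange (bil := fun _ _ => 1)
      f g hug hug' hvf hvf' hν hν₁ hν' h1 h2 h2' h3 h1' h4 h4' h3'
  | of h u v hν hw hw' =>
    rw [Term.mapCoeff_whisk, Term.mapCoeff_whisk]
    exact .of (hrel h) u v hν hw hw'
  | bad h hb => exact .bad h hb

end Signature

namespace SchurCat

variable (k : Type u) [CommRing k]

/-- Modulo `(X - 1, Y - 1, Z - 1)` every scalar is congruent to its value at `X = Y = Z = 1`. -/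
lemma algebraMap_specHom_sub_mem (r : RingXYZ k) :
    algebraMap k (RingXYZ k) (specHom k r) - r ∈ specIdeal k := by
  have hmul : ∀ a b : RingXYZ k, algebraMap k (RingXYZ k) (specHom k a) - a ∈ specIdeal k →
      algebraMap k (RingXYZ k) (specHom k b) - b ∈ specIdeal k →
      algebraMap k (RingXYZ k) (specHom k (a * b)) - a * b ∈ specIdeal k := fun a b ha hb => by
    have h : algebraMap k (RingXYZ k) (specHom k (a * b)) - a * b =
        algebraMap k (RingXYZ k) (specHom k a) * (algebraMap k (RingXYZ k) (specHom k b) - b) +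
          b * (algebraMap k (RingXYZ k) (specHom k a) - a) := by
      rw [map_mul, map_mul]
      ring
    rw [h]
    exact Ideal.add_mem _ (Ideal.mul_mem_left _ _ hb) (Ideal.mul_mem_left _ _ ha)
  have hadd : ∀ a b : RingXYZ k, algebraMap k (RingXYZ k) (specHom k a) - a ∈ specIdeal k →
      algebraMap k (RingXYZ k) (specHom k b) - b ∈ specIdeal k →
      algebraMap k (RingXYZ k) (specHom k (a + b)) - (a + b) ∈ specIdeal k := fun a b ha hb => by
    rw [map_add, map_add, add_sub_add_comm]
    exact Ideal.add_mem _ ha hb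
  have hunit : ∀ a : (RingXYZ k)ˣ, (a : RingXYZ k) - 1 ∈ specIdeal k → specUnit k a = 1 →
      algebraMap k (RingXYZ k) (specHom k a) - a ∈ specIdeal k := fun a ha h => by
    rw [specHom_coe, h, Units.val_one, map_one, ← neg_sub (a : RingXYZ k) 1]
    exact Submodule.neg_mem _ ha
  have hX := hunit (uX k) (Ideal.subset_span (by simp)) (specUnit_uX k)
  have hY := hunit (uY k) (Ideal.subset_span (by simp)) (specUnit_uY k)
  have hZ := hunit (uZ k) (Ideal.subset_span (by simp)) (specUnit_uZ k)
  have hZ' : algebraMap k (RingXYZ k) (specHom k ((uZ k)⁻¹ : (RingXYZ k)ˣ)) -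
      ((uZ k)⁻¹ : (RingXYZ k)ˣ) ∈ specIdeal k := by
    refine hunit _ ?_ (by rw [map_inv, specUnit_uZ, inv_one])
    have h : (((uZ k)⁻¹ : (RingXYZ k)ˣ) : RingXYZ k) - 1 =
        (-((uZ k)⁻¹ : (RingXYZ k)ˣ) : RingXYZ k) * ((uZ k : RingXYZ k) - 1) := by
      rw [mul_sub, neg_mul, Units.inv_mul, mul_one]
      ring
    rw [h]
    exact Ideal.mul_mem_left _ _ (Ideal.subset_span (by simp))
  have hC : ∀ a : RingXY k, algebraMap k (RingXYZ k) (specHom k (LaurentPolynomial.C a)) -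
      LaurentPolynomial.C a ∈ specIdeal k := fun a => by
    obtain ⟨a, rfl⟩ := Ideal.Quotient.mk_surjective a
    induction a using MvPolynomial.induction_on with
    | C c =>
      have h : (LaurentPolynomial.C (Ideal.Quotient.mk _ (MvPolynomial.C c)) : RingXYZ k) =
        algebraMap k (RingXYZ k) c := rfl
      rw [h, specHom_algebraMap, sub_self]
      exact Ideal.zero_mem _
    | add p q hp hq =>
      rw [map_add, map_add]
      exact hadd _ _ hp hq
    | mul_X p i hp =>
      rw [map_mul, map_mul]
      refine hmul _ _ hp ?_
      match i with
      | 0 => exact hX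
      | 1 => exact hY
  induction r using LaurentPolynomial.induction_on with
  | h_C a => exact hC a
  | h_add ha hb => exact hadd _ _ ha hb
  | h_C_mul_T m a h =>
    rw [LaurentPolynomial.T_add, ← mul_assoc]
    exact hmul _ _ h hZ
  | h_C_mul_T_Z m a h =>
    rw [LaurentPolynomial.T_sub, ← mul_assoc]
    exact hmul _ _ h hZ'

end SchurCat

namespace Signature

variable {Γ : Type} {S : Signature Γ}

lemma subst_whisk {k : Type u} [CommRing k] {Γ' : Type} {G : S.W → List S.L → List S.L → Type}
    {dg : ∀ {μ s t}, G μ s t → Γ'} (φ : ∀ {ν s t}, G ν s t → Term S k ν s t) {μ ν : S.W}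
    {u v : List S.L} (hν : S.actW v μ = ν) {s t : List S.L}
    (f : Term (Signature.mk S.W S.L S.act S.good G dg) k ν s t) {w w' : List S.L}
    (hw : w = u ++ s ++ v) (hw' : w' = u ++ t ++ v) :
    subst (S := S) (dg := dg) φ (Term.whisk (S := Signature.mk S.W S.L S.act S.good G dg)
        u v hν f hw hw') = (subst (S := S) (dg := dg) φ f).whisk u v hν hw hw' :=
  match s, t, f with
  | _, _, .id h => rfl
  | _, _, .gen u₀ v₀ h g h1 h2 =>
    (Term.whisk_whisk (S := S) h hν (φ g) h1 h2 hw hw'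
      (by rw [S.actW_append, hν]; exact h) (by simp [hw, h1]) (by simp [hw', h2])).symm
  | _, _, .comp f g =>
    congrArg₂ Term.comp (subst_whisk φ hν f hw rfl) (subst_whisk φ hν g rfl hw')
  | _, _, .zero => rfl
  | _, _, .add f g =>
    congrArg₂ Term.add (subst_whisk φ hν f hw hw') (subst_whisk φ hν g hw hw')
  | _, _, .smul r f => congrArg (Term.smul r) (subst_whisk φ hν f hw hw')
termination_by structural f

lemma Term.mapCoeff_mapCoeff {R k : Type u} {σ : R → k} {τ : k → R} (h : ∀ r, σ (τ r) = r)
    {μ : S.W} {w w' : List S.L} (f : Term S k μ w w') : (f.mapCoeff τ).mapCoeff σ = f := by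
  induction f with
  | id => rfl
  | gen => rfl
  | comp f g ihf ihg => exact congrArg₂ Term.comp ihf ihg
  | zero => rfl
  | add f g ihf ihg => exact congrArg₂ Term.add ihf ihg
  | smul r f ih => exact congrArg₂ Term.smul (h r) ih

end Signature

namespace SchurCat

open Signature

variable {n d : ℕ} {k : Type u} [CommRing k]

/-! ### The comparison of spaces of 2-morphisms -/

lemma Gen.actW_eq {ν : Fin n → ℤ} {s t : List (Letter n)} (g : Gen ν s t) :
    (sig n d).actW s ν = (sig n d).actW t ν := by
  cases g <;> simp only [actW, List.foldr_cons, List.foldr_nil, actLetter] <;> abel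

lemma _root_.MSV.Gen.actW_eq {ν : Fin n → ℤ} {s t : List (Letter n)} (g : MSV.Gen ν s t) :
    (MSV.sig n d).actW s ν = (MSV.sig n d).actW t ν := by
  cases g <;> simp only [actW, List.foldr_cons, List.foldr_nil, actLetter] <;> abel

/-- The diagram of `S(n,d)` obtained from a diagram of the graded 2-Schur algebra at
`X = Y = Z = 1`. -/
def substTo {μ : Fin n → ℤ} {w w' : List (Letter n)} (f : Term (sig n d) k μ w w') :
    Term (MSV.sig n d) k μ w w' :=
  subst (S := MSV.sig n d) (dg := Gen.deg) (toMSV n d k) f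

/-- The diagram of the graded 2-Schur algebra at `X = Y = Z = 1` obtained from a diagram of
`S(n,d)`. -/
def substOf {μ : Fin n → ℤ} {w w' : List (Letter n)} (f : Term (MSV.sig n d) k μ w w') :
    Term (sig n d) k μ w w' :=
  subst (S := sig n d) (dg := MSV.Gen.deg) (ofMSV n d k) f

section

variable {C : Type w} [Category.{v} C] [Preadditive C] [Linear k C] {A : WeightAction n d k C}

lemma eval_substTo (R : Rep (MSV.sig n d) A) {μ : Fin n → ℤ} {w w' : List (Letter n)}
    (f : Term (sig n d) k μ w w') (X : C) (hX : A.wt X = μ) :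
    R.eval (substTo f) X hX = (pullToMSV R).eval f X hX :=
  Rep.eval_subst (S := MSV.sig n d) R (dg := Gen.deg) (toMSV n d k) f X hX

lemma eval_substOf (R : Rep (sig n d) A) {μ : Fin n → ℤ} {w w' : List (Letter n)}
    (f : Term (MSV.sig n d) k μ w w') (X : C) (hX : A.wt X = μ) :
    R.eval (substOf f) X hX = (pullOfMSV R).eval f X hX :=
  Rep.eval_subst (S := sig n d) R (dg := MSV.Gen.deg) (ofMSV n d k) f X hX

end

variable {μ : Fin n → ℤ} {w w' w'' : List (Letter n)}

variable (n d k μ w w') in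
/-- The 2-morphisms of `S(n,d)`. -/
abbrev DotHom : Type u := PHom (S := MSV.sig n d) (fun _ _ => 1) (MSV.Rel k d) μ w w'

variable (n d k μ w w') in
/-- The 2-morphisms of the graded 2-Schur algebra. -/
abbrev SchurHom : Type u := PHom (S := sig n d) (bil k) (Rel k d) μ w w'

variable (n d k μ w w') in
/-- The 2-morphisms of the graded 2-Schur algebra presented at `X = Y = Z = 1`. -/
abbrev SpecHom : Type u := PHom (S := sig n d) (fun _ _ => 1) (SpecRel k n d) μ w w'

variable (n d k μ) in
/-- The tautological representation of `S(n,d)`. -/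
abbrev dotRep := Words.rep (S := MSV.sig n d) (rel := MSV.Rel k d) (μ := μ) MSV.Gen.actW_eq

variable (n d k μ) in
/-- The tautological representation of the graded 2-Schur algebra at `X = Y = Z = 1`. -/
abbrev specRep := Words.rep (S := sig n d) (rel := SpecRel k n d) (μ := μ) Gen.actW_eq

/-- The tautological representation of `S(n,d)`, pulled back along `toMSV`, satisfies the relations
of the graded 2-Schur algebra. -/
lemma substTo_eqv {f g : Term (sig n d) k μ w w'} (h : Eqv (fun _ _ => 1) (SpecRel k n d) f g) :
    (PHom.mk _ _ (substTo f) : DotHom n d k μ w w') = PHom.mk _ _ (substTo g) := by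
  refine Words.mk_eq_of_eval MSV.Gen.actW_eq ?_
  have hsat := (isModel_pullToMSV (MSV.Rep.isModel (R := dotRep n d k μ) (Words.rep_sat _))).sat
  refine (eval_substTo (dotRep n d k μ) f _ _).trans (.trans ?_
    (eval_substTo (dotRep n d k μ) g _ _).symm)
  exact Rep.eval_eq _ hsat h _ _

/-- The tautological representation of the specialized 2-Schur algebra, pulled back along `ofMSV`,
satisfies the relations of `S(n,d)`. -/
lemma substOf_eqv {f g : Term (MSV.sig n d) k μ w w'}
    (h : Eqv (fun _ _ => 1) (MSV.Rel k d) f g) :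
    (PHom.mk _ _ (substOf f) : SpecHom n d k μ w w') = PHom.mk _ _ (substOf g) := by
  refine Words.mk_eq_of_eval Gen.actW_eq ?_
  have hsat := (isModel_pullOfMSV (SpecRep.isModel (R := specRep n d k μ) (Words.rep_sat _))).sat
  refine (eval_substOf (specRep n d k μ) f _ _).trans (.trans ?_
    (eval_substOf (specRep n d k μ) g _ _).symm)
  exact Rep.eval_eq _ hsat h _ _

lemma substOf_mk_eq {f g : Term (MSV.sig n d) k μ w w'}
    (h : (PHom.mk _ _ f : DotHom n d k μ w w') = PHom.mk _ _ g) :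
    (PHom.mk _ _ (substOf f) : SpecHom n d k μ w w') = PHom.mk _ _ (substOf g) :=
  congrArg (Quot.lift (fun f => (PHom.mk _ _ (substOf f) : SpecHom n d k μ w w'))
    fun _ _ h => substOf_eqv h) h

/-- Pulling the tautological representation of `S(n,d)` back along both interpretations preserves
its `SchurData`, hence does not change it. -/
lemma substTo_substOf (f : Term (MSV.sig n d) k μ w w') :
    (PHom.mk _ _ (substTo (substOf f)) : DotHom n d k μ w w') = PHom.mk _ _ f := by
  refine Words.mk_eq_of_eval MSV.Gen.actW_eq ?_
  have h := MSV.Rep.isModel (R := dotRep n d k μ) (Words.rep_sat _)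
  refine (eval_substTo (dotRep n d k μ) _ _ _).trans
    ((eval_substOf (pullToMSV (dotRep n d k μ)) f _ _).trans ?_)
  exact Rep.eval_congr (fun g => (isModel_pullOfMSV (isModel_pullToMSV h)).gen_eq h g) f _ _

/-- Pulling the tautological representation of the specialized 2-Schur algebra back along both
interpretations preserves its `SchurData`, hence does not change it. -/
lemma substOf_substTo (f : Term (sig n d) k μ w w') :
    (PHom.mk _ _ (substOf (substTo f)) : SpecHom n d k μ w w') = PHom.mk _ _ f := by
  refine Words.mk_eq_of_eval Gen.actW_eq ?_
  have h := SpecRep.isModel (R := specRep n d k μ) (Words.rep_sat _)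
  refine (eval_substOf (specRep n d k μ) _ _ _).trans
    ((eval_substTo (pullOfMSV (specRep n d k μ)) f _ _).trans ?_)
  exact Rep.eval_congr (fun g => (isModel_pullToMSV (isModel_pullOfMSV h)).gen_eq h g) f _ _

/-- The 2-morphism of `S(n,d)` obtained from a 2-morphism of the graded 2-Schur algebra by
specializing the scalars at `X = Y = Z = 1`. -/
def toDot : SchurHom n d k μ w w' →ₛₗ[specHom k] DotHom n d k μ w w' where
  toFun := Quot.lift (fun f => PHom.mk _ _ (substTo (f.mapCoeff (specHom k)))) fun f g h =>
    substTo_eqv (h.mapCoeff (specHom k)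
      (fun x y => by rw [specHom_coe, specUnit_bil, Units.val_one])
      fun {_ _ _ f g} h => ⟨f, g, h, rfl, rfl⟩)
  map_add' := by rintro ⟨f⟩ ⟨g⟩; rfl
  map_smul' := by rintro r ⟨f⟩; rfl

lemma toDot_mk (f : Diag k n d μ w w') : toDot (PHom.mk _ _ f : SchurHom n d k μ w w') =
    PHom.mk _ _ (substTo (f.mapCoeff (specHom k))) := rfl

lemma toDot_comp (f : SchurHom n d k μ w w') (g : SchurHom n d k μ w' w'') :
    toDot (PHom.comp f g) = PHom.comp (toDot f) (toDot g) := by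
  obtain ⟨f⟩ := f
  obtain ⟨g⟩ := g
  rfl

lemma toDot_whisk {ν : Fin n → ℤ} (u v : List (Letter n)) (hν : (sig n d).actW v μ = ν)
    {s t : List (Letter n)} (hw : w = u ++ s ++ v) (hw' : w' = u ++ t ++ v)
    (f : SchurHom n d k ν s t) :
    toDot (PHom.whisk u v hν hw hw' f) =
      PHom.whisk (S := MSV.sig n d) u v hν hw hw' (toDot f) := by
  obtain ⟨f⟩ := f
  refine congrArg (PHom.mk _ _) ?_
  refine (congrArg substTo (Term.mapCoeff_whisk _ hν f hw hw')).trans ?_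
  exact subst_whisk (S := MSV.sig n d) _ hν _ hw hw'

/-- The 2-morphism of the graded 2-Schur algebra given by a diagram of `S(n,d)`. -/
def lift (f : Term (MSV.sig n d) k μ w w') : SchurHom n d k μ w w' :=
  PHom.mk _ _ ((substOf f).mapCoeff (algebraMap k (RingXYZ k)))

lemma toDot_lift (f : Term (MSV.sig n d) k μ w w') : toDot (lift f) = PHom.mk _ _ f := by
  rw [lift, toDot_mk, Term.mapCoeff_mapCoeff (specHom_algebraMap k), substTo_substOf]

lemma toDot_surjective : Function.Surjective (toDot : SchurHom n d k μ w w' → _) := by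
  rintro ⟨f⟩
  exact ⟨lift f, toDot_lift f⟩

variable (n d k μ w w') in
/-- The map from the 2-morphisms over `k` to those of the graded 2-Schur algebra modulo
`(X - 1, Y - 1, Z - 1)`. -/
def specToMod (f : SpecHom n d k μ w w') :
    PHom.Mod (S := sig n d) (bil k) (Rel k d) (specIdeal k) μ w w' :=
  Quot.lift (PHom.modMk (bil k) (Rel k d) (specIdeal k)) (fun _ _ h =>
    PHom.modMk_eq (algebraMap_specHom_sub_mem k)
      (fun x y => by rw [specHom_coe, specUnit_bil, Units.val_one]) (fun h => h) h) f

/-- If the specialization of a diagram is zero in `S(n,d)`, then it is zero in the specialized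
2-Schur algebra, whose 2-morphisms map to those of the graded 2-Schur algebra modulo the ideal. -/
lemma toDot_eq_zero_iff (f : SchurHom n d k μ w w') :
    toDot f = 0 ↔ f ∈ (specIdeal k • ⊤ : Submodule (RingXYZ k) (SchurHom n d k μ w w')) := by
  constructor
  · intro h
    induction f using PHom.ind with
    | h f =>
      have h0 : (PHom.mk _ _ (substTo (f.mapCoeff (specHom k))) : DotHom n d k μ w w') =
        PHom.mk _ _ .zero := h
      rw [← Submodule.Quotient.mk_eq_zero]
      refine (PHom.modMk_mapCoeff (algebraMap_specHom_sub_mem k) f).symm.trans ?_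
      change specToMod n d k μ w w' (PHom.mk _ _ (f.mapCoeff (specHom k))) =
        specToMod n d k μ w w' (PHom.mk _ _ .zero)
      rw [← substOf_substTo]
      exact congrArg _ (substOf_mk_eq h0)
  · intro h
    induction h using Submodule.smul_induction_on' with
    | smul r hr f _ =>
      have : specHom k r = 0 := by
        induction hr using Submodule.span_induction with
        | mem r hr =>
          rcases hr with rfl | rfl | rfl <;> simp [specHom_coe]
        | zero => exact map_zero _
        | add a b _ _ ha hb => rw [map_add, ha, hb, add_zero]
        | smul a b _ hb => rw [smul_eq_mul, map_mul, hb, mul_zero]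
      rw [LinearMap.map_smulₛₗ, this, zero_smul]
    | add f _ g _ hf hg => rw [map_add, hf, hg, add_zero]

end SchurCat

/-! ### Degrees -/

namespace Signature

namespace Term.Homog

variable {Γ : Type} [AddMonoid Γ] {S : Signature Γ} {R : Type u} {μ : S.W} {w w' : List S.L}

lemma congr {f : Term S R μ w w'} {d e : Γ} (h : f.Homog d) (he : d = e) : f.Homog e := he ▸ h

lemma mapCoeff {k : Type u} (σ : R → k) {f : Term S R μ w w'} {d : Γ} (h : f.Homog d) :
    (f.mapCoeff σ).Homog d := by
  induction h with
  | id h => exact .id h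
  | gen u v hν g hw hw' => exact .gen u v hν g hw hw'
  | comp _ _ ih1 ih2 => exact .comp ih1 ih2
  | zero d => exact .zero d
  | add _ _ ih1 ih2 => exact .add ih1 ih2
  | smul r _ ih => exact .smul _ ih

lemma whisk {ν : S.W} {u v : List S.L} (hν : S.actW v μ = ν) {s t : List S.L} {f : Term S R ν s t}
    {d : Γ} (h : f.Homog d) : ∀ {w w' : List S.L} (hw : w = u ++ s ++ v) (hw' : w' = u ++ t ++ v),
      (f.whisk u v hν hw hw').Homog d := by
  induction h with
  | id h => intros; exact .id _
  | gen => intros; exact .gen _ _ _ _ _ _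
  | comp _ _ ih1 ih2 => intro _ _ hw hw'; exact .comp (ih1 hw rfl) (ih2 rfl hw')
  | zero d => intros; exact .zero d
  | add _ _ ih1 ih2 => intro _ _ hw hw'; exact .add (ih1 hw hw') (ih2 hw hw')
  | smul r _ ih => intro _ _ hw hw'; exact .smul r (ih hw hw')

lemma pow {f : Term S R μ w w} {d : Γ} (h : f.Homog d) (m : ℕ) : (f.pow m).Homog (m • d) := by
  induction m with
  | zero => exact (Homog.id rfl).congr (zero_nsmul d).symm
  | succ m ih => exact (ih.comp h).congr (succ_nsmul d m).symm

end Term.Homog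

/-- Substituting homogeneous diagrams of the right degree for the generators. -/
lemma homog_subst {Γ Γ' : Type} [AddMonoid Γ] [AddMonoid Γ'] (q : Γ' →+ Γ) {S : Signature Γ}
    {k : Type u} [CommRing k] {G : S.W → List S.L → List S.L → Type}
    {dg : ∀ {μ s t}, G μ s t → Γ'} {φ : ∀ {ν s t}, G ν s t → Term S k ν s t}
    (hφ : ∀ {ν s t} (g : G ν s t), (φ g).Homog (q (dg g))) {μ : S.W} {w w' : List S.L}
    {f : Term (Signature.mk S.W S.L S.act S.good G dg) k μ w w'} {d : Γ'}
    (h : Term.Homog (S := Signature.mk S.W S.L S.act S.good G dg) f d) :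
    (subst (S := S) (dg := dg) φ f).Homog (q d) :=
  match w, w', f, d, h with
  | _, _, _, _, .id h => (Term.Homog.id (S := S) h).congr (map_zero q).symm
  | _, _, _, _, .gen u v hν g hw hw' => (hφ g).whisk (S := S) hν hw hw'
  | _, _, _, _, .comp h1 h2 =>
    (Term.Homog.comp (homog_subst q hφ h1) (homog_subst q hφ h2)).congr (map_add q _ _).symm
  | _, _, _, _, .zero d => .zero _
  | _, _, _, _, .add h1 h2 => .add (homog_subst q hφ h1) (homog_subst q hφ h2)
  | _, _, _, _, .smul r h => .smul r (homog_subst q hφ h)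
termination_by structural h

namespace PHom

variable {Γ : Type} [AddMonoid Γ] {S : Signature Γ} {R : Type u} [CommRing R] (bil : Γ → Γ → Rˣ)
  (rel : Relations S R) {Γ' : Type} [AddMonoid Γ'] (q : Γ →+ Γ') {μ : S.W} (w w' : List S.L)

/-- The 2-morphisms of degree `e`, for the grading obtained by applying `q` to the degrees. -/
def homogSub (μ : S.W) (w w' : List S.L) (e : Γ') : Submodule R (PHom bil rel μ w w') :=
  Submodule.span R {x | ∃ (t : Term S R μ w w') (d : Γ), t.Homog d ∧ q d = e ∧ mk bil rel t = x}

variable {bil rel q w w'}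

lemma mk_mem_homogSub {t : Term S R μ w w'} {d : Γ} (h : t.Homog d) :
    mk bil rel t ∈ homogSub bil rel q μ w w' (q d) :=
  Submodule.subset_span ⟨t, d, h, rfl, rfl⟩

lemma comp_mem_homogSub {w'' : List S.L} {f : PHom bil rel μ w w'} {g : PHom bil rel μ w' w''}
    {d e : Γ'} (hf : f ∈ homogSub bil rel q μ w w' d) (hg : g ∈ homogSub bil rel q μ w' w'' e) :
    PHom.comp f g ∈ homogSub bil rel q μ w w'' (d + e) := by
  refine LinearMap.BilinMap.apply_apply_mem_of_mem_span _ _ _ (compₗ bil rel μ w w' w'') ?_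
    f g hf hg
  rintro _ ⟨t, d, ht, rfl, rfl⟩ _ ⟨t', e, ht', rfl, rfl⟩
  rw [← map_add]
  exact mk_mem_homogSub (ht.comp ht')

/-- Substituting diagrams that are homogeneous of the right degree after applying `q`. The degrees
before `q` may differ from one summand of the result to another. -/
lemma mk_subst_mem_homogSub {k : Type u} [CommRing k] {τ : k → R}
    {G : S.W → List S.L → List S.L → Type} {dg : ∀ {μ s t}, G μ s t → Γ'} {μ : S.W}
    {φ : ∀ {ν s t}, G ν s t → Term S k ν s t}
    (hφ : ∀ {ν s t} (g : G ν s t), ∃ e, (φ g).Homog e ∧ q e = dg g)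
    {w w' : List S.L} {f : Term (Signature.mk S.W S.L S.act S.good G dg) k μ w w'} {d : Γ'}
    (h : Term.Homog (S := Signature.mk S.W S.L S.act S.good G dg) f d) :
    mk bil rel ((subst (S := S) (dg := dg) φ f).mapCoeff τ) ∈ homogSub bil rel q μ w w' d := by
  match w, w', f, d, h with
  | _, _, _, _, .id h =>
    exact map_zero q ▸ mk_mem_homogSub (Term.Homog.id (S := S) h)
  | _, _, _, _, .gen u v hν g hw hw' =>
    obtain ⟨e, he, hq⟩ := hφ g
    change _ ∈ homogSub bil rel q μ _ _ (dg g)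
    rw [← hq]
    exact mk_mem_homogSub ((he.whisk (S := S) hν hw hw').mapCoeff τ)
  | _, _, _, _, .comp h1 h2 =>
    exact comp_mem_homogSub (mk_subst_mem_homogSub hφ h1) (mk_subst_mem_homogSub hφ h2)
  | _, _, _, _, .zero d => exact Submodule.zero_mem _
  | _, _, _, _, .add h1 h2 =>
    exact Submodule.add_mem _ (mk_subst_mem_homogSub hφ h1) (mk_subst_mem_homogSub hφ h2)
  | _, _, _, _, .smul r h => exact Submodule.smul_mem _ (τ r) (mk_subst_mem_homogSub hφ h)
termination_by structural h

end PHom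

end Signature

namespace SchurCat

open Signature

variable {n d : ℕ} {k : Type u} [CommRing k]

/-- The quantum degree. -/
def qdeg : ℤ × ℤ →+ ℤ where
  toFun x := -(x.1 + x.2)
  map_zero' := rfl
  map_add' x y := by simp only [Prod.fst_add, Prod.snd_add]; ring

lemma pairing_comm (i j : Fin (n - 1)) : MSV.pairing i j = MSV.pairing j i := by
  simp only [MSV.pairing, root, Pi.sub_apply, Pi.single_apply, lo, hi, Fin.mk.injEq]
  split_ifs <;> omega

lemma pairing_self (i : Fin (n - 1)) : MSV.pairing i i = 2 := by
  rw [MSV.pairing, root_lo, root_hi]; rfl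

lemma bar_add_root (μ : Fin n → ℤ) (i j : Fin (n - 1)) :
    bar (μ + root j) i = bar μ i + MSV.pairing i j := by
  simp only [bar, MSV.pairing, Pi.add_apply]; ring

lemma bar_sub_root (μ : Fin n → ℤ) (i j : Fin (n - 1)) :
    bar (μ - root j) i = bar μ i - MSV.pairing i j := by
  simp only [bar, MSV.pairing, Pi.sub_apply]; ring

lemma qdeg_cup (μ : Fin n → ℤ) (i : Fin (n - 1)) :
    qdeg (Gen.deg (Gen.cup (μ := μ) i)) = 1 - bar μ i := by
  simp only [Gen.deg, qdeg, bar, AddMonoidHom.coe_mk, ZeroHom.coe_mk, Prod.fst_add, Prod.snd_add]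
  ring

lemma qdeg_cap (μ : Fin n → ℤ) (i : Fin (n - 1)) :
    qdeg (Gen.deg (Gen.cap (μ := μ) i)) = 1 + bar μ i := by
  simp only [Gen.deg, qdeg, bar, AddMonoidHom.coe_mk, ZeroHom.coe_mk, Prod.fst_add, Prod.snd_add,
    Prod.fst_neg, Prod.snd_neg]
  ring

lemma qdeg_dot (μ : Fin n → ℤ) (i : Fin (n - 1)) : qdeg (Gen.deg (Gen.dot (μ := μ) i)) = 2 := rfl

lemma qdeg_cross (μ : Fin n → ℤ) (i j : Fin (n - 1)) :
    qdeg (Gen.deg (Gen.cross (μ := μ) i j)) = -MSV.pairing i j := by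
  simp only [Gen.deg, qdeg, p, MSV.pairing, AddMonoidHom.coe_mk, ZeroHom.coe_mk]
  ring

lemma qdeg_invSide (μ : Fin n → ℤ) (i j : Fin (n - 1)) :
    qdeg (Gen.deg (Gen.invSide (μ := μ) i j)) = 0 := rfl

lemma qdeg_invCup (μ : Fin n → ℤ) (i : Fin (n - 1)) (m : Fin (bar μ i).toNat) :
    qdeg (Gen.deg (Gen.invCup (μ := μ) i m)) = bar μ i - 1 - 2 * (m : ℕ) := by
  simp only [Gen.deg, qdeg, bar, AddMonoidHom.coe_mk, ZeroHom.coe_mk, Prod.fst_add, Prod.snd_add,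
    Prod.fst_neg, Prod.snd_neg, Prod.smul_fst, Prod.smul_snd, smul_eq_mul]
  ring

lemma qdeg_invCap (μ : Fin n → ℤ) (i : Fin (n - 1)) (m : Fin (-bar μ i).toNat) :
    qdeg (Gen.deg (Gen.invCap (μ := μ) i m)) = -bar μ i - 1 - 2 * (m : ℕ) := by
  simp only [Gen.deg, qdeg, bar, AddMonoidHom.coe_mk, ZeroHom.coe_mk, Prod.fst_add, Prod.snd_add,
    Prod.fst_neg, Prod.snd_neg, Prod.smul_fst, Prod.smul_snd, smul_eq_mul]
  ring

lemma homog_toMSV {ν : Fin n → ℤ} {s t : List (Letter n)} (g : Gen ν s t) :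
    (toMSV n d k g).Homog (qdeg (Gen.deg g)) := by
  have hgen : ∀ {ν s t} (g : MSV.Gen ν s t), (Term.lay (S := MSV.sig n d) (R := k) [] [] g).Homog
      (MSV.Gen.deg g) := fun g => .gen (S := MSV.sig n d) _ _ _ g _ _
  have hdots : ∀ (ν : Fin n → ℤ) i m, (MSV.dotsE (μ := ν) k d i m).Homog (2 * (m : ℤ)) :=
    fun ν i m => ((hgen (MSV.Gen.dotE i)).pow m).congr (by
      simp only [MSV.Gen.deg, pairing_self, nsmul_eq_mul]; ring)
  cases g with
  | cup i => exact (hgen _).congr (qdeg_cup ν i).symm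
  | cap i => exact (hgen _).congr (qdeg_cap ν i).symm
  | dot i => exact (hgen _).congr (pairing_self i)
  | cross i j => exact .smul _ ((hgen _).congr (qdeg_cross ν i j).symm)
  | invSide i j =>
    refine .smul _ (Term.Homog.congr (.comp (.gen _ _ _ _ _ _)
      (.comp (.gen _ _ _ _ _ _) (.gen _ _ _ _ _ _))) ?_)
    simp only [MSV.Gen.deg, qdeg_invSide, actW, List.foldr_cons, List.foldr_nil, actLetter,
      bar_add_root, bar_sub_root, pairing_self]
    ring
  | invCup i m =>
    have := m.2
    refine .smul _ (Term.Homog.congr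
      (.comp ((hdots _ i _).whisk rfl rfl rfl) (.gen _ _ _ _ _ _)) ?_)
    rw [qdeg_invCup]
    simp only [MSV.Gen.deg, actW, List.foldr_nil]
    omega
  | invCap i m =>
    have := m.2
    refine .smul _ (Term.Homog.congr
      (.comp (.gen _ _ _ _ _ _) ((hdots _ i _).whisk rfl rfl rfl)) ?_)
    rw [qdeg_invCap]
    simp only [MSV.Gen.deg, actW, List.foldr_nil]
    omega

lemma homog_ofMSV {ν : Fin n → ℤ} {s t : List (Letter n)} (g : MSV.Gen ν s t) :
    ∃ e, (ofMSV n d k g).Homog e ∧ qdeg e = MSV.Gen.deg g := by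
  have hgen : ∀ {ν s t} (g : Gen ν s t), (Term.lay (S := sig n d) (R := k) [] [] g).Homog
      (Gen.deg g) := fun g => .gen (S := sig n d) _ _ _ g _ _
  cases g with
  | dotE i =>
    refine ⟨_, .comp (.gen _ _ _ _ _ _) (.comp (.gen _ _ _ _ _ _) (.gen _ _ _ _ _ _)), ?_⟩
    simp only [map_add, qdeg_cup, qdeg_cap, qdeg_dot, actW, List.foldr_cons, List.foldr_nil,
      actLetter, bar_add_root, pairing_self, MSV.Gen.deg]
    ring
  | dotF i => exact ⟨_, hgen _, (pairing_self i).symm⟩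
  | crossE i j =>
    refine ⟨_, .smul _ (.comp (.gen _ _ _ _ _ _) (.comp (.whisk _ (.mapCoeff _ (.comp
      (.gen _ _ _ _ _ _) (.comp (.gen _ _ _ _ _ _) (.gen _ _ _ _ _ _)))) _ _)
        (.gen _ _ _ _ _ _))), ?_⟩
    simp only [map_add, qdeg_cup, qdeg_cap, qdeg_cross, actW, List.foldr_cons, List.foldr_nil,
      actLetter, bar_add_root, bar_sub_root, pairing_self, MSV.Gen.deg, pairing_comm j i]
    ring
  | crossF i j => exact ⟨_, .smul _ (hgen _), qdeg_cross ν i j⟩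
  | cupEF i => exact ⟨_, hgen _, qdeg_cup ν i⟩
  | cupFE i =>
    simp only [ofMSV, MSV.Gen.deg]
    split_ifs with h h'
    · refine ⟨_, .smul _ (hgen _), ?_⟩
      rw [qdeg_invCap]
      dsimp only
      omega
    · refine ⟨_, .comp (hgen _) (.smul _ (hgen _)), ?_⟩
      refine (map_add qdeg _ _).trans
        ((congrArg₂ (· + ·) (qdeg_cup ν i) (qdeg_invSide ν i i)).trans ?_)
      omega
    · exact ⟨(-(1 + bar ν i), 0), .zero _, by simp [qdeg]⟩
  | capEF i =>
    simp only [ofMSV, MSV.Gen.deg]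
    split_ifs with h h'
    · refine ⟨_, .smul _ (hgen _), ?_⟩
      rw [qdeg_invCup]
      dsimp only
      omega
    · refine ⟨_, .comp (.smul _ (hgen _)) (hgen _), ?_⟩
      refine (map_add qdeg _ _).trans
        ((congrArg₂ (· + ·) (qdeg_invSide ν i i) (qdeg_cap ν i)).trans ?_)
      omega
    · exact ⟨(-(1 - bar ν i), 0), .zero _, by simp [qdeg]⟩
  | capFE i => exact ⟨_, hgen _, qdeg_cap ν i⟩

variable {μ : Fin n → ℤ} {w w' : List (Letter n)}

lemma homog_substTo {f : Diag k n d μ w w'} {e : ℤ × ℤ} (h : f.Homog e) :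
    (substTo (f.mapCoeff (specHom k))).Homog (qdeg e) :=
  homog_subst qdeg (S := MSV.sig n d) (dg := Gen.deg) homog_toMSV (h.mapCoeff _)

lemma lift_mem_homogSub {f : Term (MSV.sig n d) k μ w w'} {e : ℤ} (h : f.Homog e) :
    lift f ∈ PHom.homogSub (S := sig n d) (bil k) (Rel k d) qdeg μ w w' e :=
  PHom.mk_subst_mem_homogSub (S := sig n d) (dg := MSV.Gen.deg) homog_ofMSV h

end SchurCat

/-! ### Specialization of additive closures -/

-- Instances on the hom types are found only after unfolding these 2-categories to their fields.
attribute [reducible] Signature.presented GradedTwoCat.closure GradedTwoCat.reduction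

lemma Submodule.pi_mem_smul_top {R : Type*} [CommRing R] (I : Ideal R) {ι : Type*} [Finite ι]
    {M : ι → Type*} [∀ i, AddCommGroup (M i)] [∀ i, Module R (M i)] {x : ∀ i, M i}
    (hx : ∀ i, x i ∈ (I • ⊤ : Submodule R (M i))) : x ∈ (I • ⊤ : Submodule R (∀ i, M i)) := by
  classical
  cases nonempty_fintype ι
  rw [← LinearMap.sum_single_apply M x]
  exact Submodule.sum_mem _ fun i _ => Submodule.smul_top_le_comap_smul_top I (.single R M i) (hx i)

namespace GradedTwoCat

variable {R : Type u} [CommRing R] {Γ : Type} (C : GradedTwoCat.{u, v, w} R Γ) {a b c : C.Obj}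

lemma closureWhL_apply (g : Mat_ (Shifted (C.Mor b c))) {f f' : Mat_ (Shifted (C.Mor a b))}
    (β : f ⟶ f') (i : g.ι) (j : f.ι) (j' : f'.ι) :
    C.closureWhL g β (i, j) (i, j') = C.whL (g.X i).obj (Shifted.homOut (β j j')) :=
  show C.closureWhLEntry g (i, j) (i, j') _ = _ by
    rw [closureWhLEntry, dif_pos rfl]
    exact Category.comp_id _

lemma closureWhL_apply_of_ne (g : Mat_ (Shifted (C.Mor b c))) {f f' : Mat_ (Shifted (C.Mor a b))}
    (β : f ⟶ f') {i i' : g.ι} (h : i ≠ i') (j : f.ι) (j' : f'.ι) :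
    C.closureWhL g β (i, j) (i', j') = 0 :=
  show C.closureWhLEntry g (i, j) (i', j') _ = _ by
    rw [closureWhLEntry, dif_neg h]
    rfl

lemma closureWhR_apply {g g' : Mat_ (Shifted (C.Mor b c))} (f : Mat_ (Shifted (C.Mor a b)))
    (α : g ⟶ g') (i : g.ι) (i' : g'.ι) (j : f.ι) :
    C.closureWhR f α (i, j) (i', j) = C.whR (f.X j).obj (Shifted.homOut (α i i')) :=
  show C.closureWhREntry f (i, j) (i', j) _ = _ by
    rw [closureWhREntry, dif_pos rfl]
    exact Category.comp_id _

lemma closureWhR_apply_of_ne {g g' : Mat_ (Shifted (C.Mor b c))} (f : Mat_ (Shifted (C.Mor a b)))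
    (α : g ⟶ g') (i : g.ι) (i' : g'.ι) {j j' : f.ι} (h : j ≠ j') :
    C.closureWhR f α (i, j) (i', j') = 0 :=
  show C.closureWhREntry f (i, j) (i', j') _ = _ by
    rw [closureWhREntry, dif_neg h]
    rfl

end GradedTwoCat

namespace Signature

open GradedTwoCat

/-- A specialization `σ : R → k` of the scalars of a presented 2-category over `R`, with values in
a presented 2-category over `k` with the same words but possibly different generators. -/
structure Specialization {Γ : Type} [AddMonoid Γ] {S : Signature Γ} {R k : Type u} [CommRing R]
    [CommRing k] [Algebra k R] (σ : R →+* k) (I : Ideal R) (q : Γ → ℤ) (bil : Γ → Γ → Rˣ)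
    (rel : Relations S R) {G : S.W → List S.L → List S.L → Type} {dg : ∀ {μ s t}, G μ s t → ℤ}
    (rel' : Relations (Signature.mk S.W S.L S.act S.good G dg) k) where
  hom {μ : S.W} {w w' : List S.L} : PHom bil rel μ w w' →ₛₗ[σ]
    PHom (S := Signature.mk S.W S.L S.act S.good G dg) (fun _ _ => 1) rel' μ w w'
  apply_algebraMap (r : k) : σ (algebraMap k R r) = r
  surjective {μ : S.W} {w w' : List S.L} : Function.Surjective (hom (μ := μ) (w := w) (w' := w'))
  eq_zero_iff {μ : S.W} {w w' : List S.L} (f : PHom bil rel μ w w') :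
    hom f = 0 ↔ f ∈ (I • ⊤ : Submodule R (PHom bil rel μ w w'))
  id (μ : S.W) (w : List S.L) : hom (PHom.mk bil rel (.id (rfl : w = w) : Term S R μ w w)) =
    PHom.mk _ _ (.id rfl)
  comp {μ : S.W} {w w' w'' : List S.L} (f : PHom bil rel μ w w') (g : PHom bil rel μ w' w'') :
    hom (PHom.comp f g) = PHom.comp (hom f) (hom g)
  whisk {μ ν : S.W} (u v : List S.L) (hν : S.actW v μ = ν) {w w' s t : List S.L}
    (hw : w = u ++ s ++ v) (hw' : w' = u ++ t ++ v) (f : PHom bil rel ν s t) :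
    hom (PHom.whisk u v hν hw hw' f) = PHom.whisk (S := Signature.mk S.W S.L S.act S.good G dg)
      u v hν hw hw' (hom f)
  homog {μ : S.W} {w w' : List S.L} {f : Term S R μ w w'} {e : Γ} (hf : f.Homog e) :
    ∃ f' : Term (Signature.mk S.W S.L S.act S.good G dg) k μ w w',
      Term.Homog (S := Signature.mk S.W S.L S.act S.good G dg) f' (q e) ∧
        PHom.mk _ _ f' = hom (PHom.mk bil rel f)
  lift_homog {μ : S.W} {w w' : List S.L}
    {f : Term (Signature.mk S.W S.L S.act S.good G dg) k μ w w'}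
    {e : ℤ} (hf : Term.Homog (S := Signature.mk S.W S.L S.act S.good G dg) f e) :
    ∃ x ∈ Submodule.span R {x | ∃ (t : Term S R μ w w') (d : Γ),
      t.Homog d ∧ q d = e ∧ PHom.mk bil rel t = x}, hom x = PHom.mk _ _ f

namespace Specialization

variable {Γ : Type} [AddMonoid Γ] {S : Signature Γ} {R k : Type u} [CommRing R]
  [CommRing k] [Algebra k R] {σ : R →+* k} {I : Ideal R} {q : Γ → ℤ} {bil : Γ → Γ → Rˣ}
  {rel : Relations S R} {G : S.W → List S.L → List S.L → Type} {dg : ∀ {μ s t}, G μ s t → ℤ}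
  {rel' : Relations (Signature.mk S.W S.L S.act S.good G dg) k}
  (F : Specialization σ I q bil rel (dg := dg) rel') {a b c : {μ : S.W // S.good μ}}

local notation "𝒜" => GradedTwoCat.closure (Signature.presented
  (S := Signature.mk S.W S.L S.act S.good G dg) (fun _ _ => 1) rel') (fun x => x)

local notation "ℬ" => GradedTwoCat.closure (Signature.presented (S := S) bil rel) q

variable (bil rel rel') in
/-- The two 2-categories have the same words. -/
def wordEquiv : PCat (S := Signature.mk S.W S.L S.act S.good G dg) (fun _ _ => 1) rel' a b ≃
    PCat bil rel a b where
  toFun f := ⟨⟨f.out.word, f.out.actW_eq, f.out.good⟩⟩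
  invFun f := ⟨⟨f.out.word, f.out.actW_eq, f.out.good⟩⟩
  left_inv _ := rfl
  right_inv _ := rfl

variable (I q bil rel rel') in
/-- The bijection on formal direct sums of shifts of words. -/
def morEquiv : GradedTwoCat.Mor 𝒜 a b ≃ RedMor ℬ I a b where
  toFun f := ⟨⟨f.ι, fun i => ⟨wordEquiv bil rel rel' (f.X i).obj, (f.X i).shift⟩⟩⟩
  invFun f := ⟨f.out.ι, fun i => ⟨(wordEquiv bil rel rel').symm (f.out.X i).obj, (f.out.X i).shift⟩⟩
  left_inv _ := rfl
  right_inv _ := rfl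

/-- The specialization of matrices of 2-morphisms. -/
def mat (f g : GradedTwoCat.Mor 𝒜 a b) :
    ((morEquiv I q bil rel rel' f).out ⟶ (morEquiv I q bil rel rel' g).out) →ₛₗ[σ] (f ⟶ g) where
  toFun α i j := F.hom (Shifted.homOut (α i j))
  map_add' α β := by
    refine Mat_.hom_ext _ _ fun i j => ?_
    exact map_add F.hom _ _
  map_smul' r α := by
    refine Mat_.hom_ext _ _ fun i j => ?_
    exact LinearMap.map_smulₛₗ F.hom r _

lemma mat_surjective (f g : GradedTwoCat.Mor 𝒜 a b) : Function.Surjective (F.mat f g) := fun α => by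
  choose β hβ using fun i j => F.surjective (α i j)
  exact ⟨β, Mat_.hom_ext _ _ fun i j => hβ i j⟩

lemma mat_eq_zero_iff (f g : GradedTwoCat.Mor 𝒜 a b)
    (α : (morEquiv I q bil rel rel' f).out ⟶ (morEquiv I q bil rel rel' g).out) :
    F.mat f g α = 0 ↔ α ∈ redSub (morEquiv I q bil rel rel' f) (morEquiv I q bil rel rel' g) := by
  constructor
  · intro h
    refine Submodule.pi_mem_smul_top _ fun i => Submodule.pi_mem_smul_top _ fun j => ?_
    exact (F.eq_zero_iff (α i j)).1 (congrFun (congrFun h i) j)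
  · intro h
    refine Mat_.hom_ext _ _ fun i j => (F.eq_zero_iff (α i j)).2 ?_
    exact Submodule.smul_top_le_comap_smul_top _
      (LinearMap.proj (R := R) (φ := fun j => ((morEquiv I q bil rel rel' f).out.X i ⟶
        (morEquiv I q bil rel rel' g).out.X j)) j ∘ₗ LinearMap.proj (R := R)
        (φ := fun i => ∀ j, ((morEquiv I q bil rel rel' f).out.X i ⟶
          (morEquiv I q bil rel rel' g).out.X j)) i) h

/-- The specialization of matrices, on the classes modulo `I`. -/
def ofRed (f g : GradedTwoCat.Mor 𝒜 a b) :
    (morEquiv I q bil rel rel' f ⟶ morEquiv I q bil rel rel' g) →ₗ[k] (f ⟶ g) where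
  toFun := Submodule.liftQ _ (F.mat f g) fun α hα => (F.mat_eq_zero_iff f g α).2 hα
  map_add' := map_add (Submodule.liftQ _ (F.mat f g) _)
  map_smul' r α := by
    refine (LinearMap.map_smulₛₗ (Submodule.liftQ _ (F.mat f g) _) (algebraMap k R r) α).trans ?_
    rw [F.apply_algebraMap]
    rfl

lemma ofRed_redMk (f g : GradedTwoCat.Mor 𝒜 a b)
    (α : (morEquiv I q bil rel rel' f).out ⟶ (morEquiv I q bil rel rel' g).out) :
    F.ofRed f g (redMk _ _ α) = F.mat f g α := rfl

lemma ofRed_bijective (f g : GradedTwoCat.Mor 𝒜 a b) : Function.Bijective (F.ofRed f g) := by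
  refine ⟨(injective_iff_map_eq_zero _).2 fun α h => ?_, fun α => ?_⟩
  · obtain ⟨α, rfl⟩ := redMk_surjective _ _ α
    exact (Submodule.Quotient.mk_eq_zero _).2 ((F.mat_eq_zero_iff f g α).1 h)
  · obtain ⟨α, rfl⟩ := F.mat_surjective f g α
    exact ⟨redMk _ _ α, rfl⟩

/-- The isomorphisms of the spaces of 2-morphisms. -/
def homEquiv (f g : GradedTwoCat.Mor 𝒜 a b) :
    (f ⟶ g) ≃ₗ[k] (morEquiv I q bil rel rel' f ⟶ morEquiv I q bil rel rel' g) :=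
  (LinearEquiv.ofBijective (F.ofRed f g) (F.ofRed_bijective f g)).symm

lemma homEquiv_mat {f g : GradedTwoCat.Mor 𝒜 a b}
    (α : (morEquiv I q bil rel rel' f).out ⟶ (morEquiv I q bil rel rel' g).out) :
    F.homEquiv f g (F.mat f g α) = redMk _ _ α :=
  (LinearEquiv.symm_apply_eq _).2 (F.ofRed_redMk f g α).symm

lemma mat_id (f : GradedTwoCat.Mor 𝒜 a b) :
    F.mat f f (𝟙 (morEquiv I q bil rel rel' f).out) = 𝟙 f := by
  classical
  refine Mat_.hom_ext _ _ fun i j => ?_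
  by_cases h : i = j
  · subst h
    refine (congrArg F.hom (Mat_.id_apply_self (morEquiv I q bil rel rel' f).out i)).trans
      (.trans ?_ (Mat_.id_apply_self f i).symm)
    exact F.id _ _
  · refine (congrArg F.hom (Mat_.id_apply_of_ne (morEquiv I q bil rel rel' f).out i j h)).trans
      (.trans ?_ (Mat_.id_apply_of_ne f i j h).symm)
    exact map_zero F.hom

lemma mat_comp {f g h : GradedTwoCat.Mor 𝒜 a b}
    (α : (morEquiv I q bil rel rel' f).out ⟶ (morEquiv I q bil rel rel' g).out)
    (β : (morEquiv I q bil rel rel' g).out ⟶ (morEquiv I q bil rel rel' h).out) :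
    F.mat f h (α ≫ β) = F.mat f g α ≫ F.mat g h β := by
  refine Mat_.hom_ext _ _ fun i j => ?_
  refine (map_sum F.hom (fun l => PHom.comp (α i l) (β l j)) Finset.univ).trans ?_
  exact Finset.sum_congr rfl fun l _ => F.comp _ _

lemma mat_whL (g : GradedTwoCat.Mor 𝒜 b c) {f f' : GradedTwoCat.Mor 𝒜 a b}
    (β : (morEquiv I q bil rel rel' f).out ⟶ (morEquiv I q bil rel rel' f').out) :
    F.mat (GradedTwoCat.hcomp 𝒜 g f) (GradedTwoCat.hcomp 𝒜 g f')
      (GradedTwoCat.whL ℬ (morEquiv I q bil rel rel' g).out β) =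
      GradedTwoCat.whL 𝒜 g (F.mat f f' β) := by
  classical
  refine Mat_.hom_ext _ _ ?_
  rintro ⟨i, j⟩ ⟨i', j'⟩
  by_cases h : i = i'
  · subst h
    have h1 := closureWhL_apply (presented bil rel) (morEquiv I q bil rel rel' g).out β i j j'
    have h2 := closureWhL_apply (presented _ rel') g (F.mat f f' β) i j j'
    exact (congrArg F.hom h1).trans ((F.whisk _ _ _ _ _ _).trans h2.symm)
  · have h1 := closureWhL_apply_of_ne (presented bil rel) (morEquiv I q bil rel rel' g).out β h j j'
    have h2 := closureWhL_apply_of_ne (presented _ rel') g (F.mat f f' β) h j j'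
    exact (congrArg F.hom h1).trans ((map_zero F.hom).trans h2.symm)

lemma mat_whR {g g' : GradedTwoCat.Mor 𝒜 b c} (f : GradedTwoCat.Mor 𝒜 a b)
    (α : (morEquiv I q bil rel rel' g).out ⟶ (morEquiv I q bil rel rel' g').out) :
    F.mat (GradedTwoCat.hcomp 𝒜 g f) (GradedTwoCat.hcomp 𝒜 g' f)
      (GradedTwoCat.whR ℬ (morEquiv I q bil rel rel' f).out α) =
      GradedTwoCat.whR 𝒜 f (F.mat g g' α) := by
  classical
  refine Mat_.hom_ext _ _ ?_
  rintro ⟨i, j⟩ ⟨i', j'⟩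
  by_cases h : j = j'
  · subst h
    have h1 := closureWhR_apply (presented bil rel) (morEquiv I q bil rel rel' f).out α i i' j
    have h2 := closureWhR_apply (presented _ rel') f (F.mat g g' α) i i' j
    exact (congrArg F.hom h1).trans ((F.whisk _ _ _ _ _ _).trans h2.symm)
  · have h1 := closureWhR_apply_of_ne (presented bil rel) (morEquiv I q bil rel rel' f).out α i i' h
    have h2 := closureWhR_apply_of_ne (presented _ rel') f (F.mat g g' α) i i' h
    exact (congrArg F.hom h1).trans ((map_zero F.hom).trans h2.symm)

/-- The pieces of the grading of the 2-morphisms between shifts of words. -/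
lemma hom_mem_iSup
    {w w' : PCat (S := Signature.mk S.W S.L S.act S.good G dg) (fun _ _ => 1) rel' a b}
    (m m' p : ℤ) {x : wordEquiv bil rel rel' w ⟶ wordEquiv bil rel rel' w'}
    (hx : x ∈ ⨆ (e : Γ) (_ : q e + m' - m = p), (presented bil rel).deg _ _ e) :
    F.hom x ∈ ⨆ (e : ℤ) (_ : e + m' - m = p), (presented _ rel').deg w w' e := by
  have : RingHomSurjective σ := ⟨fun r => ⟨algebraMap k R r, F.apply_algebraMap r⟩⟩
  let φ : (wordEquiv bil rel rel' w ⟶ wordEquiv bil rel rel' w') →ₛₗ[σ] (w ⟶ w') := F.hom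
  suffices (⨆ (e : Γ) (_ : q e + m' - m = p), (presented bil rel).deg (wordEquiv bil rel rel' w)
      (wordEquiv bil rel rel' w') e) ≤ Submodule.comap φ
      (⨆ (e : ℤ) (_ : e + m' - m = p), (presented _ rel').deg w w' e) from this hx
  refine iSup₂_le fun e he => ?_
  rintro _ ⟨t, ht, rfl⟩
  obtain ⟨t', ht', h⟩ := F.homog ht
  exact Submodule.mem_iSup_of_mem (q e) (Submodule.mem_iSup_of_mem he ⟨t', ht', h⟩)

/-- Homogeneous 2-morphisms lift to homogeneous ones. -/
lemma exists_mem_iSup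
    {w w' : PCat (S := Signature.mk S.W S.L S.act S.good G dg) (fun _ _ => 1) rel' a b}
    (m m' p : ℤ) {x : w ⟶ w'}
    (hx : x ∈ ⨆ (e : ℤ) (_ : e + m' - m = p), (presented _ rel').deg w w' e) :
    ∃ y : wordEquiv bil rel rel' w ⟶ wordEquiv bil rel rel' w',
      y ∈ (⨆ (e : Γ) (_ : q e + m' - m = p), (presented bil rel).deg _ _ e) ∧ F.hom y = x := by
  have : RingHomSurjective σ := ⟨fun r => ⟨algebraMap k R r, F.apply_algebraMap r⟩⟩
  let φ : (wordEquiv bil rel rel' w ⟶ wordEquiv bil rel rel' w') →ₛₗ[σ] (w ⟶ w') := F.hom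
  suffices (⨆ (e : ℤ) (_ : e + m' - m = p), (presented _ rel').deg w w' e) ≤ Submodule.map φ
      (⨆ (e : Γ) (_ : q e + m' - m = p), (presented bil rel).deg (wordEquiv bil rel rel' w)
      (wordEquiv bil rel rel' w') e) from this hx
  refine iSup₂_le fun e he => ?_
  rintro _ ⟨t, ht, rfl⟩
  obtain ⟨y, hy, h⟩ := F.lift_homog ht
  refine ⟨y, Submodule.span_le (p := (⨆ (e : Γ) (_ : q e + m' - m = p), (presented bil rel).deg
    (wordEquiv bil rel rel' w) (wordEquiv bil rel rel' w') e)).2 ?_ hy, h⟩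
  rintro _ ⟨s, e', hs, rfl, rfl⟩
  exact Submodule.mem_iSup_of_mem e' (Submodule.mem_iSup_of_mem he ⟨s, hs, rfl⟩)

/-- The isomorphism of graded 2-categories. -/
def iso : GradedTwoCat.Iso 𝒜 (GradedTwoCat.reduction k I ℬ) where
  obj := Equiv.refl _
  mor := morEquiv I q bil rel rel'
  hom := F.homEquiv
  mor_one _ := rfl
  mor_hcomp _ _ := rfl
  hom_id f := (congrArg (F.homEquiv f f) (F.mat_id f).symm).trans (F.homEquiv_mat _)
  hom_comp {a b f g h} α β := by
    obtain ⟨α, rfl⟩ := F.mat_surjective f g α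
    obtain ⟨β, rfl⟩ := F.mat_surjective g h β
    refine (congrArg (F.homEquiv f h) (F.mat_comp α β).symm).trans ((F.homEquiv_mat _).trans ?_)
    exact (congrArg₂ redComp (F.homEquiv_mat α) (F.homEquiv_mat β)).symm
  hom_whL g f f' β := by
    obtain ⟨β, rfl⟩ := F.mat_surjective f f' β
    refine heq_of_eq ((congrArg (F.homEquiv _ _) (F.mat_whL g β).symm).trans
      ((F.homEquiv_mat _).trans ?_))
    exact (congrArg (redMap k _) (F.homEquiv_mat β)).symm
  hom_whR {a b c g g'} f α := by
    obtain ⟨α, rfl⟩ := F.mat_surjective g g' α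
    refine heq_of_eq ((congrArg (F.homEquiv _ _) (F.mat_whR f α).symm).trans
      ((F.homEquiv_mat _).trans ?_))
    exact (congrArg (redMap k _) (F.homEquiv_mat α)).symm
  mem_deg {a b f g} α p := by
    obtain ⟨α, rfl⟩ := F.mat_surjective f g α
    constructor
    · rintro ⟨α', hα', h⟩
      have h' : F.mat f g α' = F.mat f g α :=
        congrArg (F.ofRed f g) (h.trans (F.homEquiv_mat α))
      exact h' ▸ fun i j => F.hom_mem_iSup _ _ p (hα' i j)
    · intro h
      choose α' hα' h' using fun i j => F.exists_mem_iSup _ _ p (h i j)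
      refine ⟨α', hα', (F.homEquiv_mat α').symm.trans (congrArg (F.homEquiv f g) ?_)⟩
      exact Mat_.hom_ext _ _ fun i j => h' i j

end Specialization
end Signature

namespace SchurCat

open Signature

variable (k : Type u) [CommRing k] (n d : ℕ)

/-- The specialization of the graded 2-Schur algebra at `X = Y = Z = 1`, with values in `S(n,d)`. -/
def specialization : Specialization (S := sig n d) (specHom k) (specIdeal k)
    (fun x => -(x.1 + x.2)) (bil k) (Rel k d) (dg := MSV.Gen.deg) (MSV.Rel k d) where
  hom := toDot
  apply_algebraMap := specHom_algebraMap k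
  surjective := toDot_surjective
  eq_zero_iff := toDot_eq_zero_iff
  id _ _ := rfl
  comp := toDot_comp
  whisk u v hν _ _ _ _ hw hw' f := toDot_whisk u v hν hw hw' f
  homog hf := ⟨_, homog_substTo hf, rfl⟩
  lift_homog hf := ⟨_, lift_mem_homogSub hf, toDot_lift _⟩

end SchurCat
end

/-- `S(n,d)^• ≅ Schur_{n,d}^{⊕,cl}|_{X = Y = Z = 1}` as `ℤ`-graded `k`-linear 2-categories. -/
theorem mainTheorem8 (k : Type*) [CommRing k] (n d : ℕ) :
    Nonempty (GradedTwoCat.Iso (MSV.schurDot k n d) (SchurCat.schurSpecialized k n d)) :=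
  ⟨(SchurCat.specialization k n d).iso⟩
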